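/- \textbf{Setting.} For $n\ge 1$ let $\mathcal H_n=L^2(\mathbb R^n)$ with position and momentum operators $\hat x_i,\hat p_i$ ($[\hat x_j,\hat p_k]=i\delta_{jk}$) and energy operator $\hat E=\frac12\sum_{i=1}^n(\hat x_i^2+\hat p_i^2)$. For a unit vector $|\psi\rangle$ write $\psi=|\psi\rangle\langle\psi|$. Let $\mathcal G$ be the set of pure Gaussian states on $n$ modes and $\mathcal G_0\subset\mathcal G$ the set of those with zero mean; for a set of states $\mathcal P$ let $d_{\mathcal P}(\psi)=\inf_{\sigma\in\mathcal P}\frac12\|\psi-\sigma\|_1$. Let $$E_2(\psi)=\frac1n\inf_{S}\sqrt{\operatorname{Tr}[U_S\psi U_S^\dagger\hat E^2]}\in[0,\infty],$$ the infimum being over all $S\in \mathrm{Sp}(2n,\mathbb R)$, where $U_S$ is the symplectic Gaussian unitary of $S$ (unique up to phase). An orthogonal matrix $o\in O(k)$ acts on $\mathcal H_n^{\otimes k}\cong L^2(\mathbb R^{n\times k})$ by $(U_o\Psi)(\mathbf x)=\Psi(\mathbf x o)$. \emph{Three-copy test (Test 4):} measure $\{P,I-P\}$ on $\psi^{\otimes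 3}$ and accept on the outcome $P$, where $P$ is the projection onto the vectors of $\mathcal H_n^{\otimes3}$ invariant under $U_{o}$ for all rotations $o$ of $\mathbb R^3$ about the axis $(1,1,1)$. \emph{Two-copy test (Test 1):} the same on $\psi^{\otimes2}$, where $P$ is the projection onto the vectors of the symmetric subspace of $\mathcal H_n^{\otimes 2}$ that are invariant under $U_o$ for all $o\in SO(2)$. \textbf{Theorem.} There is a universal constant $C>0$ such that the following holds. Let $n\ge1$, $E>0$, $0\le\varepsilon_A<\varepsilon_B$, $\delta\in(0,1)$, and suppose that $$\varepsilon=C\min\Big(\varepsilon_B^2,\frac1{n^4E^4}\Big)-\varepsilon_A$$ is positive. Consider pure states $\psi$ on $n$ modes such that $E_2(\psi)\le E$ whenever $d_{\mathcal G}(\psi)>\varepsilon_B$. Then $N=\mathcal O(\varepsilon^{-2}\log(1/\delta))$ independent rounds of the three-copy test, followed by a decision depending only on the $N$ outcomes, suffice to determine with probability of error at most $\delta$ whether $d_{\mathcal G}(\psi)\le\varepsilon_A$ or $d_{\mathcal G}(\psi)>\varepsilon_B$: there is a universal $K>0$ such that for every integer $N\ge K\varepsilon^{-2}\log(1/\delta)$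 there is a decision rule, not depending on $\psi$, that rejects with probability at most $\delta$ if $d_{\mathcal G}(\psi)\le\varepsilon_A$ and accepts with probability at most $\delta$ if $d_{\mathcal G}(\psi)>\varepsilon_B$. If $\varepsilon_A=\mathcal O(\varepsilon)$, then $N=\mathcal O(\varepsilon^{-1}\log(1/\delta))$ rounds suffice: for every $c>0$ there is $K_c>0$, depending only on $c$, such that if $\varepsilon_A\le c\,\varepsilon$ the same holds for every integer $N\ge K_c\varepsilon^{-1}\log(1/\delta)$. The same statement (with possibly different constants) holds for the two-copy test, with $\mathcal G_0$ in place of $\mathcal G$, for pure states $\psi$ of even parity ($\psi(-\mathbf x)=\psi(\mathbf x)$). -/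

import Mathlib

open MeasureTheory
open scoped ENNReal SchwartzMap InnerProductSpace

noncomputable section

namespace GaussTest

/-! ### States and trace distance -/

section States

variable {H : Type*} [NormedAddCommGroup H] [InnerProductSpace ℂ H] [CompleteSpace H]

/-- The trace norm `‖A‖₁ = Tr |A|` with `|A| = √(A†A)`. The trace of the positive operator `|A|`
is the supremum of its partial traces over finite orthonormal families (`∞` if `A` is not of
trace class). -/
def traceNorm (A : H →L[ℂ] H) : ℝ≥0∞ :=
  ⨆ (m : ℕ) (e : Fin m → H) (_ : Orthonormal ℂ e),
    ENNReal.ofReal (∑ i, (⟪e i, CFC.abs A (e i)⟫_ℂ).re)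

/-- The density operator `|ψ⟩⟨ψ|` of a pure state with unit vector `ψ`. -/
def pureState (ψ : H) : H →L[ℂ] H := InnerProductSpace.rankOne ℂ ψ ψ

/-- The trace distance `d_Q(ρ) = min_{σ ∈ Q} ½‖ρ - σ‖₁` of `ρ` to a set of states `Q`. -/
def distTo (Q : Set (H →L[ℂ] H)) (ρ : H →L[ℂ] H) : ℝ≥0∞ :=
  ⨅ σ ∈ Q, traceNorm (ρ - σ) / 2

end States

/-! ### The Hilbert space of `n` bosonic modes -/

/-- `ℋₙ = L²(ℝⁿ)`. -/
abbrev Modes (n : ℕ) : Type := Lp ℂ 2 (volume : Measure (EuclideanSpace ℝ (Fin n)))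

/-- `ψ` has even parity: `ψ(-x) = ψ(x)`. -/
def EvenParity {n : ℕ} (ψ : Modes n) : Prop :=
  (fun x => ψ (-x)) =ᵐ[volume] ψ

/-! ### Pure Gaussian states -/

/-- The Gaussian wavefunction with first moment `(x₀, p₀)` and parameters `W`, `U`:
`(det W / πⁿ)^{1/4} exp(-½ (x-x₀)ᵀ(W + iU)(x-x₀) + i p₀·(x-x₀))`. -/
def gaussianWave {n : ℕ} (W U : Matrix (Fin n) (Fin n) ℝ) (x₀ p₀ x : EuclideanSpace ℝ (Fin n)) :
    ℂ :=
  (((W.det / Real.pi ^ n) ^ (1 / 4 : ℝ) : ℝ) : ℂ) *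
    Complex.exp
      (-(1 / 2 : ℂ) *
          (((x - x₀).ofLp ⬝ᵥ W.mulVec (x - x₀).ofLp : ℝ) +
            Complex.I * ((x - x₀).ofLp ⬝ᵥ U.mulVec (x - x₀).ofLp : ℝ)) +
        Complex.I * (⟪p₀, x - x₀⟫_ℝ : ℝ))

/-- `𝒢`: the pure Gaussian states on `n` modes (as density operators). -/
def gaussianStates (n : ℕ) : Set (Modes n →L[ℂ] Modes n) :=
  {σ | ∃ (φ : Modes n) (W U : Matrix (Fin n) (Fin n) ℝ) (x₀ p₀ : EuclideanSpace ℝ (Fin n)),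
    W.PosDef ∧ U.IsSymm ∧ φ =ᵐ[volume] gaussianWave W U x₀ p₀ ∧ σ = pureState φ}

/-- `𝒢₀`: the pure Gaussian states on `n` modes whose first moments vanish. -/
def zeroMeanGaussianStates (n : ℕ) : Set (Modes n →L[ℂ] Modes n) :=
  {σ | ∃ (φ : Modes n) (W U : Matrix (Fin n) (Fin n) ℝ),
    W.PosDef ∧ U.IsSymm ∧ φ =ᵐ[volume] gaussianWave W U 0 0 ∧ σ = pureState φ}

/-! ### Energy -/

/-- The energy operator `Ê = ½ ∑ᵢ (x̂ᵢ² + p̂ᵢ²) = ½ (|x|² - Δ)` on a Schwartz function. -/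
def energyOnSchwartz {n : ℕ} (φ : 𝓢(EuclideanSpace ℝ (Fin n), ℂ))
    (x : EuclideanSpace ℝ (Fin n)) : ℂ :=
  (1 / 2 : ℂ) * (((‖x‖ ^ 2 : ℝ) : ℂ) * φ x - Laplacian.laplacian (φ : _ → ℂ) x)

/-- `ψ` is in the domain of the self-adjoint operator `Ê` and `Ê ψ = g`: the identity holds in the
sense of tempered distributions, with `ψ, g ∈ L²`. -/
def EnergyEq {n : ℕ} (ψ g : Modes n) : Prop :=
  ∀ φ : 𝓢(EuclideanSpace ℝ (Fin n), ℂ), ∫ x, g x * φ x = ∫ x, ψ x * energyOnSchwartz φ x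

/-- `Tr[ψ Ê²] = ‖Ê ψ‖²`, which is `∞` when `ψ` is not in the domain of `Ê`. -/
def energySq {n : ℕ} (ψ : Modes n) : ℝ≥0∞ :=
  ⨅ (g : Modes n) (_ : EnergyEq ψ g), ‖g‖ₑ ^ 2

/-! ### Displacement operators and symplectic Gaussian unitaries -/

theorem memLp_displace {n : ℕ} (a b : EuclideanSpace ℝ (Fin n)) (f : Modes n) :
    MemLp (fun x => Complex.exp (-Complex.I * ((⟪b, x⟫_ℝ + ⟪a, b⟫_ℝ / 2 : ℝ) : ℂ)) * f (x + a))
      2 volume := by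
  have h1 : MemLp (fun x => f (x + a)) 2 volume :=
    (Lp.memLp f).comp_measurePreserving (measurePreserving_add_right volume a)
  refine h1.of_le (AEStronglyMeasurable.mul ?_ h1.1) (Filter.Eventually.of_forall fun x => ?_)
  · exact (by fun_prop : Continuous fun x : EuclideanSpace ℝ (Fin n) =>
      Complex.exp (-Complex.I * ((⟪b, x⟫_ℝ + ⟪a, b⟫_ℝ / 2 : ℝ) : ℂ))).aestronglyMeasurable
  · have h : ‖Complex.exp (-Complex.I * ((⟪b, x⟫_ℝ + ⟪a, b⟫_ℝ / 2 : ℝ) : ℂ))‖ = 1 := by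
      rw [Complex.norm_exp, neg_mul, Complex.neg_re, Complex.re_mul_ofReal]
      simp
    rw [norm_mul, h, one_mul]

/-- The displacement operator `D_r = exp(i rᵀ Ω R̂) = exp(i (a·p̂ - b·x̂))` for `r = (a, b) ∈ ℝ²ⁿ`:
`(D_r f)(x) = exp(-i (b·x + a·b/2)) f(x + a)`. -/
def displace {n : ℕ} (r : Fin n ⊕ Fin n → ℝ) (f : Modes n) : Modes n :=
  (memLp_displace (WithLp.toLp 2 (r ∘ Sum.inl)) (WithLp.toLp 2 (r ∘ Sum.inr)) f).toLp _

/-- `U` is a symplectic Gaussian unitary `U_S` associated with the symplectic matrix `S`, i.e.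
`U† R̂ U = S R̂`; in exponentiated (Weyl) form, `U D_r U† = D_{S r}` for all `r`. For each `S` this
determines `U` up to a phase. -/
def IsGaussianUnitary {n : ℕ} (S : Matrix.symplecticGroup (Fin n) ℝ)
    (U : Modes n ≃ₗᵢ[ℂ] Modes n) : Prop :=
  ∀ (r : Fin n ⊕ Fin n → ℝ) (f : Modes n), U (displace r f) = displace (S.1.mulVec r) (U f)

/-- `E₂(ψ) = (1/n) min_S √(Tr[U_S ψ U_S† Ê²])`, the minimum over all symplectic matrices `S`. -/
def E₂ {n : ℕ} (ψ : Modes n) : ℝ≥0∞ :=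
  (⨅ (S : Matrix.symplecticGroup (Fin n) ℝ) (U : Modes n ≃ₗᵢ[ℂ] Modes n)
    (_ : IsGaussianUnitary S U), (energySq (U ψ)) ^ (1 / 2 : ℝ)) / n

/-! ### Several copies, rotations between the copies, and rotation tests -/

/-- `ℋₙ^{⊗k} = L²(ℝ^{n × k})`; the configuration space consists of `k` points of `ℝⁿ`. -/
abbrev Copies (n k : ℕ) : Type :=
  Lp ℂ 2 (volume : Measure (Fin k → EuclideanSpace ℝ (Fin n)))

theorem memLp_tensorPow {n : ℕ} (k : ℕ) (ψ : Modes n) :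
    MemLp (fun x : Fin k → EuclideanSpace ℝ (Fin n) => ∏ j, ψ (x j)) 2 volume := by
  have hm : AEStronglyMeasurable
      (fun x : Fin k → EuclideanSpace ℝ (Fin n) => ∏ j, ψ (x j)) volume := by
    have : StronglyMeasurable (fun x : Fin k → EuclideanSpace ℝ (Fin n) => ∏ j, ψ (x j)) :=
      Finset.stronglyMeasurable_fun_prod _ fun j _ =>
        (Lp.stronglyMeasurable ψ).comp_measurable (measurable_pi_apply j)
    exact this.aestronglyMeasurable
  rw [memLp_two_iff_integrable_sq_norm hm]
  have h := Integrable.fintype_prod (ι := Fin k)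
    (μ := fun _ => (volume : Measure (EuclideanSpace ℝ (Fin n))))
    (f := fun _ x => ‖ψ x‖ ^ 2)
    (fun _ => (memLp_two_iff_integrable_sq_norm (Lp.aestronglyMeasurable ψ)).1 (Lp.memLp ψ))
  refine h.congr (Filter.Eventually.of_forall fun x => ?_)
  simp [norm_prod, Finset.prod_pow]

/-- `ψ^{⊗k}`, with wavefunction `(x₁, …, x_k) ↦ ψ(x₁) ⋯ ψ(x_k)`. -/
def tensorPow {n : ℕ} (k : ℕ) (ψ : Modes n) : Copies n k := (memLp_tensorPow k ψ).toLp _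

/-- The action `x ↦ x o` of a `k × k` matrix on `ℝ^{n × k}`, mixing the `k` copies of `ℝⁿ`. -/
def mix {n k : ℕ} (o : Matrix (Fin k) (Fin k) ℝ) :
    (Fin k → EuclideanSpace ℝ (Fin n)) →ₗ[ℝ] (Fin k → EuclideanSpace ℝ (Fin n)) where
  toFun x j := ∑ i, o i j • x i
  map_add' x y := by ext; simp [Finset.sum_add_distrib]
  map_smul' c x := by ext; simp [Finset.mul_sum, mul_left_comm]

theorem mix_sum_norm_sq {n k : ℕ} (o : Matrix.orthogonalGroup (Fin k) ℝ)
    (x : Fin k → EuclideanSpace ℝ (Fin n)) : ∑ j, ‖mix o.1 x j‖ ^ 2 = ∑ j, ‖x j‖ ^ 2 := by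
  have ho : o.1 * o.1.transpose = 1 := (Matrix.mem_orthogonalGroup_iff (Fin k) ℝ).1 o.2
  have h1 : ∀ j, ‖mix o.1 x j‖ ^ 2 = ∑ i, ∑ i', (o.1 i j * o.1 i' j) * ⟪x i, x i'⟫_ℝ := by
    intro j
    rw [← real_inner_self_eq_norm_sq]
    simp only [mix, LinearMap.coe_mk, AddHom.coe_mk, sum_inner, inner_sum, real_inner_smul_left,
      real_inner_smul_right, mul_assoc]
    rw [Finset.sum_comm]
    refine Finset.sum_congr rfl fun i _ => Finset.sum_congr rfl fun i' _ => ?_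
    rw [real_inner_comm]; ring
  simp only [h1]
  rw [Finset.sum_comm]
  refine Finset.sum_congr rfl fun i _ => ?_
  rw [Finset.sum_comm]
  have h2 : ∀ i', ∑ j, (o.1 i j * o.1 i' j) * ⟪x i, x i'⟫_ℝ
      = (if i = i' then 1 else 0) * ⟪x i, x i'⟫_ℝ := by
    intro i'
    rw [← Finset.sum_mul]
    have := congrFun (congrFun ho i) i'
    rw [Matrix.mul_apply, Matrix.one_apply] at this
    rw [← this]; rfl
  simp [h2]

theorem mix_measurePreserving {n k : ℕ} (o : Matrix.orthogonalGroup (Fin k) ℝ) :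
    MeasurePreserving (mix (n := n) o.1) volume volume := by
  have hinj : LinearMap.ker (mix (n := n) o.1) = ⊥ := by
    refine LinearMap.ker_eq_bot'.2 fun x hx => ?_
    have h := mix_sum_norm_sq o x
    rw [hx] at h
    have h0 : ∑ j, ‖x j‖ ^ 2 = 0 := by rw [← h]; simp
    rw [Finset.sum_eq_zero_iff_of_nonneg fun j _ => sq_nonneg _] at h0
    funext j
    simpa using h0 j (Finset.mem_univ j)
  have hdet : LinearMap.det (mix (n := n) o.1) ≠ 0 := fun h =>
    (LinearMap.bot_lt_ker_of_det_eq_zero h).ne' hinj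
  let B : Set (Fin k → EuclideanSpace ℝ (Fin n)) := {x | ∑ j, ‖x j‖ ^ 2 < 1}
  have hBo : IsOpen B := isOpen_lt (by fun_prop) continuous_const
  have hB0 : (volume B) ≠ 0 := (hBo.measure_pos volume ⟨0, by simp [B]⟩).ne'
  have hBt : (volume B) ≠ ∞ := by
    refine ((measure_mono ?_).trans_lt
      (measure_closedBall_lt_top (μ := volume) (x := 0) (r := 1))).ne
    intro x hx
    rw [mem_closedBall_zero_iff, pi_norm_le_iff_of_nonneg zero_le_one]
    intro j
    have h1 : ‖x j‖ ^ 2 ≤ ∑ j, ‖x j‖ ^ 2 :=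
      Finset.single_le_sum (f := fun j => ‖x j‖ ^ 2) (fun _ _ => sq_nonneg _) (Finset.mem_univ j)
    have h2 : ∑ j, ‖x j‖ ^ 2 < 1 := hx
    nlinarith [norm_nonneg (x j)]
  have hpre : mix (n := n) o.1 ⁻¹' B = B := by
    ext x
    simp only [B, Set.mem_preimage, Set.mem_ofPred_eq, mix_sum_norm_sq]
  have hscale := Measure.addHaar_preimage_linearMap volume hdet B
  rw [hpre] at hscale
  have hone : ENNReal.ofReal |(LinearMap.det (mix (n := n) o.1))⁻¹| = 1 := by
    have h : ENNReal.ofReal |(LinearMap.det (mix (n := n) o.1))⁻¹| * volume B = 1 * volume B := by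
      rw [one_mul]; exact hscale.symm
    exact (ENNReal.mul_left_inj hB0 hBt).1 h
  refine ⟨(LinearMap.continuous_of_finiteDimensional _).measurable, ?_⟩
  rw [Measure.map_linearMap_addHaar_eq_smul_addHaar volume hdet, hone, one_smul]

/-- The unitary `U_o` of an orthogonal matrix `o ∈ O(k)`: `(U_o Ψ)(x) = Ψ(x o)`. -/
def mixUnitary {n k : ℕ} (o : Matrix.orthogonalGroup (Fin k) ℝ) : Copies n k →ₗᵢ[ℂ] Copies n k :=
  Lp.compMeasurePreservingₗᵢ ℂ (mix o.1) (mix_measurePreserving o)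

/-- The closed subspace of vectors in `ℋₙ^{⊗k}` invariant under `U_o` for all `o ∈ O`. -/
def invariantSubspace (n : ℕ) {k : ℕ} (O : Set (Matrix.orthogonalGroup (Fin k) ℝ)) :
    Submodule ℂ (Copies n k) :=
  ⨅ o ∈ O, LinearMap.eqLocus (mixUnitary o).toLinearMap LinearMap.id

theorem isClosed_invariantSubspace (n : ℕ) {k : ℕ}
    (O : Set (Matrix.orthogonalGroup (Fin k) ℝ)) :
    IsClosed (invariantSubspace n O : Set (Copies n k)) := by
  simp only [invariantSubspace, Submodule.coe_iInf]
  refine isClosed_iInter fun o => isClosed_iInter fun _ => ?_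
  exact isClosed_eq (mixUnitary o).continuous continuous_id

instance (n : ℕ) {k : ℕ} (O : Set (Matrix.orthogonalGroup (Fin k) ℝ)) :
    (invariantSubspace n O).HasOrthogonalProjection :=
  haveI : CompleteSpace (invariantSubspace n O) :=
    (isClosed_invariantSubspace n O).completeSpace_coe
  inferInstance

/-- The acceptance probability `Tr[P ψ^{⊗k}]` of the `k`-copy test `{P, I - P}`, where `P` is the
projection onto the vectors invariant under `U_o` for all `o ∈ O`. -/
def acceptProb {n k : ℕ} (O : Set (Matrix.orthogonalGroup (Fin k) ℝ)) (ψ : Modes n) : ℝ :=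
  (⟪tensorPow k ψ, (invariantSubspace n O).starProjection (tensorPow k ψ)⟫_ℂ).re

/-- The rotation of two copies by the angle `θ`. -/
def rot2 (θ : ℝ) : Matrix.orthogonalGroup (Fin 2) ℝ :=
  ⟨!![Real.cos θ, -Real.sin θ; Real.sin θ, Real.cos θ], by
    rw [Matrix.mem_orthogonalGroup_iff]
    ext i j
    fin_cases i <;> fin_cases j <;>
      simp [Matrix.mul_apply, Fin.sum_univ_two] <;> nlinarith [Real.sin_sq_add_cos_sq θ]⟩

/-- The swap of two copies. -/
def swap2 : Matrix.orthogonalGroup (Fin 2) ℝ :=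
  ⟨!![0, 1; 1, 0], by
    rw [Matrix.mem_orthogonalGroup_iff]
    ext i j
    fin_cases i <;> fin_cases j <;> simp [Matrix.mul_apply, Fin.sum_univ_two]⟩

/-- The rotation of three copies by the angle `θ` along the axis `(1, 1, 1)`. -/
def rot3 (θ : ℝ) : Matrix.orthogonalGroup (Fin 3) ℝ :=
  ⟨(1 / 3 : ℝ) •
    !![1 + 2 * Real.cos θ, 1 - Real.cos θ - √3 * Real.sin θ, 1 - Real.cos θ + √3 * Real.sin θ;
       1 - Real.cos θ + √3 * Real.sin θ, 1 + 2 * Real.cos θ, 1 - Real.cos θ - √3 * Real.sin θ;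
       1 - Real.cos θ - √3 * Real.sin θ, 1 - Real.cos θ + √3 * Real.sin θ, 1 + 2 * Real.cos θ], by
    have h3 : √3 * √3 = (3 : ℝ) := Real.mul_self_sqrt (by norm_num)
    have hs : Real.sin θ ^ 2 = 1 - Real.cos θ ^ 2 := by linarith [Real.sin_sq_add_cos_sq θ]
    have h4 : (√3 * Real.sin θ) ^ 2 = 3 * (1 - Real.cos θ ^ 2) := by
      rw [mul_pow, hs, pow_two, h3]
    rw [Matrix.mem_orthogonalGroup_iff]
    ext i j
    fin_cases i <;> fin_cases j <;>
      simp [Matrix.mul_apply, Fin.sum_univ_three] <;> nlinarith [h4]⟩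

/-- The two-copy test for zero-mean Gaussian states: `P` projects onto the rotation-invariant
vectors in the symmetric subspace of `ℋₙ^{⊗2}`. -/
def twoCopyAcceptProb {n : ℕ} (ψ : Modes n) : ℝ := acceptProb (insert swap2 (Set.range rot2)) ψ

/-- The three-copy test for Gaussian states: `P` projects onto the vectors of `ℋₙ^{⊗3}` that are
invariant under rotations along the axis `(1, 1, 1)`. -/
def threeCopyAcceptProb {n : ℕ} (ψ : Modes n) : ℝ := acceptProb (Set.range rot3) ψ

/-! ### Repeating a test -/

/-- Probability that the outcome string of `N` independent rounds lies in `D`, where each round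
accepts (`true`) with probability `p`. -/
def outcomeProb (p : ℝ) {N : ℕ} (D : Finset (Fin N → Bool)) : ℝ :=
  ∑ s ∈ D, ∏ i, if s i then p else 1 - p

/-- `N` rounds of a test with acceptance probability `pacc` suffice to decide, with probability of
error at most `δ`, whether a pure state `ψ` (in the class `A` of admissible unit vectors) is
`εA`-close to or `εB`-far from `Q`, given that `E₂(ψ) ≤ E` in the far case. The final decision
is to accept if and only if the string of outcomes lies in a set `D` not depending on `ψ`. -/
def RoundsSuffice {n : ℕ} (pacc : Modes n → ℝ) (A : Set (Modes n))
    (Q : Set (Modes n →L[ℂ] Modes n)) (E εA εB δ : ℝ) (N : ℕ) : Prop :=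
  ∃ D : Finset (Fin N → Bool), ∀ ψ ∈ A, ‖ψ‖ = 1 →
    (ENNReal.ofReal εB < distTo Q (pureState ψ) → E₂ ψ ≤ ENNReal.ofReal E) →
    (distTo Q (pureState ψ) ≤ ENNReal.ofReal εA → outcomeProb (pacc ψ) Dᶜ ≤ δ) ∧
    (ENNReal.ofReal εB < distTo Q (pureState ψ) → outcomeProb (pacc ψ) D ≤ δ)

end GaussTest

end

/-!
Write `p` for the acceptance probability of a test on `ψ` and `d` for the trace distance of `ψ` to
the relevant set of Gaussian states. For a test that rejects with probability `1 - p`, a threshold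
on the number of rejections among the `N` outcomes separates two values of `1 - p` by the Chernoff
bound (`exists_threshold_rule`). It therefore suffices to have `1 - p ≤ 3d` for all `ψ` and `1 - p ≥
b min(d², 1/(nE)⁴)` for `ψ` of bounded energy (`threeCopy_bounds`, `twoCopy_bounds`); then
`exists_rounds` gives the number of rounds. Since all states are pure, `d` is determined by the
overlaps of `ψ` with Gaussian vectors (`overlap_of_distTo`).

*Upper bound.* A Gaussian vector is described by its characteristic function, the exponential of a
polynomial of degree two (`IsGaussVec`). So the `k`-fold power of a Gaussian vector is fixed by all
rotations of the copies that are admitted in the test, and is always accepted. A state at distance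
`d` is rejected with probability at most `3d` (`one_sub_acceptProb_le`).

*Lower bound for bounded energy.* If the rejection probability is `η = 1 - p`, every admitted
rotation moves `ψ^{⊗k}` by at most `2√η` (`norm_mixUnitary_sub_le`). The orbit under the
one-parameter group of rotations is periodic and stays in a small ball, so its velocity, the image
of `ψ^{⊗k}` under the generator `A`, satisfies a Landau-type inequality: its square is at most of
order `√η` times the norm of the acceleration `A² ψ^{⊗k}`, which is controlled by the second moment
of the energy (`RotFlow.norm_sq_genA_le_energy`). On the other hand `‖A ψ^{⊗k}‖²` is an expression
in the second moments of the operators `xᵢ` and `∂ᵢ`, centred in the three-copy case (`wedgeQ`), and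
it vanishes only for states that saturate the uncertainty relation. The quantitative form is as
follows. A linear symplectic change of the operators turns it into a bound on `∑ᵢ ‖aᵢ φ‖²` for the
lowering operators `aᵢ` (`exists_small_lowering`), and as the number operator `∑ᵢ aᵢ† aᵢ` has a
spectral gap above the vacuum (`norm_sq_sub_le_sum_lower`), `φ` is close to the vacuum. Hence some
Gaussian vector is close to `ψ` (`exists_gaussian_overlap`), and `d² ≤ 1024 √η (nE)²`
(`RotFlow.sq_dist_le_of_E₂_le`). Replacing `ψ` by `U_S ψ` does not change how far a rotation moves
`ψ^{⊗k}` (`MixCov.mixDefect_eq`), so the infimum over `S` in the definition of the energy does no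
harm.

*Lower bound for small `d`.* The previous bound only gives `η` of order `d⁴` as `d → 0`. For `d`
below an absolute constant, `η` is at least of order `d²` without any energy bound. A Gaussian
unitary moves a nearly closest Gaussian vector to the vacuum. Varying the vacuum by displacements
and squeezings then shows that optimality leaves almost no weight in the one-particle space (three
copies only) and in the two-particle space (`exists_norm_sec_one_le`, `exists_norm_sec_two_le`).
Write `ψ` as the vacuum plus a small vector `χ`. To first order in `χ`, `ψ^{⊗k}` is the vacuum plus
the sum of the `k` vectors having `χ` in one slot and the vacuum in the others. A rotation `o` acts
on the `m`-particle part of such a sum with overlap `∑ᵢⱼ oᵢⱼ^m` (`hasSum_norm_mix_oneSlot`). The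
rotation by `π` about `(1,1,1)` for three copies, and by `π/4` for two copies, moves all other
particle numbers by a fixed proportion (`le_mixDefect`, `sub_le_mixDefect`). For all other `d` the
bound for bounded energy suffices (`min_le_one_sub`).

The particle-number decomposition is obtained from coherent vectors `K_z`: their span is dense, and
sending `K_z` to its sequence of normalized powers of `z` preserves inner products (`fock`).
-/

namespace GaussTest

/-! ### Threshold decisions from repeated rounds -/

/-- The number of rejecting rounds in a string of outcomes. -/
def numReject {N : ℕ} (s : Fin N → Bool) : ℕ := (Finset.univ.filter fun i => s i = false).card

theorem sum_bernoulli_mul (p a : ℝ) (N : ℕ) :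
    ∑ s : Fin N → Bool, (∏ i, if s i then p else 1 - p) * a ^ numReject s
      = (p + (1 - p) * a) ^ N := by
  have h1 : ∀ s : Fin N → Bool, (∏ i, if s i then p else 1 - p) * a ^ numReject s
      = ∏ i, (if s i then p else (1 - p) * a) := by
    intro s
    have : a ^ numReject s = ∏ i, (if s i then 1 else a) := by
      rw [numReject, Finset.card_filter, ← Finset.prod_pow_eq_pow_sum]
      refine Finset.prod_congr rfl fun i _ => ?_
      by_cases h : s i <;> simp [h]
    rw [this, ← Finset.prod_mul_distrib]
    refine Finset.prod_congr rfl fun i _ => ?_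
    by_cases h : s i <;> simp [h]
  simp only [h1]
  have h2 := Finset.prod_univ_sum (R := ℝ) (fun _ : Fin N => (Finset.univ : Finset Bool))
    (fun _ b => if b then p else (1 - p) * a)
  simp only [Fintype.piFinset_univ] at h2
  rw [← h2]
  simp

theorem outcomeProb_le_of_le_pow {p a c : ℝ} {N : ℕ} (hp0 : 0 ≤ p) (hp1 : p ≤ 1) (ha : 0 ≤ a)
    (hc : 0 < c) (D : Finset (Fin N → Bool)) (hD : ∀ s ∈ D, c ≤ a ^ numReject s) :
    outcomeProb p D ≤ (p + (1 - p) * a) ^ N / c := by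
  rw [le_div_iff₀ hc, ← sum_bernoulli_mul, outcomeProb, Finset.sum_mul]
  have hw : ∀ s : Fin N → Bool, 0 ≤ ∏ i, if s i then p else 1 - p := fun s =>
    Finset.prod_nonneg fun i _ => by split_ifs <;> linarith
  calc ∑ s ∈ D, (∏ i, if s i then p else 1 - p) * c
      ≤ ∑ s ∈ D, (∏ i, if s i then p else 1 - p) * a ^ numReject s :=
        Finset.sum_le_sum fun s hs => mul_le_mul_of_nonneg_left (hD s hs) (hw s)
    _ ≤ _ := Finset.sum_le_sum_of_subset_of_nonneg (Finset.subset_univ _)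
        fun s _ _ => mul_nonneg (hw s) (pow_nonneg ha _)

/-- Chernoff bound for the threshold rule that accepts when the fraction of rejecting rounds is at
most `u + Δ / 2`: a rejection probability at most `u` and one at least `u + Δ` are told apart with
error `exp (-N Δ² / (16 (u + Δ)))`. -/
theorem exists_threshold_rule {u Δ δ : ℝ} {N : ℕ} (hu : 0 ≤ u) (hΔ : 0 < Δ) (hδ : 0 < δ)
    (hN : 16 * (u + Δ) / Δ ^ 2 * Real.log δ⁻¹ ≤ N) :
    ∃ D : Finset (Fin N → Bool), ∀ p : ℝ, 0 ≤ p → p ≤ 1 →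
      (1 - p ≤ u → outcomeProb p Dᶜ ≤ δ) ∧ (u + Δ ≤ 1 - p → outcomeProb p D ≤ δ) := by
  classical
  have hv : 0 < u + Δ := by linarith
  set l : ℝ := Δ / (4 * (u + Δ)) with hl
  have hl0 : 0 < l := by positivity
  have hl1 : l ≤ 1 / 4 := by
    rw [hl, div_le_div_iff₀ (by positivity) (by norm_num)]; linarith
  have hlv : l * (u + Δ) = Δ / 4 := by rw [hl]; field_simp
  have hexp : Real.exp (-(N * (l * Δ / 4))) ≤ δ := by
    have h : Real.log δ⁻¹ ≤ N * (l * Δ / 4) := by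
      have h1 : l * Δ / 4 = Δ ^ 2 / (16 * (u + Δ)) := by rw [hl]; field_simp; ring
      rw [h1]
      calc Real.log δ⁻¹ = (16 * (u + Δ) / Δ ^ 2 * Real.log δ⁻¹) * (Δ ^ 2 / (16 * (u + Δ))) := by
            field_simp
        _ ≤ _ := mul_le_mul_of_nonneg_right hN (by positivity)
    rw [Real.log_inv] at h
    calc Real.exp (-(N * (l * Δ / 4))) ≤ Real.exp (Real.log δ) :=
          Real.exp_le_exp.2 (by linarith)
      _ = δ := Real.exp_log hδ
  refine ⟨Finset.univ.filter fun s => (numReject s : ℝ) ≤ N * (u + Δ / 2), fun p hp0 hp1 =>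
    ⟨fun hq => ?_, fun hq => ?_⟩⟩
  · have hb := outcomeProb_le_of_le_pow (c := Real.exp (l * (N * (u + Δ / 2)))) hp0 hp1
      (Real.exp_pos l).le (Real.exp_pos _)
      (Finset.univ.filter fun s : Fin N → Bool => (numReject s : ℝ) ≤ N * (u + Δ / 2))ᶜ (by
        intro s hs
        simp only [Finset.mem_compl, Finset.mem_filter, Finset.mem_univ, true_and, not_le] at hs
        rw [← Real.exp_nat_mul]
        exact Real.exp_le_exp.2 (by nlinarith))
    refine hb.trans (le_trans ?_ hexp)
    rw [div_le_iff₀ (Real.exp_pos _), ← Real.exp_add]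
    have h1 : p + (1 - p) * Real.exp l ≤ Real.exp (u * (l + l ^ 2)) := by
      have h2 : Real.exp l ≤ 1 + l + l ^ 2 := by
        have := Real.abs_exp_sub_one_sub_id_le (x := l) (by rw [abs_of_pos hl0]; linarith)
        linarith [(abs_le.1 this).2]
      have h3 := Real.add_one_le_exp (u * (l + l ^ 2))
      have h4 : (1 - p) * (Real.exp l - 1) ≤ u * (l + l ^ 2) := by
        have : 0 ≤ Real.exp l - 1 := by linarith [Real.add_one_le_exp l]
        exact mul_le_mul hq (by linarith) this hu
      linarith
    calc (p + (1 - p) * Real.exp l) ^ N ≤ Real.exp (u * (l + l ^ 2)) ^ N := by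
          refine pow_le_pow_left₀ ?_ h1 N
          have := Real.exp_pos l
          nlinarith
      _ = Real.exp (N * (u * (l + l ^ 2))) := by rw [Real.exp_nat_mul]
      _ ≤ _ := by
          refine Real.exp_le_exp.2 ?_
          have h5 : u * l ^ 2 ≤ l * Δ / 4 := by
            have : u * l ≤ Δ / 4 := by nlinarith
            nlinarith
          have h6 : (0 : ℝ) ≤ N := Nat.cast_nonneg N
          nlinarith
  · have hb := outcomeProb_le_of_le_pow (c := Real.exp (-l * (N * (u + Δ / 2)))) hp0 hp1
      (Real.exp_pos (-l)).le (Real.exp_pos _)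
      (Finset.univ.filter fun s : Fin N → Bool => (numReject s : ℝ) ≤ N * (u + Δ / 2)) (by
        intro s hs
        simp only [Finset.mem_filter, Finset.mem_univ, true_and] at hs
        rw [← Real.exp_nat_mul]
        exact Real.exp_le_exp.2 (by nlinarith))
    refine hb.trans (le_trans ?_ hexp)
    rw [div_le_iff₀ (Real.exp_pos _), ← Real.exp_add]
    have h1 : p + (1 - p) * Real.exp (-l) ≤ Real.exp ((u + Δ) * (-l + l ^ 2)) := by
      have h2 : Real.exp (-l) ≤ 1 + -l + l ^ 2 := by
        have := Real.abs_exp_sub_one_sub_id_le (x := -l)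
          (by rw [abs_neg, abs_of_pos hl0]; linarith)
        have := (abs_le.1 this).2
        nlinarith
      have h3 := Real.add_one_le_exp ((u + Δ) * (-l + l ^ 2))
      have h4 : (1 - p) * (Real.exp (-l) - 1) ≤ (u + Δ) * (-l + l ^ 2) := by
        have h7 : -l + l ^ 2 ≤ 0 := by nlinarith
        nlinarith
      linarith
    calc (p + (1 - p) * Real.exp (-l)) ^ N ≤ Real.exp ((u + Δ) * (-l + l ^ 2)) ^ N := by
          refine pow_le_pow_left₀ ?_ h1 N
          have := Real.exp_pos (-l)
          nlinarith
      _ = Real.exp (N * ((u + Δ) * (-l + l ^ 2))) := by rw [Real.exp_nat_mul]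
      _ ≤ _ := by
          refine Real.exp_le_exp.2 ?_
          have h5 : (u + Δ) * l ^ 2 = l * Δ / 4 := by
            calc (u + Δ) * l ^ 2 = l * (l * (u + Δ)) := by ring
              _ = _ := by rw [hlv]; ring
          have h6 : (0 : ℝ) ≤ N := Nat.cast_nonneg N
          have h8 : (u + Δ) * (-l + l ^ 2) = -l * (u + Δ / 2) - l * Δ / 4 := by
            rw [mul_add, h5]; ring
          rw [h8]
          nlinarith

/-! ### Trace distance of pure states -/

section Trace

variable {H : Type*} [NormedAddCommGroup H] [InnerProductSpace ℂ H]

theorem pureState_apply (ψ x : H) : pureState ψ x = ⟪ψ, x⟫_ℂ • ψ := by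
  simp [pureState]

theorem pureState_smul_of_norm_eq_one (ψ : H) (c : ℂ) (hc : ‖c‖ = 1) :
    pureState (c • ψ) = pureState ψ := by
  ext x
  rw [pureState_apply, pureState_apply, inner_smul_left, smul_smul]
  congr 1
  have : (starRingEnd ℂ) c * c = 1 := by
    rw [mul_comm, Complex.mul_conj, Complex.normSq_eq_norm_sq, hc]; simp
  linear_combination ⟪ψ, x⟫_ℂ * this

theorem eq_smul_of_norm_inner_eq_one {ψ φ : H} (hψ : ‖ψ‖ = 1) (hφ : ‖φ‖ = 1)
    (h : ‖⟪ψ, φ⟫_ℂ‖ = 1) : φ = ⟪ψ, φ⟫_ℂ • ψ := by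
  have hψψ : ⟪ψ, ψ⟫_ℂ = 1 := by rw [inner_self_eq_norm_sq_to_K, hψ]; simp
  have h1 : ‖⟪ψ, φ⟫_ℂ • ψ + (φ - ⟪ψ, φ⟫_ℂ • ψ)‖ * ‖⟪ψ, φ⟫_ℂ • ψ + (φ - ⟪ψ, φ⟫_ℂ • ψ)‖ = _ :=
    norm_add_sq_eq_norm_sq_add_norm_sq_of_inner_eq_zero (𝕜 := ℂ) (⟪ψ, φ⟫_ℂ • ψ)
      (φ - ⟪ψ, φ⟫_ℂ • ψ)
      (by rw [inner_smul_left, inner_sub_right, inner_smul_right, hψψ]; ring)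
  rw [add_sub_cancel, hφ, norm_smul, hψ, h] at h1
  have h2 : ‖φ - ⟪ψ, φ⟫_ℂ • ψ‖ = 0 := by
    have := norm_nonneg (φ - ⟪ψ, φ⟫_ℂ • ψ)
    nlinarith
  exact sub_eq_zero.1 (norm_eq_zero.1 h2)

variable [CompleteSpace H]

theorem abs_pureState_sub {ψ u : H} {c : ℂ} {s : ℝ} (hψ : ‖ψ‖ = 1) (hu : ‖u‖ = 1)
    (hψu : ⟪ψ, u⟫_ℂ = 0) (hs : 0 ≤ s) (hcs : ‖c‖ ^ 2 + s ^ 2 = 1) :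
    CFC.abs (pureState ψ - pureState (c • ψ + (s : ℂ) • u))
      = (s : ℂ) • (pureState ψ + pureState u) := by
  have huψ : ⟪u, ψ⟫_ℂ = 0 := by rw [← inner_conj_symm, hψu, map_zero]
  have hψψ : ⟪ψ, ψ⟫_ℂ = 1 := by rw [inner_self_eq_norm_sq_to_K, hψ]; simp
  have huu : ⟪u, u⟫_ℂ = 1 := by rw [inner_self_eq_norm_sq_to_K, hu]; simp
  have hcc : (starRingEnd ℂ) c * c = 1 - (s : ℂ) ^ 2 := by
    rw [mul_comm, Complex.mul_conj, Complex.normSq_eq_norm_sq]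
    have : ‖c‖ ^ 2 = 1 - s ^ 2 := by linarith
    rw [this]; push_cast; ring
  have hpos : ∀ φ : H, (pureState φ).IsPositive := fun φ =>
    InnerProductSpace.isPositive_rankOne_self φ
  have hsa : ∀ φ : H, star (pureState φ) = pureState φ := fun φ => (hpos φ).isSelfAdjoint
  unfold CFC.abs
  refine CFC.sqrt_unique ?_ ?_
  · rw [star_sub, hsa, hsa]
    ext x
    simp only [mul_apply_eq_comp, sub_apply, smul_apply, add_apply, pureState_apply,
      inner_add_left, inner_add_right, inner_sub_right, inner_smul_left, inner_smul_right, hψψ, huu,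
      hψu, huψ, Complex.conj_ofReal]
    set a := ⟪ψ, x⟫_ℂ
    set b := ⟪u, x⟫_ℂ
    set c' := (starRingEnd ℂ) c with hc'
    clear_value a b c'
    match_scalars
    · linear_combination (-(s * b * c - a * (1 - c' * c))) * hcc
    · linear_combination (-(s ^ 2 * b + s * a * c')) * hcc
  · refine (ContinuousLinearMap.nonneg_iff_isPositive _).2 ?_
    refine ContinuousLinearMap.IsPositive.smul_of_nonneg ((hpos ψ).add (hpos u)) ?_
    exact_mod_cast hs

theorem traceNorm_pureState_sub {ψ φ : H} (hψ : ‖ψ‖ = 1) (hφ : ‖φ‖ = 1) :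
    traceNorm (pureState ψ - pureState φ) = ENNReal.ofReal (2 * √(1 - ‖⟪ψ, φ⟫_ℂ‖ ^ 2)) := by
  set c := ⟪ψ, φ⟫_ℂ with hc
  set s := √(1 - ‖c‖ ^ 2) with hs
  have hψψ : ⟪ψ, ψ⟫_ℂ = 1 := by rw [inner_self_eq_norm_sq_to_K, hψ]; simp
  have hc1 : ‖c‖ ≤ 1 := by
    have := norm_inner_le_norm (𝕜 := ℂ) ψ φ
    rwa [hψ, hφ, mul_one] at this
  have hss : s ^ 2 = 1 - ‖c‖ ^ 2 := Real.sq_sqrt (by nlinarith [norm_nonneg c])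
  have hw0 : ⟪ψ, φ - c • ψ⟫_ℂ = 0 := by
    rw [inner_sub_right, inner_smul_right, hψψ, ← hc]; ring
  have hw : ‖φ - c • ψ‖ ^ 2 = s ^ 2 := by
    have h1 : ‖c • ψ + (φ - c • ψ)‖ * ‖c • ψ + (φ - c • ψ)‖ = _ :=
      norm_add_sq_eq_norm_sq_add_norm_sq_of_inner_eq_zero (𝕜 := ℂ) (c • ψ) (φ - c • ψ)
      (by rw [inner_smul_left, hw0, mul_zero])
    rw [add_sub_cancel, hφ, norm_smul, hψ] at h1
    nlinarith
  have hs0 : 0 ≤ s := Real.sqrt_nonneg _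
  have hws : ‖φ - c • ψ‖ = s := by
    rwa [sq_eq_sq₀ (norm_nonneg _) hs0] at hw
  rcases hs0.eq_or_lt with h0 | h0
  · have h1 : φ = c • ψ := sub_eq_zero.1 (norm_eq_zero.1 (hws.trans h0.symm))
    have h2 : ‖c‖ = 1 := by
      rw [h1, norm_smul, hψ, mul_one] at hφ; exact hφ
    have h3 : pureState ψ - pureState φ = 0 := by
      rw [h1, pureState_smul_of_norm_eq_one _ _ h2, sub_self]
    rw [h3, ← h0]
    simp [traceNorm]
  · set u : H := ((s⁻¹ : ℝ) : ℂ) • (φ - c • ψ) with hu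
    have hu1 : ‖u‖ = 1 := by
      rw [hu, norm_smul, hws, Complex.norm_real, norm_inv, Real.norm_of_nonneg hs0,
        inv_mul_cancel₀ h0.ne']
    have hψu : ⟪ψ, u⟫_ℂ = 0 := by rw [hu, inner_smul_right, hw0, mul_zero]
    have hφu : φ = c • ψ + (s : ℂ) • u := by
      rw [hu, smul_smul, ← Complex.ofReal_mul, mul_inv_cancel₀ h0.ne']
      simp
    have huu : ⟪u, u⟫_ℂ = 1 := by rw [inner_self_eq_norm_sq_to_K, hu1]; simp
    have huψ : ⟪u, ψ⟫_ℂ = 0 := by rw [← inner_conj_symm, hψu, map_zero]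
    have key : ∀ e : H, (⟪e, CFC.abs (pureState ψ - pureState φ) e⟫_ℂ).re
        = s * (‖⟪e, ψ⟫_ℂ‖ ^ 2 + ‖⟪e, u⟫_ℂ‖ ^ 2) := by
      intro e
      have h3 : CFC.abs (pureState ψ - pureState φ) = (s : ℂ) • (pureState ψ + pureState u) := by
        conv_lhs => rw [hφu]
        exact abs_pureState_sub hψ hu1 hψu hs0 (by linarith)
      have h4 : ∀ v : H, ⟪v, e⟫_ℂ * ⟪e, v⟫_ℂ = ((‖⟪e, v⟫_ℂ‖ ^ 2 : ℝ) : ℂ) := fun v => by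
        rw [← inner_conj_symm, mul_comm, Complex.mul_conj, Complex.normSq_eq_norm_sq]
      rw [h3]
      simp only [smul_apply, add_apply, pureState_apply, inner_smul_right, inner_add_right, h4]
      rw [← Complex.ofReal_add, ← Complex.ofReal_mul, Complex.ofReal_re]
    simp only [traceNorm, key]
    apply le_antisymm
    · refine iSup_le fun m => iSup_le fun e => iSup_le fun he => ENNReal.ofReal_le_ofReal ?_
      have h1 : ∀ v : H, ‖v‖ = 1 → ∑ i, ‖⟪e i, v⟫_ℂ‖ ^ 2 ≤ 1 := fun v hv => by
        have := he.sum_inner_products_le v (s := Finset.univ)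
        rwa [hv, one_pow] at this
      rw [← Finset.mul_sum, Finset.sum_add_distrib]
      nlinarith [h1 ψ hψ, h1 u hu1]
    · have he : Orthonormal ℂ ![ψ, u] := by
        constructor
        · intro i; fin_cases i <;> simp [hψ, hu1]
        · intro i j hij
          fin_cases i <;> fin_cases j <;> simp [hψu, huψ] at hij ⊢
      refine le_iSup_of_le 2 (le_iSup_of_le ![ψ, u] (le_iSup_of_le he ?_))
      refine ENNReal.ofReal_le_ofReal ?_
      simp only [Fin.sum_univ_two, Matrix.cons_val_zero, Matrix.cons_val_one, hψψ, huu, hψu, huψ,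
        norm_one, norm_zero]
      linarith

theorem traceNorm_pureState_sub_half {ψ φ : H} (hψ : ‖ψ‖ = 1) (hφ : ‖φ‖ = 1) :
    traceNorm (pureState ψ - pureState φ) / 2 = ENNReal.ofReal √(1 - ‖⟪ψ, φ⟫_ℂ‖ ^ 2) := by
  rw [traceNorm_pureState_sub hψ hφ, ENNReal.ofReal_mul two_pos.le, mul_comm]
  simp only [ENNReal.ofReal_ofNat]
  exact ENNReal.mul_div_cancel_right (by norm_num) (by norm_num)

end Trace

/-! ### Product vectors -/

variable {n k : ℕ}

theorem memLp_prod (f : Fin k → Modes n) :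
    MemLp (fun x : Fin k → EuclideanSpace ℝ (Fin n) => ∏ j, f j (x j)) 2 volume := by
  have hm : StronglyMeasurable (fun x : Fin k → EuclideanSpace ℝ (Fin n) => ∏ j, f j (x j)) :=
    Finset.stronglyMeasurable_fun_prod _ fun j _ =>
      (Lp.stronglyMeasurable (f j)).comp_measurable (measurable_pi_apply j)
  rw [memLp_two_iff_integrable_sq_norm hm.aestronglyMeasurable]
  have h := Integrable.fintype_prod (ι := Fin k)
    (μ := fun _ => (volume : Measure (EuclideanSpace ℝ (Fin n))))
    (f := fun j x => ‖f j x‖ ^ 2)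
    (fun j => (memLp_two_iff_integrable_sq_norm (Lp.aestronglyMeasurable (f j))).1 (Lp.memLp _))
  refine h.congr (Filter.Eventually.of_forall fun x => ?_)
  simp [norm_prod, Finset.prod_pow]

theorem ae_eval_of_ae {p : EuclideanSpace ℝ (Fin n) → Prop} (j : Fin k) (h : ∀ᵐ x, p x) :
    ∀ᵐ x : Fin k → EuclideanSpace ℝ (Fin n), p (x j) :=
  (Measure.quasiMeasurePreserving_eval
    (fun _ : Fin k => (volume : Measure (EuclideanSpace ℝ (Fin n)))) j).ae h

theorem ae_prod_eq {f g : Fin k → EuclideanSpace ℝ (Fin n) → ℂ}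
    (h : ∀ j, f j =ᵐ[volume] g j) :
    (fun x : Fin k → EuclideanSpace ℝ (Fin n) => ∏ j, f j (x j)) =ᵐ[volume]
      fun x => ∏ j, g j (x j) := by
  have h1 : ∀ᵐ x : Fin k → EuclideanSpace ℝ (Fin n), ∀ j, f j (x j) = g j (x j) :=
    ae_all_iff.2 fun j => ae_eval_of_ae j (h j)
  filter_upwards [h1] with x hx
  exact Finset.prod_congr rfl fun j _ => hx j

theorem prod_update_apply [DecidableEq (Fin k)] (f : Fin k → Modes n) (i : Fin k) (c : Modes n)
    (x : Fin k → EuclideanSpace ℝ (Fin n)) :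
    ∏ j, (Function.update f i c j) (x j)
      = c (x i) * ∏ j ∈ Finset.univ.erase i, f j (x j) := by
  rw [← Finset.mul_prod_erase _ _ (Finset.mem_univ i), Function.update_self]
  congr 1
  refine Finset.prod_congr rfl fun j hj => ?_
  rw [Function.update_of_ne (Finset.ne_of_mem_erase hj)]

/-- The product vector `f₁ ⊗ ⋯ ⊗ f_k`, as a multilinear function of the factors. -/
noncomputable def ptensor (n k : ℕ) :
    MultilinearMap ℂ (fun _ : Fin k => Modes n) (Copies n k) where
  toFun f := (memLp_prod f).toLp _
  map_update_add' {_} f i a b := by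
    rw [← MemLp.toLp_add]
    refine MemLp.toLp_congr _ _ ?_
    filter_upwards [ae_eval_of_ae (k := k) i (Lp.coeFn_add a b)] with x hx
    simp only [Pi.add_apply, prod_update_apply, hx]
    ring
  map_update_smul' {_} f i c a := by
    rw [← MemLp.toLp_const_smul]
    refine MemLp.toLp_congr _ _ ?_
    filter_upwards [ae_eval_of_ae (k := k) i (Lp.coeFn_smul c a)] with x hx
    simp only [Pi.smul_apply, prod_update_apply, hx, smul_eq_mul]
    ring

theorem coeFn_ptensor (f : Fin k → Modes n) :
    ptensor n k f =ᵐ[volume] fun x => ∏ j, f j (x j) := MemLp.coeFn_toLp (memLp_prod f)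

theorem coeFn_ptensor_of_ae {f : Fin k → Modes n} {F : Fin k → EuclideanSpace ℝ (Fin n) → ℂ}
    (h : ∀ j, f j =ᵐ[volume] F j) : ptensor n k f =ᵐ[volume] fun x => ∏ j, F j (x j) :=
  (coeFn_ptensor f).trans (ae_prod_eq h)

theorem tensorPow_eq_ptensor (ψ : Modes n) : tensorPow k ψ = ptensor n k fun _ => ψ := rfl

theorem inner_ptensor (f g : Fin k → Modes n) :
    ⟪ptensor n k f, ptensor n k g⟫_ℂ = ∏ j, ⟪f j, g j⟫_ℂ := by
  rw [L2.inner_def]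
  simp only [L2.inner_def]
  rw [← integral_fintype_prod_volume_eq_prod (fun j x => ⟪f j x, g j x⟫_ℂ)]
  refine integral_congr_ae ?_
  filter_upwards [coeFn_ptensor f, coeFn_ptensor g] with x h1 h2
  rw [h1, h2]
  simp [RCLike.inner_apply, Finset.prod_mul_distrib]

theorem norm_ptensor (f : Fin k → Modes n) : ‖ptensor n k f‖ = ∏ j, ‖f j‖ := by
  have h : ‖ptensor n k f‖ ^ 2 = (∏ j, ‖f j‖) ^ 2 := by
    have h1 := inner_ptensor f f
    simp only [inner_self_eq_norm_sq_to_K] at h1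
    rw [← Finset.prod_pow]
    exact_mod_cast h1
  exact (sq_eq_sq₀ (norm_nonneg _) (Finset.prod_nonneg fun _ _ => norm_nonneg _)).1 h

theorem continuous_ptensor : Continuous (ptensor n k) :=
  ((ptensor n k).mkContinuous 1 fun f => by rw [norm_ptensor, one_mul]).cont

theorem coeFn_mixUnitary (o : Matrix.orthogonalGroup (Fin k) ℝ) (Ψ : Copies n k) :
    mixUnitary o Ψ =ᵐ[volume] fun x => Ψ (mix o.1 x) :=
  Lp.coeFn_compMeasurePreserving Ψ (mix_measurePreserving o)

theorem coeFn_mixUnitary_of_ae (o : Matrix.orthogonalGroup (Fin k) ℝ) {Ψ : Copies n k}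
    {F : (Fin k → EuclideanSpace ℝ (Fin n)) → ℂ} (h : Ψ =ᵐ[volume] F) :
    mixUnitary o Ψ =ᵐ[volume] fun x => F (mix o.1 x) :=
  (coeFn_mixUnitary o Ψ).trans ((mix_measurePreserving o).quasiMeasurePreserving.ae_eq h)

theorem mixUnitary_ptensor_eq (o : Matrix.orthogonalGroup (Fin k) ℝ) {f g : Fin k → Modes n}
    {F G : Fin k → EuclideanSpace ℝ (Fin n) → ℂ} (hf : ∀ j, f j =ᵐ[volume] F j)
    (hg : ∀ j, g j =ᵐ[volume] G j) (h : ∀ x, ∏ j, F j (mix o.1 x j) = ∏ j, G j (x j)) :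
    mixUnitary o (ptensor n k f) = ptensor n k g := by
  refine Lp.ext ?_
  refine (coeFn_mixUnitary_of_ae o (coeFn_ptensor_of_ae hf)).trans
    (Filter.EventuallyEq.trans ?_ (coeFn_ptensor_of_ae hg).symm)
  exact Filter.Eventually.of_forall h

theorem mix_apply (o : Matrix (Fin k) (Fin k) ℝ) (x : Fin k → EuclideanSpace ℝ (Fin n))
    (j : Fin k) : mix o x j = ∑ i, o i j • x i := rfl

theorem mix_mul (o o' : Matrix (Fin k) (Fin k) ℝ) (x : Fin k → EuclideanSpace ℝ (Fin n)) :
    mix o' (mix o x) = mix (o * o') x := by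
  funext j
  simp only [mix_apply, Finset.smul_sum, smul_smul, Matrix.mul_apply, Finset.sum_smul]
  rw [Finset.sum_comm]
  exact Finset.sum_congr rfl fun i _ => Finset.sum_congr rfl fun l _ => by rw [mul_comm]

/-! ### The acceptance probability -/

theorem norm_tensorPow {ψ : Modes n} (hψ : ‖ψ‖ = 1) : ‖tensorPow k ψ‖ = 1 := by
  rw [tensorPow_eq_ptensor, norm_ptensor]
  simp [hψ]

theorem acceptProb_eq (O : Set (Matrix.orthogonalGroup (Fin k) ℝ)) (ψ : Modes n) :
    acceptProb O ψ = ‖(invariantSubspace n O).starProjection (tensorPow k ψ)‖ ^ 2 := by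
  rw [acceptProb]
  set P := (invariantSubspace n O).starProjection
  have h1 : ⟪tensorPow k ψ, P (tensorPow k ψ)⟫_ℂ = ⟪P (tensorPow k ψ), P (tensorPow k ψ)⟫_ℂ := by
    have h2 : P (P (tensorPow k ψ)) = P (tensorPow k ψ) :=
      Submodule.starProjection_eq_self_iff.2 (Submodule.starProjection_apply_mem _ _)
    conv_lhs => rw [← h2]
    exact (Submodule.inner_starProjection_left_eq_right _ _ _).symm
  rw [h1, inner_self_eq_norm_sq_to_K]
  norm_cast

theorem one_sub_acceptProb (O : Set (Matrix.orthogonalGroup (Fin k) ℝ)) {ψ : Modes n}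
    (hψ : ‖ψ‖ = 1) : 1 - acceptProb O ψ =
      ‖tensorPow k ψ - (invariantSubspace n O).starProjection (tensorPow k ψ)‖ ^ 2 := by
  have h := Submodule.norm_sq_eq_add_norm_sq_starProjection (tensorPow k ψ) (invariantSubspace n O)
  rw [norm_tensorPow hψ, Submodule.starProjection_orthogonal_val] at h
  rw [acceptProb_eq]
  linarith

theorem acceptProb_nonneg (O : Set (Matrix.orthogonalGroup (Fin k) ℝ)) (ψ : Modes n) :
    0 ≤ acceptProb O ψ := by rw [acceptProb_eq]; positivity

theorem acceptProb_le_one (O : Set (Matrix.orthogonalGroup (Fin k) ℝ)) {ψ : Modes n}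
    (hψ : ‖ψ‖ = 1) : acceptProb O ψ ≤ 1 := by
  have := one_sub_acceptProb O hψ
  nlinarith [sq_nonneg ‖tensorPow k ψ - (invariantSubspace n O).starProjection (tensorPow k ψ)‖]

theorem mem_invariantSubspace {O : Set (Matrix.orthogonalGroup (Fin k) ℝ)} {Φ : Copies n k} :
    Φ ∈ invariantSubspace n O ↔ ∀ o ∈ O, mixUnitary o Φ = Φ := by
  simp [invariantSubspace, Submodule.mem_iInf, LinearMap.mem_eqLocus]

/-- The rejection probability controls how far the rotations move `ψ^{⊗k}`. -/
theorem norm_mixUnitary_sub_le {O : Set (Matrix.orthogonalGroup (Fin k) ℝ)} {ψ : Modes n}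
    (hψ : ‖ψ‖ = 1) {o : Matrix.orthogonalGroup (Fin k) ℝ} (ho : o ∈ O) :
    ‖mixUnitary o (tensorPow k ψ) - tensorPow k ψ‖ ≤ 2 * √(1 - acceptProb O ψ) := by
  rw [one_sub_acceptProb O hψ, Real.sqrt_sq (norm_nonneg _)]
  set Ψ := tensorPow k ψ
  set P := (invariantSubspace n O).starProjection
  have h1 : mixUnitary o (P Ψ) = P Ψ :=
    mem_invariantSubspace.1 (Submodule.starProjection_apply_mem _ _) o ho
  have h2 : mixUnitary o Ψ - Ψ = mixUnitary o (Ψ - P Ψ) - (Ψ - P Ψ) := by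
    rw [map_sub, h1]; abel
  rw [h2]
  calc _ ≤ ‖mixUnitary o (Ψ - P Ψ)‖ + ‖Ψ - P Ψ‖ := norm_sub_le _ _
    _ = _ := by rw [LinearIsometry.norm_map]; ring

theorem sq_norm_inner_le_acceptProb {O : Set (Matrix.orthogonalGroup (Fin k) ℝ)} {ψ φ : Modes n}
    (hφ : ‖φ‖ = 1) (h : tensorPow k φ ∈ invariantSubspace n O) :
    (‖⟪φ, ψ⟫_ℂ‖ ^ k) ^ 2 ≤ acceptProb O ψ := by
  rw [acceptProb_eq]
  have h1 : ⟪tensorPow k φ, tensorPow k ψ⟫_ℂ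
      = ⟪tensorPow k φ, (invariantSubspace n O).starProjection (tensorPow k ψ)⟫_ℂ := by
    rw [← Submodule.inner_starProjection_left_eq_right,
      Submodule.starProjection_eq_self_iff.2 h]
  have h2 := norm_inner_le_norm (𝕜 := ℂ) (tensorPow k φ)
    ((invariantSubspace n O).starProjection (tensorPow k ψ))
  rw [← h1, norm_tensorPow hφ, one_mul, tensorPow_eq_ptensor, tensorPow_eq_ptensor,
    inner_ptensor] at h2
  simp only [Finset.prod_const, Finset.card_univ, Fintype.card_fin, norm_pow] at h2
  exact pow_le_pow_left₀ (by positivity) h2 2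

/-- The configuration space `ℝⁿ`. -/
abbrev Cfg (n : ℕ) : Type := EuclideanSpace ℝ (Fin n)

/-! ### Injectivity of the Fourier transform on integrable functions -/

open FourierTransform in
theorem ae_eq_zero_of_fourier_eq_zero {V : Type*} [NormedAddCommGroup V] [InnerProductSpace ℝ V]
    [FiniteDimensional ℝ V] [MeasurableSpace V] [BorelSpace V] {f : V → ℂ}
    (hf : Integrable f) (h : ∀ b : V, ∫ x, Complex.exp (-Complex.I * (⟪b, x⟫_ℝ : ℝ)) * f x = 0) :
    f =ᵐ[volume] 0 := by
  refine ae_eq_zero_of_integral_contDiff_smul_eq_zero hf.locallyIntegrable fun g hg hgs => ?_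
  have hg' : ContDiff ℝ (⊤ : ℕ∞) (fun x => (g x : ℂ)) :=
    Complex.ofRealCLM.contDiff.comp hg
  have hgs' : HasCompactSupport (fun x => (g x : ℂ)) := hgs.comp_left Complex.ofReal_zero
  let gS : 𝓢(V, ℂ) := hgs'.toSchwartzMap hg'
  have hgS : ∀ x, gS x = g x := fun x => rfl
  have h0 : 𝓕 f = 0 := by
    funext w
    rw [Real.fourier_eq']
    have h1 := h ((2 * Real.pi) • w)
    simp only [Pi.zero_apply]
    rw [← h1]
    refine integral_congr_ae (Filter.Eventually.of_forall fun x => ?_)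
    simp only [smul_eq_mul, real_inner_smul_left, real_inner_comm x w]
    congr 2
    push_cast; ring
  have h2 := VectorFourier.integral_fourierIntegral_smul_eq_flip (L := innerₗ V)
    (μ := (volume : Measure V)) (ν := (volume : Measure V)) Real.continuous_fourierChar
    continuous_inner (g := f) (f := (𝓕⁻ gS : 𝓢(V, ℂ))) (SchwartzMap.integrable _) hf
  have h3 : VectorFourier.fourierIntegral Real.fourierChar volume (innerₗ V).flip f = 0 := by
    rw [flip_innerₗ]; exact h0
  have h4 : VectorFourier.fourierIntegral Real.fourierChar volume (innerₗ V)
      (𝓕⁻ gS : 𝓢(V, ℂ)) = gS := by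
    have : (𝓕 (𝓕⁻ gS : 𝓢(V, ℂ)) : 𝓢(V, ℂ)) = gS := FourierTransform.fourier_fourierInv_eq gS
    have h5 := congrArg (fun s : 𝓢(V, ℂ) => (s : V → ℂ)) this
    exact h5
  rw [h3, h4] at h2
  simpa [hgS] using h2

/-! ### Coherent states -/

theorem gaussian_decay (n : ℕ) (k m : ℕ) : ∃ C : ℝ, ∀ x : Cfg n,
    ‖x‖ ^ k * ‖iteratedFDeriv ℝ m (fun x : Cfg n => Real.exp (-(1 / 2) * ‖x‖ ^ 2)) x‖ ≤ C := by
  have hq : Function.HasTemperateGrowth (fun x : Cfg n => -(1 / 2) * ‖x‖ ^ 2) :=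
    (Function.HasTemperateGrowth.const (-(1 / 2) : ℝ)).mul
      (Function.hasTemperateGrowth_norm_sq (H := Cfg n))
  obtain ⟨l, C, hC, hb⟩ := hq.norm_iteratedFDeriv_le_uniform m
  -- the polynomial factor is absorbed by the Gaussian
  obtain ⟨M, hM⟩ : ∃ M : ℝ, ∀ t : ℝ, 0 ≤ t →
      (1 + t) ^ (k + l * m) * Real.exp (-(1 / 2) * t ^ 2) ≤ M := by
    refine ⟨(k + l * m).factorial * Real.exp 2, fun t ht => ?_⟩
    have h1 : (1 + t) ^ (k + l * m) ≤ (k + l * m).factorial * Real.exp (1 + t) := by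
      have := Real.pow_div_factorial_le_exp (1 + t) (by linarith) (k + l * m)
      rw [div_le_iff₀ (by positivity)] at this
      linarith
    calc (1 + t) ^ (k + l * m) * Real.exp (-(1 / 2) * t ^ 2)
        ≤ ((k + l * m).factorial * Real.exp (1 + t)) * Real.exp (-(1 / 2) * t ^ 2) :=
          mul_le_mul_of_nonneg_right h1 (Real.exp_pos _).le
      _ = (k + l * m).factorial * Real.exp (1 + t + -(1 / 2) * t ^ 2) := by
          rw [mul_assoc, ← Real.exp_add]
      _ ≤ _ := by
          refine mul_le_mul_of_nonneg_left (Real.exp_le_exp.2 ?_) (by positivity)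
          nlinarith [sq_nonneg (t - 1)]
  refine ⟨m.factorial * (1 + C) ^ m * M, fun x => ?_⟩
  have hx : 0 ≤ ‖x‖ := norm_nonneg x
  have key := norm_iteratedFDeriv_comp_le (𝕜 := ℝ) (g := Real.exp)
    (f := fun x : Cfg n => -(1 / 2) * ‖x‖ ^ 2) (n := m) (N := (⊤ : ℕ∞)) Real.contDiff_exp hq.1
    (mod_cast le_top) x (C := Real.exp (-(1 / 2) * ‖x‖ ^ 2)) (D := (1 + C) * (1 + ‖x‖) ^ l)
    (fun i _ => by
      rw [norm_iteratedFDeriv_eq_norm_iteratedDeriv, iteratedDeriv_eq_iterate,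
        Real.iter_deriv_exp, Real.norm_of_nonneg (Real.exp_pos _).le])
    (fun i hi him => by
      calc _ ≤ C * (1 + ‖x‖) ^ l := hb i him x
        _ ≤ (1 + C) * (1 + ‖x‖) ^ l := by gcongr; linarith
        _ ≤ _ := by
          refine le_self_pow₀ (one_le_mul_of_one_le_of_one_le (by linarith)
            (one_le_pow₀ (by linarith))) (by omega))
  calc ‖x‖ ^ k * ‖iteratedFDeriv ℝ m (fun x : Cfg n => Real.exp (-(1 / 2) * ‖x‖ ^ 2)) x‖
      ≤ (1 + ‖x‖) ^ k * (m.factorial * Real.exp (-(1 / 2) * ‖x‖ ^ 2)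
          * ((1 + C) * (1 + ‖x‖) ^ l) ^ m) := by
        refine mul_le_mul (pow_le_pow_left₀ hx (by linarith) k) key (norm_nonneg _) (by positivity)
    _ = m.factorial * (1 + C) ^ m *
          ((1 + ‖x‖) ^ (k + l * m) * Real.exp (-(1 / 2) * ‖x‖ ^ 2)) := by
        rw [mul_pow, ← pow_mul, pow_add]; ring
    _ ≤ _ := mul_le_mul_of_nonneg_left (hM _ hx) (by positivity)

/-- The Gaussian `exp (-|x|²/2)` as a Schwartz function. -/
noncomputable def gaussS (n : ℕ) : 𝓢(Cfg n, ℝ) where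
  toFun x := Real.exp (-(1 / 2) * ‖x‖ ^ 2)
  smooth' := Real.contDiff_exp.comp (contDiff_const.mul (contDiff_norm_sq ℝ))
  decay' := gaussian_decay n

theorem hasTemperateGrowth_cexp_I : Function.HasTemperateGrowth
    (fun t : ℝ => Complex.exp (Complex.I * t)) := by
  have hd : ∀ m : ℕ, iteratedDeriv m (fun t : ℝ => Complex.exp (Complex.I * t))
      = fun t : ℝ => Complex.I ^ m * Complex.exp (Complex.I * t) := by
    intro m
    induction m with
    | zero => simp
    | succ m ih =>
      rw [iteratedDeriv_succ, ih]
      funext t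
      have h1 : HasDerivAt (fun t : ℝ => Complex.exp (Complex.I * t))
          (Complex.exp (Complex.I * t) * (Complex.I * 1)) t :=
        ((Complex.ofRealCLM.hasDerivAt (x := t)).const_mul Complex.I).cexp
      rw [(h1.const_mul (Complex.I ^ m)).deriv]
      ring
  refine ⟨Complex.contDiff_exp.comp (contDiff_const.mul Complex.ofRealCLM.contDiff), fun m =>
    ⟨0, 1, fun t => ?_⟩⟩
  rw [norm_iteratedFDeriv_eq_norm_iteratedDeriv, hd, norm_mul, norm_pow, Complex.norm_I, one_pow,
    one_mul, Complex.norm_exp]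
  simp

theorem hasTemperateGrowth_phase {n : ℕ} {q : Cfg n → ℝ} (hq : q.HasTemperateGrowth) :
    Function.HasTemperateGrowth (fun x => Complex.exp (Complex.I * (q x : ℝ))) :=
  hasTemperateGrowth_cexp_I.comp hq

/-- The vector of real parts. -/
noncomputable def reVec (z : Fin n → ℂ) : Cfg n := WithLp.toLp 2 fun i => (z i).re

/-- The vector of imaginary parts. -/
noncomputable def imVec (z : Fin n → ℂ) : Cfg n := WithLp.toLp 2 fun i => (z i).im

/-- The wavefunction `π^{-n/4} exp(-|x|²/2 + z·x - z·z/4)`: a multiple of the coherent state with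
displacement parameter `z`, normalized so that `⟨K_w, K_z⟩ = exp(w̄·z/2)`. -/
noncomputable def cohFun (z : Fin n → ℂ) (x : Cfg n) : ℂ :=
  ((Real.pi ^ (-(n : ℝ) / 4) : ℝ) : ℂ) *
    Complex.exp (-(1 / 2) * (‖x‖ ^ 2 : ℝ) + ∑ i, z i * x i - (∑ i, z i ^ 2) / 4)

/-- The coherent wavefunction as a Schwartz function. -/
noncomputable def cohS (z : Fin n → ℂ) : 𝓢(Cfg n, ℂ) :=
  (((Real.pi ^ (-(n : ℝ) / 4) : ℝ) : ℂ) *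
    Complex.exp ((1 / 2) * (‖reVec z‖ ^ 2 : ℝ) - (∑ i, z i ^ 2) / 4)) •
  SchwartzMap.smulLeftCLM ℂ (fun x => Complex.exp (Complex.I * (⟪imVec z, x⟫_ℝ : ℝ)))
    (SchwartzMap.compSubConstCLM ℂ (reVec z)
      (SchwartzMap.postcompCLM (𝕜 := ℝ) Complex.ofRealCLM (gaussS n)))

theorem cohS_apply (z : Fin n → ℂ) (x : Cfg n) : cohS z x = cohFun z x := by
  have h : Function.HasTemperateGrowth
      (fun x : Cfg n => Complex.exp (Complex.I * (⟪imVec z, x⟫_ℝ : ℝ))) :=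
    hasTemperateGrowth_phase (Function.hasTemperateGrowth_inner_right (imVec z))
  have h1 : gaussS n (x - reVec z) = Real.exp (-(1 / 2) * ‖x - reVec z‖ ^ 2) := rfl
  rw [cohS, cohFun, smul_apply, SchwartzMap.smulLeftCLM_apply_apply h,
    SchwartzMap.compSubConstCLM_apply, SchwartzMap.postcompCLM_apply, h1]
  simp only [smul_eq_mul, Complex.ofRealCLM_apply, Complex.ofReal_exp]
  rw [mul_assoc, ← Complex.exp_add, ← Complex.exp_add]
  congr 2
  rw [norm_sub_sq_real]
  have h2 : ∑ i, z i * x i = ((⟪x, reVec z⟫_ℝ : ℝ) : ℂ) + Complex.I * (⟪imVec z, x⟫_ℝ : ℝ) := by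
    simp only [PiLp.inner_apply, RCLike.inner_apply, conj_trivial, reVec, imVec]
    push_cast
    rw [Finset.mul_sum, ← Finset.sum_add_distrib]
    refine Finset.sum_congr rfl fun i _ => ?_
    conv_lhs => rw [← Complex.re_add_im (z i)]
    ring
  rw [h2]
  push_cast
  ring

/-- The coherent vector `K_z ∈ L²(ℝⁿ)`. -/
noncomputable def coh (z : Fin n → ℂ) : Modes n := (cohS z).toLp 2

theorem coeFn_coh (z : Fin n → ℂ) : coh z =ᵐ[volume] cohFun z := by
  filter_upwards [(cohS z).coeFn_toLp 2] with x hx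
  rw [coh, hx, cohS_apply]

theorem inner_coh (w z : Fin n → ℂ) :
    ⟪coh w, coh z⟫_ℂ = Complex.exp ((∑ i, (starRingEnd ℂ) (w i) * z i) / 2) := by
  rw [L2.inner_def]
  have h1 : ∫ x, ⟪coh w x, coh z x⟫_ℂ = ∫ x : Cfg n, ((Real.pi ^ (-(n : ℝ) / 2) : ℝ) : ℂ) *
      (Complex.exp (-((∑ i, (starRingEnd ℂ) (w i) ^ 2) + (∑ i, z i ^ 2)) / 4) *
      Complex.exp (-1 * ∑ i, (x i : ℂ) ^ 2 + ∑ i, ((starRingEnd ℂ) (w i) + z i) * x i)) := by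
    refine integral_congr_ae ?_
    filter_upwards [coeFn_coh w, coeFn_coh z] with x hw hz
    rw [hw, hz, RCLike.inner_apply, cohFun, cohFun, map_mul, ← Complex.exp_conj, Complex.conj_ofReal]
    have h2 : (Real.pi ^ (-(n : ℝ) / 2) : ℝ)
        = Real.pi ^ (-(n : ℝ) / 4) * Real.pi ^ (-(n : ℝ) / 4) := by
      rw [← Real.rpow_add Real.pi_pos]; congr 1; ring
    rw [h2, mul_mul_mul_comm, ← Complex.exp_add, ← Complex.exp_add]
    push_cast
    congr 2
    have h3 : ((‖x‖ : ℝ) : ℂ) ^ 2 = ∑ i, (x i : ℂ) ^ 2 := by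
      rw [← Complex.ofReal_pow, EuclideanSpace.real_norm_sq_eq]; push_cast; rfl
    simp only [map_add, map_sub, map_mul, map_div₀, map_neg, map_sum, map_pow, Complex.conj_ofReal,
      map_one, map_ofNat, h3, add_mul, Finset.sum_add_distrib]
    ring
  rw [h1, integral_const_mul, integral_const_mul]
  rw [← (PiLp.volume_preserving_toLp (Fin n)).integral_comp
    (MeasurableEquiv.toLp 2 _).measurableEmbedding]
  rw [GaussianFourier.integral_cexp_neg_mul_sum_add (b := 1) (by simp)]
  have h4 : ((Real.pi : ℂ) / 1) ^ ((Fintype.card (Fin n) : ℂ) / 2)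
      = ((Real.pi ^ ((n : ℝ) / 2) : ℝ) : ℂ) := by
    rw [div_one, Fintype.card_fin, Complex.ofReal_cpow Real.pi_pos.le]; push_cast; rfl
  rw [h4]
  have h5 : (Real.pi ^ (-(n : ℝ) / 2) : ℝ) * Real.pi ^ ((n : ℝ) / 2) = 1 := by
    rw [← Real.rpow_add Real.pi_pos, neg_div, neg_add_cancel, Real.rpow_zero]
  have h5' : ((Real.pi ^ (-(n : ℝ) / 2) : ℝ) : ℂ) * ((Real.pi ^ ((n : ℝ) / 2) : ℝ) : ℂ) = 1 := by
    rw [← Complex.ofReal_mul, h5, Complex.ofReal_one]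
  have h6 : ∀ (p q r A B : ℂ), p * q = 1 → p * (A * (q * B)) = A * B := by
    intro p q r A B h; linear_combination A * B * h
  rw [h6 _ _ 0 _ _ h5', ← Complex.exp_add]
  congr 1
  have h7 : ∑ i, ((starRingEnd ℂ) (w i) + z i) ^ 2 = (∑ i, (starRingEnd ℂ) (w i) ^ 2)
      + (∑ i, z i ^ 2) + 2 * ∑ i, (starRingEnd ℂ) (w i) * z i := by
    rw [Finset.mul_sum, ← Finset.sum_add_distrib, ← Finset.sum_add_distrib]
    exact Finset.sum_congr rfl fun i _ => by ring
  rw [h7]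
  ring

theorem norm_coh_zero : ‖coh (0 : Fin n → ℂ)‖ = 1 := by
  have h := inner_coh (0 : Fin n → ℂ) 0
  rw [inner_self_eq_norm_sq_to_K] at h
  simp only [Pi.zero_apply, mul_zero, Finset.sum_const_zero, zero_div, Complex.exp_zero] at h
  have h1 : ‖coh (0 : Fin n → ℂ)‖ ^ 2 = 1 := Complex.ofReal_injective (by simpa using h)
  nlinarith [norm_nonneg (coh (0 : Fin n → ℂ))]

/-- The coherent vectors are total: a vector orthogonal to all `K_{ib}` has
`∫ exp(-ib·x) exp(-|x|²/2) f(x) dx = 0` for all `b`. -/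
theorem eq_zero_of_inner_coh_eq_zero {f : Modes n} (h : ∀ z, ⟪coh z, f⟫_ℂ = 0) : f = 0 := by
  have hint : Integrable (fun x => cohFun (0 : Fin n → ℂ) x * f x) := by
    have h1 := L2.integrable_inner (𝕜 := ℂ) (coh (0 : Fin n → ℂ)) f
    refine h1.congr ?_
    filter_upwards [coeFn_coh (0 : Fin n → ℂ)] with x hx
    rw [hx, RCLike.inner_apply, mul_comm]
    congr 1
    simp [cohFun, ← Complex.exp_conj, map_ofNat]
  have h0 := ae_eq_zero_of_fourier_eq_zero hint fun b => by
    have h1 := h (fun i => Complex.I * (b i : ℂ))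
    rw [L2.inner_def] at h1
    have h2 : ∫ x, ⟪coh (fun i => Complex.I * (b i : ℂ)) x, f x⟫_ℂ
        = ∫ x, Complex.exp ((∑ i, (b i : ℂ) ^ 2) / 4) *
        (Complex.exp (-Complex.I * (⟪b, x⟫_ℝ : ℝ)) * (cohFun (0 : Fin n → ℂ) x * f x)) := by
      refine integral_congr_ae ?_
      filter_upwards [coeFn_coh (fun i => Complex.I * (b i : ℂ))] with x hx
      rw [hx, RCLike.inner_apply, cohFun, cohFun, map_mul, ← Complex.exp_conj, Complex.conj_ofReal]
      have h3 : ((⟪b, x⟫_ℝ : ℝ) : ℂ) = ∑ i, (b i : ℂ) * x i := by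
        simp only [PiLp.inner_apply, RCLike.inner_apply, conj_trivial]
        push_cast
        exact Finset.sum_congr rfl fun i _ => mul_comm _ _
      have h4 : ∀ p A B D e₁ e₂ : ℂ, Complex.exp A * Complex.exp B * Complex.exp D = Complex.exp e₁
          → e₂ * (p * Complex.exp e₁) = Complex.exp A * (Complex.exp B * (p * Complex.exp D * e₂)) := by
        intro p A B D e₁ e₂ h
        rw [← h]; ring
      apply h4
      rw [← Complex.exp_add, ← Complex.exp_add]
      congr 1
      simp only [map_add, map_sub, map_mul, map_div₀, map_neg, map_sum, map_pow,
        Complex.conj_ofReal, map_one, map_ofNat, Complex.conj_I, h3, mul_pow,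
        Complex.I_sq, Pi.zero_apply, zero_mul, Finset.sum_const_zero, Finset.mul_sum]
      simp [Finset.sum_neg_distrib, mul_assoc]
      ring
    rw [h2, integral_const_mul] at h1
    exact (mul_eq_zero.1 h1).resolve_left (Complex.exp_ne_zero _)
  refine Lp.ext ?_
  filter_upwards [h0, Lp.coeFn_zero ℂ 2 (volume : Measure (Cfg n))] with x hx h0'
  rw [h0']
  refine (mul_eq_zero.1 hx).resolve_left ?_
  rw [cohFun]
  refine mul_ne_zero ?_ (Complex.exp_ne_zero _)
  exact_mod_cast (Real.rpow_pos_of_pos Real.pi_pos _).ne'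

theorem topologicalClosure_span_coh :
    (Submodule.span ℂ (Set.range (coh (n := n)))).topologicalClosure = ⊤ := by
  rw [Submodule.topologicalClosure_eq_top_iff, Submodule.eq_bot_iff]
  intro f hf
  refine eq_zero_of_inner_coh_eq_zero fun z => ?_
  exact (Submodule.mem_orthogonal _ f).1 hf _ (Submodule.subset_span ⟨z, rfl⟩)

/-- Rotating the copies of a product of coherent vectors rotates the labels. -/
theorem mixUnitary_coh (o : Matrix.orthogonalGroup (Fin k) ℝ) (z : Fin k → Fin n → ℂ) :
    mixUnitary o (ptensor n k fun j => coh (z j))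
      = ptensor n k fun i => coh fun l => ∑ j, (o.1 i j : ℂ) * z j l := by
  refine mixUnitary_ptensor_eq o (fun j => coeFn_coh _) (fun j => coeFn_coh _) fun x => ?_
  simp only [cohFun, Finset.prod_mul_distrib, ← Complex.exp_sum]
  congr 2
  have h1 := mix_sum_norm_sq o x
  have ho : o.1.transpose * o.1 = 1 := (Matrix.mem_orthogonalGroup_iff' (Fin k) ℝ).1 o.2
  simp only [Finset.sum_add_distrib, Finset.sum_sub_distrib, ← Finset.mul_sum, ← Finset.sum_div]
  congr 1
  · congr 1
    · rw [← Complex.ofReal_sum, ← Complex.ofReal_sum, h1]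
    · have h2 : ∀ j l, ((mix o.1 x j) l : ℂ) = ∑ i, (o.1 i j : ℂ) * (x i l : ℂ) := by
        intro j l
        simp [mix_apply]
      simp only [h2, Finset.mul_sum, Finset.sum_mul]
      rw [Finset.sum_congr rfl fun j _ => Finset.sum_comm, Finset.sum_comm]
      refine Finset.sum_congr rfl fun i _ => ?_
      rw [Finset.sum_comm]
      exact Finset.sum_congr rfl fun l _ => Finset.sum_congr rfl fun j _ => by ring
  · congr 1
    rw [Finset.sum_comm, Finset.sum_comm (s := (Finset.univ : Finset (Fin k)))]
    refine Finset.sum_congr rfl fun l _ => ?_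
    have h3 : ∀ j j', ∑ i, ((o.1 i j : ℂ) * (o.1 i j' : ℂ)) = if j = j' then 1 else 0 := by
      intro j j'
      have := congrFun (congrFun ho j) j'
      rw [Matrix.mul_apply, Matrix.one_apply] at this
      have h4 : ∑ i, ((o.1 i j : ℂ) * (o.1 i j' : ℂ)) = ((∑ i, o.1.transpose j i * o.1 i j' : ℝ) : ℂ) := by
        push_cast; rfl
      rw [h4, this]; split_ifs <;> simp
    calc ∑ j, z j l ^ 2 = ∑ j, ∑ j', (if j = j' then (1 : ℂ) else 0) * (z j l * z j' l) := by
          simp [pow_two]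
      _ = ∑ j, ∑ j', ∑ i, ((o.1 i j : ℂ) * (o.1 i j' : ℂ)) * (z j l * z j' l) := by
          simp only [← h3, Finset.sum_mul]
      _ = ∑ i, ∑ j, ∑ j', ((o.1 i j : ℂ) * (o.1 i j' : ℂ)) * (z j l * z j' l) := by
          rw [Finset.sum_congr rfl fun j _ => Finset.sum_comm, Finset.sum_comm]
      _ = _ := by
          refine Finset.sum_congr rfl fun i _ => ?_
          rw [pow_two, Finset.sum_mul_sum]
          exact Finset.sum_congr rfl fun j _ => Finset.sum_congr rfl fun j' _ => by ring

/-! ### The decomposition of `L²(ℝⁿ)` by particle number -/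

/-- Model of the `m`-particle space: complex tensors of rank `m` over `ℂⁿ`. -/
abbrev Sec (n m : ℕ) : Type := EuclideanSpace ℂ (Fin m → Fin n)

/-- The `ℓ²` sum of all particle-number spaces. -/
abbrev Fock (n : ℕ) : Type := lp (Sec n) 2

/-- The `m`-particle component `z^{⊗m} / √(2^m m!)` of the coherent vector `K_z`. -/
noncomputable def cohSec (z : Fin n → ℂ) (m : ℕ) : Sec n m :=
  WithLp.toLp 2 fun s => (∏ l, z (s l)) / (√(2 ^ m * m.factorial) : ℝ)

theorem inner_cohSec (w z : Fin n → ℂ) (m : ℕ) :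
    ⟪cohSec w m, cohSec z m⟫_ℂ = ((∑ i, (starRingEnd ℂ) (w i) * z i) / 2) ^ m / m.factorial := by
  simp only [cohSec, PiLp.inner_apply, RCLike.inner_apply, map_div₀, Complex.conj_ofReal, map_prod]
  have h1 : ((√(2 ^ m * m.factorial) : ℝ) : ℂ) * ((√(2 ^ m * m.factorial) : ℝ) : ℂ)
      = 2 ^ m * m.factorial := by
    rw [← Complex.ofReal_mul, Real.mul_self_sqrt (by positivity)]; push_cast; rfl
  have h2 : ∀ s : Fin m → Fin n, (∏ l, z (s l)) / ((√(2 ^ m * m.factorial) : ℝ) : ℂ) *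
      ((∏ l, (starRingEnd ℂ) (w (s l))) / ((√(2 ^ m * m.factorial) : ℝ) : ℂ))
      = (∏ l, (starRingEnd ℂ) (w (s l)) * z (s l)) / (2 ^ m * m.factorial) := by
    intro s
    rw [div_mul_div_comm, h1, Finset.prod_mul_distrib, mul_comm (∏ l, z (s l))]
  simp only [h2]
  rw [← Finset.sum_div]
  have h3 := Finset.prod_univ_sum (R := ℂ) (fun _ : Fin m => (Finset.univ : Finset (Fin n)))
    (fun _ i => (starRingEnd ℂ) (w i) * z i)
  simp only [Fintype.piFinset_univ, Finset.prod_const, Finset.card_univ, Fintype.card_fin] at h3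
  rw [← h3, div_pow, div_div]

theorem memℓp_cohSec (z : Fin n → ℂ) : Memℓp (cohSec z) 2 := by
  refine memℓp_gen ?_
  have h : ∀ m, ‖cohSec z m‖ ^ (2 : ℝ≥0∞).toReal
      = ((∑ i, ‖z i‖ ^ 2) / 2) ^ m / m.factorial := by
    intro m
    have h1 := inner_cohSec z z m
    rw [inner_self_eq_norm_sq_to_K] at h1
    have h2 : ∀ i, (starRingEnd ℂ) (z i) * z i = ((‖z i‖ ^ 2 : ℝ) : ℂ) := fun i => by
      rw [mul_comm, Complex.mul_conj, Complex.normSq_eq_norm_sq]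
    simp only [h2] at h1
    rw [ENNReal.toReal_ofNat, Real.rpow_ofNat]
    refine Complex.ofReal_injective ?_
    push_cast
    simpa using h1
  simp only [h]
  exact Real.summable_pow_div_factorial _

/-- The image of the coherent vector `K_z` in the `ℓ²` sum of the particle-number spaces. -/
noncomputable def cohFock (z : Fin n → ℂ) : Fock n := ⟨cohSec z, memℓp_cohSec z⟩

theorem inner_cohFock (w z : Fin n → ℂ) : ⟪cohFock w, cohFock z⟫_ℂ = ⟪coh w, coh z⟫_ℂ := by
  rw [inner_coh, lp.inner_eq_tsum, Complex.exp_eq_exp_ℂ, NormedSpace.exp_eq_tsum_div]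
  exact tsum_congr fun m => inner_cohSec w z m

theorem denseRange_linearCombination_coh :
    DenseRange (Finsupp.linearCombination ℂ (coh (n := n))) := by
  have h := topologicalClosure_span_coh (n := n)
  rw [← Finsupp.range_linearCombination] at h
  have h1 : Dense ((LinearMap.range (Finsupp.linearCombination ℂ (coh (n := n))) :
      Submodule ℂ (Modes n)) : Set (Modes n)) := by
    rw [dense_iff_closure_eq, ← Submodule.topologicalClosure_coe, h]; rfl
  rw [DenseRange, ← LinearMap.coe_range]
  exact h1

theorem norm_linearCombination_cohFock (c : (Fin n → ℂ) →₀ ℂ) :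
    ‖Finsupp.linearCombination ℂ cohFock c‖ = ‖Finsupp.linearCombination ℂ coh c‖ := by
  have h : ⟪Finsupp.linearCombination ℂ cohFock c, Finsupp.linearCombination ℂ cohFock c⟫_ℂ
      = ⟪Finsupp.linearCombination ℂ coh c, Finsupp.linearCombination ℂ coh c⟫_ℂ := by
    simp only [Finsupp.linearCombination_apply, Finsupp.sum, sum_inner, inner_sum, inner_smul_left,
      inner_smul_right, inner_cohFock]
  rw [inner_self_eq_norm_sq_to_K, inner_self_eq_norm_sq_to_K] at h
  have h1 : ‖Finsupp.linearCombination ℂ cohFock c‖ ^ 2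
      = ‖Finsupp.linearCombination ℂ coh c‖ ^ 2 := Complex.ofReal_injective (by simpa using h)
  exact (sq_eq_sq₀ (norm_nonneg _) (norm_nonneg _)).1 h1

/-- The isometry from `L²(ℝⁿ)` into the `ℓ²` sum of the particle-number spaces: the continuous
extension of `coh z ↦ cohFock z`, which is isometric because both families have the same Gram
matrix and the coherent vectors span a dense subspace. -/
noncomputable def fock (n : ℕ) : Modes n →L[ℂ] Fock n :=
  (Finsupp.linearCombination ℂ cohFock).extendOfNorm (Finsupp.linearCombination ℂ coh)

theorem fock_linearCombination (c : (Fin n → ℂ) →₀ ℂ) :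
    fock n (Finsupp.linearCombination ℂ coh c) = Finsupp.linearCombination ℂ cohFock c :=
  LinearMap.extendOfNorm_eq denseRange_linearCombination_coh
    ⟨1, fun c => by rw [norm_linearCombination_cohFock, one_mul]⟩ c

theorem fock_coh (z : Fin n → ℂ) : fock n (coh z) = cohFock z := by
  have := fock_linearCombination (Finsupp.single z 1)
  simpa using this

theorem norm_fock (f : Modes n) : ‖fock n f‖ = ‖f‖ := by
  refine denseRange_linearCombination_coh.induction_on
    (p := fun f => ‖fock n f‖ = ‖f‖) f (isClosed_eq (by fun_prop) (by fun_prop)) fun c => ?_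
  rw [fock_linearCombination, norm_linearCombination_cohFock]

theorem inner_fock (f g : Modes n) : ⟪fock n f, fock n g⟫_ℂ = ⟪f, g⟫_ℂ :=
  (⟨(fock n).toLinearMap, norm_fock⟩ : Modes n →ₗᵢ[ℂ] Fock n).inner_map_map f g

/-- The `m`-particle component of a vector. -/
noncomputable def sec (m : ℕ) (f : Modes n) : Sec n m := fock n f m

theorem sec_coh (z : Fin n → ℂ) (m : ℕ) : sec m (coh z) = cohSec z m := by
  rw [sec, fock_coh]; rfl

theorem sec_sub (m : ℕ) (f g : Modes n) : sec m (f - g) = sec m f - sec m g := by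
  simp [sec]

theorem sec_add (m : ℕ) (f g : Modes n) : sec m (f + g) = sec m f + sec m g := by
  simp [sec]

theorem sec_smul (m : ℕ) (c : ℂ) (f : Modes n) : sec m (c • f) = c • sec m f := by
  simp [sec]

theorem hasSum_inner_sec (f g : Modes n) :
    HasSum (fun m => ⟪sec m f, sec m g⟫_ℂ) ⟪f, g⟫_ℂ := by
  rw [← inner_fock]
  exact lp.hasSum_inner _ _

theorem hasSum_norm_sec (f : Modes n) : HasSum (fun m => ‖sec m f‖ ^ 2) (‖f‖ ^ 2) := by
  have h := (hasSum_inner_sec f f).mapL Complex.reCLM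
  simp only [inner_self_eq_norm_sq_to_K] at h
  convert h using 1
  · funext m; simp [← Complex.ofReal_pow]
  · simp [← Complex.ofReal_pow]

theorem norm_sec_le (m : ℕ) (f : Modes n) : ‖sec m f‖ ≤ ‖f‖ := by
  have h := le_hasSum (hasSum_norm_sec f) m fun _ _ => sq_nonneg _
  exact (sq_le_sq₀ (norm_nonneg _) (norm_nonneg _)).1 h

theorem norm_real_smul_sq_le {d C : ℝ} (hd : |d| ≤ C) {m : ℕ} (v : Sec n m) :
    ‖(d : ℂ) • v‖ ^ 2 ≤ C ^ 2 * ‖v‖ ^ 2 := by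
  rw [norm_smul, mul_pow, Complex.norm_real, Real.norm_eq_abs]
  gcongr

theorem memℓp_numMul {d : ℕ → ℝ} {C : ℝ} (hd : ∀ m, |d m| ≤ C) (v : Fock n) :
    Memℓp (fun m => (d m : ℂ) • v m) 2 := by
  refine memℓp_gen ?_
  have h := ((lp.memℓp v).summable (by norm_num)).mul_left (C ^ 2)
  simp only [ENNReal.toReal_ofNat, Real.rpow_ofNat] at h ⊢
  exact Summable.of_nonneg_of_le (fun m => by positivity)
    (fun m => norm_real_smul_sq_le (hd m) (v m)) h

/-- A bounded function of the particle number, as a linear map. -/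
noncomputable def numMulLin (d : ℕ → ℝ) (C : ℝ) (hd : ∀ m, |d m| ≤ C) : Fock n →ₗ[ℂ] Fock n where
  toFun v := ⟨fun m => (d m : ℂ) • v m, memℓp_numMul hd v⟩
  map_add' u v := Subtype.ext (funext fun m => smul_add (d m : ℂ) (u m) (v m))
  map_smul' c v := Subtype.ext (funext fun m => smul_comm (d m : ℂ) c (v m))

/-- A bounded function of the particle number. -/
noncomputable def numMul (d : ℕ → ℝ) (C : ℝ) (hd : ∀ m, |d m| ≤ C) : Fock n →L[ℂ] Fock n :=
  LinearMap.mkContinuous (numMulLin d C hd) C fun v => by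
    have hC : 0 ≤ C := (abs_nonneg _).trans (hd 0)
    refine lp.norm_le_of_tsum_le (by norm_num) (by positivity) ?_
    have h1 := lp.hasSum_norm (p := 2) (by norm_num) v
    simp only [ENNReal.toReal_ofNat, Real.rpow_ofNat, mul_pow] at h1 ⊢
    have h2 : ∀ m, ‖(d m : ℂ) • v m‖ ^ 2 ≤ C ^ 2 * ‖v m‖ ^ 2 := fun m =>
      norm_real_smul_sq_le (hd m) (v m)
    rw [← h1.tsum_eq, ← tsum_mul_left]
    exact Summable.tsum_le_tsum h2
      (Summable.of_nonneg_of_le (fun m => by positivity) h2 (h1.summable.mul_left _))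
      (h1.summable.mul_left _)

theorem numMul_apply (d : ℕ → ℝ) (C : ℝ) (hd : ∀ m, |d m| ≤ C) (v : Fock n) (m : ℕ) :
    numMul d C hd v m = (d m : ℂ) • v m := rfl

/-- The product vector with `f` in slot `i` and the vacuum `K_0` in all other slots. -/
noncomputable def oneSlot (i : Fin k) (f : Modes n) : Copies n k :=
  ptensor n k (Function.update (fun _ => coh 0) i f)

/-- `oneSlot` as a continuous linear map. -/
noncomputable def oneSlotL (i : Fin k) : Modes n →L[ℂ] Copies n k where
  toLinearMap := (ptensor n k).toLinearMap (fun _ => coh 0) i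
  cont := continuous_ptensor.comp (continuous_const.update i continuous_id)

theorem ext_clm_of_coh {F : Type*} [NormedAddCommGroup F] [NormedSpace ℂ F]
    {A B : Modes n →L[ℂ] F} (h : ∀ z, A (coh z) = B (coh z)) : A = B := by
  have hd := topologicalClosure_span_coh (n := n)
  refine ContinuousLinearMap.ext_on (s := Set.range coh) ?_ ?_
  · rw [dense_iff_closure_eq, ← Submodule.topologicalClosure_coe, hd]; rfl
  · rintro _ ⟨z, rfl⟩; exact h z

theorem abs_entry_le_one (o : Matrix.orthogonalGroup (Fin k) ℝ) (i j : Fin k) :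
    |o.1 i j| ≤ 1 := by
  have ho : o.1 * o.1.transpose = 1 := (Matrix.mem_orthogonalGroup_iff (Fin k) ℝ).1 o.2
  have h := congrFun (congrFun ho i) i
  rw [Matrix.mul_apply, Matrix.one_apply, if_pos rfl] at h
  simp only [Matrix.transpose_apply] at h
  have h1 := Finset.single_le_sum (f := fun l => o.1 i l * o.1 i l)
    (fun l _ => mul_self_nonneg _) (Finset.mem_univ j)
  rw [abs_le]
  constructor <;> nlinarith

/-- Rotating the copies and projecting all but one of them onto the vacuum acts as `(oᵢⱼ)^N` on the
remaining copy, where `N` is the particle number. -/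
theorem hasSum_inner_oneSlot (o : Matrix.orthogonalGroup (Fin k) ℝ) (i j : Fin k)
    (f g : Modes n) :
    HasSum (fun m => (o.1 i j : ℂ) ^ m * ⟪sec m f, sec m g⟫_ℂ)
      ⟪oneSlot i f, mixUnitary o (oneSlot j g)⟫_ℂ := by
  have hd : ∀ m, |o.1 i j ^ m| ≤ 1 := fun m => by
    rw [abs_pow]; exact pow_le_one₀ (abs_nonneg _) (abs_entry_le_one o i j)
  set D := numMul (n := n) (fun m => o.1 i j ^ m) 1 hd with hD
  have hcoh : ∀ w z : Fin n → ℂ, ⟪oneSlot i (coh w), mixUnitary o (oneSlot j (coh z))⟫_ℂ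
      = ⟪fock n (coh w), D (fock n (coh z))⟫_ℂ := by
    intro w z
    have h1 : ∀ (a : Fin k) (u : Fin n → ℂ), (Function.update (fun _ => coh 0) a (coh u) :
        Fin k → Modes n) = fun l => coh (if l = a then u else 0) := by
      intro a u; funext l
      by_cases h : l = a
      · subst h; simp
      · simp [h]
    rw [oneSlot, oneSlot, h1, h1, mixUnitary_coh, inner_ptensor]
    simp only [inner_coh]
    rw [Finset.prod_eq_single i]
    · rw [fock_coh, fock_coh, lp.inner_eq_tsum, Complex.exp_eq_exp_ℂ, NormedSpace.exp_eq_tsum_div]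
      refine tsum_congr fun m => ?_
      rw [hD, numMul_apply, inner_smul_right]
      change _ = _ * ⟪cohSec w m, cohSec z m⟫_ℂ
      rw [inner_cohSec, Complex.ofReal_pow, ← mul_div_assoc, ← mul_pow]
      congr 2
      rw [← mul_div_assoc, Finset.mul_sum]
      congr 1
      refine Finset.sum_congr rfl fun l _ => ?_
      rw [Finset.sum_eq_single j]
      · simp; ring
      · intro b _ hb; simp [hb]
      · simp
    · intro b _ hb
      simp [hb]
    · simp
  have hall : ⟪oneSlot i f, mixUnitary o (oneSlot j g)⟫_ℂ = ⟪fock n f, D (fock n g)⟫_ℂ := by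
    have h1 : ∀ w, ⟪oneSlot i (coh w), mixUnitary o (oneSlot j g)⟫_ℂ
        = ⟪fock n (coh w), D (fock n g)⟫_ℂ := by
      intro w
      have := ext_clm_of_coh (A := (innerSL ℂ (oneSlot i (coh w))).comp
        ((mixUnitary o).toContinuousLinearMap.comp (oneSlotL j)))
        (B := (innerSL ℂ (fock n (coh w))).comp (D.comp (fock n))) fun z => hcoh w z
      exact congrArg (fun A : Modes n →L[ℂ] ℂ => A g) this
    have h2 := ext_clm_of_coh (A := (innerSL ℂ (mixUnitary o (oneSlot j g))).comp (oneSlotL i))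
      (B := (innerSL ℂ (D (fock n g))).comp (fock n)) fun w => by
        have := congrArg (starRingEnd ℂ) (h1 w)
        rwa [inner_conj_symm, inner_conj_symm] at this
    have h3 : ⟪mixUnitary o (oneSlot j g), oneSlot i f⟫_ℂ = ⟪D (fock n g), fock n f⟫_ℂ :=
      congrArg (fun A : Modes n →L[ℂ] ℂ => A f) h2
    have h4 := congrArg (starRingEnd ℂ) h3
    rwa [inner_conj_symm, inner_conj_symm] at h4
  rw [hall]
  have h5 := lp.hasSum_inner (𝕜 := ℂ) (fock n f) (D (fock n g))
  refine h5.congr_fun fun m => ?_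
  rw [hD, numMul_apply, inner_smul_right, Complex.ofReal_pow]
  rfl

/-! ### Position and momentum operators on Schwartz functions -/

/-- The position operator `x_i` on Schwartz functions. -/
noncomputable def posS (i : Fin n) : 𝓢(Cfg n, ℂ) →L[ℂ] 𝓢(Cfg n, ℂ) :=
  SchwartzMap.smulLeftCLM ℂ (fun x : Cfg n => (x i : ℂ))

/-- The partial derivative `∂_i` on Schwartz functions. -/
noncomputable def derS (i : Fin n) : 𝓢(Cfg n, ℂ) →L[ℂ] 𝓢(Cfg n, ℂ) :=
  LineDeriv.lineDerivOpCLM ℂ 𝓢(Cfg n, ℂ) (EuclideanSpace.single i (1 : ℝ))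

/-- Complex conjugation on Schwartz functions. -/
noncomputable def conjS (f : 𝓢(Cfg n, ℂ)) : 𝓢(Cfg n, ℂ) :=
  SchwartzMap.postcompCLM (𝕜 := ℝ) Complex.conjCLE.toContinuousLinearMap f

theorem hasTemperateGrowth_coord (i : Fin n) :
    Function.HasTemperateGrowth (fun x : Cfg n => (x i : ℂ)) := by
  exact (Complex.ofRealCLM.comp
    (EuclideanSpace.proj (𝕜 := ℝ) i : Cfg n →L[ℝ] ℝ)).hasTemperateGrowth

theorem posS_apply (i : Fin n) (f : 𝓢(Cfg n, ℂ)) (x : Cfg n) : posS i f x = x i * f x := by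
  rw [posS, SchwartzMap.smulLeftCLM_apply_apply (hasTemperateGrowth_coord i), smul_eq_mul]

theorem derS_apply (i : Fin n) (f : 𝓢(Cfg n, ℂ)) (x : Cfg n) :
    derS i f x = fderiv ℝ f x (EuclideanSpace.single i 1) := rfl

theorem conjS_apply (f : 𝓢(Cfg n, ℂ)) (x : Cfg n) : conjS f x = (starRingEnd ℂ) (f x) := rfl

theorem hasFDerivAt_coord (i : Fin n) (x : Cfg n) : HasFDerivAt (fun x : Cfg n => (x i : ℂ))
    (Complex.ofRealCLM.comp (EuclideanSpace.proj (𝕜 := ℝ) i : Cfg n →L[ℝ] ℝ)) x :=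
  Complex.ofRealCLM.hasFDerivAt.comp x (EuclideanSpace.proj (𝕜 := ℝ) i).hasFDerivAt

theorem derS_posS (i j : Fin n) (f : 𝓢(Cfg n, ℂ)) :
    derS i (posS j f) = (if i = j then f else 0) + posS j (derS i f) := by
  ext x
  have h1 : (posS j f : Cfg n → ℂ) = fun x => (x j : ℂ) * f x := funext (posS_apply j f)
  have h2 : HasFDerivAt (fun x : Cfg n => (x j : ℂ) * f x) _ x :=
    (hasFDerivAt_coord j x).mul (f.hasFDerivAt x)
  rw [derS_apply, h1, h2.fderiv, add_apply, add_apply, posS_apply, derS_apply]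
  simp only [smul_apply, ContinuousLinearMap.comp_apply, smul_eq_mul]
  by_cases h : i = j
  · subst h; simp; ring
  · have h' : j ≠ i := fun e => h e.symm
    simp [h, h']

theorem posS_comm (i j : Fin n) (f : 𝓢(Cfg n, ℂ)) : posS i (posS j f) = posS j (posS i f) := by
  ext x; simp only [posS_apply]; ring

theorem derS_comm (i j : Fin n) (f : 𝓢(Cfg n, ℂ)) : derS i (derS j f) = derS j (derS i f) := by
  ext x
  have h : ∀ a b : Fin n, derS a (derS b f) x = fderiv ℝ (fderiv ℝ f) x
      (EuclideanSpace.single a 1) (EuclideanSpace.single b 1) := by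
    intro a b
    rw [derS_apply]
    have h1 : (derS b f : Cfg n → ℂ) = fun x => fderiv ℝ f x (EuclideanSpace.single b 1) := rfl
    have h2 : DifferentiableAt ℝ (fderiv ℝ f) x :=
      ((f.smooth 2).fderiv_right (m := 1) (by norm_num)).differentiable (by norm_num) x
    rw [h1, fderiv_clm_apply h2 (differentiableAt_const _)]
    simp
  rw [h, h]
  exact ((f.smooth 2).contDiffAt.isSymmSndFDerivAt (by simp)).eq _ _

theorem derS_conjS (i : Fin n) (f : 𝓢(Cfg n, ℂ)) : derS i (conjS f) = conjS (derS i f) := by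
  ext x
  have h1 : (conjS f : Cfg n → ℂ) = fun x => Complex.conjCLE (f x) := rfl
  rw [derS_apply, h1, conjS_apply, derS_apply]
  have h2 := (Complex.conjCLE.toContinuousLinearMap.hasFDerivAt (x := f x)).comp x (f.hasFDerivAt x)
  have h3 : HasFDerivAt (fun x => Complex.conjCLE (f x))
      (Complex.conjCLE.toContinuousLinearMap.comp (fderiv ℝ f x)) x := h2
  rw [h3.fderiv]
  rfl

theorem posS_conjS (i : Fin n) (f : 𝓢(Cfg n, ℂ)) : posS i (conjS f) = conjS (posS i f) := by
  ext x
  simp [posS_apply, conjS_apply]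

/-- The class of a Schwartz function in `L²`. -/
noncomputable def toL2 (n : ℕ) : 𝓢(Cfg n, ℂ) →L[ℂ] Modes n :=
  SchwartzMap.toLpCLM ℂ ℂ 2 (volume : Measure (Cfg n))

theorem coeFn_toL2 (f : 𝓢(Cfg n, ℂ)) : toL2 n f =ᵐ[volume] f :=
  SchwartzMap.coeFn_toLp f 2 volume

theorem inner_toL2_left (f : 𝓢(Cfg n, ℂ)) (g : Modes n) :
    ⟪toL2 n f, g⟫_ℂ = ∫ x, g x * conjS f x := by
  rw [L2.inner_def]
  refine integral_congr_ae ?_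
  filter_upwards [coeFn_toL2 f] with x hx
  rw [hx, RCLike.inner_apply, conjS_apply]

theorem inner_toL2 (f g : 𝓢(Cfg n, ℂ)) :
    ⟪toL2 n f, toL2 n g⟫_ℂ = ∫ x, conjS f x * g x := by
  rw [inner_toL2_left]
  refine integral_congr_ae ?_
  filter_upwards [coeFn_toL2 g] with x hx
  rw [hx, mul_comm]

theorem inner_posS_left (i : Fin n) (f g : 𝓢(Cfg n, ℂ)) :
    ⟪toL2 n (posS i f), toL2 n g⟫_ℂ = ⟪toL2 n f, toL2 n (posS i g)⟫_ℂ := by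
  rw [inner_toL2, inner_toL2]
  refine integral_congr_ae (Filter.Eventually.of_forall fun x => ?_)
  simp only [conjS_apply, posS_apply, map_mul, Complex.conj_ofReal]
  ring

theorem inner_derS_left (i : Fin n) (f g : 𝓢(Cfg n, ℂ)) :
    ⟪toL2 n (derS i f), toL2 n g⟫_ℂ = -⟪toL2 n f, toL2 n (derS i g)⟫_ℂ := by
  rw [inner_toL2, inner_toL2, ← derS_conjS]
  have h := SchwartzMap.integral_mul_lineDerivOp_right_eq_neg_left (μ := volume) (conjS f) g
    (EuclideanSpace.single i (1 : ℝ))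
  exact (neg_eq_iff_eq_neg.2 h).symm

/-! ### The energy operator -/

/-- The energy operator `½ ∑ᵢ (xᵢ² - ∂ᵢ²)` on Schwartz functions. -/
noncomputable def enS (f : 𝓢(Cfg n, ℂ)) : 𝓢(Cfg n, ℂ) :=
  (1 / 2 : ℂ) • ∑ i, (posS i (posS i f) - derS i (derS i f))

theorem enS_apply (f : 𝓢(Cfg n, ℂ)) (x : Cfg n) : enS f x = energyOnSchwartz f x := by
  have h1 : Laplacian.laplacian (f : Cfg n → ℂ) x = ∑ i, derS i (derS i f) x := by
    rw [← SchwartzMap.laplacian_apply, SchwartzMap.laplacian_eq_sum (EuclideanSpace.basisFun (Fin n) ℝ)]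
    simp only [EuclideanSpace.basisFun_apply]
    rw [sum_apply]
    rfl
  rw [energyOnSchwartz, h1, enS, smul_apply, smul_eq_mul, sum_apply]
  congr 1
  simp only [sub_apply, posS_apply, Finset.sum_sub_distrib]
  congr 1
  rw [EuclideanSpace.real_norm_sq_eq, Complex.ofReal_sum, Finset.sum_mul]
  refine Finset.sum_congr rfl fun i _ => ?_
  push_cast; ring

theorem enS_conjS (f : 𝓢(Cfg n, ℂ)) : enS (conjS f) = conjS (enS f) := by
  ext x
  simp only [enS, posS_conjS, derS_conjS, conjS_apply, smul_apply, sum_apply, sub_apply,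
    map_sum, map_sub, smul_eq_mul, map_mul, map_div₀, map_one, map_ofNat]

theorem enS_eq (f : 𝓢(Cfg n, ℂ)) : enS f = (1 / 2 : ℂ) •
    ∑ i, (posS i (posS i f + derS i f) - derS i (posS i f + derS i f)) + (n / 2 : ℂ) • f := by
  have h : ∀ i, posS i (posS i f) - derS i (derS i f)
      = (posS i (posS i f + derS i f) - derS i (posS i f + derS i f)) + f := by
    intro i
    simp only [map_add, derS_posS, if_true]
    abel
  rw [enS, Finset.sum_congr rfl fun i _ => h i, Finset.sum_add_distrib, smul_add]
  congr 1
  rw [Finset.sum_const, Finset.card_univ, Fintype.card_fin, ← Nat.cast_smul_eq_nsmul ℂ, smul_smul]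
  congr 1
  ring

/-- `⟨f, Ê h⟩` in terms of the ladder operators `xᵢ + ∂ᵢ`. -/
theorem inner_enS (f h : 𝓢(Cfg n, ℂ)) : ⟪toL2 n f, toL2 n (enS h)⟫_ℂ =
    (1 / 2) * ∑ i, ⟪toL2 n (posS i f + derS i f), toL2 n (posS i h + derS i h)⟫_ℂ
      + n / 2 * ⟪toL2 n f, toL2 n h⟫_ℂ := by
  rw [enS_eq, map_add, map_smul, map_smul, map_sum, inner_add_right, inner_smul_right,
    inner_smul_right, inner_sum]
  congr 2
  refine Finset.sum_congr rfl fun i _ => ?_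
  rw [map_sub, inner_sub_right, ← inner_posS_left, map_add (toL2 n) (posS i f), inner_add_left,
    inner_derS_left]
  ring

theorem inner_enS_symm (f h : 𝓢(Cfg n, ℂ)) :
    ⟪toL2 n (enS f), toL2 n h⟫_ℂ = ⟪toL2 n f, toL2 n (enS h)⟫_ℂ := by
  rw [inner_enS, ← inner_conj_symm, inner_enS]
  simp only [map_add, map_mul, map_sum, inner_conj_symm, map_div₀, map_one, map_ofNat, map_natCast]

theorem inner_eq_of_energyEq {ψ g : Modes n} (h : EnergyEq ψ g) (f : 𝓢(Cfg n, ℂ)) :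
    ⟪toL2 n f, g⟫_ℂ = ⟪toL2 n (enS f), ψ⟫_ℂ := by
  rw [inner_toL2_left, inner_toL2_left, h (conjS f), ← enS_conjS]
  simp only [enS_apply]

/-! ### Coherent vectors under the ladder operators -/

theorem derS_cohS (i : Fin n) (z : Fin n → ℂ) :
    derS i (cohS z) = z i • cohS z - posS i (cohS z) := by
  ext x
  have h0 : (cohS z : Cfg n → ℂ) = cohFun z := funext (cohS_apply z)
  have h1 : HasFDerivAt (fun x : Cfg n => -(1 / 2 : ℂ) * (‖x‖ ^ 2 : ℝ) + ∑ l, z l * x l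
      - (∑ l, z l ^ 2) / 4)
      (-(1 / 2 : ℂ) • (Complex.ofRealCLM.comp (2 • innerSL ℝ x)) + ∑ l, z l •
        (Complex.ofRealCLM.comp (EuclideanSpace.proj (𝕜 := ℝ) l : Cfg n →L[ℝ] ℝ))) x := by
    refine HasFDerivAt.sub_const _ (HasFDerivAt.add ?_ ?_)
    · exact (Complex.ofRealCLM.hasFDerivAt.comp x
        (hasStrictFDerivAt_norm_sq x).hasFDerivAt).const_mul _
    · refine HasFDerivAt.fun_sum fun l _ => ?_
      exact (hasFDerivAt_coord l x).const_mul _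
  have h2 := (h1.cexp).const_mul ((Real.pi ^ (-(n : ℝ) / 4) : ℝ) : ℂ)
  have h3 : fderiv ℝ (cohFun z) x = _ := h2.fderiv
  rw [derS_apply, h0, h3, sub_apply, smul_apply, posS_apply]
  simp only [smul_apply, add_apply, ContinuousLinearMap.comp_apply, sum_apply, smul_eq_mul,
    cohS_apply]
  have h4 : ∑ l, z l * Complex.ofRealCLM ((EuclideanSpace.proj (𝕜 := ℝ) l : Cfg n →L[ℝ] ℝ)
      (EuclideanSpace.single i 1)) = z i := by
    rw [Finset.sum_eq_single i]
    · simp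
    · intro b _ hb; simp [hb]
    · simp
  rw [h4, cohFun]
  simp only [innerSL_apply_apply, EuclideanSpace.inner_single_right]
  simp
  ring

theorem toL2_cohS (z : Fin n → ℂ) : toL2 n (cohS z) = coh z := rfl

theorem toL2_lower_cohS (i : Fin n) (z : Fin n → ℂ) :
    toL2 n (posS i (cohS z) + derS i (cohS z)) = z i • coh z := by
  rw [derS_cohS, add_sub_cancel, map_smul, toL2_cohS]

theorem inner_coh_enS (w z : Fin n → ℂ) : ⟪coh w, toL2 n (enS (cohS z))⟫_ℂ =
    ((∑ i, (starRingEnd ℂ) (w i) * z i) / 2 + n / 2) * ⟪coh w, coh z⟫_ℂ := by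
  rw [← toL2_cohS w, inner_enS]
  simp only [toL2_lower_cohS, inner_smul_left, inner_smul_right, toL2_cohS]
  rw [add_mul, Finset.sum_div, Finset.sum_mul, Finset.mul_sum]
  congr 1
  exact Finset.sum_congr rfl fun i _ => by ring

/-- The first moments of the vacuum against a coherent vector. -/
theorem inner_posS_vac (i : Fin n) (z : Fin n → ℂ) :
    ⟪toL2 n (posS i (cohS 0)), coh z⟫_ℂ = z i / 2 := by
  have h1 : derS i (cohS (0 : Fin n → ℂ)) = -posS i (cohS 0) := by
    rw [derS_cohS]; simp
  have h2 := inner_derS_left i (cohS (0 : Fin n → ℂ)) (cohS z)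
  have h3 := inner_posS_left i (cohS (0 : Fin n → ℂ)) (cohS z)
  rw [h1, map_neg, inner_neg_left, neg_inj, derS_cohS, map_sub, inner_sub_right, ← h3, map_smul,
    inner_smul_right] at h2
  have h4 : ⟪toL2 n (cohS 0), toL2 n (cohS z)⟫_ℂ = 1 := by
    rw [toL2_cohS, toL2_cohS, inner_coh]; simp
  rw [h4] at h2
  rw [← toL2_cohS z]
  linear_combination h2 / 2

/-- The second moments of the vacuum against a coherent vector. -/
theorem inner_posS_posS_vac (i j : Fin n) (z : Fin n → ℂ) :
    ⟪toL2 n (posS i (posS j (cohS 0))), coh z⟫_ℂ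
      = z i * z j / 4 + (if i = j then 1 / 2 else 0) := by
  have h1 : derS i (posS j (cohS (0 : Fin n → ℂ)))
      = (if i = j then cohS 0 else 0) - posS i (posS j (cohS 0)) := by
    rw [derS_posS, derS_cohS]
    simp [posS_comm j i, sub_eq_add_neg]
  have h2 := inner_derS_left i (posS j (cohS (0 : Fin n → ℂ))) (cohS z)
  have h3 := inner_posS_left i (posS j (cohS (0 : Fin n → ℂ))) (cohS z)
  rw [h1, map_sub, inner_sub_left, derS_cohS, map_sub, inner_sub_right, ← h3, map_smul,
    inner_smul_right, toL2_cohS, inner_posS_vac] at h2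
  have h4 : ⟪toL2 n (if i = j then cohS (0 : Fin n → ℂ) else 0), coh z⟫_ℂ
      = if i = j then 1 else 0 := by
    split_ifs
    · rw [toL2_cohS, inner_coh]; simp
    · simp
  rw [h4] at h2
  have h5 : (if i = j then (1 : ℂ) / 2 else 0) = (if i = j then 1 else 0) / 2 := by
    split_ifs <;> simp
  rw [h5]
  linear_combination -h2 / 2

/-! ### Energy and particle number -/

theorem abs_energy_weight_le {ρ : ℝ} (hρ : |ρ| < 1) (n m : ℕ) :
    |((m : ℝ) + n / 2) * ρ ^ m| ≤ 1 / (1 - |ρ|) + n / 2 := by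
  rw [abs_mul, abs_pow, abs_of_nonneg (by positivity), add_mul]
  have h0 := abs_nonneg ρ
  have h1 : (m : ℝ) * |ρ| ^ m ≤ 1 / (1 - |ρ|) := by
    have h2 := one_add_mul_le_pow (a := |ρ|⁻¹ - 1) (by
      have : 0 ≤ |ρ|⁻¹ := by positivity
      linarith) m
    rw [le_div_iff₀ (by linarith)]
    rcases eq_or_lt_of_le h0 with h | h
    · rw [← h]
      rcases Nat.eq_zero_or_pos m with rfl | hm
      · simp
      · simp [hm.ne']
    · have h3 : (|ρ|⁻¹ - 1) * |ρ| = 1 - |ρ| := by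
        rw [sub_mul, inv_mul_cancel₀ h.ne', one_mul]
      have h4 : m * (|ρ|⁻¹ - 1) * |ρ| ^ m ≤ 1 := by
        have h5 : (1 + (|ρ|⁻¹ - 1)) ^ m * |ρ| ^ m = 1 := by
          rw [← mul_pow, add_sub_cancel, inv_mul_cancel₀ h.ne', one_pow]
        have h6 : 0 < |ρ| ^ m := by positivity
        nlinarith
      have h7 : (m : ℝ) * |ρ| ^ m * (1 - |ρ|) = (m * (|ρ|⁻¹ - 1) * |ρ| ^ m) * |ρ| := by
        rw [← h3]; ring
      rw [h7]
      nlinarith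
  have h8 : (n : ℝ) / 2 * |ρ| ^ m ≤ n / 2 :=
    mul_le_of_le_one_right (by positivity) (pow_le_one₀ h0 hρ.le)
  linarith

theorem hasSum_nat_mul_exp (b c : ℂ) :
    HasSum (fun m : ℕ => ((m : ℂ) + c) * (b ^ m / m.factorial)) ((b + c) * Complex.exp b) := by
  have h := NormedSpace.expSeries_div_hasSum_exp b
  rw [← Complex.exp_eq_exp_ℂ] at h
  have h1 : HasSum (fun m : ℕ => (m : ℂ) * (b ^ m / m.factorial)) (b * Complex.exp b) := by
    rw [← hasSum_nat_add_iff' 1]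
    simp only [Finset.range_one, Finset.sum_singleton, Nat.cast_zero, zero_mul, sub_zero]
    refine (h.mul_left b).congr_fun fun m => ?_
    rw [Nat.factorial_succ, pow_succ]
    push_cast
    have h2 : ((m : ℂ) + 1) ≠ 0 := by exact_mod_cast Nat.succ_ne_zero m
    have h3 : ((m.factorial : ℕ) : ℂ) ≠ 0 := by exact_mod_cast m.factorial_ne_zero
    field_simp
  have h2 := h1.add (h.mul_left c)
  rw [← add_mul] at h2
  exact h2.congr_fun fun m => by ring

theorem cohSec_smul (c : ℂ) (z : Fin n → ℂ) (m : ℕ) : cohSec (c • z) m = c ^ m • cohSec z m := by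
  ext s
  simp [cohSec, Finset.prod_mul_distrib, mul_div_assoc]

/-- On a coherent vector with label `ρ z`, `|ρ| < 1`, the energy operator acts as multiplication
by `m + n/2` on the `m`-particle component. -/
theorem inner_numMul_cohFock {ρ : ℝ} (hρ : |ρ| < 1) (z : Fin n → ℂ) (f : Modes n) :
    ⟪numMul _ _ (abs_energy_weight_le hρ n) (cohFock z), fock n f⟫_ℂ
      = ⟪toL2 n (enS (cohS ((ρ : ℂ) • z))), f⟫_ℂ := by
  have h := ext_clm_of_coh
    (A := (innerSL ℂ (numMul _ _ (abs_energy_weight_le hρ n) (cohFock z))).comp (fock n))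
    (B := innerSL ℂ (toL2 n (enS (cohS ((ρ : ℂ) • z))))) fun w => by
      change ⟪_, fock n (coh w)⟫_ℂ = ⟪_, coh w⟫_ℂ
      rw [← inner_conj_symm _ (coh w), inner_coh_enS, fock_coh, lp.inner_eq_tsum, inner_coh]
      have h1 := hasSum_nat_mul_exp ((ρ : ℂ) * ((∑ i, (starRingEnd ℂ) (z i) * w i) / 2)) (n / 2)
      have h2 : (starRingEnd ℂ) (((∑ i, (starRingEnd ℂ) (w i) * ((ρ : ℂ) • z) i) / 2 + n / 2) *
          Complex.exp ((∑ i, (starRingEnd ℂ) (w i) * ((ρ : ℂ) • z) i) / 2))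
          = ((ρ : ℂ) * ((∑ i, (starRingEnd ℂ) (z i) * w i) / 2) + n / 2) *
          Complex.exp ((ρ : ℂ) * ((∑ i, (starRingEnd ℂ) (z i) * w i) / 2)) := by
        have h3 : (∑ i, (starRingEnd ℂ) (w i) * ((ρ : ℂ) • z) i) / 2
            = (starRingEnd ℂ) ((ρ : ℂ) * ((∑ i, (starRingEnd ℂ) (z i) * w i) / 2)) := by
          simp only [Pi.smul_apply, smul_eq_mul, map_mul, map_div₀, map_sum, Complex.conj_ofReal,
            Complex.conj_conj, map_ofNat]
          rw [← mul_div_assoc, Finset.mul_sum]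
          congr 1
          exact Finset.sum_congr rfl fun i _ => by ring
        rw [h3, map_mul, ← Complex.exp_conj, map_add, Complex.conj_conj, map_div₀, map_natCast,
          map_ofNat]
      rw [h2, ← h1.tsum_eq]
      refine tsum_congr fun m => ?_
      rw [numMul_apply, inner_smul_left]
      change _ * ⟪cohSec z m, cohSec w m⟫_ℂ = _
      rw [inner_cohSec, Complex.conj_ofReal, mul_pow]
      push_cast
      ring
  exact congrArg (fun A : Modes n →L[ℂ] ℂ => A f) h

/-- The `m`-particle component as a continuous linear map. -/
noncomputable def secL (m : ℕ) : Modes n →L[ℂ] Sec n m :=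
  LinearMap.mkContinuous ⟨⟨sec m, sec_add m⟩, sec_smul m⟩ 1 fun f => by
    rw [one_mul]; exact norm_sec_le m f

theorem secL_apply (m : ℕ) (f : Modes n) : secL m f = sec m f := rfl

theorem sec_eq_zero_of_inner_cohSec {m : ℕ} {f : Modes n}
    (h : ∀ z, ⟪cohSec z m, sec m f⟫_ℂ = 0) : sec m f = 0 := by
  have h1 := ext_clm_of_coh (A := (innerSL ℂ (sec m f)).comp (secL m)) (B := 0) fun z => by
    change ⟪sec m f, secL m (coh z)⟫_ℂ = 0
    rw [secL_apply, sec_coh, ← inner_conj_symm, h z, map_zero]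
  have h2 : ⟪sec m f, secL m f⟫_ℂ = 0 := congrArg (fun A : Modes n →L[ℂ] ℂ => A f) h1
  rwa [secL_apply, inner_self_eq_zero] at h2

/-- The formal power series in a real variable with the given complex coefficients. -/
noncomputable def realPowerSeries (c : ℕ → ℂ) : FormalMultilinearSeries ℝ ℝ ℂ :=
  fun m => ContinuousMultilinearMap.mkPiRing ℝ (Fin m) (c m)

theorem hasSum_inj_of_ball {a b : ℕ → ℂ} {F : ℝ → ℂ}
    (ha : ∀ ρ : ℝ, |ρ| < 1 → HasSum (fun m => (ρ : ℂ) ^ m * a m) (F ρ))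
    (hb : ∀ ρ : ℝ, |ρ| < 1 → HasSum (fun m => (ρ : ℂ) ^ m * b m) (F ρ)) : a = b := by
  have key : ∀ c : ℕ → ℂ, (∀ ρ : ℝ, |ρ| < 1 → HasSum (fun m => (ρ : ℂ) ^ m * c m) (F ρ)) →
      HasFPowerSeriesAt F (realPowerSeries c) 0 := by
    intro c hc
    refine hasFPowerSeriesAt_iff.2 ?_
    filter_upwards [Metric.ball_mem_nhds (0 : ℝ) one_pos] with ρ hρ
    rw [mem_ball_zero_iff, Real.norm_eq_abs] at hρ
    rw [zero_add]
    refine (hc ρ hρ).congr_fun fun m => ?_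
    simp [FormalMultilinearSeries.coeff, realPowerSeries]
  have h := (key a ha).eq_formalMultilinearSeries (key b hb)
  funext m
  have h1 := congrFun h m
  have h2 := congrArg (fun A : ContinuousMultilinearMap ℝ (fun _ : Fin m => ℝ) ℂ =>
    A (fun _ => 1)) h1
  simpa [realPowerSeries] using h2

/-- A vector in the domain of the energy operator: `Ê` is multiplication by `m + n/2` on the
`m`-particle component. -/
theorem sec_of_energy {ψ g : Modes n}
    (h : ∀ z, ⟪coh z, g⟫_ℂ = ⟪toL2 n (enS (cohS z)), ψ⟫_ℂ) (m : ℕ) :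
    sec m g = ((m : ℂ) + n / 2) • sec m ψ := by
  rw [← sub_eq_zero, ← sec_smul, ← sec_sub]
  refine sec_eq_zero_of_inner_cohSec fun z => ?_
  rw [sec_sub, inner_sub_right, sec_smul, inner_smul_right, sub_eq_zero]
  -- both sides of the hypothesis, taken along `ρ z`, are power series in `ρ`
  have key := hasSum_inj_of_ball (a := fun m => ⟪cohSec z m, sec m g⟫_ℂ)
    (b := fun m => ((m : ℂ) + n / 2) * ⟪cohSec z m, sec m ψ⟫_ℂ)
    (F := fun ρ => ⟪coh ((ρ : ℂ) • z), g⟫_ℂ) (fun ρ _ => by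
      refine (hasSum_inner_sec (coh ((ρ : ℂ) • z)) g).congr_fun fun m => ?_
      rw [sec_coh, cohSec_smul, inner_smul_left, map_pow, Complex.conj_ofReal])
    (fun ρ hρ => by
      rw [h, ← inner_numMul_cohFock hρ]
      refine (lp.hasSum_inner (𝕜 := ℂ) _ (fock n ψ)).congr_fun fun m => ?_
      rw [numMul_apply, inner_smul_left, Complex.conj_ofReal]
      change _ = _ * ⟪cohSec z m, sec m ψ⟫_ℂ
      push_cast
      ring)
  exact congrFun key m

theorem sec_of_energyEq {ψ g : Modes n} (h : EnergyEq ψ g) (m : ℕ) :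
    sec m g = ((m : ℂ) + n / 2) • sec m ψ :=
  sec_of_energy (fun z => inner_eq_of_energyEq h (cohS z)) m

theorem sec_enS (f : 𝓢(Cfg n, ℂ)) (m : ℕ) :
    sec m (toL2 n (enS f)) = ((m : ℂ) + n / 2) • sec m (toL2 n f) :=
  sec_of_energy (fun z => (inner_enS_symm (cohS z) f).symm) m

/-- The energy operator on Schwartz functions as a linear map. -/
noncomputable def enSLin (n : ℕ) : 𝓢(Cfg n, ℂ) →ₗ[ℂ] 𝓢(Cfg n, ℂ) where
  toFun := enS
  map_add' f g := by
    simp only [enS, map_add, add_sub_add_comm, Finset.sum_add_distrib, smul_add]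
  map_smul' c f := by
    simp only [enS, map_smul, ← smul_sub, ← Finset.smul_sum, RingHom.id_apply]
    rw [smul_comm]

theorem enSLin_apply (f : 𝓢(Cfg n, ℂ)) : enSLin n f = enS f := rfl

theorem one_sub_le_nat_mul {ρ : ℝ} (h0 : 0 ≤ ρ) (h1 : ρ ≤ 1) (m : ℕ) :
    |1 - ρ ^ m| ≤ m * (1 - ρ) := by
  rw [abs_of_nonneg (by linarith [pow_le_one₀ h0 h1 (n := m)])]
  have := one_add_mul_le_pow (a := ρ - 1) (by linarith) m
  rw [add_sub_cancel] at this
  linarith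

/-- A vector in the domain of the energy operator is approximated, together with the bound on its
energy, by finite linear combinations of coherent vectors. -/
theorem exists_approx_energy {ψ g : Modes n} (h : EnergyEq ψ g) {ε : ℝ} (hε : 0 < ε) :
    ∃ c : (Fin n → ℂ) →₀ ℂ, ‖toL2 n (Finsupp.linearCombination ℂ cohS c) - ψ‖ ≤ ε ∧
      ‖toL2 n (enS (Finsupp.linearCombination ℂ cohS c))‖ ≤ ‖g‖ + ε := by
  -- multiplying `z` by `ρ < 1` applies `ρ ^ m` to the `m`-particle component, after which the energy
  -- is a bounded operator and density of the span suffices; then `ρ` is taken close to `1`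
  obtain ⟨ρ, h0, h1, h2⟩ : ∃ ρ : ℝ, 0 ≤ ρ ∧ ρ < 1 ∧ (1 - ρ) * ‖g‖ ≤ ε / 2 := by
    refine ⟨1 - min (1 / 2) (ε / 2 / (‖g‖ + 1)), ?_, ?_, ?_⟩
    · linarith [min_le_left (1 / 2) (ε / 2 / (‖g‖ + 1))]
    · have : 0 < min (1 / 2) (ε / 2 / (‖g‖ + 1)) := by positivity
      linarith
    · rw [sub_sub_cancel]
      calc _ ≤ ε / 2 / (‖g‖ + 1) * (‖g‖ + 1) := by
            gcongr
            · exact min_le_right _ _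
            · linarith
        _ = ε / 2 := by field_simp
  have hρ : |ρ| < 1 := by rwa [abs_of_nonneg h0]
  have hd : ∀ m, |ρ ^ m| ≤ 1 := fun m => by rw [abs_pow]; exact pow_le_one₀ (abs_nonneg _) hρ.le
  set D := numMul (n := n) _ _ (abs_energy_weight_le hρ n) with hD
  set T := numMul (n := n) (fun m => ρ ^ m) 1 hd with hT
  have hψ := fun m => sec_of_energyEq h m
  obtain ⟨c, hc⟩ := denseRange_linearCombination_coh.exists_dist_lt ψ
    (show 0 < min (ε / 2) (ε / (‖D‖ + 1)) by positivity)
  set u := Finsupp.linearCombination ℂ (coh (n := n)) c with hu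
  rw [dist_eq_norm, norm_sub_rev] at hc
  refine ⟨Finsupp.mapDomain (fun z => (ρ : ℂ) • z) c, ?_, ?_⟩
  · have e1 : fock n (toL2 n (Finsupp.linearCombination ℂ cohS
        (Finsupp.mapDomain (fun z => (ρ : ℂ) • z) c))) = T (fock n u) := by
      rw [hu, Finsupp.linearCombination_mapDomain, Finsupp.linearCombination_apply,
        Finsupp.linearCombination_apply, Finsupp.sum, Finsupp.sum]
      simp only [map_sum, map_smul]
      refine Finset.sum_congr rfl fun z _ => ?_
      congr 1
      rw [Function.comp_apply, toL2_cohS, fock_coh, fock_coh]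
      refine lp.ext (funext fun m => ?_)
      rw [hT, numMul_apply, Complex.ofReal_pow]
      exact cohSec_smul _ _ _
    have e2 : ‖T (fock n ψ) - fock n ψ‖ ≤ ‖fock n (((1 - ρ : ℝ) : ℂ) • g)‖ := by
      refine lp.norm_mono (by norm_num) fun m => ?_
      have e3 : (T (fock n ψ) - fock n ψ) m = -(((1 - ρ ^ m : ℝ) : ℂ) • sec m ψ) := by
        rw [lp.coeFn_sub, Pi.sub_apply, hT, numMul_apply]
        push_cast
        rw [sub_smul, one_smul, neg_sub]; rfl
      have e4 : fock n (((1 - ρ : ℝ) : ℂ) • g) m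
          = ((((1 - ρ) * (m + n / 2) : ℝ)) : ℂ) • sec m ψ := by
        change sec m _ = _
        rw [sec_smul, hψ, smul_smul]; push_cast; rfl
      rw [e3, e4, norm_neg, norm_smul, norm_smul, Complex.norm_real, Complex.norm_real]
      refine mul_le_mul_of_nonneg_right ?_ (norm_nonneg _)
      rw [Real.norm_eq_abs, Real.norm_of_nonneg (by
        have : 0 ≤ 1 - ρ := by linarith
        positivity)]
      refine (one_sub_le_nat_mul h0 h1.le m).trans ?_
      have : 0 ≤ (1 - ρ) * ((n : ℝ) / 2) := mul_nonneg (by linarith) (by positivity)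
      linarith
    have e5 : ‖T (fock n u) - T (fock n ψ)‖ ≤ ‖u - ψ‖ := by
      rw [← map_sub, ← map_sub, ← norm_fock]
      refine lp.norm_mono (by norm_num) fun m => ?_
      rw [hT, numMul_apply, norm_smul, Complex.norm_real]
      exact mul_le_of_le_one_left (norm_nonneg _) (hd m)
    rw [← norm_fock, map_sub, e1]
    rw [norm_fock, norm_smul, Complex.norm_real, Real.norm_of_nonneg (by linarith)] at e2
    calc _ ≤ ‖T (fock n u) - T (fock n ψ)‖ + ‖T (fock n ψ) - fock n ψ‖ :=
          norm_sub_le_norm_sub_add_norm_sub _ _ _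
      _ ≤ ε / 2 + ε / 2 := add_le_add (e5.trans (hc.le.trans (min_le_left _ _))) (e2.trans h2)
      _ = ε := by ring
  · set φ := Finsupp.linearCombination ℂ (cohS (n := n))
      (Finsupp.mapDomain (fun z => (ρ : ℂ) • z) c) with hφ
    have e1 : ∀ f : Modes n, ⟪toL2 n (enS φ), f⟫_ℂ = ⟪D (fock n u), fock n f⟫_ℂ := by
      intro f
      have e2 : toL2 n (enS φ) = ∑ z ∈ c.support, c z • toL2 n (enS (cohS ((ρ : ℂ) • z))) := by
        rw [← enSLin_apply, hφ, Finsupp.linearCombination_mapDomain,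
          Finsupp.linearCombination_apply, Finsupp.sum, map_sum, map_sum]
        refine Finset.sum_congr rfl fun z _ => ?_
        rw [map_smul, map_smul]; rfl
      rw [e2, hu, Finsupp.linearCombination_apply, Finsupp.sum]
      simp only [map_sum, map_smul, sum_inner, inner_smul_left, fock_coh]
      refine Finset.sum_congr rfl fun z _ => ?_
      rw [inner_numMul_cohFock hρ]
    have e4 : ‖toL2 n (enS φ)‖ ≤ ‖D (fock n u)‖ := by
      have h5 := e1 (toL2 n (enS φ))
      rw [inner_self_eq_norm_sq_to_K] at h5
      have h6 : ‖toL2 n (enS φ)‖ ^ 2 ≤ ‖D (fock n u)‖ * ‖toL2 n (enS φ)‖ := by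
        have h7 := norm_inner_le_norm (𝕜 := ℂ) (D (fock n u)) (fock n (toL2 n (enS φ)))
        rw [← h5, norm_fock] at h7
        simpa using h7
      rcases eq_or_lt_of_le (norm_nonneg (toL2 n (enS φ))) with h8 | h8
      · rw [← h8]; exact norm_nonneg _
      · rw [pow_two] at h6; exact le_of_mul_le_mul_right h6 h8
    have e5 : ‖D (fock n ψ)‖ ≤ ‖g‖ := by
      rw [← norm_fock g]
      refine lp.norm_mono (by norm_num) fun m => ?_
      have e6 : fock n g m = ((m : ℂ) + n / 2) • sec m ψ := hψ m
      rw [e6, hD, numMul_apply]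
      change ‖_ • sec m ψ‖ ≤ _
      rw [norm_smul, norm_smul]
      refine mul_le_mul_of_nonneg_right ?_ (norm_nonneg _)
      rw [Complex.ofReal_mul, norm_mul, Complex.norm_real, Complex.norm_real]
      have e7 : (m : ℂ) + n / 2 = (((m : ℝ) + n / 2 : ℝ) : ℂ) := by push_cast; rfl
      rw [e7, Complex.norm_real]
      exact mul_le_of_le_one_right (norm_nonneg _) (hd m)
    have e8 : ‖D (fock n u) - D (fock n ψ)‖ ≤ ε := by
      rw [← map_sub, ← map_sub]
      refine (D.le_opNorm _).trans ?_
      rw [norm_fock]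
      calc ‖D‖ * ‖u - ψ‖ ≤ (‖D‖ + 1) * (ε / (‖D‖ + 1)) := by
            gcongr
            · linarith
            · exact hc.le.trans (min_le_right _ _)
        _ = ε := by field_simp
    calc _ ≤ ‖D (fock n u)‖ := e4
      _ ≤ ‖D (fock n ψ)‖ + ‖D (fock n u) - D (fock n ψ)‖ := by
          have := norm_add_le (D (fock n ψ)) (D (fock n u) - D (fock n ψ))
          rwa [add_sub_cancel] at this
      _ ≤ _ := add_le_add e5 e8

theorem norm_sec_zero (f : Modes n) : ‖sec 0 f‖ = ‖⟪coh 0, f⟫_ℂ‖ := by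
  have h := (hasSum_inner_sec (coh 0) f).unique (hasSum_single 0 fun m hm => by
    rw [sec_coh]
    have : cohSec (0 : Fin n → ℂ) m = 0 := by
      have h1 := cohSec_smul 0 (0 : Fin n → ℂ) m
      rwa [zero_smul, zero_pow hm, zero_smul] at h1
    rw [this, inner_zero_left])
  rw [h, sec_coh, PiLp.inner_apply, EuclideanSpace.norm_eq]
  have h1 : ∀ s : Fin 0 → Fin n, s = default := fun s => Subsingleton.elim _ _
  rw [Fintype.sum_eq_single default fun s hs => absurd (h1 s) hs,
    Fintype.sum_eq_single default fun s hs => absurd (h1 s) hs]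
  simp [cohSec, Real.sqrt_sq (norm_nonneg _)]

/-- Spectral gap of the energy operator above the vacuum. -/
theorem norm_sq_sub_le_sum_lower (f : 𝓢(Cfg n, ℂ)) :
    ‖toL2 n f‖ ^ 2 - ‖⟪coh 0, toL2 n f⟫_ℂ‖ ^ 2
      ≤ (1 / 2) * ∑ i, ‖toL2 n (posS i f + derS i f)‖ ^ 2 := by
  have h1 := hasSum_inner_sec (toL2 n f) (toL2 n (enS f))
  rw [inner_enS] at h1
  have h2 := h1.mapL Complex.reCLM
  have h3 : Complex.reCLM ((1 / 2) * ∑ i, ⟪toL2 n (posS i f + derS i f),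
      toL2 n (posS i f + derS i f)⟫_ℂ + n / 2 * ⟪toL2 n f, toL2 n f⟫_ℂ)
      = (1 / 2) * ∑ i, ‖toL2 n (posS i f + derS i f)‖ ^ 2 + n / 2 * ‖toL2 n f‖ ^ 2 := by
    simp only [inner_self_eq_norm_sq_to_K]
    have : (1 / 2 : ℂ) * ∑ i, (((‖toL2 n (posS i f + derS i f)‖ : ℝ) : ℂ)) ^ 2
        + n / 2 * ((‖toL2 n f‖ : ℝ) : ℂ) ^ 2
        = (((1 / 2) * ∑ i, ‖toL2 n (posS i f + derS i f)‖ ^ 2 + n / 2 * ‖toL2 n f‖ ^ 2 : ℝ) : ℂ) := by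
      push_cast; ring
    exact (congrArg Complex.re this).trans (Complex.ofReal_re _)
  rw [h3] at h2
  have h4 : ∀ m, Complex.reCLM ⟪sec m (toL2 n f), sec m (toL2 n (enS f))⟫_ℂ
      = (m + n / 2) * ‖sec m (toL2 n f)‖ ^ 2 := by
    intro m
    rw [sec_enS, inner_smul_right, inner_self_eq_norm_sq_to_K]
    have : ((m : ℂ) + n / 2) * ((‖sec m (toL2 n f)‖ : ℝ) : ℂ) ^ 2
        = (((m + n / 2) * ‖sec m (toL2 n f)‖ ^ 2 : ℝ) : ℂ) := by push_cast; ring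
    exact (congrArg Complex.re this).trans (Complex.ofReal_re _)
  simp only [h4] at h2
  have h5 := hasSum_norm_sec (toL2 n f)
  have h6 : HasSum (fun m => ((1 : ℝ) + n / 2) * ‖sec m (toL2 n f)‖ ^ 2
      - (if m = 0 then ‖sec 0 (toL2 n f)‖ ^ 2 else 0))
      ((1 + n / 2) * ‖toL2 n f‖ ^ 2 - ‖sec 0 (toL2 n f)‖ ^ 2) :=
    (h5.mul_left _).sub (hasSum_ite_eq 0 _)
  have h7 := hasSum_le (fun m => ?_) h6 h2
  · rw [norm_sec_zero] at h7; linarith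
  · rcases Nat.eq_zero_or_pos m with rfl | hm
    · simp; ring_nf; rfl
    · rw [if_neg hm.ne', sub_zero]
      gcongr
      exact_mod_cast hm

/-- The one-particle component in terms of the first Hermite functions `√2 xᵢ K₀`. -/
theorem ofLp_sec_one (f : Modes n) (s : Fin 1 → Fin n) :
    sec 1 f s = (√2 : ℝ) * ⟪toL2 n (posS (s 0) (cohS 0)), f⟫_ℂ := by
  have hL : ∀ f, (EuclideanSpace.proj (𝕜 := ℂ) s).comp (secL (n := n) 1) f = sec 1 f s := fun f => rfl
  have h := ext_clm_of_coh (A := (EuclideanSpace.proj (𝕜 := ℂ) s).comp (secL (n := n) 1))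
    (B := ((√2 : ℝ) : ℂ) • innerSL ℂ (toL2 n (posS (s 0) (cohS 0)))) fun z => by
      rw [hL, sec_coh]
      change _ = ((√2 : ℝ) : ℂ) * ⟪_, coh z⟫_ℂ
      rw [inner_posS_vac]
      have h2 : ((√2 : ℝ) : ℂ) * ((√2 : ℝ) : ℂ) = 2 := by
        rw [← Complex.ofReal_mul, Real.mul_self_sqrt (by norm_num)]; norm_num
      have h3 : ((√2 : ℝ) : ℂ) ≠ 0 := fun h0 => by rw [h0] at h2; norm_num at h2
      simp only [cohSec, Finset.univ_unique, Fin.default_eq_zero, Finset.prod_singleton, pow_one,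
        Nat.factorial_one, Nat.cast_one, mul_one]
      rw [div_eq_iff h3]
      linear_combination -(z (s 0)) / 2 * h2
  rw [← hL, h]; rfl

/-- The two-particle component in terms of the second Hermite functions
`√2 (xᵢ xⱼ - δᵢⱼ/2) K₀`. -/
theorem ofLp_sec_two (f : Modes n) (s : Fin 2 → Fin n) :
    sec 2 f s = (√2 : ℝ) * ⟪toL2 n (posS (s 0) (posS (s 1) (cohS 0))
      - (if s 0 = s 1 then (1 / 2 : ℂ) else 0) • cohS 0), f⟫_ℂ := by
  have hL : ∀ f, (EuclideanSpace.proj (𝕜 := ℂ) s).comp (secL (n := n) 2) f = sec 2 f s := fun f => rfl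
  have h := ext_clm_of_coh (A := (EuclideanSpace.proj (𝕜 := ℂ) s).comp (secL (n := n) 2))
    (B := ((√2 : ℝ) : ℂ) • innerSL ℂ (toL2 n (posS (s 0) (posS (s 1) (cohS 0))
      - (if s 0 = s 1 then (1 / 2 : ℂ) else 0) • cohS 0))) fun z => by
      rw [hL, sec_coh]
      change _ = ((√2 : ℝ) : ℂ) * ⟪_, coh z⟫_ℂ
      rw [map_sub, inner_sub_left, map_smul, inner_smul_left, inner_posS_posS_vac, toL2_cohS,
        inner_coh]
      have h2 : ((√2 : ℝ) : ℂ) * ((√2 : ℝ) : ℂ) = 2 := by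
        rw [← Complex.ofReal_mul, Real.mul_self_sqrt (by norm_num)]; norm_num
      have h3 : ((√2 : ℝ) : ℂ) ≠ 0 := fun h0 => by rw [h0] at h2; norm_num at h2
      have h4 : √((2 : ℝ) ^ 2 * (Nat.factorial 2 : ℕ)) = 2 * √2 := by
        rw [Real.sqrt_mul (by norm_num), Real.sqrt_sq (by norm_num)]; norm_num
      have h5 : (starRingEnd ℂ) (if s 0 = s 1 then (1 / 2 : ℂ) else 0)
          = if s 0 = s 1 then (1 / 2 : ℂ) else 0 := by
        split_ifs <;> simp [map_ofNat]
      simp only [cohSec, h4, h5, Fin.prod_univ_two, Pi.zero_apply, map_zero, zero_mul,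
        Finset.sum_const_zero, zero_div, Complex.exp_zero, mul_one, add_sub_cancel_right]
      push_cast
      rw [div_eq_iff (mul_ne_zero two_ne_zero h3)]
      linear_combination -(z (s 0) * z (s 1)) / 2 * h2
  rw [← hL, h]; rfl

/-! ### Displacement operators -/

/-- The position part of a phase-space vector. -/
def posPart (r : Fin n ⊕ Fin n → ℝ) : Cfg n := WithLp.toLp 2 (r ∘ Sum.inl)

/-- The momentum part of a phase-space vector. -/
def momPart (r : Fin n ⊕ Fin n → ℝ) : Cfg n := WithLp.toLp 2 (r ∘ Sum.inr)

/-- The phase factor of the displacement operator. -/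
noncomputable def dispPhase (r : Fin n ⊕ Fin n → ℝ) (x : Cfg n) : ℂ :=
  Complex.exp (-Complex.I * ((⟪momPart r, x⟫_ℝ + ⟪posPart r, momPart r⟫_ℝ / 2 : ℝ) : ℂ))

theorem coeFn_displace (r : Fin n ⊕ Fin n → ℝ) (f : Modes n) :
    displace r f =ᵐ[volume] fun x => dispPhase r x * f (x + posPart r) :=
  (memLp_displace _ _ f).coeFn_toLp

theorem coeFn_displace_of_ae {f : Modes n} {F : Cfg n → ℂ} (r : Fin n ⊕ Fin n → ℝ)
    (h : f =ᵐ[volume] F) :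
    displace r f =ᵐ[volume] fun x => dispPhase r x * F (x + posPart r) := by
  have h1 := (measurePreserving_add_right volume (posPart r)).quasiMeasurePreserving.ae h
  filter_upwards [coeFn_displace r f, h1] with x hx hx1
  rw [hx, hx1]

theorem norm_dispPhase (r : Fin n ⊕ Fin n → ℝ) (x : Cfg n) : ‖dispPhase r x‖ = 1 := by
  rw [dispPhase, Complex.norm_exp, neg_mul, Complex.neg_re, Complex.re_mul_ofReal]
  simp

theorem eq_of_ae {f g : Modes n} {F : Cfg n → ℂ} (hf : f =ᵐ[volume] F) (hg : g =ᵐ[volume] F) :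
    f = g := Lp.ext (hf.trans hg.symm)

theorem coeFn_smul_of_ae {f : Modes n} {F : Cfg n → ℂ} (c : ℂ) (hf : f =ᵐ[volume] F) :
    (c • f : Modes n) =ᵐ[volume] fun x => c * F x := by
  filter_upwards [Lp.coeFn_smul c f, hf] with x h1 h2
  rw [h1, Pi.smul_apply, h2, smul_eq_mul]

/-- The displacement operator as a linear isometry. -/
noncomputable def displaceL (r : Fin n ⊕ Fin n → ℝ) : Modes n →ₗᵢ[ℂ] Modes n where
  toFun := displace r
  map_add' f g := by
    refine eq_of_ae (coeFn_displace_of_ae r (Lp.coeFn_add f g)) ?_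
    filter_upwards [Lp.coeFn_add (displace r f) (displace r g), coeFn_displace r f,
      coeFn_displace r g] with x h1 h2 h3
    rw [h1, Pi.add_apply, h2, h3, Pi.add_apply, mul_add]
  map_smul' c f := by
    refine eq_of_ae (coeFn_displace_of_ae r (Lp.coeFn_smul c f)) ?_
    filter_upwards [Lp.coeFn_smul c (displace r f), coeFn_displace r f] with x h1 h2
    rw [RingHom.id_apply, h1, Pi.smul_apply, h2, Pi.smul_apply, smul_eq_mul, smul_eq_mul,
      mul_left_comm]
  norm_map' f := by
    change ‖displace r f‖ = ‖f‖
    rw [Lp.norm_def, Lp.norm_def]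
    congr 1
    have h1 : eLpNorm (displace r f) 2 volume = eLpNorm (fun x => f (x + posPart r)) 2 volume := by
      refine eLpNorm_congr_norm_ae ?_
      filter_upwards [coeFn_displace r f] with x hx
      rw [hx, norm_mul, norm_dispPhase, one_mul]
    rw [h1]
    exact eLpNorm_comp_measurePreserving (Lp.aestronglyMeasurable f)
      (measurePreserving_add_right volume (posPart r))

theorem displaceL_apply (r : Fin n ⊕ Fin n → ℝ) (f : Modes n) : displaceL r f = displace r f := rfl

/-- The symplectic form `a·b' - b·a'` of two phase-space vectors `(a, b)`, `(a', b')`. -/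
noncomputable def sympForm (r s : Fin n ⊕ Fin n → ℝ) : ℝ :=
  ⟪posPart r, momPart s⟫_ℝ - ⟪momPart r, posPart s⟫_ℝ

theorem posPart_add (r s : Fin n ⊕ Fin n → ℝ) : posPart (r + s) = posPart r + posPart s := rfl

theorem momPart_add (r s : Fin n ⊕ Fin n → ℝ) : momPart (r + s) = momPart r + momPart s := rfl

/-- The Weyl relations. -/
theorem displace_displace (r s : Fin n ⊕ Fin n → ℝ) (f : Modes n) :
    displace r (displace s f)
      = Complex.exp (-Complex.I * (sympForm r s / 2 : ℝ)) • displace (r + s) f := by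
  refine eq_of_ae (coeFn_displace_of_ae r (coeFn_displace s f)) ?_
  filter_upwards [coeFn_smul_of_ae (Complex.exp (-Complex.I * (sympForm r s / 2 : ℝ)))
    (coeFn_displace (r + s) f)] with x hx
  rw [hx, ← mul_assoc, ← mul_assoc, dispPhase, dispPhase, dispPhase, ← Complex.exp_add,
    ← Complex.exp_add, posPart_add, momPart_add, ← add_assoc x]
  congr 2
  rw [sympForm]
  simp only [inner_add_left, inner_add_right, real_inner_comm (momPart s) (posPart r),
    real_inner_comm (posPart s) (momPart r)]
  push_cast
  ring

theorem displace_comm (r s : Fin n ⊕ Fin n → ℝ) (f : Modes n) :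
    displace r (displace s f)
      = Complex.exp (-Complex.I * (sympForm r s : ℝ)) • displace s (displace r f) := by
  have h : sympForm s r = -sympForm r s := by
    rw [sympForm, sympForm, real_inner_comm (momPart r), real_inner_comm (posPart r)]; ring
  rw [displace_displace, displace_displace, smul_smul, ← Complex.exp_add, add_comm s r, h]
  congr 2
  push_cast; ring

theorem displace_zero (f : Modes n) : displace 0 f = f := by
  refine eq_of_ae (coeFn_displace 0 f) (Filter.Eventually.of_forall fun x => ?_)
  have h1 : posPart (0 : Fin n ⊕ Fin n → ℝ) = 0 := rfl
  have h2 : momPart (0 : Fin n ⊕ Fin n → ℝ) = 0 := rfl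
  simp [dispPhase, h1, h2]

theorem displace_neg_displace (r : Fin n ⊕ Fin n → ℝ) (f : Modes n) :
    displace r (displace (-r) f) = f := by
  have h1 : posPart (-r) = -posPart r := rfl
  have h2 : momPart (-r) = -momPart r := rfl
  have h3 : sympForm r (-r) = 0 := by
    rw [sympForm, h1, h2, inner_neg_right, inner_neg_right, real_inner_comm]; ring
  rw [displace_displace, h3, add_neg_cancel, displace_zero]
  simp

/-- The displacement operator as a unitary. -/
noncomputable def displaceE (r : Fin n ⊕ Fin n → ℝ) : Modes n ≃ₗᵢ[ℂ] Modes n :=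
  LinearIsometryEquiv.ofSurjective (displaceL r) fun f =>
    ⟨displace (-r) f, displace_neg_displace r f⟩

theorem displaceE_apply (r : Fin n ⊕ Fin n → ℝ) (f : Modes n) : displaceE r f = displace r f := rfl

/-- Displaced vacua are coherent vectors. -/
theorem displace_coh_zero (r : Fin n ⊕ Fin n → ℝ) : displace r (coh 0)
    = Complex.exp (-(1 / 4) * (∑ i, r i ^ 2 : ℝ)) •
      coh (fun i => -((r (Sum.inl i) : ℂ) + Complex.I * r (Sum.inr i))) := by
  refine eq_of_ae (coeFn_displace_of_ae r (coeFn_coh 0)) ?_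
  filter_upwards [coeFn_smul_of_ae (Complex.exp (-(1 / 4) * (∑ i, r i ^ 2 : ℝ)))
    (coeFn_coh (fun i => -((r (Sum.inl i) : ℂ) + Complex.I * r (Sum.inr i))))] with x hx
  rw [hx, cohFun, cohFun, dispPhase, mul_left_comm, mul_left_comm (Complex.exp (-Complex.I * _)),
    ← Complex.exp_add, ← Complex.exp_add]
  congr 2
  rw [EuclideanSpace.real_norm_sq_eq, EuclideanSpace.real_norm_sq_eq]
  simp only [posPart, momPart, PiLp.inner_apply, RCLike.inner_apply, conj_trivial,
    Fintype.sum_sum_type, Pi.zero_apply, PiLp.add_apply, Function.comp_apply]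
  push_cast
  simp only [mul_add, Finset.mul_sum, Finset.sum_div, ← Finset.sum_add_distrib,
    ← Finset.sum_sub_distrib]
  refine Finset.sum_congr rfl fun i _ => ?_
  ring_nf
  rw [Complex.I_sq]
  ring

/-- The phase-space point of a coherent vector. -/
def cohPoint (z : Fin n → ℂ) : Fin n ⊕ Fin n → ℝ := Sum.elim (fun i => -(z i).re) fun i => -(z i).im

theorem coh_eq_displace (z : Fin n → ℂ) :
    coh z = Complex.exp ((1 / 4) * (∑ i, cohPoint z i ^ 2 : ℝ)) •
      displace (cohPoint z) (coh 0) := by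
  rw [displace_coh_zero, smul_smul, ← Complex.exp_add]
  have h : (fun i => -((cohPoint z (Sum.inl i) : ℂ) + Complex.I * cohPoint z (Sum.inr i))) = z := by
    funext i
    simp only [cohPoint, Sum.elim_inl, Sum.elim_inr]
    conv_rhs => rw [← Complex.re_add_im (z i)]
    push_cast; ring
  rw [h, neg_mul, add_neg_cancel, Complex.exp_zero, one_smul]

/-! ### Characteristic functions of Gaussian vectors -/

/-- `h` is a unit vector whose characteristic function `r ↦ ⟨h, D_r h⟩` is the Gaussian
`exp (-|S r|²/4 + i l·r)` for some symplectic matrix `S`; the vector `l` encodes the mean. -/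
def IsGaussVec (h : Modes n) (l : Fin n ⊕ Fin n → ℝ) : Prop :=
  ‖h‖ = 1 ∧ ∃ S : Matrix.symplecticGroup (Fin n) ℝ, ∀ r,
    ⟪h, displace r h⟫_ℂ = Complex.exp (-(1 / 4) * ((S.1.mulVec r ⬝ᵥ S.1.mulVec r : ℝ) : ℂ)
      + Complex.I * ((l ⬝ᵥ r : ℝ) : ℂ))

theorem isGaussVec_vac : IsGaussVec (coh (0 : Fin n → ℂ)) 0 := by
  refine ⟨norm_coh_zero, 1, fun r => ?_⟩
  rw [displace_coh_zero, inner_smul_right, inner_coh]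
  simp [dotProduct, pow_two]

theorem IsGaussianUnitary.isGaussVec {S : Matrix.symplecticGroup (Fin n) ℝ}
    {U : Modes n ≃ₗᵢ[ℂ] Modes n} (hU : IsGaussianUnitary S U) {h : Modes n}
    {l : Fin n ⊕ Fin n → ℝ} (hh : IsGaussVec h l) :
    IsGaussVec (U h) ((S⁻¹).1.transpose.mulVec l) := by
  obtain ⟨h1, S₀, h2⟩ := hh
  refine ⟨by rw [U.norm_map, h1], S₀ * S⁻¹, fun r => ?_⟩
  have h3 := hU ((S⁻¹).1.mulVec r) h
  have h4 : S.1 * (S⁻¹).1 = 1 := congrArg Subtype.val (mul_inv_cancel S)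
  rw [Matrix.mulVec_mulVec, h4, Matrix.one_mulVec] at h3
  rw [← h3, U.inner_map_map, h2]
  congr 3
  · rw [Matrix.mulVec_mulVec]; rfl
  · rw [Matrix.mulVec_transpose, Matrix.dotProduct_mulVec]

theorem IsGaussianUnitary.symm {S : Matrix.symplecticGroup (Fin n) ℝ}
    {U : Modes n ≃ₗᵢ[ℂ] Modes n} (hU : IsGaussianUnitary S U) :
    IsGaussianUnitary S⁻¹ U.symm := by
  intro r f
  rw [LinearIsometryEquiv.symm_apply_eq, hU, U.apply_symm_apply, Matrix.mulVec_mulVec]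
  have h4 : S.1 * (S⁻¹).1 = 1 := congrArg Subtype.val (mul_inv_cancel S)
  rw [h4, Matrix.one_mulVec]

theorem IsGaussVec.displace {h : Modes n} {l : Fin n ⊕ Fin n → ℝ} (hh : IsGaussVec h l)
    (s : Fin n ⊕ Fin n → ℝ) : IsGaussVec (displace s h)
      (l + Sum.elim (fun i => -s (Sum.inr i)) fun i => s (Sum.inl i)) := by
  obtain ⟨h1, S, h2⟩ := hh
  refine ⟨by rw [← displaceL_apply, LinearIsometry.norm_map, h1], S, fun r => ?_⟩
  rw [displace_comm, inner_smul_right, ← displaceL_apply, ← displaceL_apply,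
    LinearIsometry.inner_map_map, h2, ← Complex.exp_add]
  congr 1
  rw [add_dotProduct]
  have h3 : (Sum.elim (fun i => -s (Sum.inr i)) fun i => s (Sum.inl i)) ⬝ᵥ r = -sympForm r s := by
    rw [sympForm]
    simp only [dotProduct, Fintype.sum_sum_type, Sum.elim_inl, Sum.elim_inr, posPart, momPart,
      PiLp.inner_apply, RCLike.inner_apply, conj_trivial, Function.comp_apply, neg_mul,
      Finset.sum_neg_distrib]
    ring
  rw [h3]
  push_cast; ring

/-- A unit vector is determined up to a phase by its characteristic function. -/
theorem pureState_eq_of_char_eq {h h' : Modes n} (hn : ‖h‖ = 1) (hn' : ‖h'‖ = 1)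
    (hc : ∀ r, ⟪h, displace r h⟫_ℂ = ⟪h', displace r h'⟫_ℂ) : pureState h = pureState h' := by
  -- For each shift `a`, injectivity of the Fourier transform gives `h̄(x) h(x+a) = h̄'(x) h'(x+a)`.
  have hint : ∀ (f : Modes n) (r : Fin n ⊕ Fin n → ℝ),
      Integrable (fun x => (starRingEnd ℂ) (f x) * f (x + posPart r)) := by
    intro f r
    have h1 := L2.integrable_inner (𝕜 := ℂ) f (displace (Sum.elim (r ∘ Sum.inl) 0) f)
    refine h1.congr ?_
    filter_upwards [coeFn_displace (Sum.elim (r ∘ Sum.inl) 0) f] with x hx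
    have h2 : posPart (Sum.elim (r ∘ Sum.inl) (0 : Fin n → ℝ)) = posPart r := rfl
    have h3 : momPart (Sum.elim (r ∘ Sum.inl) (0 : Fin n → ℝ)) = 0 := rfl
    rw [hx, RCLike.inner_apply, dispPhase, h2, h3]
    simp [mul_comm]
  have hchar : ∀ (f : Modes n) (a b : Cfg n), ⟪f, displace (Sum.elim a b) f⟫_ℂ
      = Complex.exp (-Complex.I * (⟪a, b⟫_ℝ / 2 : ℝ)) * ∫ x, Complex.exp (-Complex.I *
        (⟪b, x⟫_ℝ : ℝ)) * ((starRingEnd ℂ) (f x) * f (x + a)) := by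
    intro f a b
    rw [L2.inner_def, ← integral_const_mul]
    refine integral_congr_ae ?_
    filter_upwards [coeFn_displace (Sum.elim a b) f] with x hx
    have h2 : posPart (Sum.elim a b) = a := rfl
    have h3 : momPart (Sum.elim a b) = b := rfl
    rw [hx, RCLike.inner_apply, dispPhase, h2, h3]
    push_cast
    rw [mul_add, Complex.exp_add]
    ring
  have hpt : ∀ a : Cfg n, ∀ᵐ x, (starRingEnd ℂ) (h x) * h (x + a)
      = (starRingEnd ℂ) (h' x) * h' (x + a) := by
    intro a
    have i1 := hint h (Sum.elim a 0)
    have i2 := hint h' (Sum.elim a 0)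
    have h2 : posPart (Sum.elim a.ofLp (0 : Fin n → ℝ)) = a := rfl
    rw [h2] at i1 i2
    have h0 := ae_eq_zero_of_fourier_eq_zero (i1.sub i2) fun b => by
      have h3 := hc (Sum.elim a b)
      rw [hchar, hchar] at h3
      have h4 := mul_left_cancel₀ (Complex.exp_ne_zero _) h3
      have bd : ∀ {F : Cfg n → ℂ}, Integrable F →
          Integrable fun x => Complex.exp (-Complex.I * (⟪b, x⟫_ℝ : ℝ)) * F x := by
        intro F hF
        refine hF.bdd_mul (c := 1) (by fun_prop) (Filter.Eventually.of_forall fun x => ?_)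
        rw [Complex.norm_exp, neg_mul, Complex.neg_re, Complex.re_mul_ofReal]; simp
      simp only [Pi.sub_apply, mul_sub]
      rw [integral_sub (bd i1) (bd i2), sub_eq_zero]
      exact h4
    filter_upwards [h0] with x hx
    exact sub_eq_zero.1 hx
  -- By Fubini, `h̄(x) h(y) = h̄'(x) h'(y)` for almost all `(x, y)`.
  have hm : ∀ f : Modes n, Measurable f := fun f => (Lp.stronglyMeasurable f).measurable
  have hprod : ∀ᵐ p : Cfg n × Cfg n, (starRingEnd ℂ) (h p.1) * h p.2
      = (starRingEnd ℂ) (h' p.1) * h' p.2 := by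
    have hms : MeasurableSet {p : Cfg n × Cfg n | (starRingEnd ℂ) (h p.1) * h p.2
      = (starRingEnd ℂ) (h' p.1) * h' p.2} := by
      have c : Measurable (starRingEnd ℂ : ℂ → ℂ) := Complex.continuous_conj.measurable
      exact measurableSet_eq_fun
        ((c.comp ((hm h).comp measurable_fst)).mul ((hm h).comp measurable_snd))
        ((c.comp ((hm h').comp measurable_fst)).mul ((hm h').comp measurable_snd))
    have h5 : ∀ᵐ p : Cfg n × Cfg n, (starRingEnd ℂ) (h p.1) * h (p.1 + p.2)
        = (starRingEnd ℂ) (h' p.1) * h' (p.1 + p.2) := by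
      have mp := (measurePreserving_prod_add (volume : Measure (Cfg n)) (volume : Measure (Cfg n)))
      have hms' := mp.measurable hms
      have h6 : ∀ᵐ p : Cfg n × Cfg n, (starRingEnd ℂ) (h p.2) * h (p.2 + p.1)
          = (starRingEnd ℂ) (h' p.2) * h' (p.2 + p.1) := by
        refine (Measure.ae_prod_iff_ae_ae ?_).2 (Filter.Eventually.of_forall hpt)
        exact measurable_swap hms'
      exact (Measure.measurePreserving_swap (μ := (volume : Measure (Cfg n)))
        (ν := (volume : Measure (Cfg n)))).quasiMeasurePreserving.ae h6
    have mp := (measurePreserving_prod_add (volume : Measure (Cfg n)) (volume : Measure (Cfg n)))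
    rw [Measure.volume_eq_prod] at h5 ⊢
    rw [← mp.map_eq, ae_map_iff mp.measurable.aemeasurable hms]
    exact h5
  -- Integrating against `h'(x) h̄'(y)` gives `|⟨h, h'⟩|² = 1`.
  have key : ⟪h, h'⟫_ℂ * ⟪h', h⟫_ℂ = ⟪h', h'⟫_ℂ * ⟪h', h'⟫_ℂ := by
    simp only [L2.inner_def, RCLike.inner_apply]
    rw [← integral_prod_mul, ← integral_prod_mul]
    refine integral_congr_ae ?_
    filter_upwards [hprod] with p hp
    linear_combination (h' p.1 * (starRingEnd ℂ) (h' p.2)) * hp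
  rw [inner_self_eq_norm_sq_to_K, hn', ← inner_conj_symm h' h, Complex.mul_conj,
    Complex.normSq_eq_norm_sq] at key
  have h7 : ‖⟪h, h'⟫_ℂ‖ ^ 2 = 1 := Complex.ofReal_injective (by simpa using key)
  have h8 : ‖⟪h, h'⟫_ℂ‖ = 1 := by nlinarith [norm_nonneg ⟪h, h'⟫_ℂ]
  rw [eq_smul_of_norm_inner_eq_one hn hn' h8, pureState_smul_of_norm_eq_one _ _ h8]

/-! ### Gaussian unitaries from linear substitutions and quadratic phases -/

/-- An invertible matrix as a linear equivalence of the configuration space. -/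
noncomputable def linE (B : (Matrix (Fin n) (Fin n) ℝ)ˣ) : Cfg n ≃L[ℝ] Cfg n :=
  ContinuousLinearEquiv.unitsEquiv ℝ (Cfg n)
    (Units.map (Matrix.toEuclideanCLM (n := Fin n) (𝕜 := ℝ)).toMonoidHom B)

theorem ofLp_linE (B : (Matrix (Fin n) (Fin n) ℝ)ˣ) (x : Cfg n) :
    (linE B x).ofLp = B.1.mulVec x.ofLp := rfl

theorem linE_linE (A B : (Matrix (Fin n) (Fin n) ℝ)ˣ) (x : Cfg n) :
    linE A (linE B x) = linE (A * B) x := by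
  ext i
  rw [ofLp_linE, ofLp_linE, ofLp_linE, Matrix.mulVec_mulVec]; rfl

theorem linE_one (x : Cfg n) : linE 1 x = x := by
  ext i; rw [ofLp_linE]; simp

/-- The quadratic form of a matrix. -/
def quadF (U : Matrix (Fin n) (Fin n) ℝ) (x : Cfg n) : ℝ := x.ofLp ⬝ᵥ U.mulVec x.ofLp

theorem hasTemperateGrowth_quadF (U : Matrix (Fin n) (Fin n) ℝ) :
    Function.HasTemperateGrowth (quadF U) := by
  have h : quadF U = fun x => ∑ i, ∑ j, x i * (U i j * x j) := by
    funext x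
    simp [quadF, dotProduct, Matrix.mulVec, Finset.mul_sum]
  rw [h]
  have hc : ∀ i, Function.HasTemperateGrowth (fun x : Cfg n => x i) := fun i =>
    (EuclideanSpace.proj (𝕜 := ℝ) i : Cfg n →L[ℝ] ℝ).hasTemperateGrowth
  exact Function.HasTemperateGrowth.sum fun i _ => Function.HasTemperateGrowth.sum fun j _ =>
    (hc i).mul ((Function.HasTemperateGrowth.const (U i j)).mul (hc j))

/-- The phase factor `exp (-(i/2) xᵀUx)`. -/
noncomputable def quadPhase (U : Matrix (Fin n) (Fin n) ℝ) (x : Cfg n) : ℂ :=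
  Complex.exp (Complex.I * ((-(1 / 2) * quadF U x : ℝ) : ℂ))

theorem hasTemperateGrowth_quadPhase (U : Matrix (Fin n) (Fin n) ℝ) :
    Function.HasTemperateGrowth (quadPhase U) :=
  hasTemperateGrowth_phase
    ((Function.HasTemperateGrowth.const (-(1 / 2) : ℝ)).mul (hasTemperateGrowth_quadF U))

/-- The Gaussian unitary `f(x) ↦ |det B|^{1/2} exp (-(i/2) xᵀUx) f(Bx)` on Schwartz functions. -/
noncomputable def gauS (B : (Matrix (Fin n) (Fin n) ℝ)ˣ) (U : Matrix (Fin n) (Fin n) ℝ) :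
    𝓢(Cfg n, ℂ) →L[ℂ] 𝓢(Cfg n, ℂ) :=
  ((√|B.1.det| : ℝ) : ℂ) • (SchwartzMap.smulLeftCLM ℂ (quadPhase U)).comp
    (SchwartzMap.compCLMOfContinuousLinearEquiv ℂ (linE B))

theorem gauS_apply (B : (Matrix (Fin n) (Fin n) ℝ)ˣ) (U : Matrix (Fin n) (Fin n) ℝ)
    (f : 𝓢(Cfg n, ℂ)) (x : Cfg n) :
    gauS B U f x = ((√|B.1.det| : ℝ) : ℂ) * (quadPhase U x * f (linE B x)) := by
  rw [gauS, smul_apply, ContinuousLinearMap.comp_apply, smul_apply,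
    SchwartzMap.smulLeftCLM_apply_apply (hasTemperateGrowth_quadPhase U)]
  rfl

theorem det_units_ne_zero (B : (Matrix (Fin n) (Fin n) ℝ)ˣ) : B.1.det ≠ 0 :=
  ((Matrix.isUnit_iff_isUnit_det _).1 B.isUnit).ne_zero

theorem integral_comp_linE (B : (Matrix (Fin n) (Fin n) ℝ)ˣ) (F : Cfg n → ℂ) :
    ∫ x, ((|B.1.det| : ℝ) : ℂ) * F (linE B x) = ∫ x, F x := by
  have hd : LinearMap.det (linE B : Cfg n →ₗ[ℝ] Cfg n) = B.1.det := by
    have h1 : (linE B : Cfg n →ₗ[ℝ] Cfg n) = Matrix.toEuclideanLin B.1 := rfl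
    rw [h1, Matrix.toEuclideanLin_eq_toLin_orthonormal, LinearMap.det_toLin]
  have hne : LinearMap.det (linE B : Cfg n →ₗ[ℝ] Cfg n) ≠ 0 := by
    rw [hd]; exact det_units_ne_zero B
  have h := Measure.map_linearMap_addHaar_eq_smul_addHaar (volume : Measure (Cfg n)) hne
  rw [hd] at h
  have h2 : ∫ x, F (linE B x) = ∫ x, F x ∂(Measure.map (linE B) volume) :=
    ((linE B).toHomeomorph.measurableEmbedding.integral_map F).symm
  have h3 : Measure.map (linE B) volume
      = Measure.map (linE B : Cfg n →ₗ[ℝ] Cfg n) (volume : Measure (Cfg n)) := rfl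
  have h4 : 0 < |B.1.det| := abs_pos.2 (det_units_ne_zero B)
  rw [integral_const_mul, h2, h3, h, integral_smul_measure, abs_inv,
    ENNReal.toReal_ofReal (by positivity), Complex.real_smul, ← mul_assoc, ← Complex.ofReal_mul,
    mul_inv_cancel₀ h4.ne', Complex.ofReal_one, one_mul]

theorem norm_quadPhase (U : Matrix (Fin n) (Fin n) ℝ) (x : Cfg n) : ‖quadPhase U x‖ = 1 := by
  rw [quadPhase, mul_comm, Complex.norm_exp_ofReal_mul_I]

theorem norm_gauS (B : (Matrix (Fin n) (Fin n) ℝ)ˣ) (U : Matrix (Fin n) (Fin n) ℝ)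
    (f : 𝓢(Cfg n, ℂ)) : ‖toL2 n (gauS B U f)‖ = ‖toL2 n f‖ := by
  have h : ⟪toL2 n (gauS B U f), toL2 n (gauS B U f)⟫_ℂ = ⟪toL2 n f, toL2 n f⟫_ℂ := by
    rw [inner_toL2, inner_toL2, ← integral_comp_linE B (fun x => conjS f x * f x)]
    refine integral_congr_ae (Filter.Eventually.of_forall fun x => ?_)
    simp only [conjS_apply, gauS_apply, map_mul, Complex.conj_ofReal]
    have h1 : (starRingEnd ℂ) (quadPhase U x) * quadPhase U x = 1 := by
      rw [mul_comm, Complex.mul_conj, Complex.normSq_eq_norm_sq, norm_quadPhase]; simp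
    have h2 : ((√|B.1.det| : ℝ) : ℂ) * ((√|B.1.det| : ℝ) : ℂ) = (|B.1.det| : ℝ) := by
      rw [← Complex.ofReal_mul, Real.mul_self_sqrt (abs_nonneg _)]
    linear_combination (starRingEnd ℂ) (f (linE B x)) * f (linE B x) *
      (((√|B.1.det| : ℝ) : ℂ) * ((√|B.1.det| : ℝ) : ℂ) * h1 + h2)
  rw [inner_self_eq_norm_sq_to_K, inner_self_eq_norm_sq_to_K] at h
  have h1 : ‖toL2 n (gauS B U f)‖ ^ 2 = ‖toL2 n f‖ ^ 2 :=
    Complex.ofReal_injective (by simpa using h)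
  exact (sq_eq_sq₀ (norm_nonneg _) (norm_nonneg _)).1 h1

theorem denseRange_toL2 : DenseRange (toL2 n) :=
  SchwartzMap.denseRange_toLpCLM ENNReal.ofNat_ne_top

/-- The Gaussian unitary `f(x) ↦ |det B|^{1/2} exp (-(i/2) xᵀUx) f(Bx)` as a continuous linear
map on `L²`. -/
noncomputable def gauL (B : (Matrix (Fin n) (Fin n) ℝ)ˣ) (U : Matrix (Fin n) (Fin n) ℝ) :
    Modes n →L[ℂ] Modes n :=
  ((toL2 n).comp (gauS B U)).toLinearMap.extendOfNorm (toL2 n).toLinearMap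

theorem gauL_toL2 (B : (Matrix (Fin n) (Fin n) ℝ)ˣ) (U : Matrix (Fin n) (Fin n) ℝ)
    (f : 𝓢(Cfg n, ℂ)) : gauL B U (toL2 n f) = toL2 n (gauS B U f) :=
  LinearMap.extendOfNorm_eq (f := ((toL2 n).comp (gauS B U)).toLinearMap)
    (e := (toL2 n).toLinearMap) denseRange_toL2
    ⟨1, fun f => by rw [one_mul]; exact (norm_gauS B U f).le⟩ f

theorem norm_gauL (B : (Matrix (Fin n) (Fin n) ℝ)ˣ) (U : Matrix (Fin n) (Fin n) ℝ)
    (f : Modes n) : ‖gauL B U f‖ = ‖f‖ := by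
  refine denseRange_toL2.induction_on (p := fun f => ‖gauL B U f‖ = ‖f‖) f
    (isClosed_eq (by fun_prop) (by fun_prop)) fun c => ?_
  rw [gauL_toL2, norm_gauS]

theorem mulVec_dotProduct_eq {ι : Type*} [Fintype ι] (A : Matrix ι ι ℝ) (v w : ι → ℝ) :
    A.mulVec v ⬝ᵥ w = v ⬝ᵥ A.transpose.mulVec w := by
  rw [Matrix.mulVec_transpose, dotProduct_comm v, ← Matrix.dotProduct_mulVec, dotProduct_comm]

theorem quadF_linE (B : (Matrix (Fin n) (Fin n) ℝ)ˣ) (U : Matrix (Fin n) (Fin n) ℝ) (x : Cfg n) :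
    quadF U (linE B x) = quadF (B.1.transpose * U * B.1) x := by
  rw [quadF, quadF, ofLp_linE, mulVec_dotProduct_eq, Matrix.mulVec_mulVec, Matrix.mulVec_mulVec]

theorem gauS_gauS (A B : (Matrix (Fin n) (Fin n) ℝ)ˣ) (U V : Matrix (Fin n) (Fin n) ℝ)
    (f : 𝓢(Cfg n, ℂ)) :
    gauS A U (gauS B V f) = gauS (B * A) (U + A.1.transpose * V * A.1) f := by
  ext x
  have h1 : √|(B * A).1.det| = √|A.1.det| * √|B.1.det| := by
    rw [Units.val_mul, Matrix.det_mul, abs_mul, mul_comm, Real.sqrt_mul (abs_nonneg _)]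
  have h2 : quadPhase (U + A.1.transpose * V * A.1) x = quadPhase U x * quadPhase V (linE A x) := by
    have h3 : quadF (U + A.1.transpose * V * A.1) x
        = quadF U x + quadF (A.1.transpose * V * A.1) x := by
      simp only [quadF, Matrix.add_mulVec, dotProduct_add]
    rw [quadPhase, quadPhase, quadPhase, quadF_linE, h3, ← Complex.exp_add]
    congr 1
    push_cast; ring
  rw [gauS_apply, gauS_apply, gauS_apply, h1, h2, linE_linE]
  push_cast
  ring

theorem gauS_one_zero (f : 𝓢(Cfg n, ℂ)) : gauS 1 0 f = f := by
  ext x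
  rw [gauS_apply, linE_one, quadPhase, quadF]
  simp

theorem gauL_inv (B : (Matrix (Fin n) (Fin n) ℝ)ˣ) (U : Matrix (Fin n) (Fin n) ℝ) (f : Modes n) :
    gauL B U (gauL B⁻¹ (-((B⁻¹).1.transpose * U * (B⁻¹).1)) f) = f := by
  refine denseRange_toL2.induction_on (p := fun f =>
    gauL B U (gauL B⁻¹ (-((B⁻¹).1.transpose * U * (B⁻¹).1)) f) = f) f
    (isClosed_eq (by fun_prop) (by fun_prop)) fun c => ?_
  have h1 : (B⁻¹).1 * B.1 = 1 := by rw [← Units.val_mul, inv_mul_cancel]; rfl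
  have h2 : B.1.transpose * (B⁻¹).1.transpose = 1 := by
    rw [← Matrix.transpose_mul, h1, Matrix.transpose_one]
  have h3 : U + B.1.transpose * -((B⁻¹).1.transpose * U * (B⁻¹).1) * B.1 = 0 := by
    have : B.1.transpose * ((B⁻¹).1.transpose * U * (B⁻¹).1) * B.1
        = (B.1.transpose * (B⁻¹).1.transpose) * U * ((B⁻¹).1 * B.1) := by
      simp only [Matrix.mul_assoc]
    rw [Matrix.mul_neg, Matrix.neg_mul, this, h1, h2, Matrix.one_mul, Matrix.mul_one,
      add_neg_cancel]
  rw [gauL_toL2, gauL_toL2, gauS_gauS, h3, inv_mul_cancel, gauS_one_zero]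

/-- The Gaussian unitary `f(x) ↦ |det B|^{1/2} exp (-(i/2) xᵀUx) f(Bx)`. -/
noncomputable def gauE (B : (Matrix (Fin n) (Fin n) ℝ)ˣ) (U : Matrix (Fin n) (Fin n) ℝ) :
    Modes n ≃ₗᵢ[ℂ] Modes n :=
  LinearIsometryEquiv.ofSurjective ⟨(gauL B U).toLinearMap, norm_gauL B U⟩ fun f =>
    ⟨_, gauL_inv B U f⟩

theorem gauE_toL2 (B : (Matrix (Fin n) (Fin n) ℝ)ˣ) (U : Matrix (Fin n) (Fin n) ℝ)
    (f : 𝓢(Cfg n, ℂ)) : gauE B U (toL2 n f) = toL2 n (gauS B U f) := gauL_toL2 B U f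

/-- The symplectic matrix of the Gaussian unitary `gauE B U`. -/
noncomputable def gauSymp (B : (Matrix (Fin n) (Fin n) ℝ)ˣ) (U : Matrix (Fin n) (Fin n) ℝ)
    (hU : U.IsSymm) : Matrix.symplecticGroup (Fin n) ℝ :=
  ⟨Matrix.fromBlocks (B⁻¹).1 0 (-(U * (B⁻¹).1)) B.1.transpose, by
    have h1 : B.1 * (B⁻¹).1 = 1 := by rw [← Units.val_mul, mul_inv_cancel]; rfl
    rw [SymplecticGroup.fromBlocks_mem_iff]
    refine ⟨?_, by simp, ?_⟩
    · rw [Matrix.transpose_neg, Matrix.transpose_mul, hU.eq, Matrix.mul_neg, Matrix.neg_mul,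
        Matrix.mul_assoc]
    · rw [Matrix.mul_zero, sub_zero, ← Matrix.transpose_mul, h1, Matrix.transpose_one]⟩

/-- Displacement on Schwartz functions. -/
noncomputable def displaceS (r : Fin n ⊕ Fin n → ℝ) (f : 𝓢(Cfg n, ℂ)) : 𝓢(Cfg n, ℂ) :=
  SchwartzMap.smulLeftCLM ℂ (fun x => Complex.exp (Complex.I *
    ((-(⟪momPart r, x⟫_ℝ + ⟪posPart r, momPart r⟫_ℝ / 2) : ℝ) : ℂ)))
    (SchwartzMap.compSubConstCLM ℂ (-posPart r) f)

theorem displaceS_apply (r : Fin n ⊕ Fin n → ℝ) (f : 𝓢(Cfg n, ℂ)) (x : Cfg n) :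
    displaceS r f x = dispPhase r x * f (x + posPart r) := by
  have h : Function.HasTemperateGrowth (fun x : Cfg n => Complex.exp (Complex.I *
      ((-(⟪momPart r, x⟫_ℝ + ⟪posPart r, momPart r⟫_ℝ / 2) : ℝ) : ℂ))) :=
    hasTemperateGrowth_phase
      ((Function.hasTemperateGrowth_inner_right (momPart r)).add
        (Function.HasTemperateGrowth.const _)).neg
  rw [displaceS, SchwartzMap.smulLeftCLM_apply_apply h, SchwartzMap.compSubConstCLM_apply,
    sub_neg_eq_add, smul_eq_mul, dispPhase]
  congr 2
  push_cast; ring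

theorem toL2_displaceS (r : Fin n ⊕ Fin n → ℝ) (f : 𝓢(Cfg n, ℂ)) :
    toL2 n (displaceS r f) = displace r (toL2 n f) := by
  refine (eq_of_ae (coeFn_displace_of_ae r (coeFn_toL2 f)) ?_).symm
  filter_upwards [coeFn_toL2 (displaceS r f)] with x hx
  rw [hx, displaceS_apply]

theorem quadratic_covariance {U B : Matrix (Fin n) (Fin n) ℝ} (hU : U.IsSymm) (x a b : Fin n → ℝ) :
    (-(U.mulVec a) + B.transpose.mulVec b) ⬝ᵥ x
      + (a ⬝ᵥ (-(U.mulVec a) + B.transpose.mulVec b)) / 2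
      + 1 / 2 * ((x + a) ⬝ᵥ U.mulVec (x + a))
    = b ⬝ᵥ B.mulVec x + (B.mulVec a ⬝ᵥ b) / 2 + 1 / 2 * (x ⬝ᵥ U.mulVec x) := by
  have h1 : ∀ y, B.transpose.mulVec b ⬝ᵥ y = b ⬝ᵥ B.mulVec y := fun y => by
    rw [Matrix.mulVec_transpose, Matrix.dotProduct_mulVec]
  have h2 : x ⬝ᵥ U.mulVec a = a ⬝ᵥ U.mulVec x := by
    rw [Matrix.dotProduct_mulVec, ← Matrix.mulVec_transpose, hU.eq, dotProduct_comm]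
  have h3 : U.mulVec a ⬝ᵥ x = a ⬝ᵥ U.mulVec x := by rw [dotProduct_comm, h2]
  rw [add_dotProduct, dotProduct_add, h1, dotProduct_comm a (B.transpose.mulVec b), h1,
    neg_dotProduct, dotProduct_neg, Matrix.mulVec_add, dotProduct_add, add_dotProduct,
    add_dotProduct, h2, h3, dotProduct_comm (B.mulVec a) b]
  ring

theorem inner_eq_dotProduct (x y : Cfg n) : ⟪x, y⟫_ℝ = x.ofLp ⬝ᵥ y.ofLp := by
  simp only [PiLp.inner_apply, RCLike.inner_apply, conj_trivial, dotProduct]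
  exact Finset.sum_congr rfl fun i _ => mul_comm _ _

theorem isGaussianUnitary_gauE (B : (Matrix (Fin n) (Fin n) ℝ)ˣ) {U : Matrix (Fin n) (Fin n) ℝ}
    (hU : U.IsSymm) : IsGaussianUnitary (gauSymp B U hU) (gauE B U) := by
  intro r f
  change gauE B U (displaceL r f) = displaceL _ (gauE B U f)
  refine denseRange_toL2.induction_on (p := fun f =>
    gauE B U (displaceL r f) = displaceL ((gauSymp B U hU).1.mulVec r) (gauE B U f)) f
    (isClosed_eq (by fun_prop) (by fun_prop)) fun f => ?_
  rw [displaceL_apply, displaceL_apply, ← toL2_displaceS, gauE_toL2, gauE_toL2, ← toL2_displaceS]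
  congr 1
  ext x
  set a := (B⁻¹).1.mulVec (r ∘ Sum.inl) with ha
  have hBa : B.1.mulVec a = r ∘ Sum.inl := by
    rw [ha, Matrix.mulVec_mulVec, ← Units.val_mul, mul_inv_cancel]; simp
  have hr : (gauSymp B U hU).1.mulVec r
      = Sum.elim a (-(U.mulVec a) + B.1.transpose.mulVec (r ∘ Sum.inr)) := by
    rw [gauSymp, Matrix.fromBlocks_mulVec]
    congr 1
    · simp [ha]
    · rw [Matrix.neg_mulVec, ha, Matrix.mulVec_mulVec]
  have hp : posPart ((gauSymp B U hU).1.mulVec r) = WithLp.toLp 2 a := by rw [hr]; rfl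
  have hm : momPart ((gauSymp B U hU).1.mulVec r)
      = WithLp.toLp 2 (-(U.mulVec a) + B.1.transpose.mulVec (r ∘ Sum.inr)) := by rw [hr]; rfl
  have hx : linE B (x + WithLp.toLp 2 a) = linE B x + posPart r := by
    rw [map_add]; congr 1
    ext i; rw [ofLp_linE]; exact congrFun hBa i
  rw [gauS_apply, displaceS_apply, displaceS_apply, gauS_apply, hp, hx]
  suffices h : quadPhase U x * dispPhase r (linE B x)
      = dispPhase ((gauSymp B U hU).1.mulVec r) x * quadPhase U (x + WithLp.toLp 2 a) by
    linear_combination ((√|B.1.det| : ℝ) : ℂ) * f (linE B x + posPart r) * h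
  rw [quadPhase, quadPhase, dispPhase, dispPhase, ← Complex.exp_add, ← Complex.exp_add, hp, hm]
  congr 1
  have key := quadratic_covariance (B := B.1) hU x.ofLp a (r ∘ Sum.inr)
  rw [hBa] at key
  simp only [inner_eq_dotProduct, quadF, ofLp_linE, posPart, momPart, WithLp.ofLp_add]
  have key' := congrArg (fun t : ℝ => (t : ℂ)) key
  simp only [] at key'
  push_cast at key' ⊢
  linear_combination Complex.I * key'

/-! ### Gaussian states as vectors with Gaussian characteristic function -/

/-- The wavefunction of a displaced squeezed vacuum. -/
theorem coeFn_displace_gauE_vac (B : (Matrix (Fin n) (Fin n) ℝ)ˣ) (U : Matrix (Fin n) (Fin n) ℝ)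
    (s : Fin n ⊕ Fin n → ℝ) : displace s (gauE B U (coh 0)) =ᵐ[volume] fun x =>
      Complex.exp (Complex.I * (⟪posPart s, momPart s⟫_ℝ / 2 : ℝ)) *
        gaussianWave (B.1.transpose * B.1) U (-posPart s) (-momPart s) x := by
  rw [← toL2_cohS, gauE_toL2, ← toL2_displaceS]
  filter_upwards [coeFn_toL2 (displaceS s (gauS B U (cohS 0)))] with x hx
  rw [hx, displaceS_apply, gauS_apply, cohS_apply, cohFun, gaussianWave, sub_neg_eq_add]
  have h1 : ((B.1.transpose * B.1).det / Real.pi ^ n) ^ (1 / 4 : ℝ)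
      = √|B.1.det| * Real.pi ^ (-(n : ℝ) / 4) := by
    rw [Matrix.det_mul, Matrix.det_transpose, Real.div_rpow (mul_self_nonneg _) (by positivity),
      ← abs_mul_abs_self, ← pow_two, ← Real.rpow_natCast, ← Real.rpow_natCast,
      ← Real.rpow_mul (abs_nonneg _), ← Real.rpow_mul Real.pi_pos.le, Real.sqrt_eq_rpow,
      div_eq_mul_inv, ← Real.rpow_neg Real.pi_pos.le]
    congr 2 <;> push_cast <;> ring
  have h2 : (‖linE B (x + posPart s)‖ ^ 2 : ℝ)
      = (x + posPart s).ofLp ⬝ᵥ (B.1.transpose * B.1).mulVec (x + posPart s).ofLp := by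
    have := quadF_linE B 1 (x + posPart s)
    rw [Matrix.mul_one] at this
    rw [← real_inner_self_eq_norm_sq, inner_eq_dotProduct]
    simpa [quadF] using this
  rw [h1, h2, Complex.ofReal_mul]
  have h3 : ∀ p c e₁ e₂ e₃ e₄ e₅ : ℂ, Complex.exp e₁ * Complex.exp e₂ * Complex.exp e₃
      = Complex.exp e₄ * Complex.exp e₅ → Complex.exp e₁ * (c * (Complex.exp e₂ *
        (p * Complex.exp e₃))) = Complex.exp e₄ * (c * p * Complex.exp e₅) := by
    intro p c e₁ e₂ e₃ e₄ e₅ h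
    linear_combination c * p * h
  rw [dispPhase, quadPhase]
  apply h3
  rw [← Complex.exp_add, ← Complex.exp_add, ← Complex.exp_add]
  congr 1
  rw [quadF, inner_neg_left, inner_add_right, real_inner_comm (posPart s) (momPart s)]
  simp only [Pi.zero_apply, zero_mul, Finset.sum_const_zero, ne_eq, OfNat.ofNat_ne_zero,
    not_false_eq_true, zero_pow]
  push_cast
  ring

theorem exists_transpose_mul_self {W : Matrix (Fin n) (Fin n) ℝ} (hW : W.PosDef) :
    ∃ B : (Matrix (Fin n) (Fin n) ℝ)ˣ, B.1.transpose * B.1 = W := by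
  open scoped MatrixOrder in
  obtain ⟨y, hy⟩ := CStarAlgebra.nonneg_iff_eq_star_mul_self.mp hW.posSemidef.nonneg
  have h1 : W = y.transpose * y := by
    rw [hy, Matrix.star_eq_conjTranspose, Matrix.conjTranspose_eq_transpose_of_trivial]
  have h2 : IsUnit y := by
    rw [Matrix.isUnit_iff_isUnit_det, isUnit_iff_ne_zero]
    intro h0
    have := hW.det_pos
    rw [h1, Matrix.det_mul, h0, mul_zero] at this
    exact lt_irrefl _ this
  exact ⟨h2.unit, h1.symm⟩

theorem isGaussVec_smul {h : Modes n} {l : Fin n ⊕ Fin n → ℝ} {c : ℂ} (hc : ‖c‖ = 1)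
    (hh : IsGaussVec h l) : IsGaussVec (c • h) l := by
  obtain ⟨h1, S, h2⟩ := hh
  refine ⟨by rw [norm_smul, hc, h1, one_mul], S, fun r => ?_⟩
  rw [← h2, ← displaceL_apply, map_smul, displaceL_apply, inner_smul_left, inner_smul_right,
    ← mul_assoc, mul_comm _ c, Complex.mul_conj, Complex.normSq_eq_norm_sq, hc]
  simp

theorem isGaussVec_of_wave {φ : Modes n} {W U : Matrix (Fin n) (Fin n) ℝ} {x₀ p₀ : Cfg n}
    (hW : W.PosDef) (hU : U.IsSymm) (hφ : φ =ᵐ[volume] gaussianWave W U x₀ p₀) :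
    IsGaussVec φ (Sum.elim p₀.ofLp fun i => -x₀.ofLp i) := by
  obtain ⟨B, hB⟩ := exists_transpose_mul_self hW
  set s : Fin n ⊕ Fin n → ℝ := Sum.elim (fun i => -x₀.ofLp i) fun i => -p₀.ofLp i with hs
  have hp : posPart s = -x₀ := rfl
  have hm : momPart s = -p₀ := rfl
  have h1 := coeFn_displace_gauE_vac B U s
  rw [hB, hp, hm, neg_neg, neg_neg] at h1
  have h2 : φ = Complex.exp (-(Complex.I * (⟪-x₀, -p₀⟫_ℝ / 2 : ℝ))) •
      displace s (gauE B U (coh 0)) := by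
    refine eq_of_ae hφ ?_
    filter_upwards [coeFn_smul_of_ae (Complex.exp (-(Complex.I * (⟪-x₀, -p₀⟫_ℝ / 2 : ℝ)))) h1]
      with x hx
    rw [hx, ← mul_assoc, ← Complex.exp_add, neg_add_cancel, Complex.exp_zero, one_mul]
  rw [h2]
  refine isGaussVec_smul ?_ ?_
  · rw [Complex.norm_exp, Complex.neg_re, mul_comm, Complex.re_ofReal_mul]; simp
  · have h3 := (((isGaussianUnitary_gauE B hU).isGaussVec isGaussVec_vac).displace s)
    rw [Matrix.mulVec_zero, zero_add] at h3
    convert h3 using 2 <;> simp [hs]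

theorem exists_isGaussVec_of_mem {σ : Modes n →L[ℂ] Modes n} (h : σ ∈ gaussianStates n) :
    ∃ φ l, IsGaussVec φ l ∧ σ = pureState φ := by
  obtain ⟨φ, W, U, x₀, p₀, hW, hU, hφ, rfl⟩ := h
  exact ⟨φ, _, isGaussVec_of_wave hW hU hφ, rfl⟩

theorem exists_isGaussVec_of_mem_zeroMean {σ : Modes n →L[ℂ] Modes n}
    (h : σ ∈ zeroMeanGaussianStates n) : ∃ φ, IsGaussVec φ 0 ∧ σ = pureState φ := by
  obtain ⟨φ, W, U, hW, hU, hφ, rfl⟩ := h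
  refine ⟨φ, ?_, rfl⟩
  have h1 := isGaussVec_of_wave hW hU hφ
  convert h1 using 1
  funext i
  cases i <;> simp

/-- The block form `SᵀS = [[W + U W⁻¹ U, U W⁻¹], [W⁻¹ U, W⁻¹]]` of a positive symplectic matrix. -/
theorem exists_blocks_of_symplectic (S : Matrix.symplecticGroup (Fin n) ℝ) :
    ∃ (B : (Matrix (Fin n) (Fin n) ℝ)ˣ) (U : Matrix (Fin n) (Fin n) ℝ) (hU : U.IsSymm), ∀ r,
      S.1.mulVec r ⬝ᵥ S.1.mulVec r
        = ((gauSymp B U hU)⁻¹).1.mulVec r ⬝ᵥ ((gauSymp B U hU)⁻¹).1.mulVec r := by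
  set M := S.1.transpose * S.1 with hM
  have hMs : M ∈ Matrix.symplecticGroup (Fin n) ℝ :=
    Submonoid.mul_mem _ (SymplecticGroup.transpose_mem S.2) S.2
  have hSu : IsUnit S.1 :=
    (Matrix.isUnit_iff_isUnit_det _).2 (SymplecticGroup.symplectic_det S.2)
  set P := M.toBlocks₁₁
  set Q := M.toBlocks₁₂
  set Q' := M.toBlocks₂₁
  set T := M.toBlocks₂₂
  have hMb : M = Matrix.fromBlocks P Q Q' T := (Matrix.fromBlocks_toBlocks M).symm
  have hMt : M.transpose = M := by rw [hM, Matrix.transpose_mul, Matrix.transpose_transpose]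
  rw [hMb, Matrix.fromBlocks_transpose, Matrix.fromBlocks_inj] at hMt
  obtain ⟨hP, hQ, hQ2, hT⟩ := hMt
  rw [hMb, SymplecticGroup.fromBlocks_mem_iff] at hMs
  obtain ⟨e1, e2, e3⟩ := hMs
  rw [hP] at e3
  rw [hQ2, hT, ← hQ] at e2
  have hTpos : T.PosDef := by
    refine Matrix.PosDef.of_dotProduct_mulVec_pos ?_ fun x hx => ?_
    · rw [Matrix.IsHermitian, Matrix.conjTranspose_eq_transpose_of_trivial, hT]
    · rw [star_trivial]
      have h1 : x ⬝ᵥ T.mulVec x = S.1.mulVec (Sum.elim 0 x) ⬝ᵥ S.1.mulVec (Sum.elim 0 x) := by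
        have h2 : S.1.mulVec (Sum.elim 0 x) ⬝ᵥ S.1.mulVec (Sum.elim 0 x)
            = Sum.elim 0 x ⬝ᵥ M.mulVec (Sum.elim 0 x) := by
          rw [hM, mulVec_dotProduct_eq, Matrix.mulVec_mulVec]
        rw [h2, hMb, Matrix.fromBlocks_mulVec]
        simp [dotProduct, Fintype.sum_sum_type]
      rw [h1]
      have h3 : S.1.mulVec (Sum.elim 0 x) ≠ 0 := by
        intro h0
        have := Matrix.mulVec_injective_of_isUnit hSu (h0.trans (Matrix.mulVec_zero _).symm)
        exact hx (funext fun i => congrFun this (Sum.inr i))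
      have h4 := Matrix.dotProduct_star_self_pos_iff.2 h3
      rwa [star_trivial] at h4
  have hTi : IsUnit T.det := hTpos.det_pos.ne'.isUnit
  -- `T` plays the role of `W⁻¹`, so `BᵀB = W` and `U = T⁻¹ Q'`
  obtain ⟨B, hB⟩ := exists_transpose_mul_self hTpos.inv
  have hU : (T⁻¹ * Q').IsSymm := by
    rw [Matrix.IsSymm, Matrix.transpose_mul, Matrix.transpose_nonsing_inv, hT]
    calc Q'.transpose * T⁻¹ = T⁻¹ * (T * Q'.transpose) * T⁻¹ := by
          rw [← Matrix.mul_assoc, Matrix.nonsing_inv_mul _ hTi, Matrix.one_mul]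
      _ = T⁻¹ * Q' := by
          rw [← e2, ← Matrix.mul_assoc, Matrix.mul_assoc _ T, Matrix.mul_nonsing_inv _ hTi,
            Matrix.mul_one]
  obtain ⟨U, hUdef⟩ : ∃ U, U = T⁻¹ * Q' := ⟨_, rfl⟩
  rw [← hUdef] at hU
  refine ⟨B, U, hU, fun r => ?_⟩
  have hTU : T * U = Q' := by
    rw [hUdef, ← Matrix.mul_assoc, Matrix.mul_nonsing_inv _ hTi, Matrix.one_mul]
  have hUT : U * T = Q'.transpose := by
    rw [← hTU, Matrix.transpose_mul, hU.eq, hT]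
  have hPe : P = T⁻¹ + U * (T * U) := by
    have h1 : P * T = 1 + Q'.transpose * Q'.transpose := by rw [← e3, hQ]; abel
    calc P = P * T * T⁻¹ := by
          rw [Matrix.mul_assoc, Matrix.mul_nonsing_inv _ hTi, Matrix.mul_one]
      _ = T⁻¹ + U * (T * U) := by
          have h2 : U = Q'.transpose * T⁻¹ := by
            rw [← hUT, Matrix.mul_assoc, Matrix.mul_nonsing_inv _ hTi, Matrix.mul_one]
          rw [h1, Matrix.add_mul, Matrix.one_mul, ← Matrix.mul_assoc U, hUT, Matrix.mul_assoc, ← h2]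
  set a := r ∘ Sum.inl with ha
  set b := r ∘ Sum.inr with hb
  have hr : r = Sum.elim a b := by funext i; cases i <;> rfl
  have hBB : B.1.transpose * (B⁻¹).1.transpose = 1 := by
    rw [← Matrix.transpose_mul, ← Units.val_mul, inv_mul_cancel]; simp
  have hinv : ((gauSymp B U hU)⁻¹).1.mulVec r
      = Sum.elim (B.1.mulVec a) ((B⁻¹).1.transpose.mulVec (b + U.mulVec a)) := by
    have h1 : (gauSymp B U hU).1.mulVec
        (Sum.elim (B.1.mulVec a) ((B⁻¹).1.transpose.mulVec (b + U.mulVec a))) = r := by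
      rw [gauSymp, Matrix.fromBlocks_mulVec, hr]
      have h2 : (B⁻¹).1.mulVec (B.1.mulVec a) = a := by
        rw [Matrix.mulVec_mulVec, ← Units.val_mul, inv_mul_cancel]; simp
      simp only [Sum.elim_comp_inl, Sum.elim_comp_inr]
      rw [Matrix.neg_mulVec, ← Matrix.mulVec_mulVec, h2, Matrix.zero_mulVec, add_zero,
        Matrix.mulVec_mulVec, hBB, Matrix.one_mulVec, neg_add_cancel_comm_assoc]
    have h4 : ((gauSymp B U hU)⁻¹).1 * (gauSymp B U hU).1 = 1 :=
      congrArg Subtype.val (inv_mul_cancel (gauSymp B U hU))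
    conv_lhs => rw [← h1]
    rw [Matrix.mulVec_mulVec, h4, Matrix.one_mulVec]
  have hBT : (B⁻¹).1 * (B⁻¹).1.transpose = T := by
    have h1 : T⁻¹ * ((B⁻¹).1 * (B⁻¹).1.transpose) = 1 := by
      rw [← hB, Matrix.mul_assoc, ← Matrix.mul_assoc B.1, ← Units.val_mul, mul_inv_cancel,
        Units.val_one, Matrix.one_mul, hBB]
    calc _ = T * (T⁻¹ * ((B⁻¹).1 * (B⁻¹).1.transpose)) := by
          rw [← Matrix.mul_assoc, Matrix.mul_nonsing_inv _ hTi, Matrix.one_mul]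
      _ = T := by rw [h1, Matrix.mul_one]
  have hS : S.1.mulVec r ⬝ᵥ S.1.mulVec r = r ⬝ᵥ M.mulVec r := by
    rw [hM, mulVec_dotProduct_eq, Matrix.mulVec_mulVec]
  have hsum : ∀ p q p' q' : Fin n → ℝ, Sum.elim p q ⬝ᵥ Sum.elim p' q' = p ⬝ᵥ p' + q ⬝ᵥ q' := by
    intro p q p' q'
    simp [dotProduct, Fintype.sum_sum_type]
  rw [hS, hinv, hsum, mulVec_dotProduct_eq, mulVec_dotProduct_eq (B⁻¹).1.transpose,
    Matrix.mulVec_mulVec, hB, Matrix.transpose_transpose, Matrix.mulVec_mulVec, hBT, hMb,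
    Matrix.fromBlocks_mulVec, hr, hsum]
  simp only [Sum.elim_comp_inl, Sum.elim_comp_inr]
  have h5 : a ⬝ᵥ Q.mulVec b = b ⬝ᵥ Q'.mulVec a := by
    rw [← hQ, ← mulVec_dotProduct_eq, dotProduct_comm]
  have h6 : U.mulVec a ⬝ᵥ T.mulVec b = b ⬝ᵥ Q'.mulVec a := by
    rw [mulVec_dotProduct_eq, hU.eq, Matrix.mulVec_mulVec, hUT, hQ, h5]
  have h7 : U.mulVec a ⬝ᵥ T.mulVec (U.mulVec a) = a ⬝ᵥ (U * (T * U)).mulVec a := by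
    rw [mulVec_dotProduct_eq, hU.eq, Matrix.mulVec_mulVec, Matrix.mulVec_mulVec, Matrix.mul_assoc]
  rw [Matrix.mulVec_add, dotProduct_add, dotProduct_add, dotProduct_add, add_dotProduct,
    add_dotProduct, h5, h6, h7, hPe, Matrix.add_mulVec, dotProduct_add, Matrix.mulVec_mulVec, hTU]
  ring

/-- Every vector with Gaussian characteristic function is a displaced squeezed vacuum. -/
theorem exists_gauE_of_isGaussVec {h : Modes n} {l : Fin n ⊕ Fin n → ℝ} (hh : IsGaussVec h l) :
    ∃ (B : (Matrix (Fin n) (Fin n) ℝ)ˣ) (U : Matrix (Fin n) (Fin n) ℝ), U.IsSymm ∧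
      pureState h = pureState (displace (Sum.elim (fun i => l (Sum.inr i)) fun i => -l (Sum.inl i))
        (gauE B U (coh 0))) := by
  obtain ⟨h1, S, h2⟩ := hh
  obtain ⟨B, U, hU, hBU⟩ := exists_blocks_of_symplectic S
  refine ⟨B, U, hU, ?_⟩
  set s : Fin n ⊕ Fin n → ℝ := Sum.elim (fun i => l (Sum.inr i)) fun i => -l (Sum.inl i) with hs
  have h3 : ∀ r, ⟪gauE B U (coh 0), displace r (gauE B U (coh 0))⟫_ℂ
      = Complex.exp (-(1 / 4) * ((((gauSymp B U hU)⁻¹).1.mulVec r ⬝ᵥ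
        ((gauSymp B U hU)⁻¹).1.mulVec r : ℝ) : ℂ)) := by
    intro r
    have h5 := isGaussianUnitary_gauE B hU (((gauSymp B U hU)⁻¹).1.mulVec r) (coh 0)
    have h4 : (gauSymp B U hU).1 * ((gauSymp B U hU)⁻¹).1 = 1 :=
      congrArg Subtype.val (mul_inv_cancel (gauSymp B U hU))
    rw [Matrix.mulVec_mulVec, h4, Matrix.one_mulVec] at h5
    rw [← h5, LinearIsometryEquiv.inner_map_map, displace_coh_zero, inner_smul_right, inner_coh]
    simp [dotProduct, pow_two]
  refine pureState_eq_of_char_eq h1 ?_ fun r => ?_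
  · rw [← displaceL_apply, LinearIsometry.norm_map, LinearIsometryEquiv.norm_map, norm_coh_zero]
  · rw [h2, displace_comm, inner_smul_right, ← displaceL_apply s, ← displaceL_apply s,
      LinearIsometry.inner_map_map, h3, ← Complex.exp_add, hBU]
    have h6 : l ⬝ᵥ r = -sympForm r s := by
      rw [sympForm]
      simp only [dotProduct, Fintype.sum_sum_type, posPart, momPart, hs,
        PiLp.inner_apply, RCLike.inner_apply, conj_trivial, Function.comp_apply, Sum.elim_inl,
        Sum.elim_inr, neg_mul, Finset.sum_neg_distrib]
      ring
    rw [h6]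
    congr 1
    push_cast; ring

theorem posDef_transpose_mul_self (B : (Matrix (Fin n) (Fin n) ℝ)ˣ) :
    (B.1.transpose * B.1).PosDef := by
  have h := Matrix.PosDef.conjTranspose_mul_self B.1 (Matrix.mulVec_injective_of_isUnit B.isUnit)
  rwa [Matrix.conjTranspose_eq_transpose_of_trivial] at h

theorem pureState_displace_gauE_mem (B : (Matrix (Fin n) (Fin n) ℝ)ˣ)
    (U : Matrix (Fin n) (Fin n) ℝ) (s : Fin n ⊕ Fin n → ℝ) :
    ∃ φ : Modes n, pureState (displace s (gauE B U (coh 0))) = pureState φ ∧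
      φ =ᵐ[volume] gaussianWave (B.1.transpose * B.1) U (-posPart s) (-momPart s) := by
  set c := Complex.exp (-(Complex.I * (⟪posPart s, momPart s⟫_ℝ / 2 : ℝ))) with hc
  refine ⟨c • displace s (gauE B U (coh 0)), ?_, ?_⟩
  · rw [pureState_smul_of_norm_eq_one]
    rw [hc, Complex.norm_exp, Complex.neg_re, mul_comm, Complex.re_ofReal_mul]; simp
  · filter_upwards [coeFn_smul_of_ae c (coeFn_displace_gauE_vac B U s)] with x hx
    rw [hx, ← mul_assoc, hc, ← Complex.exp_add, neg_add_cancel, Complex.exp_zero, one_mul]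

theorem IsGaussVec.mem {h : Modes n} {l : Fin n ⊕ Fin n → ℝ} (hh : IsGaussVec h l) :
    pureState h ∈ gaussianStates n := by
  obtain ⟨B, U, hU, h1⟩ := exists_gauE_of_isGaussVec hh
  obtain ⟨φ, h2, h3⟩ := pureState_displace_gauE_mem B U _
  exact ⟨φ, _, U, _, _, posDef_transpose_mul_self B, hU, h3, h1.trans h2⟩

theorem IsGaussVec.mem_zeroMean {h : Modes n} (hh : IsGaussVec h 0) :
    pureState h ∈ zeroMeanGaussianStates n := by
  obtain ⟨B, U, hU, h1⟩ := exists_gauE_of_isGaussVec hh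
  obtain ⟨φ, h2, h3⟩ := pureState_displace_gauE_mem B U
    (Sum.elim (fun i => (0 : Fin n ⊕ Fin n → ℝ) (Sum.inr i))
      fun i => -(0 : Fin n ⊕ Fin n → ℝ) (Sum.inl i))
  refine ⟨φ, _, U, posDef_transpose_mul_self B, hU, ?_, h1.trans h2⟩
  convert h3 using 2
  · ext i; simp [posPart]
  · ext i; simp [momPart]

/-! ### Gaussian unitaries commute with mixing the copies -/

theorem sum_bilin_mix (o : Matrix.orthogonalGroup (Fin k) ℝ) (β : Cfg n →ₗ[ℝ] Cfg n →ₗ[ℝ] ℝ)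
    (x y : Fin k → Cfg n) : ∑ j, β (mix o.1 x j) (mix o.1 y j) = ∑ i, β (x i) (y i) := by
  have ho : o.1 * o.1.transpose = 1 := (Matrix.mem_orthogonalGroup_iff (Fin k) ℝ).1 o.2
  have h1 : ∀ j, β (mix o.1 x j) (mix o.1 y j)
      = ∑ i, ∑ i', (o.1 i j * o.1 i' j) * β (x i) (y i') := by
    intro j
    simp only [mix_apply, map_sum, map_smul, LinearMap.sum_apply, LinearMap.smul_apply, smul_eq_mul,
      Finset.mul_sum]
    rw [Finset.sum_comm]
    exact Finset.sum_congr rfl fun i _ => Finset.sum_congr rfl fun i' _ => by ring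
  simp only [h1]
  rw [Finset.sum_comm]
  refine Finset.sum_congr rfl fun i _ => ?_
  rw [Finset.sum_comm]
  have h2 : ∀ i', ∑ j, (o.1 i j * o.1 i' j) * β (x i) (y i')
      = (if i = i' then 1 else 0) * β (x i) (y i') := by
    intro i'
    rw [← Finset.sum_mul]
    have := congrFun (congrFun ho i) i'
    rw [Matrix.mul_apply, Matrix.one_apply] at this
    rw [← this]; rfl
  simp [h2]

/-- The bilinear form of a matrix. -/
noncomputable def bilF (U : Matrix (Fin n) (Fin n) ℝ) : Cfg n →ₗ[ℝ] Cfg n →ₗ[ℝ] ℝ :=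
  LinearMap.mk₂ ℝ (fun x y => x.ofLp ⬝ᵥ U.mulVec y.ofLp) (fun x y z => by simp)
    (fun c x y => by simp) (fun x y z => by simp [Matrix.mulVec_add])
    (fun c x y => by simp [Matrix.mulVec_smul])

theorem bilF_apply (U : Matrix (Fin n) (Fin n) ℝ) (x y : Cfg n) :
    bilF U x y = x.ofLp ⬝ᵥ U.mulVec y.ofLp := rfl

theorem sum_inner_mix (o : Matrix.orthogonalGroup (Fin k) ℝ) (x y : Fin k → Cfg n) :
    ∑ j, ⟪mix o.1 x j, mix o.1 y j⟫_ℝ = ∑ i, ⟪x i, y i⟫_ℝ := by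
  have h := sum_bilin_mix o (bilF 1) x y
  simpa only [bilF_apply, Matrix.one_mulVec, ← inner_eq_dotProduct] using h

theorem sum_quadF_mix (o : Matrix.orthogonalGroup (Fin k) ℝ) (U : Matrix (Fin n) (Fin n) ℝ)
    (x : Fin k → Cfg n) : ∑ j, quadF U (mix o.1 x j) = ∑ i, quadF U (x i) :=
  sum_bilin_mix o (bilF U) x x

/-- The action of a mixing matrix on tuples of phase-space vectors. -/
noncomputable def mixPhase (o : Matrix (Fin k) (Fin k) ℝ) (s : Fin k → Fin n ⊕ Fin n → ℝ)
    (i : Fin k) : Fin n ⊕ Fin n → ℝ := ∑ j, o i j • s j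

theorem posPart_mixPhase (o : Matrix (Fin k) (Fin k) ℝ) (s : Fin k → Fin n ⊕ Fin n → ℝ)
    (i : Fin k) : posPart (mixPhase o s i) = ∑ j, o i j • posPart (s j) := by
  ext l; simp [posPart, mixPhase]

theorem momPart_mixPhase (o : Matrix (Fin k) (Fin k) ℝ) (s : Fin k → Fin n ⊕ Fin n → ℝ)
    (i : Fin k) : momPart (mixPhase o s i) = ∑ j, o i j • momPart (s j) := by
  ext l; simp [momPart, mixPhase]

theorem mix_transpose_mix (o : Matrix.orthogonalGroup (Fin k) ℝ) (v : Fin k → Cfg n) (j : Fin k) :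
    mix o.1 (fun i => ∑ l, o.1 i l • v l) j = v j := by
  have h1 : (fun i => ∑ l, o.1 i l • v l) = mix o.1.transpose v := by
    funext i; rw [mix_apply]; rfl
  have ho : o.1.transpose * o.1 = 1 := (Matrix.mem_orthogonalGroup_iff' (Fin k) ℝ).1 o.2
  rw [h1, mix_mul, ho, mix_apply]
  simp [Matrix.one_apply]

theorem exists_eq_smul_of_pureState_eq {g φ : Modes n} (hg : ‖g‖ = 1)
    (h : pureState g = pureState φ) : ∃ c : ℂ, g = c • φ := by
  have h1 := congrArg (fun A : Modes n →L[ℂ] Modes n => A g) h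
  simp only [pureState_apply] at h1
  refine ⟨⟪φ, g⟫_ℂ, ?_⟩
  rw [← h1, inner_self_eq_norm_sq_to_K, hg]; simp

/-- Mixing the copies of a product of displaced centred Gaussian vectors mixes the
displacements. -/
theorem mixUnitary_displace (o : Matrix.orthogonalGroup (Fin k) ℝ) {g : Modes n}
    (hg : IsGaussVec g 0) (s : Fin k → Fin n ⊕ Fin n → ℝ) :
    mixUnitary o (ptensor n k fun j => displace (s j) g)
      = ptensor n k fun i => displace (mixPhase o.1 s i) g := by
  obtain ⟨φ, W, U, hW, hU, hφ, hs⟩ := hg.mem_zeroMean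
  have hn := (isGaussVec_of_wave hW hU hφ).1
  obtain ⟨c, hc⟩ := exists_eq_smul_of_pureState_eq hg.1 hs
  have hga : g =ᵐ[volume] fun x => c * gaussianWave W U 0 0 x := by
    rw [hc]; exact coeFn_smul_of_ae c hφ
  refine mixUnitary_ptensor_eq o (fun j => coeFn_displace_of_ae (s j) hga)
    (fun j => coeFn_displace_of_ae _ hga) fun x => ?_
  simp only [dispPhase, gaussianWave, sub_zero, inner_zero_left, Complex.ofReal_zero, mul_zero,
    add_zero]
  have h3 : ∀ e₁ c p e₂ : ℂ, Complex.exp e₁ * (c * (p * Complex.exp e₂))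
      = (c * p) * Complex.exp (e₁ + e₂) := by
    intro e₁ c p e₂; rw [Complex.exp_add]; ring
  simp only [h3, Finset.prod_mul_distrib, ← Complex.exp_sum]
  congr 2
  set a : Fin k → Cfg n := fun i => posPart (mixPhase o.1 s i) with ha
  set b : Fin k → Cfg n := fun i => momPart (mixPhase o.1 s i) with hb
  have hpa : ∀ j, posPart (s j) = mix o.1 a j := fun j => by
    rw [ha]; simp only [posPart_mixPhase]; rw [mix_transpose_mix o fun j => posPart (s j)]
  have hpb : ∀ j, momPart (s j) = mix o.1 b j := fun j => by
    rw [hb]; simp only [momPart_mixPhase]; rw [mix_transpose_mix o fun j => momPart (s j)]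
  have hadd : ∀ j, mix o.1 x j + mix o.1 a j = mix o.1 (x + a) j := fun j => by
    rw [map_add]; rfl
  simp only [hpa, hpb, hadd]
  have q1 := congrArg (fun t : ℝ => (t : ℂ)) (sum_quadF_mix o W (x + a))
  have q2 := congrArg (fun t : ℝ => (t : ℂ)) (sum_quadF_mix o U (x + a))
  have q3 := congrArg (fun t : ℝ => (t : ℂ)) (sum_inner_mix o b x)
  have q4 := congrArg (fun t : ℝ => (t : ℂ)) (sum_inner_mix o a b)
  simp only [quadF, Pi.add_apply, Complex.ofReal_sum] at q1 q2 q3 q4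
  push_cast
  simp only [Finset.sum_add_distrib, ← Finset.mul_sum, ← Finset.sum_div, mul_add]
  rw [q1, q2, q3, q4]

theorem cohPoint_mix (o : Matrix (Fin k) (Fin k) ℝ) (z : Fin k → Fin n → ℂ) (i : Fin k) :
    cohPoint (fun l => ∑ j, (o i j : ℂ) * z j l) = mixPhase o (fun j => cohPoint (z j)) i := by
  funext l
  cases l <;> simp [cohPoint, mixPhase, Finset.sum_neg_distrib]

theorem sum_sq_mixPhase (o : Matrix.orthogonalGroup (Fin k) ℝ)
    (s : Fin k → Fin n ⊕ Fin n → ℝ) :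
    ∑ i, ∑ l, mixPhase o.1 s i l ^ 2 = ∑ j, ∑ l, s j l ^ 2 := by
  have h1 : ∀ r : Fin n ⊕ Fin n → ℝ, ∑ l, r l ^ 2
      = ⟪posPart r, posPart r⟫_ℝ + ⟪momPart r, momPart r⟫_ℝ := by
    intro r
    simp only [Fintype.sum_sum_type, inner_eq_dotProduct, dotProduct, posPart, momPart, pow_two]
    rfl
  simp only [h1, Finset.sum_add_distrib]
  have hpa : ∀ j, posPart (s j) = mix o.1 (fun i => posPart (mixPhase o.1 s i)) j := fun j => by
    simp only [posPart_mixPhase]; rw [mix_transpose_mix o fun j => posPart (s j)]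
  have hpb : ∀ j, momPart (s j) = mix o.1 (fun i => momPart (mixPhase o.1 s i)) j := fun j => by
    simp only [momPart_mixPhase]; rw [mix_transpose_mix o fun j => momPart (s j)]
  simp only [hpa, hpb, sum_inner_mix]

/-- `U_o` acts on products of the vectors `T K_z` as on products of coherent vectors `K_z`. -/
def MixCov (o : Matrix.orthogonalGroup (Fin k) ℝ) (T : Modes n ≃ₗᵢ[ℂ] Modes n) : Prop :=
  ∀ z : Fin k → Fin n → ℂ, mixUnitary o (ptensor n k fun j => T (coh (z j)))
    = ptensor n k fun i => T (coh fun l => ∑ j, (o.1 i j : ℂ) * z j l)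

theorem mixCov_of_isGaussianUnitary (o : Matrix.orthogonalGroup (Fin k) ℝ)
    {S : Matrix.symplecticGroup (Fin n) ℝ} {U : Modes n ≃ₗᵢ[ℂ] Modes n}
    (hU : IsGaussianUnitary S U) : MixCov o U := by
  intro z
  have hg : IsGaussVec (U (coh 0)) 0 := by
    have := hU.isGaussVec isGaussVec_vac
    rwa [Matrix.mulVec_zero] at this
  have h1 : ∀ w : Fin n → ℂ, U (coh w) = Complex.exp ((1 / 4) * (∑ i, cohPoint w i ^ 2 : ℝ)) •
      displace (S.1.mulVec (cohPoint w)) (U (coh 0)) := fun w => by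
    rw [coh_eq_displace, map_smul, hU]
  rw [funext fun j => h1 (z j), funext fun i => h1 fun l => ∑ j, (o.1 i j : ℂ) * z j l,
    MultilinearMap.map_smul_univ, MultilinearMap.map_smul_univ, map_smul, mixUnitary_displace o hg,
    ← Complex.exp_sum, ← Complex.exp_sum]
  congr 1
  · congr 1
    simp only [cohPoint_mix]
    rw [← Finset.mul_sum, ← Finset.mul_sum, ← Complex.ofReal_sum, ← Complex.ofReal_sum,
      sum_sq_mixPhase]
  · congr 1
    funext i
    congr 1
    rw [cohPoint_mix, mixPhase, mixPhase, Matrix.mulVec_sum]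
    exact Finset.sum_congr rfl fun j _ => (Matrix.mulVec_smul _ _ _).symm

theorem sympForm_sum_right {ι : Type*} (t : Finset ι) (r : Fin n ⊕ Fin n → ℝ)
    (p : ι → Fin n ⊕ Fin n → ℝ) : sympForm r (∑ j ∈ t, p j) = ∑ j ∈ t, sympForm r (p j) := by
  have h1 : posPart (∑ j ∈ t, p j) = ∑ j ∈ t, posPart (p j) := by ext l; simp [posPart]
  have h2 : momPart (∑ j ∈ t, p j) = ∑ j ∈ t, momPart (p j) := by ext l; simp [momPart]
  simp only [sympForm, h1, h2, inner_sum, Finset.sum_sub_distrib]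

/-- Displacing all copies equally commutes with mixing matrices that fix the vector
`(1, …, 1)`. -/
theorem mixCov_displaceE {o : Matrix.orthogonalGroup (Fin k) ℝ} (h1 : ∀ i, ∑ j, o.1 i j = 1)
    (h2 : ∀ j, ∑ i, o.1 i j = 1) (s : Fin n ⊕ Fin n → ℝ) : MixCov o (displaceE (n := n) s) := by
  intro z
  have h3 : ∀ w : Fin n → ℂ, displaceE s (coh w)
      = (Complex.exp ((1 / 4) * (∑ i, cohPoint w i ^ 2 : ℝ)) *
        Complex.exp (-Complex.I * (sympForm s (cohPoint w) / 2 : ℝ))) •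
      displace (s + cohPoint w) (coh 0) := fun w => by
    rw [coh_eq_displace, map_smul, displaceE_apply, displace_displace, smul_smul]
  simp only [h3, MultilinearMap.map_smul_univ, map_smul, Finset.prod_mul_distrib,
    ← Complex.exp_sum]
  rw [mixUnitary_displace o isGaussVec_vac]
  congr 1
  · congr 2
    · simp only [cohPoint_mix]
      rw [← Finset.mul_sum, ← Finset.mul_sum, ← Complex.ofReal_sum, ← Complex.ofReal_sum,
        sum_sq_mixPhase]
    · have h4 : ∑ i, sympForm s (mixPhase o.1 (fun j => cohPoint (z j)) i)
          = ∑ j, sympForm s (cohPoint (z j)) := by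
        rw [← sympForm_sum_right, ← sympForm_sum_right]
        congr 1
        simp only [mixPhase]
        rw [Finset.sum_comm]
        refine Finset.sum_congr rfl fun j _ => ?_
        rw [← Finset.sum_smul, h2, one_smul]
      simp only [cohPoint_mix]
      rw [← Finset.mul_sum, ← Finset.mul_sum, ← Complex.ofReal_sum, ← Complex.ofReal_sum,
        ← Finset.sum_div, ← Finset.sum_div, h4]
  · congr 1
    funext i
    congr 1
    rw [cohPoint_mix, mixPhase, mixPhase]
    simp only [smul_add, Finset.sum_add_distrib]
    rw [← Finset.sum_smul, h1, one_smul]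

/-- How far the mixing matrix `o` moves the vector `ψ^{⊗k}`. -/
noncomputable def mixDefect (o : Matrix.orthogonalGroup (Fin k) ℝ) (ψ : Modes n) : ℝ :=
  ‖mixUnitary o (tensorPow k ψ) - tensorPow k ψ‖

theorem continuous_tensorPow : Continuous (tensorPow (n := n) k) :=
  continuous_ptensor.comp (continuous_pi fun _ => continuous_id)

theorem continuous_mixDefect (o : Matrix.orthogonalGroup (Fin k) ℝ) :
    Continuous (mixDefect (n := n) o) :=
  continuous_norm.comp
    (((mixUnitary (n := n) o).continuous.comp continuous_tensorPow).sub continuous_tensorPow)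

theorem tensorPow_linearCombination {G : Type*} (v : G → Modes n) (c : G →₀ ℂ) :
    tensorPow k (Finsupp.linearCombination ℂ v c)
      = ∑ r ∈ Fintype.piFinset fun _ : Fin k => c.support,
        (∏ i, c (r i)) • ptensor n k fun i => v (r i) := by
  rw [tensorPow_eq_ptensor, Finsupp.linearCombination_apply, Finsupp.sum]
  have h := (ptensor n k).map_sum_finset (fun _ z => c z • v z) (fun _ => c.support)
  rw [h]
  exact Finset.sum_congr rfl fun r _ => MultilinearMap.map_smul_univ _ _ _

/-- Unitaries that commute with mixing do not change how far mixing moves product vectors. -/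
theorem MixCov.mixDefect_eq {o : Matrix.orthogonalGroup (Fin k) ℝ} {T : Modes n ≃ₗᵢ[ℂ] Modes n}
    (hT : MixCov o T) (ψ : Modes n) : mixDefect o (T ψ) = mixDefect o ψ := by
  have key : ∀ (V : Modes n ≃ₗᵢ[ℂ] Modes n), MixCov o V → ∀ c : (Fin n → ℂ) →₀ ℂ,
      ⟪tensorPow k (Finsupp.linearCombination ℂ (fun z => V (coh z)) c),
        mixUnitary o (tensorPow k (Finsupp.linearCombination ℂ (fun z => V (coh z)) c))⟫_ℂ
      = ⟪tensorPow k (Finsupp.linearCombination ℂ coh c),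
        mixUnitary o (tensorPow k (Finsupp.linearCombination ℂ coh c))⟫_ℂ := by
    intro V hV c
    simp only [tensorPow_linearCombination, map_sum, map_smul, sum_inner, inner_sum,
      inner_smul_left, inner_smul_right]
    refine Finset.sum_congr rfl fun r _ => ?_
    congr 1
    refine Finset.sum_congr rfl fun r' _ => ?_
    rw [hV, mixUnitary_coh, inner_ptensor, inner_ptensor]
    simp only [LinearIsometryEquiv.inner_map_map]
  refine denseRange_linearCombination_coh.induction_on
    (p := fun ψ => mixDefect o (T ψ) = mixDefect o ψ) ψ
    (isClosed_eq ((continuous_mixDefect o).comp T.continuous) (continuous_mixDefect o)) fun c => ?_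
  have h1 : T (Finsupp.linearCombination ℂ coh c)
      = Finsupp.linearCombination ℂ (fun z => T (coh z)) c := by
    simp [Finsupp.linearCombination_apply, Finsupp.sum, map_sum]
  have h2 : ‖tensorPow k (T (Finsupp.linearCombination ℂ coh c))‖
      = ‖tensorPow k (Finsupp.linearCombination ℂ (coh (n := n)) c)‖ := by
    rw [tensorPow_eq_ptensor, tensorPow_eq_ptensor, norm_ptensor, norm_ptensor]
    simp
  have h3 : ∀ Ψ : Copies n k, ‖mixUnitary o Ψ - Ψ‖ ^ 2
      = 2 * ‖Ψ‖ ^ 2 - 2 * (⟪Ψ, mixUnitary o Ψ⟫_ℂ).re := by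
    intro Ψ
    rw [norm_sub_rev, norm_sub_sq (𝕜 := ℂ), LinearIsometry.norm_map]
    simp only [RCLike.re_to_complex]
    ring
  have h4 := key T hT c
  rw [← h1] at h4
  refine (sq_eq_sq₀ (norm_nonneg _) (norm_nonneg _)).1 ?_
  rw [h3, h3, h2, h4]

/-- Products of identical Gaussian vectors are invariant under mixing matrices that fix
`(1, …, 1)`. -/
theorem IsGaussVec.mixUnitary_tensorPow {o : Matrix.orthogonalGroup (Fin k) ℝ} {h : Modes n}
    {l : Fin n ⊕ Fin n → ℝ} (hh : IsGaussVec h l) (h1 : ∀ i, ∑ j, o.1 i j = 1) :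
    mixUnitary o (tensorPow k h) = tensorPow k h := by
  obtain ⟨B, U, hU, hs⟩ := exists_gauE_of_isGaussVec hh
  obtain ⟨c, hc⟩ := exists_eq_smul_of_pureState_eq hh.1 hs
  have hg : IsGaussVec (gauE B U (coh 0)) 0 := by
    have := (isGaussianUnitary_gauE B hU).isGaussVec isGaussVec_vac
    rwa [Matrix.mulVec_zero] at this
  rw [hc, tensorPow_eq_ptensor, MultilinearMap.map_smul_univ, map_smul, mixUnitary_displace o hg]
  congr 2
  funext i
  rw [mixPhase, ← Finset.sum_smul, h1, one_smul]

theorem IsGaussVec.mixUnitary_tensorPow_of_zero (o : Matrix.orthogonalGroup (Fin k) ℝ)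
    {h : Modes n} (hh : IsGaussVec h 0) : mixUnitary o (tensorPow k h) = tensorPow k h := by
  have h1 := mixUnitary_displace o hh (fun _ => 0)
  have h2 : mixPhase o.1 (fun _ => (0 : Fin n ⊕ Fin n → ℝ)) = fun _ => 0 := by
    funext i; simp [mixPhase]
  rw [h2] at h1
  simp only [displace_zero] at h1
  exact h1

/-! ### The distance to a set of pure states -/

theorem distTo_le_of_mem {Q : Set (Modes n →L[ℂ] Modes n)} {ψ g : Modes n} (hψ : ‖ψ‖ = 1)
    (hg : ‖g‖ = 1) (h : pureState g ∈ Q) :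
    distTo Q (pureState ψ) ≤ ENNReal.ofReal √(1 - ‖⟪g, ψ⟫_ℂ‖ ^ 2) := by
  rw [norm_inner_symm, ← traceNorm_pureState_sub_half hψ hg]
  exact iInf₂_le _ h

/-- The distance of a pure state `ψ` to a set of pure states in terms of overlaps. -/
theorem overlap_of_distTo {Q : Set (Modes n →L[ℂ] Modes n)} {P : Modes n → Prop}
    (hP : ∀ g, P g → ‖g‖ = 1) (hQ : ∀ g, P g → pureState g ∈ Q)
    (hQ' : ∀ σ ∈ Q, ∃ g, P g ∧ σ = pureState g) (hne : ∃ g, P g) {ψ : Modes n} (hψ : ‖ψ‖ = 1) :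
    ∃ d : ℝ, 0 ≤ d ∧ d ≤ 1 ∧ distTo Q (pureState ψ) = ENNReal.ofReal d ∧
      (∀ g, P g → ‖⟪g, ψ⟫_ℂ‖ ^ 2 ≤ 1 - d ^ 2) ∧
      ∀ κ > 0, ∃ g, P g ∧ 1 - d ^ 2 - κ ≤ ‖⟪g, ψ⟫_ℂ‖ ^ 2 := by
  have hle1 : ∀ g, P g → ‖⟪g, ψ⟫_ℂ‖ ^ 2 ≤ 1 := fun g hg => by
    have := norm_inner_le_norm (𝕜 := ℂ) g ψ
    rw [hP g hg, hψ, one_mul] at this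
    exact pow_le_one₀ (norm_nonneg _) this
  have h1 : distTo Q (pureState ψ) ≤ 1 := by
    obtain ⟨g, hg⟩ := hne
    refine (distTo_le_of_mem hψ (hP g hg) (hQ g hg)).trans ?_
    rw [← ENNReal.ofReal_one]
    refine ENNReal.ofReal_le_ofReal (Real.sqrt_le_one.2 ?_)
    linarith [sq_nonneg ‖⟪g, ψ⟫_ℂ‖]
  have hfin : distTo Q (pureState ψ) ≠ ∞ := (h1.trans_lt ENNReal.one_lt_top).ne
  refine ⟨(distTo Q (pureState ψ)).toReal, ENNReal.toReal_nonneg,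
    ENNReal.toReal_le_of_le_ofReal zero_le_one (by simpa using h1),
    (ENNReal.ofReal_toReal hfin).symm, fun g hg => ?_, fun κ hκ => ?_⟩
  · have h2 := ENNReal.toReal_le_of_le_ofReal (Real.sqrt_nonneg _)
      (distTo_le_of_mem hψ (hP g hg) (hQ g hg))
    have h3 := Real.sq_sqrt (show 0 ≤ 1 - ‖⟪g, ψ⟫_ℂ‖ ^ 2 by linarith [hle1 g hg])
    have h4 := pow_le_pow_left₀ ENNReal.toReal_nonneg h2 2
    linarith
  · set d := (distTo Q (pureState ψ)).toReal with hd
    have hd0 : 0 ≤ d := ENNReal.toReal_nonneg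
    have h2 : distTo Q (pureState ψ) < ENNReal.ofReal √(d ^ 2 + κ) := by
      rw [← ENNReal.ofReal_toReal hfin]
      refine (ENNReal.ofReal_lt_ofReal_iff (Real.sqrt_pos.2 (by positivity))).2 ?_
      exact Real.lt_sqrt_of_sq_lt (by linarith)
    rw [distTo] at h2
    simp only [iInf_lt_iff] at h2
    obtain ⟨σ, hσ, h3⟩ := h2
    obtain ⟨g, hg, rfl⟩ := hQ' σ hσ
    refine ⟨g, hg, ?_⟩
    rw [traceNorm_pureState_sub_half hψ (hP g hg), norm_inner_symm] at h3
    have h4 := ENNReal.ofReal_lt_ofReal_iff (Real.sqrt_pos.2 (by positivity)) |>.1 h3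
    have h5 := Real.sqrt_lt_sqrt_iff (by linarith [hle1 g hg]) |>.1 h4
    linarith

/-! ### The generator of a one-parameter group of copy rotations -/

/-- The lowering operator `x_l + ∂_l` (that is, `√2` times the annihilation operator). -/
noncomputable def lowS (l : Fin n) : 𝓢(Cfg n, ℂ) →L[ℂ] 𝓢(Cfg n, ℂ) := posS l + derS l

/-- The raising operator `x_l - ∂_l` (that is, `√2` times the creation operator). -/
noncomputable def raiseS (l : Fin n) : 𝓢(Cfg n, ℂ) →L[ℂ] 𝓢(Cfg n, ℂ) := posS l - derS l

theorem lowS_apply (l : Fin n) (f : 𝓢(Cfg n, ℂ)) : lowS l f = posS l f + derS l f := rfl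

theorem raiseS_apply (l : Fin n) (f : 𝓢(Cfg n, ℂ)) : raiseS l f = posS l f - derS l f := rfl

theorem inner_lowS_left (l : Fin n) (f g : 𝓢(Cfg n, ℂ)) :
    ⟪toL2 n (lowS l f), toL2 n g⟫_ℂ = ⟪toL2 n f, toL2 n (raiseS l g)⟫_ℂ := by
  rw [lowS_apply, raiseS_apply, map_add, map_sub, inner_add_left, inner_sub_right,
    inner_posS_left, inner_derS_left]
  ring

theorem inner_raiseS_left (l : Fin n) (f g : 𝓢(Cfg n, ℂ)) :
    ⟪toL2 n (raiseS l f), toL2 n g⟫_ℂ = ⟪toL2 n f, toL2 n (lowS l g)⟫_ℂ := by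
  rw [lowS_apply, raiseS_apply, map_add, map_sub, inner_sub_left, inner_add_right,
    inner_posS_left, inner_derS_left]
  ring

theorem lowS_raiseS (l m : Fin n) (f : 𝓢(Cfg n, ℂ)) :
    lowS l (raiseS m f) = raiseS m (lowS l f) + if l = m then (2 : ℂ) • f else 0 := by
  simp only [lowS_apply, raiseS_apply, map_add, map_sub, derS_posS, posS_comm l m, derS_comm l m,
    eq_comm (a := m) (b := l)]
  split_ifs
  · rw [two_smul]; abel
  · abel

theorem lowS_cohS (l : Fin n) (z : Fin n → ℂ) : lowS l (cohS z) = z l • cohS z := by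
  rw [lowS_apply, derS_cohS, add_sub_cancel]

theorem inner_coh_raiseS (w : Fin n → ℂ) (l : Fin n) (f : 𝓢(Cfg n, ℂ)) :
    ⟪coh w, toL2 n (raiseS l f)⟫_ℂ = (starRingEnd ℂ) (w l) * ⟪coh w, toL2 n f⟫_ℂ := by
  rw [← toL2_cohS, ← inner_lowS_left, lowS_cohS, map_smul, inner_smul_left]

/-- The span of the coherent wavefunctions. -/
noncomputable def cohSpan (n : ℕ) : Submodule ℂ 𝓢(Cfg n, ℂ) :=
  Submodule.span ℂ (Set.range cohS)

theorem lowS_mem_cohSpan (l : Fin n) {f : 𝓢(Cfg n, ℂ)} (hf : f ∈ cohSpan n) :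
    lowS l f ∈ cohSpan n := by
  induction hf using Submodule.span_induction with
  | mem f hf =>
    obtain ⟨z, rfl⟩ := hf
    rw [lowS_cohS]
    exact Submodule.smul_mem _ _ (Submodule.subset_span ⟨z, rfl⟩)
  | zero => rw [map_zero]; exact zero_mem _
  | add f g _ _ h1 h2 => rw [map_add]; exact add_mem h1 h2
  | smul a f _ h1 => rw [map_smul]; exact Submodule.smul_mem _ _ h1

/-- `w ↦ ⟨K_w, f⟩` is differentiable along curves, with antiholomorphic derivative given by the
lowering operators. -/
def CohDiff (f : 𝓢(Cfg n, ℂ)) : Prop :=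
  ∀ (γ : ℝ → Fin n → ℂ) (γ' : Fin n → ℂ) (t : ℝ),
    (∀ l, HasDerivAt (fun s => γ s l) (γ' l) t) →
    HasDerivAt (fun s => ⟪coh (γ s), toL2 n f⟫_ℂ)
      (∑ l, (starRingEnd ℂ) (γ' l) / 2 * ⟪coh (γ t), toL2 n (lowS l f)⟫_ℂ) t

theorem hasDerivAt_conj {γ : ℝ → ℂ} {γ' : ℂ} {t : ℝ} (h : HasDerivAt γ γ' t) :
    HasDerivAt (fun s => (starRingEnd ℂ) (γ s)) ((starRingEnd ℂ) γ') t :=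
  (Complex.conjCLE.toContinuousLinearMap.hasFDerivAt (x := γ t)).comp_hasDerivAt t h

theorem cohDiff_of_mem {f : 𝓢(Cfg n, ℂ)} (hf : f ∈ cohSpan n) : CohDiff f := by
  intro γ γ' t hγ
  induction hf using Submodule.span_induction with
  | mem f hf =>
    obtain ⟨z, rfl⟩ := hf
    simp only [toL2_cohS, lowS_cohS, map_smul, inner_smul_right, inner_coh]
    have h1 : HasDerivAt (fun s => (∑ i, (starRingEnd ℂ) (γ s i) * z i) / 2)
        ((∑ i, (starRingEnd ℂ) (γ' i) * z i) / 2) t :=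
      (HasDerivAt.fun_sum fun i _ => (hasDerivAt_conj (hγ i)).mul_const (z i)).div_const 2
    refine h1.cexp.congr_deriv ?_
    rw [mul_comm, Finset.sum_div, Finset.sum_mul]
    exact Finset.sum_congr rfl fun i _ => by ring
  | zero => simpa using hasDerivAt_const t (0 : ℂ)
  | add f g _ _ h1 h2 =>
    simp only [map_add, inner_add_right, mul_add, Finset.sum_add_distrib]
    exact h1.add h2
  | smul a f _ h1 =>
    simp only [map_smul, inner_smul_right]
    refine (h1.const_mul a).congr_deriv ?_
    rw [Finset.mul_sum]
    exact Finset.sum_congr rfl fun i _ => by ring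

theorem CohDiff.raiseS {f : 𝓢(Cfg n, ℂ)} (hf : CohDiff f) (m : Fin n) : CohDiff (raiseS m f) := by
  intro γ γ' t hγ
  simp only [inner_coh_raiseS, lowS_raiseS, map_add, inner_add_right, mul_add,
    Finset.sum_add_distrib]
  refine ((hasDerivAt_conj (hγ m)).mul (hf γ γ' t hγ)).congr_deriv ?_
  rw [add_comm, Finset.mul_sum]
  congr 1
  · exact Finset.sum_congr rfl fun i _ => by ring
  · rw [Finset.sum_eq_single m]
    · rw [if_pos rfl, map_smul, inner_smul_right]; ring
    · intro b _ hb; simp [hb]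
    · simp

/-- Lower mode `l` in copy `i` and raise it in copy `p`. -/
noncomputable def hop (i p : Fin k) (l : Fin n) (f : Fin k → 𝓢(Cfg n, ℂ)) : Fin k → 𝓢(Cfg n, ℂ) :=
  fun s => if s = i then lowS l (f s) else if s = p then raiseS l (f s) else f s

/-- The product vector of Schwartz functions. -/
noncomputable def ptS (f : Fin k → 𝓢(Cfg n, ℂ)) : Copies n k := ptensor n k fun s => toL2 n (f s)

/-- The infinitesimal copy rotation with antisymmetric matrix `J` on product vectors:
`½ ∑_{i,p,l} J_{ip} (x_l + ∂_l)_i (x_l - ∂_l)_p`. -/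
noncomputable def genA (J : Matrix (Fin k) (Fin k) ℝ) (f : Fin k → 𝓢(Cfg n, ℂ)) : Copies n k :=
  ∑ i, ∑ p, ∑ l, ((J i p / 2 : ℝ) : ℂ) • ptS (hop i p l f)

/-- A one-parameter group of copy rotations with generator `J` and period `T`. -/
structure RotFlow (o : ℝ → Matrix.orthogonalGroup (Fin k) ℝ) (J : Matrix (Fin k) (Fin k) ℝ)
    (T : ℝ) : Prop where
  pos : 0 < T
  period : o T = o 0
  antisymm : ∀ i j, J j i = -J i j
  hasDerivAt : ∀ t i j, HasDerivAt (fun s => (o s).1 i j) (∑ p, J i p * (o t).1 p j) t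

theorem RotFlow.diag {o : ℝ → Matrix.orthogonalGroup (Fin k) ℝ} {J : Matrix (Fin k) (Fin k) ℝ}
    {T : ℝ} (h : RotFlow o J T) (i : Fin k) : J i i = 0 := by
  have := h.antisymm i i; linarith

theorem RotFlow.hasDerivAt_coh {o : ℝ → Matrix.orthogonalGroup (Fin k) ℝ}
    {J : Matrix (Fin k) (Fin k) ℝ} {T : ℝ} (h : RotFlow o J T) {f : Fin k → 𝓢(Cfg n, ℂ)}
    (hf : ∀ s, CohDiff (f s)) (z : Fin k → Fin n → ℂ) (t : ℝ) :
    HasDerivAt (fun s => ⟪mixUnitary (o s) (ptensor n k fun j => coh (z j)), ptS f⟫_ℂ)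
      ⟪mixUnitary (o t) (ptensor n k fun j => coh (z j)), genA J f⟫_ℂ t := by
  simp only [mixUnitary_coh, ptS, genA, inner_sum, inner_smul_right, inner_ptensor]
  set γ : ℝ → Fin k → Fin n → ℂ := fun s i l => ∑ j, ((o s).1 i j : ℂ) * z j l with hγ
  have h1 : ∀ i l, HasDerivAt (fun s => γ s i l) (∑ p, (J i p : ℂ) * γ t p l) t := by
    intro i l
    refine (HasDerivAt.fun_sum fun j _ =>
      ((h.hasDerivAt t i j).ofReal_comp).mul_const (z j l)).congr_deriv ?_
    simp only [hγ, Finset.mul_sum, Complex.ofReal_sum, Finset.sum_mul, Complex.ofReal_mul]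
    rw [Finset.sum_comm]
    exact Finset.sum_congr rfl fun p _ => Finset.sum_congr rfl fun j _ => by ring
  have h2 := HasDerivAt.fun_finsetProd (u := Finset.univ)
    fun i _ => hf i (fun s => γ s i) _ t (h1 i)
  refine h2.congr_deriv (Finset.sum_congr rfl fun i _ => ?_)
  simp only [map_sum, map_mul, Complex.conj_ofReal, smul_eq_mul, Finset.sum_div, Finset.sum_mul,
    Finset.mul_sum]
  rw [Finset.sum_comm]
  refine Finset.sum_congr rfl fun p _ => Finset.sum_congr rfl fun l _ => ?_
  by_cases hip : i = p
  · subst hip; simp [h.diag]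
  · have hp : p ∈ Finset.univ.erase i := Finset.mem_erase.2 ⟨fun e => hip e.symm, Finset.mem_univ _⟩
    rw [← Finset.mul_prod_erase Finset.univ _ (Finset.mem_univ i),
      ← Finset.mul_prod_erase _ _ hp, ← Finset.mul_prod_erase _ _ hp]
    have h3 : ∏ s ∈ (Finset.univ.erase i).erase p, ⟪coh (γ t s), toL2 n (hop i p l f s)⟫_ℂ
        = ∏ s ∈ (Finset.univ.erase i).erase p, ⟪coh (γ t s), toL2 n (f s)⟫_ℂ := by
      refine Finset.prod_congr rfl fun s hs => ?_
      have hs1 := Finset.ne_of_mem_erase hs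
      have hs2 := Finset.ne_of_mem_erase (Finset.mem_of_mem_erase hs)
      simp [hop, hs1, hs2]
    have h4 : hop i p l f i = lowS l (f i) := by simp [hop]
    have h5 : hop i p l f p = raiseS l (f p) := by
      simp only [hop, if_neg (Ne.symm hip), if_true]
    rw [h3, h4, h5, inner_coh_raiseS]
    push_cast
    ring

theorem RotFlow.hasDerivAt_inner {o : ℝ → Matrix.orthogonalGroup (Fin k) ℝ}
    {J : Matrix (Fin k) (Fin k) ℝ} {T : ℝ} (h : RotFlow o J T) {f : Fin k → 𝓢(Cfg n, ℂ)}
    (hf : ∀ s, CohDiff (f s)) (c : (Fin n → ℂ) →₀ ℂ) (t : ℝ) :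
    HasDerivAt (fun s => ⟪mixUnitary (o s) (tensorPow k (Finsupp.linearCombination ℂ coh c)),
        ptS f⟫_ℂ)
      ⟪mixUnitary (o t) (tensorPow k (Finsupp.linearCombination ℂ coh c)), genA J f⟫_ℂ t := by
  simp only [tensorPow_linearCombination, map_sum, map_smul, sum_inner, inner_smul_left]
  exact HasDerivAt.fun_sum fun r _ => (h.hasDerivAt_coh hf (fun i => r i) t).const_mul _

theorem inner_hop_left (i p : Fin k) (hip : i ≠ p) (l : Fin n) (f g : Fin k → 𝓢(Cfg n, ℂ)) :
    ⟪ptS (hop i p l f), ptS g⟫_ℂ = ⟪ptS f, ptS (hop p i l g)⟫_ℂ := by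
  rw [ptS, ptS, ptS, ptS, inner_ptensor, inner_ptensor]
  refine Finset.prod_congr rfl fun s _ => ?_
  simp only [hop]
  by_cases h1 : s = i
  · subst h1
    rw [if_pos rfl, if_neg hip, if_pos rfl, inner_lowS_left]
  · rw [if_neg h1, if_neg h1]
    split_ifs
    · rw [inner_raiseS_left]
    · rfl

/-- The generator is antisymmetric. -/
theorem RotFlow.inner_genA_left {o : ℝ → Matrix.orthogonalGroup (Fin k) ℝ}
    {J : Matrix (Fin k) (Fin k) ℝ} {T : ℝ} (h : RotFlow o J T) (f g : Fin k → 𝓢(Cfg n, ℂ)) :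
    ⟪genA J f, ptS g⟫_ℂ = -⟪ptS f, genA J g⟫_ℂ := by
  simp only [genA, sum_inner, inner_sum, inner_smul_left, inner_smul_right, Complex.conj_ofReal]
  rw [Finset.sum_comm]
  simp only [← Finset.sum_neg_distrib]
  refine Finset.sum_congr rfl fun i _ => Finset.sum_congr rfl fun p _ =>
    Finset.sum_congr rfl fun l _ => ?_
  by_cases hip : p = i
  · subst hip; simp [h.diag]
  · rw [inner_hop_left p i hip, h.antisymm i p]
    push_cast; ring

/-- The generator applied twice. -/
noncomputable def genAA (J : Matrix (Fin k) (Fin k) ℝ) (f : Fin k → 𝓢(Cfg n, ℂ)) : Copies n k :=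
  ∑ i, ∑ p, ∑ l, ((J i p / 2 : ℝ) : ℂ) • genA J (hop i p l f)

theorem RotFlow.norm_sq_genA {o : ℝ → Matrix.orthogonalGroup (Fin k) ℝ}
    {J : Matrix (Fin k) (Fin k) ℝ} {T : ℝ} (h : RotFlow o J T) (f : Fin k → 𝓢(Cfg n, ℂ)) :
    ⟪ptS f, genAA J f⟫_ℂ = -((‖genA J f‖ ^ 2 : ℝ) : ℂ) := by
  have h1 : ∀ X : Copies n k, ⟪X, genA J f⟫_ℂ
      = ∑ i, ∑ p, ∑ l, ((J i p / 2 : ℝ) : ℂ) * ⟪X, ptS (hop i p l f)⟫_ℂ := fun X => by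
    simp only [genA, inner_sum, inner_smul_right]
  have h2 : ((‖genA J f‖ : ℝ) : ℂ) ^ 2 = -⟪ptS f, genAA J f⟫_ℂ := by
    refine (inner_self_eq_norm_sq_to_K (𝕜 := ℂ) (genA J f)).symm.trans ?_
    rw [h1]
    simp only [h.inner_genA_left, genAA, inner_sum, inner_smul_right, mul_neg,
      Finset.sum_neg_distrib]
  push_cast
  linear_combination h2

theorem cohDiff_hop {f : 𝓢(Cfg n, ℂ)} (hf : f ∈ cohSpan n) (i p : Fin k) (l : Fin n) (s : Fin k) :
    CohDiff (hop i p l (fun _ => f) s) := by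
  simp only [hop]
  split_ifs
  · exact cohDiff_of_mem (lowS_mem_cohSpan l hf)
  · exact (cohDiff_of_mem hf).raiseS l
  · exact cohDiff_of_mem hf

theorem linearCombination_cohS_mem (c : (Fin n → ℂ) →₀ ℂ) :
    Finsupp.linearCombination ℂ cohS c ∈ cohSpan n := by
  rw [cohSpan, Finsupp.mem_span_range_iff_exists_finsupp]
  exact ⟨c, Finsupp.linearCombination_apply _ _ |>.symm⟩

theorem toL2_linearCombination (c : (Fin n → ℂ) →₀ ℂ) :
    toL2 n (Finsupp.linearCombination ℂ cohS c) = Finsupp.linearCombination ℂ coh c := by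
  simp [Finsupp.linearCombination_apply, Finsupp.sum, map_sum, toL2_cohS]

/-- If a periodic rotation moves `φ^{⊗k}` by at most `ε` at all times, then its generator is small
on `φ^{⊗k}`: by periodicity the real part of `t ↦ ⟨U_t φ^{⊗k}, A φ^{⊗k}⟩` has a critical point,
where `⟨U_t φ^{⊗k}, A² φ^{⊗k}⟩` has real part zero and differs from `-‖A φ^{⊗k}‖²` by at most
`ε ‖A² φ^{⊗k}‖`. -/
theorem RotFlow.norm_sq_genA_le {o : ℝ → Matrix.orthogonalGroup (Fin k) ℝ}
    {J : Matrix (Fin k) (Fin k) ℝ} {T : ℝ} (h : RotFlow o J T) (c : (Fin n → ℂ) →₀ ℂ) {ε : ℝ}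
    (hε : ∀ t, mixDefect (o t) (Finsupp.linearCombination ℂ (coh (n := n)) c) ≤ ε) :
    ‖genA J fun _ : Fin k => Finsupp.linearCombination ℂ (cohS (n := n)) c‖ ^ 2
      ≤ ε * ‖genAA J fun _ : Fin k => Finsupp.linearCombination ℂ (cohS (n := n)) c‖ := by
  set φ := Finsupp.linearCombination ℂ (cohS (n := n)) c with hφ
  set Ψ := tensorPow k (Finsupp.linearCombination ℂ (coh (n := n)) c) with hΨ
  have hΨ' : Ψ = ptS (fun _ : Fin k => φ) := by
    rw [hΨ, tensorPow_eq_ptensor, ptS, hφ, toL2_linearCombination]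
  have hder : ∀ t, HasDerivAt (fun s => ⟪mixUnitary (o s) Ψ, genA J fun _ : Fin k => φ⟫_ℂ)
      ⟪mixUnitary (o t) Ψ, genAA J fun _ : Fin k => φ⟫_ℂ t := by
    intro t
    conv => arg 1; ext s; rw [genA]
    rw [genAA]
    simp only [inner_sum, inner_smul_right]
    refine HasDerivAt.fun_sum fun i _ => HasDerivAt.fun_sum fun p _ => HasDerivAt.fun_sum
      fun l _ => HasDerivAt.const_mul _ ?_
    exact h.hasDerivAt_inner (cohDiff_hop (linearCombination_cohS_mem c) i p l) c t
  have hre : ∀ t, HasDerivAt (fun s => (⟪mixUnitary (o s) Ψ, genA J fun _ : Fin k => φ⟫_ℂ).re)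
      (⟪mixUnitary (o t) Ψ, genAA J fun _ : Fin k => φ⟫_ℂ).re t := fun t =>
    (Complex.reCLM.hasFDerivAt (x := _)).comp_hasDerivAt t (hder t)
  obtain ⟨t, -, ht⟩ := exists_hasDerivAt_eq_zero h.pos
    (fun t _ => (hre t).continuousAt.continuousWithinAt) (by simp only [h.period])
    (fun t _ => hre t)
  have h1 := h.norm_sq_genA (fun _ => φ)
  rw [← hΨ'] at h1
  have h2 : (⟪mixUnitary (o t) Ψ - Ψ, genAA J fun _ : Fin k => φ⟫_ℂ).re
      = ‖genA J fun _ : Fin k => φ‖ ^ 2 := by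
    rw [inner_sub_left, Complex.sub_re, ht, h1, Complex.neg_re, Complex.ofReal_re]
    ring
  rw [← h2]
  refine (Complex.re_le_norm _).trans ((norm_inner_le_norm _ _).trans ?_)
  exact mul_le_mul_of_nonneg_right (hε t) (norm_nonneg _)

/-! ### The energy bounds the square of the generator -/

theorem lowS_comm (l m : Fin n) (f : 𝓢(Cfg n, ℂ)) : lowS l (lowS m f) = lowS m (lowS l f) := by
  simp only [lowS_apply, map_add, derS_posS, posS_comm l m, derS_comm l m,
    eq_comm (a := m) (b := l)]
  abel

theorem raiseS_comm (l m : Fin n) (f : 𝓢(Cfg n, ℂ)) :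
    raiseS l (raiseS m f) = raiseS m (raiseS l f) := by
  simp only [raiseS_apply, map_sub, derS_posS, posS_comm l m, derS_comm l m,
    eq_comm (a := m) (b := l)]
  abel

theorem enS_eq_raiseS_lowS (f : 𝓢(Cfg n, ℂ)) :
    enS f = (1 / 2 : ℂ) • ∑ m, raiseS m (lowS m f) + (n / 2 : ℂ) • f := enS_eq f

theorem enS_lowS (l : Fin n) (f : 𝓢(Cfg n, ℂ)) : enS (lowS l f) = lowS l (enS f) - lowS l f := by
  have h : ∀ m, lowS l (raiseS m (lowS m f))
      = raiseS m (lowS m (lowS l f)) + if l = m then (2 : ℂ) • lowS l f else 0 := by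
    intro m
    rw [lowS_raiseS, lowS_comm l m]
    split_ifs with h
    · rw [h]
    · rfl
  simp only [enS_eq_raiseS_lowS, map_add, map_smul, map_sum, h, Finset.sum_add_distrib,
    Finset.sum_ite_eq, Finset.mem_univ, if_true, smul_add, smul_smul]
  norm_num
  abel

theorem enS_raiseS (l : Fin n) (f : 𝓢(Cfg n, ℂ)) :
    enS (raiseS l f) = raiseS l (enS f) + raiseS l f := by
  have h : ∀ m, raiseS m (lowS m (raiseS l f))
      = raiseS l (raiseS m (lowS m f)) + if m = l then (2 : ℂ) • raiseS l f else 0 := by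
    intro m
    rw [lowS_raiseS, map_add, raiseS_comm m l]
    split_ifs with h
    · rw [h, map_smul]
    · rw [map_zero]
  simp only [enS_eq_raiseS_lowS, map_add, map_smul, map_sum, h, Finset.sum_add_distrib,
    Finset.sum_ite_eq', Finset.mem_univ, if_true, smul_add, smul_smul]
  norm_num
  abel

theorem inner_enS_lowS (f h : 𝓢(Cfg n, ℂ)) : ∑ l, ⟪toL2 n (lowS l f), toL2 n (lowS l h)⟫_ℂ =
    2 * ⟪toL2 n f, toL2 n (enS h)⟫_ℂ - n * ⟪toL2 n f, toL2 n h⟫_ℂ := by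
  have h1 := inner_enS f h
  simp only [← lowS_apply] at h1
  rw [h1]; ring

theorem inner_enS_raiseS (f h : 𝓢(Cfg n, ℂ)) :
    ∑ l, ⟪toL2 n (raiseS l f), toL2 n (raiseS l h)⟫_ℂ =
    2 * ⟪toL2 n f, toL2 n (enS h)⟫_ℂ + n * ⟪toL2 n f, toL2 n h⟫_ℂ := by
  have h1 : ∀ l, ⟪toL2 n (raiseS l f), toL2 n (raiseS l h)⟫_ℂ
      = ⟪toL2 n (lowS l f), toL2 n (lowS l h)⟫_ℂ + 2 * ⟪toL2 n f, toL2 n h⟫_ℂ := by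
    intro l
    rw [inner_raiseS_left, lowS_raiseS, if_pos rfl, map_add, inner_add_right, ← inner_lowS_left,
      map_smul, inner_smul_right]
  simp only [h1, Finset.sum_add_distrib, inner_enS_lowS, Finset.sum_const, Finset.card_univ,
    Fintype.card_fin, nsmul_eq_mul]
  ring

/-- `‖(x_l + ∂_l) f‖² + ‖(x_l - ∂_l) f‖²`. -/
noncomputable def ladderSq (f : 𝓢(Cfg n, ℂ)) (l : Fin n) : ℝ :=
  ‖toL2 n (lowS l f)‖ ^ 2 + ‖toL2 n (raiseS l f)‖ ^ 2

theorem ladderSq_nonneg (f : 𝓢(Cfg n, ℂ)) (l : Fin n) : 0 ≤ ladderSq f l := by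
  rw [ladderSq]; positivity

theorem ofReal_norm_sq {H : Type*} [NormedAddCommGroup H] [InnerProductSpace ℂ H] (f : H) :
    ((‖f‖ ^ 2 : ℝ) : ℂ) = ⟪f, f⟫_ℂ := by
  rw [inner_self_eq_norm_sq_to_K]; push_cast; rfl

theorem sum_ladderSq (f : 𝓢(Cfg n, ℂ)) :
    ((∑ l, ladderSq f l : ℝ) : ℂ) = 4 * ⟪toL2 n f, toL2 n (enS f)⟫_ℂ := by
  simp only [ladderSq, Complex.ofReal_sum, Complex.ofReal_add, ofReal_norm_sq,
    Finset.sum_add_distrib, inner_enS_lowS, inner_enS_raiseS]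
  ring

/-- The sum of the squares of all products of two ladder operators. -/
theorem sum_ladderSq_ladder (f : 𝓢(Cfg n, ℂ)) :
    ∑ l, ∑ m, (ladderSq (lowS l f) m + ladderSq (raiseS l f) m)
      = 16 * ‖toL2 n (enS f)‖ ^ 2 + 8 * n * ‖toL2 n f‖ ^ 2 := by
  apply Complex.ofReal_injective
  have h1 : ∀ l, ((∑ m, (ladderSq (lowS l f) m + ladderSq (raiseS l f) m) : ℝ) : ℂ)
      = 4 * (⟪toL2 n (lowS l f), toL2 n (lowS l (enS f))⟫_ℂ
        - ⟪toL2 n (lowS l f), toL2 n (lowS l f)⟫_ℂ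
        + ⟪toL2 n (raiseS l f), toL2 n (raiseS l (enS f))⟫_ℂ
        + ⟪toL2 n (raiseS l f), toL2 n (raiseS l f)⟫_ℂ) := by
    intro l
    rw [Finset.sum_add_distrib, Complex.ofReal_add, sum_ladderSq, sum_ladderSq, enS_lowS,
      enS_raiseS, map_sub, map_add, inner_sub_right, inner_add_right]
    ring
  rw [Complex.ofReal_sum, Finset.sum_congr rfl fun l _ => h1 l, ← Finset.mul_sum]
  simp only [Finset.sum_add_distrib, Finset.sum_sub_distrib, inner_enS_lowS, inner_enS_raiseS]
  rw [← inner_enS_symm f (enS f)]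
  simp only [Complex.ofReal_add, Complex.ofReal_mul, ofReal_norm_sq]
  push_cast
  ring

theorem dim_le_energy {f : 𝓢(Cfg n, ℂ)} (hf : ‖toL2 n f‖ = 1) :
    (n : ℝ) ≤ 2 * ‖toL2 n (enS f)‖ := by
  have h1 := inner_enS_lowS f f
  have h2 : ((∑ l, ‖toL2 n (lowS l f)‖ ^ 2 + n : ℝ) : ℂ) = 2 * ⟪toL2 n f, toL2 n (enS f)⟫_ℂ := by
    have h3 := ofReal_norm_sq (toL2 n f)
    rw [hf] at h3
    push_cast at h3
    simp only [Complex.ofReal_add, Complex.ofReal_sum, ofReal_norm_sq, h1, ← h3]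
    push_cast
    ring
  have h4 : ‖(2 * ⟪toL2 n f, toL2 n (enS f)⟫_ℂ)‖ ≤ 2 * ‖toL2 n (enS f)‖ := by
    rw [norm_mul]
    have := norm_inner_le_norm (𝕜 := ℂ) (toL2 n f) (toL2 n (enS f))
    rw [hf, one_mul] at this
    simpa using this
  rw [← h2, Complex.norm_real] at h4
  have h5 : 0 ≤ ∑ l, ‖toL2 n (lowS l f)‖ ^ 2 := Finset.sum_nonneg fun _ _ => sq_nonneg _
  have := Real.le_norm_self (∑ l, ‖toL2 n (lowS l f)‖ ^ 2 + (n : ℝ))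
  linarith

theorem sum_ladderSq_le {f : 𝓢(Cfg n, ℂ)} (hf : ‖toL2 n f‖ = 1) :
    ∑ l, ladderSq f l ≤ 4 * ‖toL2 n (enS f)‖ := by
  have h1 := congrArg norm (sum_ladderSq f)
  rw [Complex.norm_real, norm_mul] at h1
  have := norm_inner_le_norm (𝕜 := ℂ) (toL2 n f) (toL2 n (enS f))
  rw [hf, one_mul] at this
  refine (Real.le_norm_self _).trans (h1.le.trans ?_)
  simpa using this

/-- Two pairs of at most three copies have one or two copies in common. -/
theorem prod_ite_le {N L M : ℝ} (hk : k ≤ 3) {i p i' p' : Fin k} (h : i ≠ p)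
    (h' : i' ≠ p') :
    ∏ s, (if s = i ∨ s = p then (if s = i' ∨ s = p' then N else L)
      else (if s = i' ∨ s = p' then M else 1)) ≤ N ^ 2 + (L * M) ^ 2 := by
  set A : Finset (Fin k) := {i, p} with hA
  set B : Finset (Fin k) := {i', p'} with hB
  have h1 : ∀ s, (if s = i ∨ s = p then (if s = i' ∨ s = p' then N else L)
      else (if s = i' ∨ s = p' then M else 1))
      = (if s ∈ A ∩ B then N else 1) * ((if s ∈ A \ B then L else 1) *
        (if s ∈ B \ A then M else 1)) := by
    intro s
    by_cases ha : s = i ∨ s = p <;> by_cases hb : s = i' ∨ s = p' <;> simp [hA, hB, ha, hb]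
  simp only [h1, Finset.prod_mul_distrib, Finset.prod_ite_mem, Finset.univ_inter,
    Finset.prod_const]
  have hAc : A.card = 2 := Finset.card_pair h
  have hBc : B.card = 2 := Finset.card_pair h'
  have h2 := Finset.card_sdiff_add_card_inter A B
  have h3 := Finset.card_sdiff_add_card_inter B A
  have h4 := Finset.card_union_add_card_inter A B
  have h5 : (A ∪ B).card ≤ k := (Finset.card_le_univ _).trans_eq (Fintype.card_fin k)
  rw [Finset.inter_comm B A] at h3
  have h6 : (A ∩ B).card = 1 ∨ (A ∩ B).card = 2 := by omega
  rcases h6 with h6 | h6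
  · rw [h6, show (A \ B).card = 1 by omega, show (B \ A).card = 1 by omega]
    nlinarith [sq_nonneg (N - L * M)]
  · rw [h6, show (A \ B).card = 0 by omega, show (B \ A).card = 0 by omega]
    nlinarith [sq_nonneg (L * M)]

theorem norm_ptS_hop_hop_le {f : 𝓢(Cfg n, ℂ)} (hf : ‖toL2 n f‖ = 1) (hk : k ≤ 3)
    {i p i' p' : Fin k} (h : i ≠ p) (h' : i' ≠ p') (l m : Fin n) :
    ‖ptS (hop i' p' m (hop i p l fun _ : Fin k => f))‖
      ≤ (ladderSq (lowS l f) m + ladderSq (raiseS l f) m) + ladderSq f l * ladderSq f m := by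
  set N := √(ladderSq (lowS l f) m + ladderSq (raiseS l f) m)
  have hN : N ^ 2 = ladderSq (lowS l f) m + ladderSq (raiseS l f) m :=
    Real.sq_sqrt (add_nonneg (ladderSq_nonneg _ _) (ladderSq_nonneg _ _))
  have hL : √(ladderSq f l) ^ 2 = ladderSq f l := Real.sq_sqrt (ladderSq_nonneg _ _)
  have hM : √(ladderSq f m) ^ 2 = ladderSq f m := Real.sq_sqrt (ladderSq_nonneg _ _)
  have h1 := prod_ite_le (L := √(ladderSq f l)) (M := √(ladderSq f m))
    (N := N) hk h h'
  rw [mul_pow, hN, hL, hM] at h1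
  refine le_trans ?_ h1
  rw [ptS, norm_ptensor]
  refine Finset.prod_le_prod (fun _ _ => norm_nonneg _) fun s _ => ?_
  have hstep : ∀ (F : Fin k → 𝓢(Cfg n, ℂ)) (a b : Fin k) (c : Fin n), s = a ∨ s = b →
      ‖toL2 n (hop a b c F s)‖ ≤ √(ladderSq (F s) c) := by
    intro F a b c hs
    refine Real.le_sqrt_of_sq_le ?_
    rw [ladderSq, hop]
    have h1 := sq_nonneg ‖toL2 n (lowS c (F s))‖
    have h2 := sq_nonneg ‖toL2 n (raiseS c (F s))‖
    by_cases h3 : s = a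
    · rw [if_pos h3]; linarith
    · rw [if_neg h3, if_pos (hs.resolve_left h3)]; linarith
  have hstay : ∀ (F : Fin k → 𝓢(Cfg n, ℂ)) (a b : Fin k) (c : Fin n), ¬ (s = a ∨ s = b) →
      hop a b c F s = F s := by
    intro F a b c hs
    rw [hop, if_neg fun e => hs (Or.inl e), if_neg fun e => hs (Or.inr e)]
  by_cases ha : s = i ∨ s = p <;> by_cases hb : s = i' ∨ s = p'
  · rw [if_pos ha, if_pos hb]
    refine (hstep _ _ _ _ hb).trans (Real.sqrt_le_sqrt ?_)
    have h3 := ladderSq_nonneg (lowS l f) m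
    have h4 := ladderSq_nonneg (raiseS l f) m
    rw [hop]
    by_cases h5 : s = i
    · rw [if_pos h5]; linarith
    · rw [if_neg h5, if_pos (ha.resolve_left h5)]; linarith
  · rw [if_pos ha, if_neg hb, hstay _ _ _ _ hb]
    exact hstep _ _ _ _ ha
  · rw [if_neg ha, if_pos hb]
    refine (hstep _ _ _ _ hb).trans_eq ?_
    rw [hstay _ _ _ _ ha]
  · rw [if_neg ha, if_neg hb, hstay _ _ _ _ hb, hstay _ _ _ _ ha, hf]

/-- The square of the generator is bounded on `f^{⊗k}` by the second moment of the energy. -/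
theorem RotFlow.norm_genAA_le {o : ℝ → Matrix.orthogonalGroup (Fin k) ℝ}
    {J : Matrix (Fin k) (Fin k) ℝ} {T : ℝ} (h : RotFlow o J T) (hk : k ≤ 3) (hn : 0 < n)
    (hJ : ∑ i, ∑ p, |J i p| ≤ 4) {f : 𝓢(Cfg n, ℂ)} (hf : ‖toL2 n f‖ = 1) :
    ‖genAA J fun _ : Fin k => f‖ ≤ 256 * ‖toL2 n (enS f)‖ ^ 2 := by
  set b : Fin n → Fin n → ℝ := fun l m =>
    (ladderSq (lowS l f) m + ladderSq (raiseS l f) m) + ladderSq f l * ladderSq f m with hb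
  have hb0 : ∀ l m, 0 ≤ b l m := fun l m => by
    have := ladderSq_nonneg (lowS l f) m
    have := ladderSq_nonneg (raiseS l f) m
    have := mul_nonneg (ladderSq_nonneg f l) (ladderSq_nonneg f m)
    simp only [hb]; linarith
  have h1 : ∀ i p l, i ≠ p → ‖genA J (hop i p l fun _ : Fin k => f)‖ ≤ 2 * ∑ m, b l m := by
    intro i p l hip
    calc ‖genA J (hop i p l fun _ : Fin k => f)‖
        ≤ ∑ i', ∑ p', ∑ m, |J i' p'| / 2 * b l m := by
          refine norm_sum_le_of_le _ fun i' _ => norm_sum_le_of_le _ fun p' _ =>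
            norm_sum_le_of_le _ fun m _ => ?_
          rw [norm_smul, Complex.norm_real, Real.norm_eq_abs, abs_div, abs_two]
          by_cases h' : i' = p'
          · subst h'; simp [h.diag]
          · exact mul_le_mul_of_nonneg_left (norm_ptS_hop_hop_le hf hk hip h' l m) (by positivity)
      _ = (∑ i, ∑ p, |J i p|) / 2 * ∑ m, b l m := by
          simp only [← Finset.mul_sum, ← Finset.sum_mul, ← Finset.sum_div]
      _ ≤ 4 / 2 * ∑ m, b l m := by
          refine mul_le_mul_of_nonneg_right (by linarith) (Finset.sum_nonneg fun m _ => hb0 l m)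
      _ = _ := by norm_num
  have h2 : ‖genAA J fun _ : Fin k => f‖ ≤ 4 * ∑ l, ∑ m, b l m := by
    calc ‖genAA J fun _ : Fin k => f‖
        ≤ ∑ i, ∑ p, ∑ l, |J i p| / 2 * (2 * ∑ m, b l m) := by
          refine norm_sum_le_of_le _ fun i _ => norm_sum_le_of_le _ fun p _ =>
            norm_sum_le_of_le _ fun l _ => ?_
          rw [norm_smul, Complex.norm_real, Real.norm_eq_abs, abs_div, abs_two]
          by_cases h' : i = p
          · subst h'; simp [h.diag]
          · exact mul_le_mul_of_nonneg_left (h1 i p l h') (by positivity)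
      _ = (∑ i, ∑ p, |J i p|) * ∑ l, ∑ m, b l m := by
          simp only [← Finset.mul_sum, ← Finset.sum_mul, ← Finset.sum_div]
          ring
      _ ≤ _ := mul_le_mul_of_nonneg_right hJ
          (Finset.sum_nonneg fun l _ => Finset.sum_nonneg fun m _ => hb0 l m)
  have h3 : ∑ l, ∑ m, b l m = 16 * ‖toL2 n (enS f)‖ ^ 2 + 8 * n + (∑ l, ladderSq f l) ^ 2 := by
    simp only [hb, Finset.sum_add_distrib, ← Finset.mul_sum, ← Finset.sum_mul]
    have := sum_ladderSq_ladder f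
    simp only [Finset.sum_add_distrib, hf] at this
    rw [this]; ring
  have h4 := sum_ladderSq_le hf
  have h5 : 0 ≤ ∑ l, ladderSq f l := Finset.sum_nonneg fun l _ => ladderSq_nonneg f l
  have h6 := dim_le_energy hf
  have h7 : (1 : ℝ) ≤ n := by exact_mod_cast hn
  have h8 : (∑ l, ladderSq f l) ^ 2 ≤ (4 * ‖toL2 n (enS f)‖) ^ 2 := pow_le_pow_left₀ h5 h4 2
  nlinarith

/-- The generator estimate: a product vector that is nearly invariant under a periodic rotation of
the copies is nearly annihilated by its generator. -/
theorem RotFlow.norm_sq_genA_le_energy {o : ℝ → Matrix.orthogonalGroup (Fin k) ℝ}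
    {J : Matrix (Fin k) (Fin k) ℝ} {T : ℝ} (h : RotFlow o J T) (hk : k ≤ 3) (hn : 0 < n)
    (hJ : ∑ i, ∑ p, |J i p| ≤ 4) (c : (Fin n → ℂ) →₀ ℂ)
    (hc : ‖Finsupp.linearCombination ℂ (coh (n := n)) c‖ = 1) {ε : ℝ}
    (hε : ∀ t, mixDefect (o t) (Finsupp.linearCombination ℂ (coh (n := n)) c) ≤ ε) :
    ‖genA J fun _ : Fin k => Finsupp.linearCombination ℂ (cohS (n := n)) c‖ ^ 2
      ≤ 256 * ε * ‖toL2 n (enS (Finsupp.linearCombination ℂ cohS c))‖ ^ 2 := by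
  have h0 : 0 ≤ ε := (norm_nonneg _).trans (hε 0)
  have h1 := h.norm_genAA_le hk hn hJ (f := Finsupp.linearCombination ℂ cohS c)
    (by rw [toL2_linearCombination, hc])
  have h2 := h.norm_sq_genA_le c hε
  nlinarith

/-! ### The two rotation groups -/

theorem rotFlow_rot2 : RotFlow rot2 !![0, -1; 1, 0] (2 * Real.pi) where
  pos := by positivity
  period := by
    apply Subtype.ext
    simp [rot2]
  antisymm i j := by fin_cases i <;> fin_cases j <;> simp
  hasDerivAt t i j := by
    fin_cases i <;> fin_cases j <;> simp [rot2, Fin.sum_univ_two]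
    · exact Real.hasDerivAt_cos t
    · exact (Real.hasDerivAt_sin t).neg
    · exact Real.hasDerivAt_sin t
    · exact Real.hasDerivAt_cos t

/-- The generator of the rotations of `ℝ³` about the axis `(1, 1, 1)`. -/
noncomputable def axisJ : Matrix (Fin 3) (Fin 3) ℝ :=
  (√3)⁻¹ • !![0, -1, 1; 1, 0, -1; -1, 1, 0]

theorem rotFlow_rot3 : RotFlow rot3 axisJ (2 * Real.pi) where
  pos := by positivity
  period := by
    apply Subtype.ext
    simp [rot3]
  antisymm i j := by fin_cases i <;> fin_cases j <;> simp [axisJ]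
  hasDerivAt t i j := by
    have h3 : √3 * √3 = (3 : ℝ) := Real.mul_self_sqrt (by norm_num)
    have h4 : (√3)⁻¹ = √3 / 3 := by
      field_simp; nlinarith
    have hc := Real.hasDerivAt_cos t
    have hs := Real.hasDerivAt_sin t
    have e1 : HasDerivAt (fun t => (1 / 3 : ℝ) * (1 + 2 * Real.cos t))
      ((1 / 3) * (2 * -Real.sin t)) t := ((hc.const_mul 2).const_add 1).const_mul _
    have e2 : HasDerivAt (fun t => (1 / 3 : ℝ) * (1 - Real.cos t - √3 * Real.sin t))
      ((1 / 3) * (-(-Real.sin t) - √3 * Real.cos t)) t :=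
      ((hc.const_sub 1).sub (hs.const_mul _)).const_mul _
    have e3 : HasDerivAt (fun t => (1 / 3 : ℝ) * (1 - Real.cos t + √3 * Real.sin t))
      ((1 / 3) * (-(-Real.sin t) + √3 * Real.cos t)) t :=
      ((hc.const_sub 1).add (hs.const_mul _)).const_mul _
    fin_cases i <;> fin_cases j <;>
      simp only [rot3, axisJ, Fin.sum_univ_three, h4]
    all_goals
      first
        | refine HasDerivAt.congr_deriv (f := fun t => (1 / 3 : ℝ) * (1 + 2 * Real.cos t)) e1 ?_
        | refine HasDerivAt.congr_deriv (f := fun t => (1 / 3 : ℝ) * (1 - Real.cos t - √3 * Real.sin t)) e2 ?_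
        | refine HasDerivAt.congr_deriv (f := fun t => (1 / 3 : ℝ) * (1 - Real.cos t + √3 * Real.sin t)) e3 ?_
      simp
      first
        | linear_combination (2 / 9 * Real.sin t) * h3
        | linear_combination (-1 / 9 * Real.sin t) * h3

theorem sum_abs_rot2 : ∑ i, ∑ p, |(!![0, -1; 1, 0] : Matrix (Fin 2) (Fin 2) ℝ) i p| ≤ 4 := by
  simp [Fin.sum_univ_two]; norm_num

theorem sum_abs_axisJ : ∑ i, ∑ p, |axisJ i p| ≤ 4 := by
  have h : (3 / 2 : ℝ) ≤ √3 := Real.le_sqrt_of_sq_le (by norm_num)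
  have h1 : (√3)⁻¹ ≤ 2 / 3 := by
    rw [inv_le_comm₀ (by positivity) (by norm_num)]; norm_num; linarith
  simp [axisJ, Fin.sum_univ_three, abs_of_nonneg]
  linarith

/-! ### A matrix form of the uncertainty relation -/

section Gram

variable {H : Type*} [NormedAddCommGroup H] [InnerProductSpace ℂ H] {n : ℕ}

/-- The matrix of inner products of two families of vectors. -/
noncomputable def gramM (v w : Fin n → H) : Matrix (Fin n) (Fin n) ℂ :=
  Matrix.of fun i j => ⟪v i, w j⟫_ℂ

/-- A real matrix applied to a family of vectors. -/
noncomputable def linC {M : Type*} [AddCommGroup M] [Module ℂ M] (B : Matrix (Fin n) (Fin n) ℝ)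
    (v : Fin n → M) (i : Fin n) : M :=
  ∑ j, (B i j : ℂ) • v j

theorem inner_sum_smul_sum_smul (x y : Fin n → ℝ) (v w : Fin n → H) :
    ⟪∑ a, (x a : ℂ) • v a, ∑ b, (y b : ℂ) • w b⟫_ℂ
      = ∑ a, ∑ b, (x a : ℂ) * (y b : ℂ) * ⟪v a, w b⟫_ℂ := by
  rw [sum_inner]
  refine Finset.sum_congr rfl fun a _ => ?_
  rw [inner_sum]
  refine Finset.sum_congr rfl fun b _ => ?_
  rw [inner_smul_left, inner_smul_right, Complex.conj_ofReal, mul_assoc]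

theorem gramM_linC (B D : Matrix (Fin n) (Fin n) ℝ) (v w : Fin n → H) :
    gramM (linC B v) (linC D w)
      = B.map Complex.ofReal * gramM v w * (D.map Complex.ofReal).transpose := by
  ext i j
  simp only [gramM, linC, Matrix.of_apply, inner_sum_smul_sum_smul, Matrix.mul_apply,
    Matrix.map_apply, Matrix.transpose_apply, Finset.sum_mul]
  rw [Finset.sum_comm]
  exact Finset.sum_congr rfl fun a _ => Finset.sum_congr rfl fun b _ => by ring

/-- Half the squared norm of `∑ₗ (vₗ ⊗ wₗ - wₗ ⊗ vₗ)`. -/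
noncomputable def wedgeQ (v w : Fin n → H) : ℂ :=
  ∑ i, ∑ j, (⟪v i, v j⟫_ℂ * ⟪w i, w j⟫_ℂ - ⟪v i, w j⟫_ℂ * ⟪w i, v j⟫_ℂ)

theorem wedgeQ_eq_trace (v w : Fin n → H) :
    wedgeQ v w = (gramM v v * (gramM w w).transpose).trace
      - (gramM v w * (gramM w v).transpose).trace := by
  simp [wedgeQ, Matrix.trace, Matrix.mul_apply, gramM, Finset.sum_sub_distrib]

/-- Contragredient changes of the two families do not change `wedgeQ`. -/
theorem wedgeQ_linC (B : (Matrix (Fin n) (Fin n) ℝ)ˣ) (v w : Fin n → H) :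
    wedgeQ (linC B.1 v) (linC (B⁻¹).1.transpose w) = wedgeQ v w := by
  set b := B.1.map Complex.ofReal with hb
  set b' := (B⁻¹).1.map Complex.ofReal with hb'
  have h1 : b' * b = 1 := by
    have h0 : (B⁻¹).1 * B.1 = 1 := by rw [← Units.val_mul, inv_mul_cancel]; rfl
    have := congrArg (fun M : Matrix (Fin n) (Fin n) ℝ => M.map Complex.ofRealHom) h0
    rw [Matrix.map_mul] at this
    exact this.trans (Matrix.map_one _ (map_zero _) (map_one _))
  have h2 : (B⁻¹).1.transpose.map Complex.ofReal = b'.transpose := rfl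
  have h1' : b.transpose * b'.transpose = 1 := by rw [← Matrix.transpose_mul, h1]; simp
  simp only [wedgeQ_eq_trace, gramM_linC, h2, Matrix.transpose_mul, Matrix.transpose_transpose,
    ← hb]
  have h3 : ∀ X Y : Matrix (Fin n) (Fin n) ℂ,
      (b * X * b.transpose * (b'.transpose * (Y * b'))).trace = (X * Y).trace := by
    intro X Y
    rw [Matrix.mul_assoc, ← Matrix.mul_assoc b.transpose, h1', Matrix.one_mul, Matrix.mul_assoc,
      Matrix.trace_mul_comm, Matrix.mul_assoc, Matrix.mul_assoc, h1, Matrix.mul_one]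
  have h4 : ∀ X Y : Matrix (Fin n) (Fin n) ℂ,
      (b * X * b' * (b * (Y * b'))).trace = (X * Y).trace := by
    intro X Y
    rw [Matrix.mul_assoc, ← Matrix.mul_assoc b', h1, Matrix.one_mul, Matrix.mul_assoc,
      Matrix.trace_mul_comm, Matrix.mul_assoc, Matrix.mul_assoc, h1, Matrix.mul_one]
  rw [h3, h4]

/-- The uncertainty relation when the vectors `vᵢ` are orthogonal of square norm `½`: some
symmetric matrix `U` makes all `wᵢ + vᵢ + i ∑ⱼ Uᵢⱼ vⱼ` small. -/
theorem sum_norm_sq_le_wedgeQ {v w : Fin n → H}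
    (hv : ∀ i j, ⟪v i, v j⟫_ℂ = if i = j then 1 / 2 else 0)
    (hvw : ∀ i j, (⟪v i, w j⟫_ℂ).re = if i = j then -(1 / 2) else 0) :
    ∃ U : Matrix (Fin n) (Fin n) ℝ, U.IsSymm ∧
      ∑ i, ‖w i + v i + Complex.I • linC U v i‖ ^ 2 ≤ 2 * (wedgeQ v w).re := by
  set y : Fin n → Fin n → ℝ := fun i j => (⟪v i, w j⟫_ℂ).im with hy
  -- this `U` cancels the symmetric part of `Im ⟪vᵢ, wⱼ⟫`
  set U : Matrix (Fin n) (Fin n) ℝ := Matrix.of fun i j => -(y i j + y j i) with hU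
  have hUs : ∀ i j, U i j = -(y i j + y j i) := fun i j => rfl
  refine ⟨U, by ext i j; simp [hU, add_comm], ?_⟩
  have hwv : ∀ i j, ⟪w i, v j⟫_ℂ
      = (((⟪v j, w i⟫_ℂ).re : ℝ) : ℂ) - Complex.I * (y j i : ℝ) := by
    intro i j
    rw [← inner_conj_symm (w i) (v j)]
    apply Complex.ext <;> simp [hy, -inner_conj_symm]
  have h1 : ∀ i, ‖w i + v i + Complex.I • linC U v i‖ ^ 2
      = ‖w i‖ ^ 2 - 1 / 2 + ∑ j, (2 * (U i j * y j i) + 1 / 2 * U i j ^ 2) := by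
    intro i
    have hu : ‖v i + Complex.I • linC U v i‖ ^ 2 = 1 / 2 + 1 / 2 * ∑ j, U i j ^ 2 := by
      have e1 : ⟪v i, linC U v i⟫_ℂ = U i i / 2 := by
        simp [linC, hv]
        ring
      have e2 : ⟪linC U v i, v i⟫_ℂ = U i i / 2 := by
        simp [linC, hv]
        ring
      have e3 : ⟪linC U v i, linC U v i⟫_ℂ = 1 / 2 * ∑ j, (U i j : ℂ) ^ 2 := by
        rw [linC, inner_sum_smul_sum_smul, Finset.mul_sum]
        refine Finset.sum_congr rfl fun a _ => ?_
        simp [hv]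
        ring
      apply Complex.ofReal_injective
      rw [ofReal_norm_sq]
      simp only [inner_add_left, inner_add_right, inner_smul_left, inner_smul_right, e1, e2, e3,
        hv i i, if_true, Complex.conj_I]
      push_cast
      linear_combination (-(1 / 2) * ∑ x, (U i x : ℂ) ^ 2) * Complex.I_mul_I
    rw [add_assoc, norm_add_sq (𝕜 := ℂ), hu]
    have h2 : RCLike.re ⟪w i, v i + Complex.I • linC U v i⟫_ℂ = -(1 / 2) + ∑ j, U i j * y j i := by
      have h0 : ⟪w i, v i + Complex.I • linC U v i⟫_ℂ = ⟪w i, v i⟫_ℂ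
          + ∑ j, Complex.I * ((U i j : ℂ) * ⟪w i, v j⟫_ℂ) := by
        simp only [linC, inner_add_right, inner_smul_right, inner_sum, Finset.mul_sum]
      rw [h0, RCLike.re_to_complex, Complex.add_re, Complex.re_sum, hwv, hvw]
      congr 1
      · simp
      · refine Finset.sum_congr rfl fun j _ => ?_
        rw [hwv]
        simp
    rw [h2, Finset.sum_add_distrib, ← Finset.mul_sum, ← Finset.mul_sum]
    ring
  have h2 : (wedgeQ v w).re = ∑ i, (1 / 2 * ‖w i‖ ^ 2 - 1 / 4 - ∑ j, y i j * y j i) := by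
    rw [wedgeQ, Complex.re_sum]
    refine Finset.sum_congr rfl fun i _ => ?_
    have h3 : ∀ j, (⟪v i, v j⟫_ℂ * ⟪w i, w j⟫_ℂ - ⟪v i, w j⟫_ℂ * ⟪w i, v j⟫_ℂ).re
        = (if i = j then 1 / 2 * ‖w i‖ ^ 2 - 1 / 4 else 0) - y i j * y j i := by
      intro j
      have h4 : ⟪v i, w j⟫_ℂ = (((⟪v i, w j⟫_ℂ).re : ℝ) : ℂ) + (y i j : ℝ) * Complex.I :=
        (Complex.re_add_im _).symm
      rw [hv, hwv, h4, hvw, hvw]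
      by_cases hij : i = j
      · subst hij
        rw [inner_self_eq_norm_sq_to_K]
        simp [← Complex.ofReal_pow]
        ring
      · have hij' : j ≠ i := fun e => hij e.symm
        simp [hij, hij']
    rw [Complex.re_sum, Finset.sum_congr rfl fun j _ => h3 j, Finset.sum_sub_distrib]
    simp
  rw [h2, Finset.sum_congr rfl fun i _ => h1 i, Finset.mul_sum]
  simp only [Finset.sum_add_distrib, Finset.sum_sub_distrib, mul_sub, Finset.mul_sum]
  have h3 : ∑ i, ∑ j, y i j ^ 2 = ∑ i, ∑ j, y j i ^ 2 := Finset.sum_comm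
  have h4 : ∑ i, ∑ j, 2 * (U i j * y j i) + ∑ i, ∑ j, 1 / 2 * U i j ^ 2
      + ∑ i, ∑ j, 2 * (y i j * y j i) ≤ 0 := by
    have h5 : ∑ i, ∑ j, 2 * (U i j * y j i) + ∑ i, ∑ j, 1 / 2 * U i j ^ 2
        + ∑ i, ∑ j, 2 * (y i j * y j i)
        = ∑ i, ∑ j, (-(1 / 2) * (y i j - y j i) ^ 2)
          + (∑ i, ∑ j, y i j ^ 2 - ∑ i, ∑ j, y j i ^ 2) := by
      simp only [← Finset.sum_add_distrib, ← Finset.sum_sub_distrib]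
      refine Finset.sum_congr rfl fun i _ => Finset.sum_congr rfl fun j _ => ?_
      rw [hUs]; ring
    rw [h5, h3, sub_self, add_zero]
    exact Finset.sum_nonpos fun i _ => Finset.sum_nonpos fun j _ => by
      nlinarith [sq_nonneg (y i j - y j i)]
  have h6 : ∀ c : ℝ, ∑ i : Fin n, c = n * c := fun c => by simp
  have h7 : ∑ i, 2 * (1 / 2 * ‖w i‖ ^ 2) = ∑ i, ‖w i‖ ^ 2 :=
    Finset.sum_congr rfl fun i _ => by ring
  rw [h7, h6, h6]
  linarith

/-- The uncertainty relation for vectors `vᵢ = (xᵢ - ⟨xᵢ⟩) φ` and `wᵢ = (∂ᵢ - ⟨∂ᵢ⟩) φ`: up to a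
linear symplectic change of the operators, all vectors `wᵢ + vᵢ` are small if `wedgeQ v w` is. -/
theorem exists_small_lowering {v w : Fin n → H} (hv : ∀ i j, (⟪v i, v j⟫_ℂ).im = 0)
    (hvw : ∀ i j, (⟪v i, w j⟫_ℂ).re = if i = j then -(1 / 2) else 0) :
    ∃ (B : (Matrix (Fin n) (Fin n) ℝ)ˣ) (U : Matrix (Fin n) (Fin n) ℝ), U.IsSymm ∧
      ∑ i, ‖linC (B⁻¹).1.transpose w i + linC B.1 v i + Complex.I • linC U (linC B.1 v) i‖ ^ 2
        ≤ 2 * (wedgeQ v w).re := by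
  set V : Matrix (Fin n) (Fin n) ℝ := Matrix.of fun i j => 2 * (⟪v i, v j⟫_ℂ).re with hV
  have hVv : ∀ i j, ⟪v i, v j⟫_ℂ = ((V i j / 2 : ℝ) : ℂ) := by
    intro i j
    apply Complex.ext
    · simp [hV]
    · rw [hv]; simp
  -- the commutation relation `hvw` forces the real linear combinations of the `vᵢ` to be nonzero
  have hVpos : V.PosDef := by
    refine Matrix.PosDef.of_dotProduct_mulVec_pos ?_ fun x hx => ?_
    · ext i j
      have := congrArg Complex.re (inner_conj_symm (𝕜 := ℂ) (v i) (v j))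
      rw [Complex.conj_re] at this
      simp [hV, this]
    · set s := ∑ i, (x i : ℂ) • v i with hs
      set t := ∑ i, (x i : ℂ) • w i with ht
      have h1 : ⟪s, s⟫_ℂ = ((1 / 2 * (x ⬝ᵥ V.mulVec x) : ℝ) : ℂ) := by
        simp only [hs, inner_sum_smul_sum_smul, hVv, dotProduct, Matrix.mulVec, Finset.mul_sum]
        push_cast
        exact Finset.sum_congr rfl fun i _ => Finset.sum_congr rfl fun j _ => by ring
      have h2 : (⟪s, t⟫_ℂ).re = -(1 / 2) * (x ⬝ᵥ x) := by
        simp only [hs, ht, inner_sum_smul_sum_smul, Complex.re_sum, mul_assoc,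
          Complex.re_ofReal_mul, hvw, dotProduct, Finset.mul_sum, mul_ite, mul_zero,
          Finset.sum_ite_eq, Finset.mem_univ, if_true]
        exact Finset.sum_congr rfl fun i _ => by ring
      have h3 : s ≠ 0 := by
        intro h0
        rw [h0, inner_zero_left] at h2
        have h4 := Matrix.dotProduct_star_self_pos_iff.2 hx
        rw [star_trivial] at h4
        simp only [Complex.zero_re] at h2
        linarith
      have h4 : 0 < ‖s‖ ^ 2 := by positivity
      have h5 : ‖s‖ ^ 2 = 1 / 2 * (x ⬝ᵥ V.mulVec x) := by
        rw [← ofReal_norm_sq] at h1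
        exact Complex.ofReal_injective h1
      rw [star_trivial]
      linarith
  have hVd : IsUnit V.det := hVpos.det_pos.ne'.isUnit
  obtain ⟨B, hB⟩ := exists_transpose_mul_self hVpos.inv
  have hBB : B.1 * (B⁻¹).1 = 1 := by rw [← Units.val_mul, mul_inv_cancel]; rfl
  have hBV : B.1 * V * B.1.transpose = 1 := by
    have h1 : B.1.transpose * (B.1 * V) = 1 := by
      rw [← Matrix.mul_assoc, hB, Matrix.nonsing_inv_mul _ hVd]
    exact mul_eq_one_comm.1 h1
  have hv' : ∀ i j, ⟪linC B.1 v i, linC B.1 v j⟫_ℂ = if i = j then 1 / 2 else 0 := by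
    intro i j
    have h1 : ⟪linC B.1 v i, linC B.1 v j⟫_ℂ
        = (((B.1 * V * B.1.transpose) i j / 2 : ℝ) : ℂ) := by
      simp only [linC, inner_sum_smul_sum_smul, hVv, Matrix.mul_apply, Matrix.transpose_apply,
        Finset.sum_mul, Finset.sum_div]
      rw [Finset.sum_comm]
      push_cast
      exact Finset.sum_congr rfl fun a _ => Finset.sum_congr rfl fun b _ => by ring
    rw [h1, hBV, Matrix.one_apply]
    split_ifs <;> simp
  have hvw' : ∀ i j, (⟪linC B.1 v i, linC (B⁻¹).1.transpose w j⟫_ℂ).re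
      = if i = j then -(1 / 2) else 0 := by
    intro i j
    have h1 : (⟪linC B.1 v i, linC (B⁻¹).1.transpose w j⟫_ℂ).re
        = -(1 / 2) * (B.1 * (B⁻¹).1) i j := by
      simp only [linC, inner_sum_smul_sum_smul, Complex.re_sum, mul_assoc, Complex.re_ofReal_mul,
        hvw, Matrix.mul_apply, Matrix.transpose_apply, mul_ite, mul_zero, Finset.sum_ite_eq,
        Finset.mem_univ, if_true, Finset.mul_sum]
      exact Finset.sum_congr rfl fun a _ => by ring
    rw [h1, hBB, Matrix.one_apply]
    split_ifs <;> simp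
  obtain ⟨U, hU, h⟩ := sum_norm_sq_le_wedgeQ hv' hvw'
  rw [wedgeQ_linC] at h
  exact ⟨B, U, hU, h⟩

end Gram

/-! ### Gaussian unitaries and the ladder operators -/

theorem posS_gauS (C : (Matrix (Fin n) (Fin n) ℝ)ˣ) (V : Matrix (Fin n) (Fin n) ℝ) (i : Fin n)
    (f : 𝓢(Cfg n, ℂ)) :
    posS i (gauS C V f) = linC (C⁻¹).1 (fun j => gauS C V (posS j f)) i := by
  ext x
  simp only [linC, sum_apply, smul_apply, smul_eq_mul, posS_apply, gauS_apply]
  have h : ((x i : ℝ) : ℂ) = ∑ j, ((C⁻¹).1 i j : ℂ) * (linE C x j : ℂ) := by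
    have h1 : x = linE C⁻¹ (linE C x) := by rw [linE_linE, inv_mul_cancel, linE_one]
    have h2 : x i = ∑ j, (C⁻¹).1 i j * linE C x j := by
      conv_lhs => rw [h1]
      rfl
    rw [h2]; push_cast; rfl
  rw [h, Finset.sum_mul]
  exact Finset.sum_congr rfl fun j _ => by ring

theorem hasFDerivAt_quadF (V : Matrix (Fin n) (Fin n) ℝ) (x : Cfg n) : ∃ L : Cfg n →L[ℝ] ℝ,
    HasFDerivAt (quadF V) L x ∧
      ∀ y, L y = y.ofLp ⬝ᵥ V.mulVec x.ofLp + x.ofLp ⬝ᵥ V.mulVec y.ofLp := by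
  have h1 := (hasFDerivAt_id (𝕜 := ℝ) x).inner ℝ
    (Matrix.toEuclideanCLM (n := Fin n) (𝕜 := ℝ) V).hasFDerivAt
  refine ⟨_, h1.congr_of_eventuallyEq (Filter.Eventually.of_forall fun y => ?_), fun y => ?_⟩
  · simp only [inner_eq_dotProduct]; rfl
  · simp [inner_eq_dotProduct, add_comm]

theorem derS_gauS (C : (Matrix (Fin n) (Fin n) ℝ)ˣ) {V : Matrix (Fin n) (Fin n) ℝ}
    (hV : V.IsSymm) (i : Fin n) (f : 𝓢(Cfg n, ℂ)) :
    derS i (gauS C V f) = linC C.1.transpose (fun j => gauS C V (derS j f)) i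
      - Complex.I • linC V (fun j => posS j (gauS C V f)) i := by
  ext x
  obtain ⟨L, hL, hL'⟩ := hasFDerivAt_quadF V x
  have h0 : (gauS C V f : Cfg n → ℂ) = fun x => ((√|C.1.det| : ℝ) : ℂ)
      * (Complex.exp (Complex.I * ((-(1 / 2) * quadF V x : ℝ) : ℂ)) * f (linE C x)) :=
    funext fun x => gauS_apply C V f x
  have h1 : HasFDerivAt (fun x => Complex.exp (Complex.I * ((-(1 / 2) * quadF V x : ℝ) : ℂ)))
      _ x := ((Complex.ofRealCLM.hasFDerivAt.comp x (hL.const_mul (-(1 / 2)))).const_mul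
        Complex.I).cexp
  have h2 : HasFDerivAt (fun x => f (linE C x)) _ x :=
    (f.hasFDerivAt (linE C x)).comp x (linE C).hasFDerivAt
  have h3 := (h1.mul h2).const_mul ((√|C.1.det| : ℝ) : ℂ)
  have h4 := (h3.congr_of_eventuallyEq (Filter.Eventually.of_forall fun y => congrFun h0 y)).fderiv
  have h5 : linE C (EuclideanSpace.single i 1) = ∑ j, C.1 j i • EuclideanSpace.single j (1 : ℝ) := by
    ext l
    rw [ofLp_linE]
    simp [Matrix.mulVec, dotProduct, Pi.single_apply]
  have h6 : L (EuclideanSpace.single i 1) = 2 * ∑ j, V i j * x j := by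
    have h7 : V.mulVec x.ofLp i = ∑ j, V i j * x j := rfl
    have h8 : x.ofLp ⬝ᵥ V.mulVec (EuclideanSpace.single i (1 : ℝ)).ofLp
        = (EuclideanSpace.single i (1 : ℝ)).ofLp ⬝ᵥ V.mulVec x.ofLp := by
      rw [dotProduct_comm, mulVec_dotProduct_eq, hV.eq]
    rw [hL', h8, ← two_mul, ← h7]
    simp
  rw [derS_apply, h4]
  simp only [smul_apply, add_apply, ContinuousLinearMap.comp_apply, ContinuousLinearEquiv.coe_coe,
    h5, map_sum, map_smul, h6, linC, sub_apply, sum_apply, smul_eq_mul, gauS_apply, posS_apply,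
    derS_apply, quadPhase, Function.comp_apply, Complex.ofRealCLM_apply, Matrix.transpose_apply]
  have e1 : ∀ (c E : ℂ) (D : Fin n → ℂ), ∑ j, ((C.1 j i : ℝ) : ℂ) * (c * (E * D j))
      = c * (E * ∑ j, C.1 j i • D j) := fun c E D => by
    simp only [Finset.mul_sum, Complex.real_smul]
    exact Finset.sum_congr rfl fun j _ => by ring
  rw [e1, ← Finset.sum_congr rfl fun j _ => mul_assoc _ _ _, ← Finset.sum_mul]
  push_cast
  ring

theorem map_linC {M N F : Type*} [AddCommGroup M] [Module ℂ M] [AddCommGroup N] [Module ℂ N]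
    [FunLike F M N] [LinearMapClass F ℂ M N] (T : F) (B : Matrix (Fin n) (Fin n) ℝ) (v : Fin n → M)
    (i : Fin n) : T (linC B v i) = linC B (fun j => T (v j)) i := by
  rw [linC, linC, map_sum]
  exact Finset.sum_congr rfl fun j _ => map_smul T _ _

/-- The shifted position operator `x_i - a_i`, for `r = (a, b)`. -/
noncomputable def opX (r : Fin n ⊕ Fin n → ℝ) (i : Fin n) (f : 𝓢(Cfg n, ℂ)) : 𝓢(Cfg n, ℂ) :=
  posS i f - (r (Sum.inl i) : ℂ) • f

/-- The shifted derivative `∂_i - i b_i`, for `r = (a, b)`. -/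
noncomputable def opD (r : Fin n ⊕ Fin n → ℝ) (i : Fin n) (f : 𝓢(Cfg n, ℂ)) : 𝓢(Cfg n, ℂ) :=
  derS i f - (Complex.I * r (Sum.inr i)) • f

theorem inner_opX_left (r : Fin n ⊕ Fin n → ℝ) (i : Fin n) (f g : 𝓢(Cfg n, ℂ)) :
    ⟪toL2 n (opX r i f), toL2 n g⟫_ℂ = ⟪toL2 n f, toL2 n (opX r i g)⟫_ℂ := by
  simp only [opX, map_sub, map_smul, inner_sub_left, inner_sub_right, inner_smul_left,
    inner_smul_right, inner_posS_left, Complex.conj_ofReal]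

theorem inner_opD_left (r : Fin n ⊕ Fin n → ℝ) (i : Fin n) (f g : 𝓢(Cfg n, ℂ)) :
    ⟪toL2 n (opD r i f), toL2 n g⟫_ℂ = -⟪toL2 n f, toL2 n (opD r i g)⟫_ℂ := by
  simp only [opD, map_sub, map_smul, inner_sub_left, inner_sub_right, inner_smul_left,
    inner_smul_right, inner_derS_left, map_mul, Complex.conj_I, Complex.conj_ofReal]
  ring

theorem opX_comm (r : Fin n ⊕ Fin n → ℝ) (i j : Fin n) (f : 𝓢(Cfg n, ℂ)) :
    opX r i (opX r j f) = opX r j (opX r i f) := by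
  simp only [opX, map_sub, map_smul, posS_comm i j, smul_sub, smul_smul]
  rw [mul_comm (r (Sum.inl j) : ℂ)]
  abel

theorem opD_opX (r : Fin n ⊕ Fin n → ℝ) (i j : Fin n) (f : 𝓢(Cfg n, ℂ)) :
    opD r i (opX r j f) = opX r j (opD r i f) + if i = j then f else 0 := by
  simp only [opX, opD, map_sub, map_smul, derS_posS, smul_sub, smul_smul]
  rw [mul_comm (r (Sum.inl j) : ℂ)]
  abel

theorem opX_displaceS (r : Fin n ⊕ Fin n → ℝ) (i : Fin n) (f : 𝓢(Cfg n, ℂ)) :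
    posS i (displaceS r f) = displaceS r (opX r i f) := by
  ext x
  simp only [opX, posS_apply, displaceS_apply, sub_apply, smul_apply, smul_eq_mul]
  have : ((x + posPart r) i : ℂ) = x i + r (Sum.inl i) := by simp [posPart]
  rw [this]; ring

theorem opD_displaceS (r : Fin n ⊕ Fin n → ℝ) (i : Fin n) (f : 𝓢(Cfg n, ℂ)) :
    derS i (displaceS r f) = displaceS r (opD r i f) := by
  ext x
  have h0 : ∀ x, displaceS r f x = dispPhase r x * f (x + posPart r) := displaceS_apply r f
  have h1 : HasFDerivAt (fun x : Cfg n => ((⟪momPart r, x⟫_ℝ + ⟪posPart r, momPart r⟫_ℝ / 2 : ℝ)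
      : ℂ)) (Complex.ofRealCLM.comp (innerSL ℝ (momPart r))) x :=
    Complex.ofRealCLM.hasFDerivAt.comp x ((innerSL ℝ (momPart r)).hasFDerivAt.add_const _)
  have h2 : HasFDerivAt (fun x => f (x + posPart r)) (fderiv ℝ f (x + posPart r)) x :=
    (hasFDerivAt_comp_add_right (posPart r)).2 (f.hasFDerivAt (x + posPart r))
  have h3 := ((h1.const_mul (-Complex.I)).cexp).mul h2
  have h4 := (h3.congr_of_eventuallyEq (Filter.Eventually.of_forall h0)).fderiv
  rw [derS_apply, h4, displaceS_apply, opD, sub_apply, smul_apply, derS_apply]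
  simp only [smul_apply, add_apply, ContinuousLinearMap.comp_apply, smul_eq_mul, dispPhase,
    Complex.ofRealCLM_apply, innerSL_apply_apply, EuclideanSpace.inner_single_right]
  simp [momPart]
  ring

/-- A stability version of the theorem that only Gaussian wavefunctions saturate the uncertainty
relation. The Gaussian unitary turns the small vectors of `exists_small_lowering` into the lowering
operators applied to the transformed state, and the spectral gap of the number operator bounds its
distance from the vacuum. -/
theorem exists_gaussian_overlap {φ : 𝓢(Cfg n, ℂ)} (hφ : ‖toL2 n φ‖ = 1)
    (r : Fin n ⊕ Fin n → ℝ) :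
    ∃ (C : (Matrix (Fin n) (Fin n) ℝ)ˣ) (V : Matrix (Fin n) (Fin n) ℝ), V.IsSymm ∧
      1 - ‖⟪coh 0, gauE C V (displaceE r (toL2 n φ))⟫_ℂ‖ ^ 2
        ≤ (wedgeQ (fun i => toL2 n (opX r i φ)) fun i => toL2 n (opD r i φ)).re := by
  set v : Fin n → Modes n := fun i => toL2 n (opX r i φ) with hv
  set w : Fin n → Modes n := fun i => toL2 n (opD r i φ) with hw
  have hvv : ∀ i j, (⟪v i, v j⟫_ℂ).im = 0 := by
    intro i j
    rw [← Complex.conj_eq_iff_im, inner_conj_symm]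
    simp only [hv]
    rw [inner_opX_left, opX_comm, ← inner_opX_left]
  have hvw : ∀ i j, (⟪v i, w j⟫_ℂ).re = if i = j then -(1 / 2) else 0 := by
    intro i j
    have h1 : ⟪v i, w j⟫_ℂ + ⟪w j, v i⟫_ℂ = if i = j then -1 else 0 := by
      simp only [hv, hw]
      rw [inner_opX_left, inner_opD_left, opD_opX, map_add, inner_add_right]
      by_cases h : i = j
      · subst h
        rw [if_pos rfl, if_pos rfl, inner_self_eq_norm_sq_to_K, hφ]
        simp
      · rw [if_neg h, if_neg (Ne.symm h)]; simp
    have h2 := congrArg Complex.re h1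
    rw [← inner_conj_symm (w j) (v i), Complex.add_re, Complex.conj_re] at h2
    split_ifs at h2 ⊢ <;> simp at h2 <;> linarith
  obtain ⟨B, U, hU, hBU⟩ := exists_small_lowering hvv hvw
  refine ⟨B⁻¹, -U, hU.neg, ?_⟩
  have hT : ∀ g : 𝓢(Cfg n, ℂ), toL2 n (gauS B⁻¹ (-U) (displaceS r g))
      = gauE B⁻¹ (-U) (displaceE r (toL2 n g)) := fun g => by
    rw [displaceE_apply, ← toL2_displaceS, gauE_toL2]
  set f := gauS B⁻¹ (-U) (displaceS r φ) with hf
  have hX : ∀ i, toL2 n (posS i f)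
      = gauE B⁻¹ (-U) (displaceE r (linC B.1 v i)) := by
    intro i
    rw [hf, posS_gauS, inv_inv, map_linC, map_linC, map_linC]
    simp only [opX_displaceS, hT, hv]
  have hlow : ∀ i, toL2 n (posS i f + derS i f) = gauE B⁻¹ (-U) (displaceE r
      (linC (B⁻¹).1.transpose w i + linC B.1 v i + Complex.I • linC U (linC B.1 v) i)) := by
    intro i
    have h1 : toL2 n (derS i f) = gauE B⁻¹ (-U) (displaceE r
        (linC (B⁻¹).1.transpose w i + Complex.I • linC U (linC B.1 v) i)) := by
      rw [hf, derS_gauS _ hU.neg, ← hf, map_sub, map_smul, map_linC, map_linC]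
      simp only [opD_displaceS, hT, hX, map_add, map_smul]
      rw [map_linC (displaceE r), map_linC (displaceE r), map_linC (gauE B⁻¹ (-U)),
        map_linC (gauE B⁻¹ (-U)), sub_eq_add_neg, ← smul_neg]
      congr 2
      simp [linC]
    rw [map_add, hX, h1]
    simp only [map_add]
    abel
  have h1 := norm_sq_sub_le_sum_lower f
  simp only [hlow, LinearIsometryEquiv.norm_map] at h1
  rw [hf, hT, LinearIsometryEquiv.norm_map, LinearIsometryEquiv.norm_map, hφ] at h1
  linarith

/-! ### The generators as second-moment quantities -/

theorem opX_zero (i : Fin n) (f : 𝓢(Cfg n, ℂ)) : opX 0 i f = posS i f := by simp [opX]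

theorem opD_zero (i : Fin n) (f : 𝓢(Cfg n, ℂ)) : opD 0 i f = derS i f := by simp [opD]

/-- The generator of the rotations of two copies, in terms of the uncentred second moments. -/
theorem norm_sq_genA_rot2 (f : 𝓢(Cfg n, ℂ)) :
    ((‖genA (!![0, -1; 1, 0] : Matrix (Fin 2) (Fin 2) ℝ) fun _ => f‖ ^ 2 : ℝ) : ℂ)
      = 2 * wedgeQ (fun i => toL2 n (opX 0 i f)) fun i => toL2 n (opD 0 i f) := by
  have h1 : genA (!![0, -1; 1, 0] : Matrix (Fin 2) (Fin 2) ℝ) (fun _ => f)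
      = ∑ l, (1 / 2 : ℂ) • (ptS (hop (1 : Fin 2) 0 l fun _ => f) - ptS (hop 0 1 l fun _ => f)) := by
    simp only [genA, Fin.sum_univ_two, ← Finset.sum_add_distrib]
    refine Finset.sum_congr rfl fun l _ => ?_
    simp [neg_div]
    rw [smul_sub]; abel
  rw [h1, ofReal_norm_sq, sum_inner, wedgeQ, Finset.mul_sum]
  refine Finset.sum_congr rfl fun l _ => ?_
  rw [inner_sum, Finset.mul_sum]
  refine Finset.sum_congr rfl fun m _ => ?_
  simp only [inner_smul_left, inner_smul_right, inner_sub_left, inner_sub_right, ptS,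
    inner_ptensor, Fin.prod_univ_two, hop, opX_zero, opD_zero]
  simp only [Fin.isValue, one_ne_zero, zero_ne_one, if_true, if_false, lowS_apply, raiseS_apply,
    map_add, map_sub, inner_add_left, inner_add_right, inner_sub_left, inner_sub_right, map_div₀,
    map_one, map_ofNat]
  ring

/-- The generator of the rotations about `(1, 1, 1)` commutes with equal displacements of the three
copies, so only the centred second moments enter. -/
theorem norm_sq_genA_axisJ {f : 𝓢(Cfg n, ℂ)} (hf : ‖toL2 n f‖ = 1) :
    ∃ r : Fin n ⊕ Fin n → ℝ, ((‖genA axisJ fun _ => f‖ ^ 2 : ℝ) : ℂ)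
      = 2 * wedgeQ (fun i => toL2 n (opX r i f)) fun i => toL2 n (opD r i f) := by
  have hff : ⟪toL2 n f, toL2 n f⟫_ℂ = 1 := by rw [inner_self_eq_norm_sq_to_K, hf]; simp
  -- centering the operators makes the vectors below orthogonal to `f`
  set r : Fin n ⊕ Fin n → ℝ := Sum.elim (fun i => (⟪toL2 n f, toL2 n (posS i f)⟫_ℂ).re)
    fun i => (⟪toL2 n f, toL2 n (derS i f)⟫_ℂ).im with hr
  have hX : ∀ i, ⟪toL2 n f, toL2 n (opX r i f)⟫_ℂ = 0 := by
    intro i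
    have h1 : (⟪toL2 n f, toL2 n (posS i f)⟫_ℂ).im = 0 := by
      rw [← Complex.conj_eq_iff_im, inner_conj_symm, inner_posS_left]
    rw [opX, map_sub, inner_sub_right, map_smul, inner_smul_right, hff]
    apply Complex.ext <;> simp [hr, h1]
  have hD : ∀ i, ⟪toL2 n f, toL2 n (opD r i f)⟫_ℂ = 0 := by
    intro i
    have h1 : (⟪toL2 n f, toL2 n (derS i f)⟫_ℂ).re = 0 := by
      have h2 := congrArg Complex.re (inner_conj_symm (toL2 n f) (toL2 n (derS i f)))
      rw [inner_derS_left, Complex.conj_re, Complex.neg_re] at h2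
      linarith
    rw [opD, map_sub, inner_sub_right, map_smul, inner_smul_right, hff]
    apply Complex.ext <;> simp [hr, h1]
  have hX' : ∀ i, ⟪toL2 n (opX r i f), toL2 n f⟫_ℂ = 0 := fun i => by
    rw [← inner_conj_symm, hX, map_zero]
  have hD' : ∀ i, ⟪toL2 n (opD r i f), toL2 n f⟫_ℂ = 0 := fun i => by
    rw [← inner_conj_symm, hD, map_zero]
  refine ⟨r, ?_⟩
  set ζ : Fin n → ℂ := fun i => r (Sum.inl i) + Complex.I * r (Sum.inr i) with hζ
  have hlow : ∀ i, lowS i f = opX r i f + opD r i f + ζ i • f := fun i => by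
    rw [lowS_apply, opX, opD, hζ, add_smul]; abel
  have hraise : ∀ i, raiseS i f = opX r i f - opD r i f + (starRingEnd ℂ) (ζ i) • f := fun i => by
    have : (starRingEnd ℂ) (ζ i) = r (Sum.inl i) - Complex.I * r (Sum.inr i) := by
      simp [hζ, sub_eq_add_neg]
    rw [raiseS_apply, opX, opD, this, sub_smul]; abel
  have h1 : genA axisJ (fun _ => f) = ∑ l, (((√3)⁻¹ / 2 : ℝ) : ℂ) •
      ((ptS (hop (1 : Fin 3) 0 l fun _ => f) - ptS (hop 0 1 l fun _ => f))
      + (ptS (hop (2 : Fin 3) 1 l fun _ => f) - ptS (hop 1 2 l fun _ => f))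
      + (ptS (hop (0 : Fin 3) 2 l fun _ => f) - ptS (hop 2 0 l fun _ => f))) := by
    simp only [genA, Fin.sum_univ_three, ← Finset.sum_add_distrib]
    refine Finset.sum_congr rfl fun l _ => ?_
    simp [axisJ, neg_div]
    simp only [smul_sub]
    abel
  have h3 : ((√3 : ℝ) : ℂ)⁻¹ * ((√3 : ℝ) : ℂ)⁻¹ = 1 / 3 := by
    rw [← mul_inv, ← Complex.ofReal_mul, Real.mul_self_sqrt (by norm_num)]; norm_num
  rw [h1, ofReal_norm_sq, sum_inner, wedgeQ, Finset.mul_sum]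
  refine Finset.sum_congr rfl fun l _ => ?_
  rw [inner_sum, Finset.mul_sum]
  refine Finset.sum_congr rfl fun m _ => ?_
  simp only [inner_smul_left, inner_smul_right, Complex.conj_ofReal]
  have hLL : ⟪toL2 n (lowS l f), toL2 n (lowS m f)⟫_ℂ
      = ⟪toL2 n (opX r l f), toL2 n (opX r m f)⟫_ℂ + ⟪toL2 n (opX r l f), toL2 n (opD r m f)⟫_ℂ
      + ⟪toL2 n (opD r l f), toL2 n (opX r m f)⟫_ℂ + ⟪toL2 n (opD r l f), toL2 n (opD r m f)⟫_ℂ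
      + (starRingEnd ℂ) (ζ l) * ζ m := by
    simp only [hlow, map_add, map_smul, inner_add_left, inner_add_right, inner_smul_left,
      inner_smul_right, hX, hD, hX', hD', hff]
    ring
  have hLR : ⟪toL2 n (lowS l f), toL2 n (raiseS m f)⟫_ℂ
      = ⟪toL2 n (opX r l f), toL2 n (opX r m f)⟫_ℂ - ⟪toL2 n (opX r l f), toL2 n (opD r m f)⟫_ℂ
      + ⟪toL2 n (opD r l f), toL2 n (opX r m f)⟫_ℂ - ⟪toL2 n (opD r l f), toL2 n (opD r m f)⟫_ℂ
      + (starRingEnd ℂ) (ζ l) * (starRingEnd ℂ) (ζ m) := by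
    simp only [hlow, hraise, map_add, map_sub, map_smul, inner_add_left, inner_add_right,
      inner_sub_right, inner_smul_left, inner_smul_right, hX, hD, hX', hD', hff]
    ring
  have hRL : ⟪toL2 n (raiseS l f), toL2 n (lowS m f)⟫_ℂ
      = ⟪toL2 n (opX r l f), toL2 n (opX r m f)⟫_ℂ + ⟪toL2 n (opX r l f), toL2 n (opD r m f)⟫_ℂ
      - ⟪toL2 n (opD r l f), toL2 n (opX r m f)⟫_ℂ - ⟪toL2 n (opD r l f), toL2 n (opD r m f)⟫_ℂ
      + ζ l * ζ m := by
    simp only [hlow, hraise, map_add, map_sub, map_smul, inner_add_left, inner_add_right,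
      inner_sub_left, inner_smul_left, inner_smul_right, hX, hD, hX', hD', hff, Complex.conj_conj]
    ring
  have hRR : ⟪toL2 n (raiseS l f), toL2 n (raiseS m f)⟫_ℂ
      = ⟪toL2 n (opX r l f), toL2 n (opX r m f)⟫_ℂ - ⟪toL2 n (opX r l f), toL2 n (opD r m f)⟫_ℂ
      - ⟪toL2 n (opD r l f), toL2 n (opX r m f)⟫_ℂ + ⟪toL2 n (opD r l f), toL2 n (opD r m f)⟫_ℂ
      + ζ l * (starRingEnd ℂ) (ζ m) := by
    simp only [hraise, map_add, map_sub, map_smul, inner_add_left, inner_add_right,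
      inner_sub_left, inner_sub_right, inner_smul_left, inner_smul_right, hX, hD, hX', hD', hff,
      Complex.conj_conj]
    ring
  have hL : ⟪toL2 n (lowS l f), toL2 n f⟫_ℂ = (starRingEnd ℂ) (ζ l) := by
    simp only [hlow, map_add, map_smul, inner_add_left, inner_smul_left, hX', hD', hff]; ring
  have hR : ⟪toL2 n (raiseS l f), toL2 n f⟫_ℂ = ζ l := by
    simp only [hraise, map_add, map_sub, map_smul, inner_add_left, inner_sub_left,
      inner_smul_left, hX', hD', hff, Complex.conj_conj]; ring
  have hL' : ⟪toL2 n f, toL2 n (lowS m f)⟫_ℂ = ζ m := by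
    simp only [hlow, map_add, map_smul, inner_add_right, inner_smul_right, hX, hD, hff]; ring
  have hR' : ⟪toL2 n f, toL2 n (raiseS m f)⟫_ℂ = (starRingEnd ℂ) (ζ m) := by
    simp only [hraise, map_add, map_sub, map_smul, inner_add_right, inner_sub_right,
      inner_smul_right, hX, hD, hff]; ring
  have e01 : (0 : Fin 3) ≠ 1 := by decide
  have e02 : (0 : Fin 3) ≠ 2 := by decide
  have e12 : (1 : Fin 3) ≠ 2 := by decide
  simp only [inner_add_left, inner_add_right, inner_sub_left, inner_sub_right, ptS, inner_ptensor,
    Fin.prod_univ_three, hop, if_true, if_neg e01, if_neg e02, if_neg e12, if_neg e01.symm,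
    if_neg e02.symm, if_neg e12.symm]
  simp only [hLL, hLR, hRL, hRR, hL, hR, hL', hR', hff]
  push_cast
  generalize ((√3 : ℝ) : ℂ)⁻¹ = c at h3
  generalize ⟪toL2 n (opX r l f), toL2 n (opX r m f)⟫_ℂ = a
  generalize ⟪toL2 n (opX r l f), toL2 n (opD r m f)⟫_ℂ = b
  generalize ⟪toL2 n (opD r l f), toL2 n (opX r m f)⟫_ℂ = c'
  generalize ⟪toL2 n (opD r l f), toL2 n (opD r m f)⟫_ℂ = d
  generalize (starRingEnd ℂ) (ζ l) = z1
  generalize (starRingEnd ℂ) (ζ m) = z2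
  linear_combination (6 * (a * d - b * c')) * h3

/-- A state whose two copies are nearly annihilated by the generator is close to a zero-mean Gaussian
vector. -/
theorem exists_gauss_near_rot2 {f : 𝓢(Cfg n, ℂ)} (hf : ‖toL2 n f‖ = 1) :
    ∃ g, IsGaussVec g 0 ∧ 1 - ‖⟪g, toL2 n f⟫_ℂ‖ ^ 2
      ≤ 1 / 2 * ‖genA (!![0, -1; 1, 0] : Matrix (Fin 2) (Fin 2) ℝ) fun _ => f‖ ^ 2 := by
  obtain ⟨C, V, hV, h⟩ := exists_gaussian_overlap hf 0
  have h1 := congrArg Complex.re (norm_sq_genA_rot2 f)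
  have h2 : displaceE 0 (toL2 n f) = toL2 n f := by rw [displaceE_apply, displace_zero]
  refine ⟨(gauE C V).symm (coh 0), ?_, ?_⟩
  · have h3 := (isGaussianUnitary_gauE C hV).symm.isGaussVec isGaussVec_vac
    rwa [Matrix.mulVec_zero] at h3
  · rw [LinearIsometryEquiv.inner_map_eq_flip, LinearIsometryEquiv.symm_symm]
    rw [h2] at h
    rw [Complex.ofReal_re] at h1
    rw [h1]
    simpa using h

/-- A state whose three copies are nearly annihilated by the generator is close to a Gaussian
vector. -/
theorem exists_gauss_near_rot3 {f : 𝓢(Cfg n, ℂ)} (hf : ‖toL2 n f‖ = 1) :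
    ∃ g l, IsGaussVec g l ∧ 1 - ‖⟪g, toL2 n f⟫_ℂ‖ ^ 2
      ≤ 1 / 2 * ‖genA axisJ fun _ => f‖ ^ 2 := by
  obtain ⟨r, hr⟩ := norm_sq_genA_axisJ hf
  obtain ⟨C, V, hV, h⟩ := exists_gaussian_overlap hf r
  have h1 := congrArg Complex.re hr
  have h2 : (displaceE r).symm ((gauE C V).symm (coh 0)) = displace (-r) ((gauE C V).symm (coh 0)) :=
    (LinearIsometryEquiv.symm_apply_eq _).2 (displace_neg_displace r _).symm
  have h3 := ((isGaussianUnitary_gauE C hV).symm.isGaussVec isGaussVec_vac).displace (-r)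
  rw [← h2] at h3
  refine ⟨_, _, h3, ?_⟩
  rw [LinearIsometryEquiv.inner_map_eq_flip, LinearIsometryEquiv.symm_symm,
    LinearIsometryEquiv.inner_map_eq_flip, LinearIsometryEquiv.symm_symm]
  rw [Complex.ofReal_re] at h1
  rw [h1]
  simpa using h

/-! ### Bounded energy: nearly invariant states are close to Gaussian states -/

open Filter Topology in
/-- Unit vectors in the domain of the energy operator are approximated, together with their
energy, by normalized finite superpositions of coherent vectors. -/
theorem exists_unit_approx_energy {ψ g : Modes n} (hψ : ‖ψ‖ = 1) (h : EnergyEq ψ g) {η : ℝ}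
    (hη : 0 < η) : ∃ c : (Fin n → ℂ) →₀ ℂ, ‖Finsupp.linearCombination ℂ coh c‖ = 1 ∧
      ‖Finsupp.linearCombination ℂ coh c - ψ‖ ≤ η ∧
      ‖tensorPow k (Finsupp.linearCombination ℂ coh c) - tensorPow k ψ‖ ≤ η ∧
      ‖toL2 n (enS (Finsupp.linearCombination ℂ cohS c))‖ ≤ ‖g‖ + η := by
  obtain ⟨δ₀, hδ₀, hcont⟩ := Metric.continuous_iff.1 (continuous_tensorPow (n := n) (k := k)) ψ η hη
  have hR := norm_nonneg g
  set δ := min (min (1 / 2) (δ₀ / 3)) (η / (2 + 2 * ‖g‖)) with hδ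
  have hδpos : 0 < δ := by rw [hδ]; positivity
  have hδ1 : δ ≤ 1 / 2 := (min_le_left _ _).trans (min_le_left _ _)
  have hδ2 : δ ≤ δ₀ / 3 := (min_le_left _ _).trans (min_le_right _ _)
  have hδ3 : δ * (2 + 2 * ‖g‖) ≤ η := by
    rw [← le_div_iff₀ (by positivity)]; exact min_le_right _ _
  obtain ⟨c, hc1, hc2⟩ := exists_approx_energy h hδpos
  rw [toL2_linearCombination] at hc1
  set φ := Finsupp.linearCombination ℂ (coh (n := n)) c with hφ
  have hs : |‖φ‖ - 1| ≤ δ := by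
    rw [← hψ]; exact (abs_norm_sub_norm_le φ ψ).trans hc1
  obtain ⟨hs1, hs2⟩ := abs_le.1 hs
  have hspos : 0 < ‖φ‖ := by linarith
  have hnorm : ‖((‖φ‖⁻¹ : ℝ) : ℂ)‖ = ‖φ‖⁻¹ := by
    rw [Complex.norm_real, Real.norm_of_nonneg (by positivity)]
  have hlin : Finsupp.linearCombination ℂ (coh (n := n)) (((‖φ‖⁻¹ : ℝ) : ℂ) • c)
      = ((‖φ‖⁻¹ : ℝ) : ℂ) • φ := by rw [map_smul]
  have hdist : ‖((‖φ‖⁻¹ : ℝ) : ℂ) • φ - ψ‖ ≤ 2 * δ := by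
    have h1 : ((‖φ‖⁻¹ : ℝ) : ℂ) • φ - φ = ((‖φ‖⁻¹ - 1 : ℝ) : ℂ) • φ := by
      push_cast; rw [sub_smul, one_smul]
    have h2 : ‖((‖φ‖⁻¹ : ℝ) : ℂ) • φ - φ‖ ≤ δ := by
      rw [h1, norm_smul, Complex.norm_real, Real.norm_eq_abs]
      calc |‖φ‖⁻¹ - 1| * ‖φ‖ = |(‖φ‖⁻¹ - 1) * ‖φ‖| := by rw [abs_mul, abs_norm]
        _ = |1 - ‖φ‖| := by rw [sub_mul, inv_mul_cancel₀ hspos.ne', one_mul]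
        _ ≤ δ := by rwa [abs_sub_comm]
    calc ‖((‖φ‖⁻¹ : ℝ) : ℂ) • φ - ψ‖ = ‖(((‖φ‖⁻¹ : ℝ) : ℂ) • φ - φ) + (φ - ψ)‖ := by abel_nf
      _ ≤ _ := (norm_add_le _ _).trans (by linarith)
  refine ⟨((‖φ‖⁻¹ : ℝ) : ℂ) • c, ?_, ?_, ?_, ?_⟩
  · rw [hlin, norm_smul, hnorm, inv_mul_cancel₀ hspos.ne']
  · rw [hlin]
    nlinarith
  · rw [hlin, ← dist_eq_norm]
    refine (hcont _ ?_).le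
    rw [dist_eq_norm]
    linarith
  · have h1 : toL2 n (enS (Finsupp.linearCombination ℂ cohS (((‖φ‖⁻¹ : ℝ) : ℂ) • c)))
        = ((‖φ‖⁻¹ : ℝ) : ℂ) • toL2 n (enS (Finsupp.linearCombination ℂ cohS c)) := by
      rw [map_smul]
      have : enS (((‖φ‖⁻¹ : ℝ) : ℂ) • Finsupp.linearCombination ℂ (cohS (n := n)) c)
          = ((‖φ‖⁻¹ : ℝ) : ℂ) • enS (Finsupp.linearCombination ℂ cohS c) :=
        (enSLin n).map_smul _ _
      rw [this, map_smul]
    rw [h1, norm_smul, hnorm, inv_mul_le_iff₀ hspos]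
    nlinarith

open Filter Topology in
/-- If rotating the copies moves `ψ^{⊗k}` by at most `ε`, then the distance `d` of `ψ` to the
Gaussian states satisfies `d² ≤ 128 ε ‖Êψ‖²`. -/
theorem RotFlow.sq_dist_le {o : ℝ → Matrix.orthogonalGroup (Fin k) ℝ}
    {J : Matrix (Fin k) (Fin k) ℝ} {T : ℝ} (h : RotFlow o J T) (hk : k ≤ 3) (hn : 0 < n)
    (hJ : ∑ i, ∑ p, |J i p| ≤ 4) {P : Modes n → Prop} (hP : ∀ g, P g → ‖g‖ = 1)
    (hnear : ∀ f : 𝓢(Cfg n, ℂ), ‖toL2 n f‖ = 1 → ∃ g, P g ∧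
      1 - ‖⟪g, toL2 n f⟫_ℂ‖ ^ 2 ≤ 1 / 2 * ‖genA J fun _ => f‖ ^ 2)
    {ψ e : Modes n} (hψ : ‖ψ‖ = 1) (he : EnergyEq ψ e) {ε d : ℝ}
    (hε : ∀ t, mixDefect (o t) ψ ≤ ε) (hd : ∀ g, P g → ‖⟪g, ψ⟫_ℂ‖ ^ 2 ≤ 1 - d ^ 2) :
    d ^ 2 ≤ 128 * ε * ‖e‖ ^ 2 := by
  have key : ∀ η > 0, d ^ 2 ≤ 128 * (ε + 2 * η) * (‖e‖ + η) ^ 2 + 2 * η := by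
    intro η hη
    obtain ⟨c, hc1, hc2, hc3, hc4⟩ := exists_unit_approx_energy (k := k) hψ he hη
    set φ := Finsupp.linearCombination ℂ (coh (n := n)) c with hφ
    have hφε : ∀ t, mixDefect (o t) φ ≤ ε + 2 * η := by
      intro t
      have h1 : mixUnitary (o t) (tensorPow k φ) - tensorPow k φ
          = mixUnitary (o t) (tensorPow k φ - tensorPow k ψ)
            + (mixUnitary (o t) (tensorPow k ψ) - tensorPow k ψ)
            - (tensorPow k φ - tensorPow k ψ) := by rw [map_sub]; abel
      have h2 := hε t
      rw [mixDefect] at h2 ⊢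
      rw [h1]
      refine (norm_sub_le _ _).trans ?_
      refine (add_le_add (norm_add_le _ _) le_rfl).trans ?_
      rw [LinearIsometry.norm_map]
      linarith
    have h1 := h.norm_sq_genA_le_energy hk hn hJ c hc1 hφε
    obtain ⟨g, hg, hgo⟩ := hnear (Finsupp.linearCombination ℂ cohS c)
      (by rw [toL2_linearCombination, hc1])
    rw [toL2_linearCombination] at hgo
    have h0 : 0 ≤ ε + 2 * η := (norm_nonneg _).trans (hφε 0)
    have h2 : ‖toL2 n (enS (Finsupp.linearCombination ℂ cohS c))‖ ^ 2 ≤ (‖e‖ + η) ^ 2 :=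
      pow_le_pow_left₀ (norm_nonneg _) hc4 2
    have h3 : ‖⟪g, φ⟫_ℂ‖ ≤ ‖⟪g, ψ⟫_ℂ‖ + η := by
      have h4 : ⟪g, φ⟫_ℂ = ⟪g, ψ⟫_ℂ + ⟪g, φ - ψ⟫_ℂ := by rw [inner_sub_right]; ring
      rw [h4]
      refine (norm_add_le _ _).trans (add_le_add le_rfl ?_)
      refine (norm_inner_le_norm _ _).trans ?_
      rwa [hP g hg, one_mul]
    have h4 : ‖⟪g, φ⟫_ℂ‖ ≤ 1 := by
      have := norm_inner_le_norm (𝕜 := ℂ) g φ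
      rwa [hP g hg, hc1, one_mul] at this
    have h5 : ‖⟪g, ψ⟫_ℂ‖ ≤ 1 := by
      have := norm_inner_le_norm (𝕜 := ℂ) g ψ
      rwa [hP g hg, hψ, one_mul] at this
    have h6 := hd g hg
    have h7 := norm_nonneg ⟪g, φ⟫_ℂ
    have h8 := norm_nonneg ⟪g, ψ⟫_ℂ
    have h9 : ‖⟪g, φ⟫_ℂ‖ ^ 2 ≤ ‖⟪g, ψ⟫_ℂ‖ ^ 2 + 2 * η := by nlinarith
    have h10 := mul_le_mul_of_nonneg_left h2 (by linarith : 0 ≤ 256 * (ε + 2 * η))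
    linarith
  have hlim : Tendsto (fun η : ℝ => 128 * (ε + 2 * η) * (‖e‖ + η) ^ 2 + 2 * η) (𝓝[>] 0)
      (𝓝 (128 * (ε + 2 * 0) * (‖e‖ + 0) ^ 2 + 2 * 0)) :=
    ((by fun_prop : Continuous fun η : ℝ => 128 * (ε + 2 * η) * (‖e‖ + η) ^ 2 + 2 * η).tendsto
      0).mono_left nhdsWithin_le_nhds
  have := ge_of_tendsto hlim (eventually_mem_nhdsWithin.mono fun η hη => key η hη)
  simpa using this

theorem exists_energyEq_of_E₂_le {ψ : Modes n} {E : ℝ} (hn : 0 < n) (hE : 0 < E)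
    (h : E₂ ψ ≤ ENNReal.ofReal E) : ∃ (S : Matrix.symplecticGroup (Fin n) ℝ)
      (U : Modes n ≃ₗᵢ[ℂ] Modes n) (e : Modes n), IsGaussianUnitary S U ∧ EnergyEq (U ψ) e ∧
      ‖e‖ ≤ 2 * n * E := by
  have hn' : (0 : ℝ) < n := by exact_mod_cast hn
  have hn0 : (n : ℝ≥0∞) ≠ 0 := by exact_mod_cast hn.ne'
  rw [E₂, ENNReal.div_le_iff hn0 (ENNReal.natCast_ne_top n)] at h
  have h1 : ENNReal.ofReal E * (n : ℝ≥0∞) < ENNReal.ofReal (2 * n * E) := by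
    rw [← ENNReal.ofReal_natCast, ← ENNReal.ofReal_mul hE.le]
    exact (ENNReal.ofReal_lt_ofReal_iff (by positivity)).2 (by nlinarith [mul_pos hn' hE])
  have h2 := h.trans_lt h1
  simp only [iInf_lt_iff] at h2
  obtain ⟨S, U, hU, h3⟩ := h2
  have h4 : energySq (U ψ) < ENNReal.ofReal (2 * n * E) ^ (2 : ℝ) := by
    have h5 := ENNReal.rpow_lt_rpow h3 (z := 2) (by norm_num)
    rwa [← ENNReal.rpow_mul, one_div, inv_mul_cancel₀ (by norm_num), ENNReal.rpow_one] at h5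
  rw [energySq] at h4
  simp only [iInf_lt_iff] at h4
  obtain ⟨e, he, h5⟩ := h4
  refine ⟨S, U, e, hU, he, ?_⟩
  rw [ENNReal.rpow_two] at h5
  have h6 := lt_of_not_ge fun h' => h5.not_ge (pow_le_pow_left' h' 2)
  rw [← ofReal_norm, ENNReal.ofReal_lt_ofReal_iff (by positivity)] at h6
  exact h6.le

/-- The quantitative consequence of the energy bound for a rotation test. -/
theorem RotFlow.sq_dist_le_of_E₂_le {o : ℝ → Matrix.orthogonalGroup (Fin k) ℝ}
    {J : Matrix (Fin k) (Fin k) ℝ} {T : ℝ} (h : RotFlow o J T) (hk : k ≤ 3) (hn : 0 < n)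
    (hJ : ∑ i, ∑ p, |J i p| ≤ 4) {P : Modes n → Prop} (hP : ∀ g, P g → ‖g‖ = 1)
    (hPU : ∀ S U, IsGaussianUnitary S U → ∀ g, P g → P (U g))
    (hnear : ∀ f : 𝓢(Cfg n, ℂ), ‖toL2 n f‖ = 1 → ∃ g, P g ∧
      1 - ‖⟪g, toL2 n f⟫_ℂ‖ ^ 2 ≤ 1 / 2 * ‖genA J fun _ => f‖ ^ 2)
    {O : Set (Matrix.orthogonalGroup (Fin k) ℝ)} (hO : ∀ t, o t ∈ O)
    {ψ : Modes n} (hψ : ‖ψ‖ = 1) {E d : ℝ} (hE : 0 < E) (hE₂ : E₂ ψ ≤ ENNReal.ofReal E)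
    (hd : ∀ g, P g → ‖⟪g, ψ⟫_ℂ‖ ^ 2 ≤ 1 - d ^ 2) :
    d ^ 2 ≤ 1024 * √(1 - acceptProb O ψ) * (n * E) ^ 2 := by
  obtain ⟨S, U, e, hU, he, hle⟩ := exists_energyEq_of_E₂_le hn hE hE₂
  have h1 : ∀ t, mixDefect (o t) (U ψ) ≤ 2 * √(1 - acceptProb O ψ) := by
    intro t
    rw [(mixCov_of_isGaussianUnitary (o t) hU).mixDefect_eq]
    exact norm_mixUnitary_sub_le hψ (hO t)
  have h2 : ∀ g, P g → ‖⟪g, U ψ⟫_ℂ‖ ^ 2 ≤ 1 - d ^ 2 := by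
    intro g hg
    have h3 := hd _ (hPU _ _ hU.symm g hg)
    rwa [LinearIsometryEquiv.inner_map_eq_flip, LinearIsometryEquiv.symm_symm] at h3
  have h3 := h.sq_dist_le hk hn hJ hP hnear (by rw [U.norm_map, hψ]) he h1 h2
  have h4 : ‖e‖ ^ 2 ≤ (2 * n * E) ^ 2 := pow_le_pow_left₀ (norm_nonneg _) hle 2
  have h5 := mul_le_mul_of_nonneg_left h4
    (by positivity : 0 ≤ 128 * (2 * √(1 - acceptProb O ψ)))
  linarith

/-! ### Rotations move product vectors near the vacuum -/

theorem sec_coh_zero {m : ℕ} (hm : m ≠ 0) : sec m (coh (0 : Fin n → ℂ)) = 0 := by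
  rw [sec_coh]
  have h1 := cohSec_smul 0 (0 : Fin n → ℂ) m
  rwa [zero_smul, zero_pow hm, zero_smul] at h1

theorem inner_oneSlot_ptensor (j : Fin k) (χ f : Modes n) :
    ⟪oneSlot j χ, ptensor n k fun _ => f⟫_ℂ = ⟪χ, f⟫_ℂ * ⟪coh 0, f⟫_ℂ ^ (k - 1) := by
  rw [oneSlot, inner_ptensor, ← Finset.mul_prod_erase _ _ (Finset.mem_univ j),
    Function.update_self]
  congr 1
  rw [Finset.prod_congr rfl fun l hl => by rw [Function.update_of_ne (Finset.ne_of_mem_erase hl)],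
    Finset.prod_const, Finset.card_erase_of_mem (Finset.mem_univ j), Finset.card_univ,
    Fintype.card_fin]

theorem inner_oneSlot_oneSlot {χ : Modes n} (hχ : ⟪coh 0, χ⟫_ℂ = 0) (i j : Fin k) :
    ⟪oneSlot i χ, oneSlot j χ⟫_ℂ = if i = j then ⟪χ, χ⟫_ℂ else 0 := by
  have hχ' : ⟪χ, coh 0⟫_ℂ = 0 := by rw [← inner_conj_symm, hχ, map_zero]
  rw [oneSlot, oneSlot, inner_ptensor]
  split_ifs with h
  · subst h
    rw [← Finset.mul_prod_erase _ _ (Finset.mem_univ i), Function.update_self,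
      Finset.prod_eq_one, mul_one]
    intro l hl
    rw [Function.update_of_ne (Finset.ne_of_mem_erase hl), inner_self_eq_norm_sq_to_K,
      norm_coh_zero]
    simp
  · refine Finset.prod_eq_zero (Finset.mem_univ i) ?_
    rw [Function.update_self, Function.update_of_ne h, hχ']

/-- On a single excitation `χ` distributed over the copies, a rotation `o` acts on the `m`-particle
component with overlap `∑ oᵢⱼ^m`. -/
theorem hasSum_norm_mix_oneSlot (o : Matrix.orthogonalGroup (Fin k) ℝ) {χ : Modes n}
    (hχ : ⟪coh 0, χ⟫_ℂ = 0) :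
    HasSum (fun m => 2 * ((k : ℝ) - ∑ i, ∑ j, o.1 i j ^ m) * ‖sec m χ‖ ^ 2)
      (‖mixUnitary o (∑ j, oneSlot j χ) - ∑ j, oneSlot j χ‖ ^ 2) := by
  set B : Copies n k := ∑ j, oneSlot j χ with hB
  have hBB : ‖B‖ ^ 2 = k * ‖χ‖ ^ 2 := by
    apply Complex.ofReal_injective
    rw [ofReal_norm_sq, Complex.ofReal_mul, ofReal_norm_sq]
    simp only [hB, sum_inner, inner_sum, inner_oneSlot_oneSlot hχ]
    simp
  have h1 : HasSum (fun m => ∑ i, ∑ j, (o.1 i j : ℂ) ^ m * ⟪sec m χ, sec m χ⟫_ℂ)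
      ⟪B, mixUnitary o B⟫_ℂ := by
    simp only [hB, map_sum, sum_inner, inner_sum]
    rw [Finset.sum_comm]
    exact hasSum_sum fun i _ => hasSum_sum fun j _ => hasSum_inner_oneSlot o i j χ χ
  have h2 : HasSum (fun m => (∑ i, ∑ j, o.1 i j ^ m) * ‖sec m χ‖ ^ 2) (⟪B, mixUnitary o B⟫_ℂ).re := by
    refine (h1.mapL Complex.reCLM).congr_fun fun m => ?_
    simp only [inner_self_eq_norm_sq_to_K, ← Finset.sum_mul]
    have : (∑ i, ∑ j, (o.1 i j : ℂ) ^ m) * ((‖sec m χ‖ : ℝ) : ℂ) ^ 2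
        = (((∑ i, ∑ j, o.1 i j ^ m) * ‖sec m χ‖ ^ 2 : ℝ) : ℂ) := by push_cast; rfl
    exact (congrArg Complex.re this).trans (Complex.ofReal_re _) |>.symm
  have h3 : ‖mixUnitary o B - B‖ ^ 2
      = 2 * (k * ‖χ‖ ^ 2 - (⟪B, mixUnitary o B⟫_ℂ).re) := by
    rw [norm_sub_rev, norm_sub_sq (𝕜 := ℂ), LinearIsometry.norm_map, hBB]
    simp only [RCLike.re_to_complex]
    ring
  rw [h3]
  refine (((hasSum_norm_sec χ).mul_left (k : ℝ)).sub h2 |>.mul_left 2).congr_fun fun m => ?_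
  ring

/-- A lower bound for how far a rotation moves `f^{⊗k}`, in terms of the weight `1 - |⟨K₀, f⟩|²` of
`f` outside the vacuum and its weight in the particle numbers that the rotation does not detect. -/
theorem le_mixDefect (hk2 : 2 ≤ k) (hk3 : k ≤ 3) (o : Matrix.orthogonalGroup (Fin k) ℝ)
    {f : Modes n} (hf : ‖f‖ = 1) (bad : Finset ℕ)
    (hgood : ∀ m, 1 ≤ m → m ∉ bad → 1 / 2 ≤ (k : ℝ) - ∑ i, ∑ j, o.1 i j ^ m)
    (hbad : ∀ m ∈ bad, 0 ≤ (k : ℝ) - ∑ i, ∑ j, o.1 i j ^ m) :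
    ‖⟪coh 0, f⟫_ℂ‖ ^ 2 * √(1 - ‖⟪coh 0, f⟫_ℂ‖ ^ 2 - ∑ m ∈ bad, ‖sec m f‖ ^ 2)
      - 4 * (1 - ‖⟪coh 0, f⟫_ℂ‖ ^ 2) ≤ mixDefect o f := by
  set α := ⟪coh 0, f⟫_ℂ with hα
  set χ := f - α • coh 0 with hχ
  have h00 : ⟪coh (0 : Fin n → ℂ), coh 0⟫_ℂ = 1 := by
    rw [inner_self_eq_norm_sq_to_K, norm_coh_zero]; simp
  have hff : ⟪f, f⟫_ℂ = 1 := by rw [inner_self_eq_norm_sq_to_K, hf]; simp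
  have hf0 : ⟪f, coh 0⟫_ℂ = (starRingEnd ℂ) α := by rw [hα, inner_conj_symm]
  have hχ0 : ⟪coh 0, χ⟫_ℂ = 0 := by
    rw [hχ, inner_sub_right, inner_smul_right, h00, ← hα]; ring
  have hχ0' : ⟪χ, coh 0⟫_ℂ = 0 := by rw [← inner_conj_symm, hχ0, map_zero]
  have hαα : (starRingEnd ℂ) α * α = ((‖α‖ ^ 2 : ℝ) : ℂ) := by
    rw [mul_comm, Complex.mul_conj, Complex.normSq_eq_norm_sq]
  have hχf : ⟪χ, f⟫_ℂ = ((1 - ‖α‖ ^ 2 : ℝ) : ℂ) := by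
    rw [hχ, inner_sub_left, inner_smul_left, hff, ← hα, hαα]; push_cast; rfl
  have hχχ : ⟪χ, χ⟫_ℂ = ((1 - ‖α‖ ^ 2 : ℝ) : ℂ) := by
    rw [← hχf]
    conv_lhs => arg 3; rw [hχ]
    rw [inner_sub_right, inner_smul_right, hχ0', mul_zero, sub_zero]
  have hX : ‖χ‖ ^ 2 = 1 - ‖α‖ ^ 2 := Complex.ofReal_injective (by rw [ofReal_norm_sq, hχχ])
  have hX0 : 0 ≤ 1 - ‖α‖ ^ 2 := hX ▸ sq_nonneg _
  have hα1 : ‖α‖ ≤ 1 := by nlinarith [norm_nonneg α]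
  set B : Copies n k := ∑ j, oneSlot j χ with hB
  set V : Copies n k := tensorPow k (coh 0) with hV
  set Ψ : Copies n k := tensorPow k f with hΨ
  have hVV : ⟪V, V⟫_ℂ = 1 := by
    rw [hV, tensorPow_eq_ptensor, inner_ptensor, h00]; simp
  have hΨΨ : ⟪Ψ, Ψ⟫_ℂ = 1 := by
    rw [hΨ, tensorPow_eq_ptensor, inner_ptensor, hff]; simp
  have hVΨ : ⟪V, Ψ⟫_ℂ = α ^ k := by
    rw [hV, hΨ, tensorPow_eq_ptensor, tensorPow_eq_ptensor, inner_ptensor]; simp [hα]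
  have hBV : ⟪B, V⟫_ℂ = 0 := by
    rw [hB, sum_inner]
    refine Finset.sum_eq_zero fun j _ => ?_
    rw [hV, tensorPow_eq_ptensor, inner_oneSlot_ptensor, hχ0', zero_mul]
  have hBΨ : ⟪B, Ψ⟫_ℂ = k * ((1 - ‖α‖ ^ 2 : ℝ) : ℂ) * α ^ (k - 1) := by
    rw [hB, sum_inner, hΨ, tensorPow_eq_ptensor]
    simp only [inner_oneSlot_ptensor, hχf, ← hα]
    simp [mul_assoc]
  have hBB : ⟪B, B⟫_ℂ = k * ((1 - ‖α‖ ^ 2 : ℝ) : ℂ) := by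
    simp only [hB, sum_inner, inner_sum, inner_oneSlot_oneSlot hχ0, hχχ]
    simp
    ring
  -- `f^{⊗k}` is the vacuum term, the term of first order in `χ`, and a remainder of order `‖χ‖²`
  set R := Ψ - α ^ k • V - α ^ (k - 1) • B with hR
  have hRR : ‖R‖ ^ 2 = 1 - (‖α‖ ^ 2) ^ k - k * (1 - ‖α‖ ^ 2) * (‖α‖ ^ 2) ^ (k - 1) := by
    apply Complex.ofReal_injective
    have hΨV : ⟪Ψ, V⟫_ℂ = (starRingEnd ℂ) α ^ k := by rw [← inner_conj_symm, hVΨ, map_pow]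
    have hVB : ⟪V, B⟫_ℂ = 0 := by rw [← inner_conj_symm, hBV, map_zero]
    have hΨB : ⟪Ψ, B⟫_ℂ = k * ((1 - ‖α‖ ^ 2 : ℝ) : ℂ) * (starRingEnd ℂ) α ^ (k - 1) := by
      rw [← inner_conj_symm, hBΨ]
      simp only [map_mul, map_pow, Complex.conj_ofReal, map_natCast]
    rw [ofReal_norm_sq, hR]
    simp only [inner_sub_left, inner_sub_right, inner_smul_left, inner_smul_right, hVV, hΨΨ, hVΨ,
      hΨV, hBV, hVB, hBΨ, hΨB, hBB, map_pow]
    have e1 : ((‖α‖ : ℂ) ^ 2) ^ k = (starRingEnd ℂ) α ^ k * α ^ k := by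
      rw [← mul_pow, hαα]; push_cast; rfl
    have e2 : ((‖α‖ : ℂ) ^ 2) ^ (k - 1) = (starRingEnd ℂ) α ^ (k - 1) * α ^ (k - 1) := by
      rw [← mul_pow, hαα]; push_cast; rfl
    push_cast
    rw [e1, e2]
    ring
  have hRle : ‖R‖ ≤ 2 * (1 - ‖α‖ ^ 2) := by
    refine (sq_le_sq₀ (norm_nonneg _) (by linarith)).1 ?_
    rw [hRR]
    set a := ‖α‖ ^ 2
    have ha : 0 ≤ a := sq_nonneg _
    have hk : k = 2 ∨ k = 3 := by omega
    rcases hk with h | h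
    · have e : 1 - a ^ 2 - ((2 : ℕ) : ℝ) * (1 - a) * a ^ (2 - 1) = (1 - a) ^ 2 := by norm_num; ring
      rw [h, e, mul_pow]
      linarith [sq_nonneg (1 - a)]
    · have e : 1 - a ^ 3 - ((3 : ℕ) : ℝ) * (1 - a) * a ^ (3 - 1) = (1 - a) ^ 2 * (1 + 2 * a) := by
        norm_num; ring
      rw [h, e, mul_pow]
      linarith [sq_nonneg (1 - a), mul_nonneg (sq_nonneg (1 - a)) hX0]
  have hmove : mixUnitary o Ψ - Ψ
      = α ^ (k - 1) • (mixUnitary o B - B) + (mixUnitary o R - R) := by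
    have hMV : mixUnitary o V = V := IsGaussVec.mixUnitary_tensorPow_of_zero o isGaussVec_vac
    rw [hR, map_sub, map_sub, map_smul, map_smul, hMV, smul_sub]
    abel
  have hBlow : √(1 - ‖α‖ ^ 2 - ∑ m ∈ bad, ‖sec m f‖ ^ 2) ≤ ‖mixUnitary o B - B‖ := by
    rw [Real.sqrt_le_left (norm_nonneg _)]
    have hsec0 : sec 0 χ = 0 := by
      have := norm_sec_zero χ
      rw [hχ0, norm_zero] at this
      exact norm_eq_zero.1 this
    have hsec : ∀ m, ‖sec m χ‖ ^ 2 ≤ ‖sec m f‖ ^ 2 := by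
      intro m
      rcases eq_or_ne m 0 with rfl | hm
      · rw [hsec0]; simp
      · rw [hχ, sec_sub, sec_smul, sec_coh_zero hm, smul_zero, sub_zero]
    have h1 := hasSum_norm_mix_oneSlot o hχ0
    have h2 := (hasSum_norm_sec χ).sub
      (hasSum_sum_of_ne_finset_zero (f := fun m => if m ∈ bad then ‖sec m χ‖ ^ 2 else 0) (s := bad)
        fun m hm => if_neg hm)
    have h3 := hasSum_le (fun m => ?_) h2 h1
    · have h4 : ∑ m ∈ bad, (if m ∈ bad then ‖sec m χ‖ ^ 2 else 0)
          ≤ ∑ m ∈ bad, ‖sec m f‖ ^ 2 :=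
        Finset.sum_le_sum fun m hm => by rw [if_pos hm]; exact hsec m
      rw [hX] at h3
      linarith
    · rcases eq_or_ne m 0 with rfl | hm
      · rw [hsec0]; simp
      · have hs := sq_nonneg ‖sec m χ‖
        by_cases hb : m ∈ bad
        · rw [if_pos hb, sub_self]
          have := mul_nonneg (hbad m hb) hs
          linarith
        · rw [if_neg hb, sub_zero]
          have := mul_le_mul_of_nonneg_right (hgood m (Nat.one_le_iff_ne_zero.2 hm) hb) hs
          linarith
  have hpow : ‖α‖ ^ 2 ≤ ‖α‖ ^ (k - 1) := pow_le_pow_of_le_one (norm_nonneg _) hα1 (by omega)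
  rw [mixDefect, ← hΨ, hmove]
  have h5 : ‖α ^ (k - 1) • (mixUnitary o B - B)‖ - ‖mixUnitary o R - R‖
      ≤ ‖α ^ (k - 1) • (mixUnitary o B - B) + (mixUnitary o R - R)‖ := by
    have := norm_sub_norm_le (α ^ (k - 1) • (mixUnitary o B - B)) (-(mixUnitary o R - R))
    rwa [norm_neg, sub_neg_eq_add] at this
  have h6 : ‖mixUnitary o R - R‖ ≤ 2 * ‖R‖ := by
    refine (norm_sub_le _ _).trans ?_
    rw [LinearIsometry.norm_map]; linarith
  rw [norm_smul, norm_pow] at h5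
  have h7 := mul_le_mul hpow hBlow (Real.sqrt_nonneg _) (by positivity)
  linarith

/-! ### First-order optimality of the closest Gaussian state -/

/-- If `φ₀` is within `κ` of the best overlap with `f` among the vectors of a class that contains
perturbations `φ₀ + tcw + O(t²)` up to normalization, then `f` is nearly orthogonal to `w`. -/
theorem norm_inner_le_of_variation {H : Type*} [NormedAddCommGroup H] [InnerProductSpace ℂ H]
    {P : H → Prop} {f φ₀ w : H} {C d κ : ℝ} (hφ₀ : ‖φ₀‖ = 1) (hf : ‖f‖ = 1) (hw : ⟪φ₀, w⟫_ℂ = 0)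
    (hP : ∀ g, P g → ‖g‖ = 1) (hd : ∀ g, P g → ‖⟪g, f⟫_ℂ‖ ^ 2 ≤ 1 - d ^ 2)
    (hvar : ∀ t : ℝ, 0 < t → t ≤ 1 / 16 → ∀ c : ℂ, ‖c‖ = 1 → ∃ (g : H) (N : ℂ) (r : H), P g ∧
      ‖r‖ ≤ C * t ^ 2 ∧ N • g = φ₀ + (t * c) • w + r)
    (hκ : 0 < κ) (hκ' : κ ≤ 1 / 256) (h : 1 - d ^ 2 - κ ≤ ‖⟪φ₀, f⟫_ℂ‖ ^ 2)
    (hα : 1 / 2 ≤ ‖⟪φ₀, f⟫_ℂ‖) : ‖⟪w, f⟫_ℂ‖ ≤ (1 + ‖w‖ ^ 2 + 2 * C) * √κ := by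
  set α := ⟪φ₀, f⟫_ℂ with hαdef
  set β := ⟪w, f⟫_ℂ with hβdef
  set t := √κ with ht
  have htpos : 0 < t := Real.sqrt_pos.2 hκ
  have ht2 : t ^ 2 = κ := Real.sq_sqrt hκ.le
  have ht16 : t ≤ 1 / 16 := by
    rw [ht]; exact (Real.sqrt_le_left (by norm_num)).2 (by norm_num; linarith)
  have hαpos : 0 < ‖α‖ := by linarith
  have hα0 : α ≠ 0 := norm_pos_iff.1 hαpos
  -- the phase that aligns the first-order term with the overlap
  obtain ⟨c, hc1, hc2⟩ : ∃ c : ℂ, ‖c‖ = 1 ∧ (starRingEnd ℂ) c * β = α * ((‖β‖ / ‖α‖ : ℝ) : ℂ) := by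
    rcases eq_or_ne β 0 with h0 | h0
    · exact ⟨1, by simp, by simp [h0]⟩
    · refine ⟨(starRingEnd ℂ) (α * ((‖β‖ / ‖α‖ : ℝ) : ℂ) / β), ?_, ?_⟩
      · have : 0 < ‖β‖ := norm_pos_iff.2 h0
        rw [RCLike.norm_conj, norm_div, norm_mul, Complex.norm_real,
          Real.norm_of_nonneg (by positivity)]
        field_simp
      · rw [Complex.conj_conj, div_mul_cancel₀ _ h0]
  obtain ⟨g, N, r, hg, hr, hN⟩ := hvar t htpos ht16 c hc1
  have h1 : ⟪N • g, f⟫_ℂ = α * ((1 + t * (‖β‖ / ‖α‖) : ℝ) : ℂ) + ⟪r, f⟫_ℂ := by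
    rw [hN, inner_add_left, inner_add_left, inner_smul_left, map_mul, Complex.conj_ofReal,
      mul_assoc, ← hβdef, hc2]
    push_cast; ring
  have h2 : ‖α‖ + t * ‖β‖ - C * t ^ 2 ≤ ‖⟪N • g, f⟫_ℂ‖ := by
    have h3 : ‖α * ((1 + t * (‖β‖ / ‖α‖) : ℝ) : ℂ)‖ = ‖α‖ + t * ‖β‖ := by
      rw [norm_mul, Complex.norm_real, Real.norm_of_nonneg (by positivity)]
      field_simp
    have h4 : ‖⟪r, f⟫_ℂ‖ ≤ C * t ^ 2 := by
      refine (norm_inner_le_norm _ _).trans ?_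
      rwa [hf, mul_one]
    have h5 := norm_sub_norm_le (α * ((1 + t * (‖β‖ / ‖α‖) : ℝ) : ℂ)) (-⟪r, f⟫_ℂ)
    rw [norm_neg, sub_neg_eq_add, ← h1, h3] at h5
    linarith
  have h3 : ‖N‖ ≤ 1 + (‖w‖ ^ 2 / 2 + C) * t ^ 2 := by
    have h4 : ‖N‖ = ‖φ₀ + (t * c) • w + r‖ := by rw [← hN, norm_smul, hP g hg, mul_one]
    have h5 : ‖φ₀ + ((t : ℂ) * c) • w‖ ≤ 1 + ‖w‖ ^ 2 / 2 * t ^ 2 := by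
      refine (sq_le_sq₀ (norm_nonneg _) (by positivity)).1 ?_
      have h6 := norm_add_sq (𝕜 := ℂ) φ₀ (((t : ℂ) * c) • w)
      rw [inner_smul_right, hw, mul_zero, map_zero, hφ₀, norm_smul, norm_mul, hc1,
        Complex.norm_real, Real.norm_of_nonneg htpos.le] at h6
      rw [h6]
      linarith [sq_nonneg (‖w‖ ^ 2 * t ^ 2)]
    rw [h4]
    refine (norm_add_le _ _).trans ?_
    linarith
  have h4 : ‖⟪N • g, f⟫_ℂ‖ = ‖N‖ * ‖⟪g, f⟫_ℂ‖ := by rw [inner_smul_left, norm_mul, RCLike.norm_conj]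
  have h5 : ‖⟪g, f⟫_ℂ‖ ≤ 1 := by
    have := norm_inner_le_norm (𝕜 := ℂ) g f
    rwa [hP g hg, hf, one_mul] at this
  have h6 : ‖⟪g, f⟫_ℂ‖ ≤ ‖α‖ + κ := by
    refine (sq_le_sq₀ (norm_nonneg _) (by positivity)).1 ?_
    have := hd g hg
    linarith [mul_le_mul_of_nonneg_right hα hκ.le, sq_nonneg κ]
  have hC : 0 ≤ C := by
    have := (norm_nonneg _).trans hr
    by_contra hneg
    nlinarith [mul_pos_of_neg_of_neg (not_le.1 hneg) (neg_lt_zero.2 (pow_pos htpos 2))]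
  have h7 : ‖N‖ * ‖⟪g, f⟫_ℂ‖ ≤ ‖α‖ + κ + (‖w‖ ^ 2 / 2 + C) * t ^ 2 := by
    have h8 : 0 ≤ (‖w‖ ^ 2 / 2 + C) * t ^ 2 := by positivity
    calc ‖N‖ * ‖⟪g, f⟫_ℂ‖ ≤ (1 + (‖w‖ ^ 2 / 2 + C) * t ^ 2) * ‖⟪g, f⟫_ℂ‖ :=
          mul_le_mul_of_nonneg_right h3 (norm_nonneg _)
      _ ≤ _ := by linarith [mul_le_mul_of_nonneg_left h5 h8]
  rw [h4] at h2
  have h8 : t * ‖β‖ ≤ t * ((1 + ‖w‖ ^ 2 + 2 * C) * t) := by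
    have : 0 ≤ ‖w‖ ^ 2 * κ := by positivity
    rw [ht2] at h2 h7
    have h9 : t * ((1 + ‖w‖ ^ 2 + 2 * C) * t) = (1 + ‖w‖ ^ 2 + 2 * C) * κ := by
      rw [← ht2]; ring
    rw [h9]
    linarith
  exact le_of_mul_le_mul_left h8 htpos

/-! ### Gaussian variations of the vacuum -/

theorem norm_exp_sub_one_sub_le {s : ℂ} {t u : ℝ} (ht : 0 < t) (ht' : t ≤ 1 / 16) (hu : 0 ≤ u)
    (hs : ‖s‖ ≤ t * u) : ‖Complex.exp s - 1 - s‖ ≤ 512 * t ^ 2 * Real.exp (u / 8) := by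
  have h1 : ‖Complex.exp s - 1 - s‖ ≤ ‖s‖ ^ 2 * Real.exp ‖s‖ := by
    have := Complex.norm_exp_sub_sum_le_norm_mul_exp s 2
    simpa [Finset.sum_range_succ, sub_sub] using this
  have h2 : t * u ≤ u / 16 := by nlinarith
  have h3 : u ^ 2 ≤ 512 * Real.exp (u / 16) := by
    have := Real.quadratic_le_exp_of_nonneg (x := u / 16) (by positivity)
    nlinarith
  have h4 : Real.exp (u / 8) = Real.exp (u / 16) * Real.exp (u / 16) := by
    rw [← Real.exp_add]; congr 1; ring
  calc ‖Complex.exp s - 1 - s‖ ≤ ‖s‖ ^ 2 * Real.exp ‖s‖ := h1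
    _ ≤ (t * u) ^ 2 * Real.exp (u / 16) := by
        gcongr
        exact hs.trans h2
    _ = t ^ 2 * Real.exp (u / 16) * u ^ 2 := by ring
    _ ≤ t ^ 2 * Real.exp (u / 16) * (512 * Real.exp (u / 16)) := by gcongr
    _ = _ := by rw [h4]; ring

theorem cohFun_zero (x : Cfg n) : cohFun 0 x
    = ((Real.pi ^ (-(n : ℝ) / 4) : ℝ) : ℂ) * Complex.exp (-(1 / 2) * (‖x‖ ^ 2 : ℝ)) := by
  simp [cohFun]

/-- Multiplication by `exp (tcq)`, for a real function `q` of at most quadratic growth, moves the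
vacuum by `tcq` up to an error of order `t²`. -/
theorem exists_norm_remainder_le (n : ℕ) : ∃ K : ℝ, ∀ (q : Cfg n → ℝ),
    (∀ x, |q x| ≤ ‖x‖ ^ 2 + 1) → ∀ t : ℝ, 0 < t → t ≤ 1 / 16 → ∀ c : ℂ, ‖c‖ = 1 →
    ∀ y w : Modes n, y =ᵐ[volume] (fun x => cohFun 0 x * Complex.exp (t * c * q x)) →
    w =ᵐ[volume] (fun x => q x * cohFun 0 x) →
    ‖y - coh 0 - ((t : ℂ) * c) • w‖ ≤ K * t ^ 2 := by
  have h3 : √3 * √3 = (3 : ℝ) := Real.mul_self_sqrt (by norm_num)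
  have h30 : √3 ≠ (0 : ℝ) := by positivity
  -- the error is dominated by a Gaussian of smaller precision, the vacuum in the variable `(√3/2)x`
  let B : (Matrix (Fin n) (Fin n) ℝ)ˣ := Units.map (Matrix.scalar (Fin n)).toMonoidHom
    (Units.mk0 (√3 / 2) (by positivity))
  have hB : ∀ x : Cfg n, linE B x = (√3 / 2) • x := by
    intro x
    ext i
    rw [ofLp_linE]
    simp [B]
  have hdet : 0 < √|B.1.det| := Real.sqrt_pos.2 (abs_pos.2 (det_units_ne_zero B))
  refine ⟨512 * Real.exp (1 / 8) / √|B.1.det| * ‖toL2 n (gauS B 0 (cohS 0))‖,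
    fun q hq t ht ht' c hc y w hy hw => ?_⟩
  have key : ‖y - coh 0 - ((t : ℂ) * c) • w‖
      ≤ (512 * Real.exp (1 / 8) / √|B.1.det| * t ^ 2) * ‖toL2 n (gauS B 0 (cohS 0))‖ := by
    refine Lp.norm_le_mul_norm_of_ae_le_mul ?_
    filter_upwards [Lp.coeFn_sub (y - coh 0) (((t : ℂ) * c) • w), Lp.coeFn_sub y (coh 0),
      Lp.coeFn_smul ((t : ℂ) * c) w, hy, hw, coeFn_coh (0 : Fin n → ℂ),
      coeFn_toL2 (gauS B 0 (cohS 0))] with x h1 h2 h4 h5 h6 h7 h8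
    rw [h1, Pi.sub_apply, h2, Pi.sub_apply, h4, Pi.smul_apply, h5, h6, h7, h8, gauS_apply,
      cohS_apply, hB]
    have e1 : cohFun 0 x * Complex.exp (t * c * q x) - cohFun 0 x - (t * c : ℂ) • (q x * cohFun 0 x)
        = cohFun 0 x * (Complex.exp (t * c * q x) - 1 - t * c * q x) := by
      rw [smul_eq_mul]; ring
    have e2 : ‖Complex.exp (t * c * q x) - 1 - t * c * q x‖
        ≤ 512 * t ^ 2 * Real.exp ((‖x‖ ^ 2 + 1) / 8) := by
      refine norm_exp_sub_one_sub_le ht ht' (by positivity) ?_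
      rw [norm_mul, norm_mul, hc, Complex.norm_real, Complex.norm_real, mul_one,
        Real.norm_of_nonneg ht.le, Real.norm_eq_abs]
      exact mul_le_mul_of_nonneg_left (hq x) ht.le
    have e3 : ∀ v : Cfg n, ‖cohFun 0 v‖ = Real.pi ^ (-(n : ℝ) / 4) * Real.exp (-(1 / 2) * ‖v‖ ^ 2) := by
      intro v
      have e : -(1 / 2 : ℂ) * ((‖v‖ ^ 2 : ℝ) : ℂ) = ((-(1 / 2) * ‖v‖ ^ 2 : ℝ) : ℂ) := by
        push_cast; ring
      rw [cohFun_zero, norm_mul, Complex.norm_real, Real.norm_of_nonneg (by positivity),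
        Complex.norm_exp, e, Complex.ofReal_re]
    have e4 : ‖cohFun 0 ((√3 / 2) • x)‖
        = Real.pi ^ (-(n : ℝ) / 4) * Real.exp (-(1 / 2) * ‖x‖ ^ 2) * Real.exp (‖x‖ ^ 2 / 8) := by
      rw [e3, mul_assoc, ← Real.exp_add, norm_smul, mul_pow, Real.norm_of_nonneg (by positivity),
        div_pow, pow_two (√3), h3]
      congr 2
      ring
    rw [e1, norm_mul, norm_mul, norm_mul, norm_quadPhase, Complex.norm_real,
      Real.norm_of_nonneg hdet.le, e4, one_mul, e3]
    have e5 : Real.exp ((‖x‖ ^ 2 + 1) / 8) = Real.exp (‖x‖ ^ 2 / 8) * Real.exp (1 / 8) := by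
      rw [← Real.exp_add]; congr 1; ring
    rw [e5] at e2
    refine (mul_le_mul_of_nonneg_left e2 (by positivity)).trans (le_of_eq ?_)
    field_simp
  refine key.trans (le_of_eq ?_)
  ring

theorem abs_coord_le (x : Cfg n) (i : Fin n) : |x i| ≤ ‖x‖ := PiLp.norm_apply_le x i

/-- Displacing the vacuum varies it in the directions of one-particle vectors. -/
theorem exists_displaced_variation (c : ℂ) (t : ℝ) (i : Fin n) :
    ∃ (g : Modes n) (l : Fin n ⊕ Fin n → ℝ) (N : ℂ), IsGaussVec g l ∧
      N • g =ᵐ[volume] fun x => cohFun 0 x * Complex.exp (t * c * (x i : ℝ)) := by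
  let z : Fin n → ℂ := Pi.single i (t * c)
  refine ⟨displace (cohPoint z) (coh 0), _, Complex.exp ((t * c) ^ 2 / 4) *
    Complex.exp ((1 / 4) * (∑ i, cohPoint z i ^ 2 : ℝ)), isGaussVec_vac.displace _, ?_⟩
  rw [mul_smul, ← coh_eq_displace]
  refine (coeFn_smul_of_ae _ (coeFn_coh z)).trans (Filter.Eventually.of_forall fun x => ?_)
  have h1 : ∑ j, z j * (x j : ℂ) = t * c * (x i : ℂ) := by
    rw [Finset.sum_eq_single i] <;> simp +contextual [z]
  have h2 : ∑ j, z j ^ 2 = (t * c) ^ 2 := by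
    rw [Finset.sum_eq_single i] <;> simp +contextual [z]
  show _ * cohFun z x = cohFun 0 x * Complex.exp (t * c * (x i : ℝ))
  rw [cohFun_zero, cohFun, h1, h2, mul_left_comm, ← Complex.exp_add,
    mul_assoc _ (Complex.exp (-(1 / 2) * (‖x‖ ^ 2 : ℝ))), ← Complex.exp_add]
  congr 2
  ring

theorem quadF_add_transpose (a : ℝ) (i j : Fin n) (x : Cfg n) :
    quadF (a • (Matrix.single i j 1 + Matrix.single j i 1)) x = 2 * a * (x i * x j) := by
  simp only [quadF, Matrix.smul_mulVec, Matrix.add_mulVec, dotProduct_smul, dotProduct_add,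
    Matrix.single_mulVec]
  simp [Function.update_apply, dotProduct, Finset.sum_ite_eq']
  ring

/-- Squeezing and shearing the vacuum varies it in the directions of two-particle vectors. -/
theorem exists_squeezed_variation {c : ℂ} (hc : ‖c‖ = 1) {t : ℝ} (ht : 0 < t) (ht' : t ≤ 1 / 16)
    (i j : Fin n) (a : ℝ) :
    ∃ (g : Modes n) (N : ℂ), IsGaussVec g 0 ∧
      N • g =ᵐ[volume] fun x => cohFun 0 x * Complex.exp (t * c * (x i * x j - a : ℝ)) := by
  let D : Matrix (Fin n) (Fin n) ℝ := Matrix.single i j 1 + Matrix.single j i 1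
  have hD : D.IsSymm := by
    simp [D, Matrix.IsSymm, Matrix.transpose_add, add_comm]
  have hre : |c.re| ≤ 1 := hc ▸ Complex.abs_re_le_norm c
  have hW : (1 + (-(t * c.re)) • D).PosDef := by
    refine Matrix.PosDef.of_dotProduct_mulVec_pos ?_ fun v hv => ?_
    · rw [Matrix.IsHermitian, Matrix.conjTranspose_eq_transpose_of_trivial, Matrix.transpose_add,
        Matrix.transpose_one, Matrix.transpose_smul, hD]
    · have h1 : star v ⬝ᵥ (1 + (-(t * c.re)) • D).mulVec v
          = ‖(WithLp.toLp 2 v : Cfg n)‖ ^ 2 - 2 * (t * c.re) * (v i * v j) := by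
        rw [Matrix.add_mulVec, Matrix.one_mulVec, dotProduct_add, star_trivial]
        have := quadF_add_transpose (-(t * c.re)) i j (WithLp.toLp 2 v)
        simp only [quadF] at this
        rw [this, EuclideanSpace.real_norm_sq_eq]
        simp only [dotProduct, pow_two]
        ring
      rw [h1]
      set x : Cfg n := WithLp.toLp 2 v with hx
      have hx0 : 0 < ‖x‖ := norm_pos_iff.2 fun h => hv (by simpa [hx] using h)
      have h2 : |(t * c.re) * (v i * v j)| ≤ 1 / 16 * (‖x‖ * ‖x‖) := by
        rw [abs_mul, abs_mul, abs_mul, abs_of_pos ht]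
        have h3 : |v i| * |v j| ≤ ‖x‖ * ‖x‖ :=
          mul_le_mul (abs_coord_le x i) (abs_coord_le x j) (abs_nonneg _) (norm_nonneg _)
        have h4 : t * |c.re| ≤ 1 / 16 * 1 := mul_le_mul ht' hre (abs_nonneg _) (by norm_num)
        rw [mul_one] at h4
        exact mul_le_mul h4 h3 (by positivity) (by norm_num)
      have := (abs_le.1 h2).2
      nlinarith
  obtain ⟨B, hB⟩ := exists_transpose_mul_self hW
  have hU : ((-(t * c.im)) • D).IsSymm := by
    rw [Matrix.IsSymm, Matrix.transpose_smul, hD]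
  have hdet : √|B.1.det| ≠ 0 := (Real.sqrt_pos.2 (abs_pos.2 (det_units_ne_zero B))).ne'
  refine ⟨gauE B ((-(t * c.im)) • D) (coh 0),
    Complex.exp (-(t * c * a)) * (((√|B.1.det|)⁻¹ : ℝ) : ℂ), ?_, ?_⟩
  · have := (isGaussianUnitary_gauE B hU).isGaussVec isGaussVec_vac
    rwa [Matrix.mulVec_zero] at this
  rw [← toL2_cohS, gauE_toL2]
  refine (coeFn_smul_of_ae _ (coeFn_toL2 _)).trans (Filter.Eventually.of_forall fun x => ?_)
  have h1 : ‖linE B x‖ ^ 2 = ‖x‖ ^ 2 - 2 * (t * c.re) * (x i * x j) := by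
    rw [EuclideanSpace.real_norm_sq_eq, EuclideanSpace.real_norm_sq_eq]
    have h2 : ∑ l, (linE B x) l ^ 2 = x.ofLp ⬝ᵥ (B.1.transpose * B.1).mulVec x.ofLp := by
      rw [← Matrix.mulVec_mulVec, Matrix.dotProduct_mulVec, Matrix.vecMul_transpose]
      simp only [dotProduct, ← ofLp_linE, pow_two]
    have h3 := quadF_add_transpose (-(t * c.re)) i j x
    simp only [quadF] at h3
    rw [h2, hB, Matrix.add_mulVec, Matrix.one_mulVec, dotProduct_add, h3]
    simp only [dotProduct, pow_two]
    ring
  show _ * gauS B _ (cohS 0) x = cohFun 0 x * Complex.exp (t * c * (x i * x j - a : ℝ))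
  have h2 := quadF_add_transpose (-(t * c.im)) i j x
  rw [gauS_apply, cohS_apply, cohFun_zero, cohFun_zero, h1, quadPhase, h2]
  have h4 : (((√|B.1.det|)⁻¹ : ℝ) : ℂ) * ((√|B.1.det| : ℝ) : ℂ) = 1 := by
    rw [← Complex.ofReal_mul, inv_mul_cancel₀ hdet, Complex.ofReal_one]
  have h5 : (c.re : ℂ) + c.im * Complex.I = c := Complex.re_add_im c
  set p : ℂ := ((Real.pi ^ (-(n : ℝ) / 4) : ℝ) : ℂ)
  calc _ = ((((√|B.1.det|)⁻¹ : ℝ) : ℂ) * ((√|B.1.det| : ℝ) : ℂ)) * (p * (Complex.exp (-(t * c * a)) *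
        Complex.exp (Complex.I * ((-(1 / 2) * (2 * -(t * c.im) * (x i * x j)) : ℝ) : ℂ)) *
        Complex.exp (-(1 / 2) * ((‖x‖ ^ 2 - 2 * (t * c.re) * (x i * x j) : ℝ) : ℂ)))) := by ring
    _ = _ := by
        rw [h4, one_mul, mul_assoc (Complex.exp (-(t * c * a))), ← Complex.exp_add, ← Complex.exp_add,
          mul_assoc p, ← Complex.exp_add]
        congr 2
        push_cast
        linear_combination (t * (x i * x j) : ℂ) * h5

/-! ### One- and two-particle weights at a nearly optimal Gaussian -/

theorem abs_coord_le_sq (x : Cfg n) (i : Fin n) : |x i| ≤ ‖x‖ ^ 2 + 1 := by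
  have := abs_coord_le x i
  nlinarith [sq_nonneg (‖x‖ - 1), norm_nonneg x]

theorem abs_coord_mul_sub_le (x : Cfg n) (i j : Fin n) :
    |x i * x j - (if i = j then 1 / 2 else 0)| ≤ ‖x‖ ^ 2 + 1 := by
  have h1 : |x i * x j| ≤ ‖x‖ ^ 2 := by
    rw [abs_mul, pow_two]
    exact mul_le_mul (abs_coord_le x i) (abs_coord_le x j) (abs_nonneg _) (norm_nonneg _)
  have h2 : |(if i = j then (1 / 2 : ℝ) else 0)| ≤ 1 := by
    split_ifs
    · rw [abs_of_pos] <;> norm_num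
    · norm_num
  exact (abs_sub _ _).trans (add_le_add h1 h2)

/-- If the vacuum is, up to `κ`, the best approximation of `f` in a class containing the zero-mean
Gaussian vectors, then the two-particle weight of `f` is at most of order `κ`: the two-particle
vectors are the directions in which the vacuum varies within the class. -/
theorem exists_norm_sec_two_le (n : ℕ) : ∃ A : ℝ, ∀ (P : Modes n → Prop),
    (∀ g, IsGaussVec g 0 → P g) → (∀ g, P g → ‖g‖ = 1) → ∀ (f : Modes n) (d κ : ℝ), ‖f‖ = 1 →
    (∀ g, P g → ‖⟪g, f⟫_ℂ‖ ^ 2 ≤ 1 - d ^ 2) → 0 < κ → κ ≤ 1 / 256 →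
    1 - d ^ 2 - κ ≤ ‖⟪coh 0, f⟫_ℂ‖ ^ 2 → 1 / 2 ≤ ‖⟪coh 0, f⟫_ℂ‖ → ‖sec 2 f‖ ^ 2 ≤ A * κ := by
  obtain ⟨K, hK⟩ := exists_norm_remainder_le n
  set w : (Fin 2 → Fin n) → Modes n := fun s => toL2 n (posS (s 0) (posS (s 1) (cohS 0))
    - (if s 0 = s 1 then (1 / 2 : ℂ) else 0) • cohS 0) with hw
  refine ⟨∑ s, 2 * (1 + ‖w s‖ ^ 2 + 2 * K) ^ 2, fun P hP0 hP f d κ hf hd hκ hκ' h hα => ?_⟩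
  rw [EuclideanSpace.norm_sq_eq, Finset.sum_mul]
  refine Finset.sum_le_sum fun s _ => ?_
  have h1 : ‖⟪w s, f⟫_ℂ‖ ≤ (1 + ‖w s‖ ^ 2 + 2 * K) * √κ := by
    refine norm_inner_le_of_variation norm_coh_zero hf ?_ hP hd ?_ hκ hκ' h hα
    · rw [← inner_conj_symm, hw]
      simp only [map_sub, inner_sub_left, map_smul, inner_smul_left, inner_posS_posS_vac,
        toL2_cohS, inner_coh]
      split_ifs <;> simp [map_ofNat]
    · intro t ht ht' c hc
      obtain ⟨g, N, hg, hN⟩ := exists_squeezed_variation hc ht ht' (s 0) (s 1)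
        (if s 0 = s 1 then 1 / 2 else 0)
      refine ⟨g, N, N • g - coh 0 - ((t : ℂ) * c) • w s, hP0 g hg, ?_, by abel⟩
      refine hK _ (fun x => abs_coord_mul_sub_le x (s 0) (s 1)) t ht ht' c hc _ _ hN ?_
      refine (coeFn_toL2 _).trans (Filter.Eventually.of_forall fun x => ?_)
      simp only [sub_apply, smul_apply, posS_apply, cohS_apply, smul_eq_mul]
      split_ifs <;> push_cast <;> ring
  rw [ofLp_sec_two, norm_mul, mul_pow, Complex.norm_real, Real.norm_of_nonneg (Real.sqrt_nonneg _),
    Real.sq_sqrt (by norm_num), mul_assoc]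
  refine mul_le_mul_of_nonneg_left ?_ (by norm_num)
  calc ‖⟪w s, f⟫_ℂ‖ ^ 2 ≤ ((1 + ‖w s‖ ^ 2 + 2 * K) * √κ) ^ 2 := by gcongr
    _ = _ := by rw [mul_pow, Real.sq_sqrt hκ.le]

/-- The analogue of `exists_norm_sec_two_le` for the one-particle weight, in a class that contains
the displaced Gaussian vectors. -/
theorem exists_norm_sec_one_le (n : ℕ) : ∃ A : ℝ, ∀ (P : Modes n → Prop),
    (∀ g l, IsGaussVec g l → P g) → (∀ g, P g → ‖g‖ = 1) → ∀ (f : Modes n) (d κ : ℝ), ‖f‖ = 1 →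
    (∀ g, P g → ‖⟪g, f⟫_ℂ‖ ^ 2 ≤ 1 - d ^ 2) → 0 < κ → κ ≤ 1 / 256 →
    1 - d ^ 2 - κ ≤ ‖⟪coh 0, f⟫_ℂ‖ ^ 2 → 1 / 2 ≤ ‖⟪coh 0, f⟫_ℂ‖ → ‖sec 1 f‖ ^ 2 ≤ A * κ := by
  obtain ⟨K, hK⟩ := exists_norm_remainder_le n
  set w : (Fin 1 → Fin n) → Modes n := fun s => toL2 n (posS (s 0) (cohS 0)) with hw
  refine ⟨∑ s, 2 * (1 + ‖w s‖ ^ 2 + 2 * K) ^ 2, fun P hP0 hP f d κ hf hd hκ hκ' h hα => ?_⟩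
  rw [EuclideanSpace.norm_sq_eq, Finset.sum_mul]
  refine Finset.sum_le_sum fun s _ => ?_
  have h1 : ‖⟪w s, f⟫_ℂ‖ ≤ (1 + ‖w s‖ ^ 2 + 2 * K) * √κ := by
    refine norm_inner_le_of_variation norm_coh_zero hf ?_ hP hd ?_ hκ hκ' h hα
    · rw [← inner_conj_symm, hw]
      simp [inner_posS_vac]
    · intro t ht ht' c hc
      obtain ⟨g, l, N, hg, hN⟩ := exists_displaced_variation c t (s 0)
      refine ⟨g, N, N • g - coh 0 - ((t : ℂ) * c) • w s, hP0 g l hg, ?_, by abel⟩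
      refine hK _ (fun x => abs_coord_le_sq x (s 0)) t ht ht' c hc _ _ hN ?_
      refine (coeFn_toL2 _).trans (Filter.Eventually.of_forall fun x => ?_)
      simp only [posS_apply, cohS_apply]
  rw [ofLp_sec_one, norm_mul, mul_pow, Complex.norm_real, Real.norm_of_nonneg (Real.sqrt_nonneg _),
    Real.sq_sqrt (by norm_num), mul_assoc]
  refine mul_le_mul_of_nonneg_left ?_ (by norm_num)
  calc ‖⟪w s, f⟫_ℂ‖ ^ 2 ≤ ((1 + ‖w s‖ ^ 2 + 2 * K) * √κ) ^ 2 := by gcongr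
    _ = _ := by rw [mul_pow, Real.sq_sqrt hκ.le]

/-! ### Rejection probability near and far from the Gaussian states -/

open Filter Topology in
/-- A state at distance `d` from the Gaussian class is moved by the rotation by about `d`, as long
as `d` is small: the rotation detects every particle number that is not already excluded by the
optimality of the best Gaussian approximation. -/
theorem sub_le_mixDefect (hk2 : 2 ≤ k) (hk3 : k ≤ 3) (o : Matrix.orthogonalGroup (Fin k) ℝ)
    (bad : Finset ℕ) (hgood : ∀ m, 1 ≤ m → m ∉ bad → 1 / 2 ≤ (k : ℝ) - ∑ i, ∑ j, o.1 i j ^ m)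
    (hbad : ∀ m ∈ bad, 0 ≤ (k : ℝ) - ∑ i, ∑ j, o.1 i j ^ m) {P : Modes n → Prop} {A : ℝ}
    (hA : ∀ (f : Modes n) (d κ : ℝ), ‖f‖ = 1 → (∀ g, P g → ‖⟪g, f⟫_ℂ‖ ^ 2 ≤ 1 - d ^ 2) → 0 < κ →
      κ ≤ 1 / 256 → 1 - d ^ 2 - κ ≤ ‖⟪coh 0, f⟫_ℂ‖ ^ 2 → 1 / 2 ≤ ‖⟪coh 0, f⟫_ℂ‖ →
      ∑ m ∈ bad, ‖sec m f‖ ^ 2 ≤ A * κ)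
    (hT : ∀ g, P g → ∃ T : Modes n ≃ₗᵢ[ℂ] Modes n, (∀ f, mixDefect o (T f) = mixDefect o f) ∧
      (∀ h, P h → P (T h)) ∧ ∃ c : ℂ, ‖c‖ = 1 ∧ g = c • T (coh 0))
    {ψ : Modes n} (hψ : ‖ψ‖ = 1) {d : ℝ} (hd0 : 0 ≤ d) (hd1 : d ^ 2 ≤ 1 / 4)
    (hd : ∀ g, P g → ‖⟪g, ψ⟫_ℂ‖ ^ 2 ≤ 1 - d ^ 2)
    (hopt : ∀ κ > 0, ∃ g, P g ∧ 1 - d ^ 2 - κ ≤ ‖⟪g, ψ⟫_ℂ‖ ^ 2) :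
    (1 - d ^ 2) * d - 4 * d ^ 2 ≤ mixDefect o ψ := by
  have key : ∀ κ : ℝ, 0 < κ → κ ≤ 1 / 256 →
      (1 - d ^ 2 - κ) * √(d ^ 2 - A * κ) - 4 * (d ^ 2 + κ) ≤ mixDefect o ψ := by
    intro κ hκ hκ'
    obtain ⟨g, hg, hgκ⟩ := hopt κ hκ
    obtain ⟨T, hTd, hTP, c, hc, rfl⟩ := hT g hg
    set f := T.symm ψ with hf
    have hTf : T f = ψ := T.apply_symm_apply ψ
    have hf1 : ‖f‖ = 1 := by rw [hf, T.symm.norm_map, hψ]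
    have hov : ‖⟪c • T (coh 0), ψ⟫_ℂ‖ = ‖⟪coh 0, f⟫_ℂ‖ := by
      rw [inner_smul_left, norm_mul, RCLike.norm_conj, hc, one_mul, ← hTf,
        LinearIsometryEquiv.inner_map_map]
    have hdf : ∀ g, P g → ‖⟪g, f⟫_ℂ‖ ^ 2 ≤ 1 - d ^ 2 := by
      intro h hh
      have := hd _ (hTP h hh)
      rwa [← hTf, LinearIsometryEquiv.inner_map_map] at this
    have hup := hd _ hg
    rw [hov] at hgκ hup
    have hhalf : 1 / 2 ≤ ‖⟪coh 0, f⟫_ℂ‖ := by nlinarith [norm_nonneg ⟪coh 0, f⟫_ℂ]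
    have h1 := hA f d κ hf1 hdf hκ hκ' hgκ hhalf
    have h2 := le_mixDefect hk2 hk3 o hf1 bad hgood hbad
    rw [← hTd f, hTf] at h2
    refine le_trans ?_ h2
    have h3 : √(d ^ 2 - A * κ) ≤ √(1 - ‖⟪coh 0, f⟫_ℂ‖ ^ 2 - ∑ m ∈ bad, ‖sec m f‖ ^ 2) :=
      Real.sqrt_le_sqrt (by linarith)
    have h4 := mul_le_mul hgκ h3 (Real.sqrt_nonneg _) (sq_nonneg _)
    linarith
  have hlim : Tendsto (fun κ : ℝ => (1 - d ^ 2 - κ) * √(d ^ 2 - A * κ) - 4 * (d ^ 2 + κ)) (𝓝[>] 0)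
      (𝓝 ((1 - d ^ 2 - 0) * √(d ^ 2 - A * 0) - 4 * (d ^ 2 + 0))) :=
    ((by fun_prop : Continuous fun κ : ℝ =>
      (1 - d ^ 2 - κ) * √(d ^ 2 - A * κ) - 4 * (d ^ 2 + κ)).tendsto 0).mono_left nhdsWithin_le_nhds
  have h := le_of_tendsto hlim (eventually_mem_nhdsWithin.and
    (Filter.Eventually.filter_mono nhdsWithin_le_nhds (eventually_le_nhds (by norm_num :
      (0 : ℝ) < 1 / 256))) |>.mono fun κ hκ => key κ hκ.1 hκ.2)
  simpa [Real.sqrt_sq hd0] using h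

/-- A universal constant `b` such that the test rejects with probability at least
`b min (d², 1/(nE)⁴)`. -/
noncomputable def rejectConst : ℝ := 1 / (1024000 : ℝ) ^ 2

theorem min_le_one_sub {d η x : ℝ} (hd0 : 0 ≤ d) (hη : 0 ≤ η) (hx : 0 < x)
    (hsmall : d ^ 2 ≤ 1 / 4 → (1 - d ^ 2) * d - 4 * d ^ 2 ≤ 2 * √η)
    (hlarge : d ^ 2 ≤ 1024 * √η * x ^ 2) : rejectConst * min (d ^ 2) (1 / x ^ 4) ≤ η := by
  have hsq := Real.sq_sqrt hη
  have hs0 := Real.sqrt_nonneg η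
  rcases le_total (d ^ 2) (1 / 1000) with h | h
  · have h1 := hsmall (by linarith)
    have h2 : d ≤ 1 / 30 := by nlinarith
    have h3 : d / 4 ≤ √η := by nlinarith
    have h4 : (d / 4) ^ 2 ≤ η := by rw [← hsq]; exact pow_le_pow_left₀ (by positivity) h3 2
    calc rejectConst * min (d ^ 2) (1 / x ^ 4) ≤ rejectConst * d ^ 2 :=
          mul_le_mul_of_nonneg_left (min_le_left _ _) (by rw [rejectConst]; positivity)
      _ ≤ 1 / 16 * d ^ 2 := by
          refine mul_le_mul_of_nonneg_right ?_ (sq_nonneg d)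
          rw [rejectConst]; norm_num
      _ ≤ η := by linarith
  · have h1 : 1 / 1024000 ≤ √η * x ^ 2 := by linarith
    have h2 : (1 / 1024000 : ℝ) ^ 2 ≤ η * x ^ 4 := by
      calc (1 / 1024000 : ℝ) ^ 2 ≤ (√η * x ^ 2) ^ 2 := pow_le_pow_left₀ (by norm_num) h1 2
        _ = η * x ^ 4 := by rw [mul_pow, hsq]; ring
    calc rejectConst * min (d ^ 2) (1 / x ^ 4) ≤ rejectConst * (1 / x ^ 4) :=
          mul_le_mul_of_nonneg_left (min_le_right _ _) (by rw [rejectConst]; positivity)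
      _ ≤ η := by
          rw [mul_one_div, div_le_iff₀ (by positivity), rejectConst]
          rwa [one_div_pow] at h2

open Filter Topology in
/-- A state at distance `d` from the invariant class is rejected with probability at most `3d`. -/
theorem one_sub_acceptProb_le (hk3 : k ≤ 3) {O : Set (Matrix.orthogonalGroup (Fin k) ℝ)}
    {P : Modes n → Prop} (hP : ∀ g, P g → ‖g‖ = 1)
    (hinv : ∀ g, P g → tensorPow k g ∈ invariantSubspace n O) {ψ : Modes n} (hψ : ‖ψ‖ = 1) {d : ℝ}
    (hd0 : 0 ≤ d) (hd1 : d ≤ 1)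
    (hopt : ∀ κ > 0, ∃ g, P g ∧ 1 - d ^ 2 - κ ≤ ‖⟪g, ψ⟫_ℂ‖ ^ 2) :
    1 - acceptProb O ψ ≤ 3 * d := by
  have h2 : 1 - acceptProb O ψ ≤ 3 * d ^ 2 := by
    refine le_of_forall_pos_le_add fun ε hε => ?_
    obtain ⟨g, hg, h⟩ := hopt (ε / 3) (by positivity)
    have h1 := sq_norm_inner_le_acceptProb (ψ := ψ) (hP g hg) (hinv g hg)
    have hle : ‖⟪g, ψ⟫_ℂ‖ ≤ 1 := by
      have := norm_inner_le_norm (𝕜 := ℂ) g ψ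
      rwa [hP g hg, hψ, one_mul] at this
    set a := ‖⟪g, ψ⟫_ℂ‖ with ha
    have ha0 : 0 ≤ a := norm_nonneg _
    have h3 : (a ^ 2) ^ 3 ≤ (a ^ k) ^ 2 := by
      rw [← pow_mul, ← pow_mul]
      exact pow_le_pow_of_le_one ha0 hle (by omega)
    have h4 : 1 - 3 * (1 - a ^ 2) ≤ (a ^ 2) ^ 3 := by
      have := one_add_mul_le_pow (a := a ^ 2 - 1) (by nlinarith [sq_nonneg a]) 3
      push_cast at this
      rw [add_sub_cancel] at this
      linarith
    linarith
  nlinarith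

/-- The decision problem for one test, from bounds on its rejection probability near and far from
the set of free states. -/
theorem roundsSuffice_of_bounds {pacc : Modes n → ℝ} {A : Set (Modes n)}
    {Q : Set (Modes n →L[ℂ] Modes n)} {E εA εB δ ε : ℝ} {N : ℕ} (hA0 : 0 ≤ εA) (hAB : εA < εB)
    (hδ : 0 < δ) (hδ1 : δ < 1)
    (hεdef : ε = rejectConst / 3 * min (εB ^ 2) (1 / ((n : ℝ) ^ 4 * E ^ 4)) - εA)
    (hε : 0 < ε)
    (hb : ∀ ψ ∈ A, ‖ψ‖ = 1 → ∃ d, 0 ≤ d ∧ distTo Q (pureState ψ) = ENNReal.ofReal d ∧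
      0 ≤ pacc ψ ∧ pacc ψ ≤ 1 ∧ 1 - pacc ψ ≤ 3 * d ∧ (E₂ ψ ≤ ENNReal.ofReal E →
        rejectConst * min (d ^ 2) (1 / ((n : ℝ) ^ 4 * E ^ 4)) ≤ 1 - pacc ψ))
    (hN : 16 * (εA + ε) / ε ^ 2 * Real.log δ⁻¹ ≤ N) : RoundsSuffice pacc A Q E εA εB δ N := by
  have hlog0 : 0 ≤ Real.log δ⁻¹ := Real.log_nonneg ((one_le_inv₀ hδ).2 hδ1.le)
  have hlog : 16 * (3 * εA + 3 * ε) / (3 * ε) ^ 2 * Real.log δ⁻¹ ≤ N := by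
    refine le_trans (mul_le_mul_of_nonneg_right ?_ hlog0) hN
    have h1 : 16 * (3 * εA + 3 * ε) / (3 * ε) ^ 2 = 16 * (εA + ε) / ε ^ 2 / 3 := by field_simp
    rw [h1]
    have h2 : 0 ≤ 16 * (εA + ε) / ε ^ 2 := by positivity
    linarith
  obtain ⟨D, hD⟩ := exists_threshold_rule (by positivity : 0 ≤ 3 * εA)
    (by positivity : 0 < 3 * ε) hδ hlog
  refine ⟨D, fun ψ hψA hψ hE => ?_⟩
  obtain ⟨d, hd0, hdist, hp0, hp1, hnear, hfar⟩ := hb ψ hψA hψ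
  rw [hdist] at hE ⊢
  refine ⟨fun h => (hD _ hp0 hp1).1 ?_, fun h => (hD _ hp0 hp1).2 ?_⟩
  · rw [ENNReal.ofReal_le_ofReal_iff hA0] at h
    linarith
  · have h1 := hfar (hE h)
    have h2 : εB < d := (ENNReal.ofReal_lt_ofReal_iff_of_nonneg (by linarith)).1 h
    have h3 : εB ^ 2 ≤ d ^ 2 := pow_le_pow_left₀ (by linarith) h2.le 2
    have h4 := mul_le_mul_of_nonneg_left (min_le_min_right (1 / ((n : ℝ) ^ 4 * E ^ 4)) h3)
      (by rw [rejectConst]; positivity : 0 ≤ rejectConst)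
    linarith

/-! ### The two tests -/

/-- The number of rounds of a test from bounds on its rejection probability. -/
theorem exists_rounds {pacc : ∀ n, Modes n → ℝ} {A : ∀ n, Set (Modes n)}
    {Q : ∀ n, Set (Modes n →L[ℂ] Modes n)}
    (hb : ∀ (n : ℕ) (E : ℝ), 0 < n → 0 < E → ∀ ψ ∈ A n, ‖ψ‖ = 1 →
      ∃ d, 0 ≤ d ∧ d ≤ 1 ∧ distTo (Q n) (pureState ψ) = ENNReal.ofReal d ∧
      0 ≤ pacc n ψ ∧ pacc n ψ ≤ 1 ∧ 1 - pacc n ψ ≤ 3 * d ∧ (E₂ ψ ≤ ENNReal.ofReal E →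
        rejectConst * min (d ^ 2) (1 / ((n : ℝ) ^ 4 * E ^ 4)) ≤ 1 - pacc n ψ)) :
    ∃ C : ℝ, 0 < C ∧
      (∃ K : ℝ, 0 < K ∧ ∀ (n : ℕ) (E εA εB δ ε : ℝ), 0 < n → 0 < E → 0 ≤ εA → εA < εB →
        0 < δ → δ < 1 → ε = C * min (εB ^ 2) (1 / ((n : ℝ) ^ 4 * E ^ 4)) - εA → 0 < ε →
        ∀ N : ℕ, K * (ε ^ 2)⁻¹ * Real.log δ⁻¹ ≤ N →
          RoundsSuffice (pacc n) (A n) (Q n) E εA εB δ N) ∧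
      (∀ c : ℝ, 0 < c → ∃ K : ℝ, 0 < K ∧
        ∀ (n : ℕ) (E εA εB δ ε : ℝ), 0 < n → 0 < E → 0 ≤ εA → εA < εB →
        0 < δ → δ < 1 → ε = C * min (εB ^ 2) (1 / ((n : ℝ) ^ 4 * E ^ 4)) - εA → 0 < ε →
        εA ≤ c * ε →
        ∀ N : ℕ, K * ε⁻¹ * Real.log δ⁻¹ ≤ N →
          RoundsSuffice (pacc n) (A n) (Q n) E εA εB δ N) := by
  have hb' : ∀ (n : ℕ) (E : ℝ), 0 < n → 0 < E → ∀ ψ ∈ A n, ‖ψ‖ = 1 →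
      ∃ d, 0 ≤ d ∧ distTo (Q n) (pureState ψ) = ENNReal.ofReal d ∧
      0 ≤ pacc n ψ ∧ pacc n ψ ≤ 1 ∧ 1 - pacc n ψ ≤ 3 * d ∧ (E₂ ψ ≤ ENNReal.ofReal E →
        rejectConst * min (d ^ 2) (1 / ((n : ℝ) ^ 4 * E ^ 4)) ≤ 1 - pacc n ψ) :=
    fun n E hn hE ψ hψA hψ => by
      obtain ⟨d, h0, -, h⟩ := hb n E hn hE ψ hψA hψ
      exact ⟨d, h0, h⟩
  have hlog : ∀ {δ : ℝ}, 0 < δ → δ < 1 → 0 ≤ Real.log δ⁻¹ := fun h0 h1 =>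
    Real.log_nonneg ((one_le_inv₀ h0).2 h1.le)
  refine ⟨rejectConst / 3, by rw [rejectConst]; positivity, ⟨16, by norm_num, ?_⟩, fun c hc =>
    ⟨16 * (c + 1), by positivity, ?_⟩⟩
  · intro n E εA εB δ ε hn hE hA0 hAB hδ hδ1 hεdef hε N hN
    rcases lt_or_ge εB 1 with h1 | h1
    · refine roundsSuffice_of_bounds hA0 hAB hδ hδ1 hεdef hε (hb' n E hn hE) (le_trans ?_ hN)
      refine mul_le_mul_of_nonneg_right ?_ (hlog hδ hδ1)
      have h2 : min (εB ^ 2) (1 / ((n : ℝ) ^ 4 * E ^ 4)) ≤ 1 :=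
        (min_le_left _ _).trans (by nlinarith)
      have h3 : rejectConst / 3 ≤ 1 := by rw [rejectConst]; norm_num
      have h4 : 0 < rejectConst / 3 := by rw [rejectConst]; norm_num
      have h5 : εA + ε ≤ 1 := by nlinarith
      rw [← div_eq_mul_inv]
      gcongr
      linarith
    · -- trace distances do not exceed `1`: no state is far, and accepting always is correct
      refine ⟨Finset.univ, fun ψ hψA hψ _ => ⟨fun _ => ?_, fun h => ?_⟩⟩
      · rw [Finset.compl_univ, outcomeProb, Finset.sum_empty]; exact hδ.le
      · obtain ⟨d, hd0, hd1, hdist, -⟩ := hb n E hn hE ψ hψA hψ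
        rw [hdist] at h
        exact absurd h (not_lt.2 (ENNReal.ofReal_le_ofReal (hd1.trans h1)))
  · intro n E εA εB δ ε hn hE hA0 hAB hδ hδ1 hεdef hε hAc N hN
    refine roundsSuffice_of_bounds hA0 hAB hδ hδ1 hεdef hε (hb' n E hn hE) (le_trans ?_ hN)
    refine mul_le_mul_of_nonneg_right ?_ (hlog hδ hδ1)
    have h1 : 16 * (c + 1) * ε⁻¹ = 16 * ((c + 1) * ε) / ε ^ 2 := by field_simp
    rw [h1]
    gcongr
    linarith

theorem exists_gauE_eq_smul {g : Modes n} {l : Fin n ⊕ Fin n → ℝ} (hg : IsGaussVec g l) :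
    ∃ (B : (Matrix (Fin n) (Fin n) ℝ)ˣ) (U : Matrix (Fin n) (Fin n) ℝ) (c : ℂ), U.IsSymm ∧ ‖c‖ = 1 ∧
      g = c • displace (Sum.elim (fun i => l (Sum.inr i)) fun i => -l (Sum.inl i))
        (gauE B U (coh 0)) := by
  obtain ⟨B, U, hU, hs⟩ := exists_gauE_of_isGaussVec hg
  obtain ⟨c, hc⟩ := exists_eq_smul_of_pureState_eq hg.1 hs
  refine ⟨B, U, c, hU, ?_, hc⟩
  have h := congrArg norm hc
  rw [hg.1, norm_smul, ← displaceL_apply, LinearIsometry.norm_map, LinearIsometryEquiv.norm_map,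
    norm_coh_zero, mul_one] at h
  exact h.symm

theorem rot3_row_sum (θ : ℝ) (i : Fin 3) : ∑ j, (rot3 θ).1 i j = 1 := by
  fin_cases i <;> simp [rot3, Fin.sum_univ_three] <;> ring

theorem rot3_col_sum (θ : ℝ) (j : Fin 3) : ∑ i, (rot3 θ).1 i j = 1 := by
  fin_cases j <;> simp [rot3, Fin.sum_univ_three] <;> ring

theorem sum_rot3_pi (m : ℕ) : ∑ i, ∑ j, (rot3 Real.pi).1 i j ^ m
    = 3 * (-(1 / 3) : ℝ) ^ m + 6 * (2 / 3 : ℝ) ^ m := by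
  have h1 : (3⁻¹ * (1 + -2) : ℝ) = -(1 / 3) := by norm_num
  have h2 : (3⁻¹ * (1 + 1) : ℝ) = 2 / 3 := by norm_num
  simp [rot3, Fin.sum_univ_three, h1, h2]
  ring

theorem sum_rot2_pi_div_four (m : ℕ) : ∑ i, ∑ j, (rot2 (Real.pi / 4)).1 i j ^ m
    = 3 * (√2 / 2) ^ m + (-(√2 / 2)) ^ m := by
  simp [rot2, Fin.sum_univ_two]
  ring

/-- Rotating three copies by `π` about `(1, 1, 1)` detects all particle numbers above two. -/
theorem rot3_detects {m : ℕ} (hm1 : 1 ≤ m) (hm : m ∉ ({1, 2} : Finset ℕ)) :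
    1 / 2 ≤ ((3 : ℕ) : ℝ) - ∑ i, ∑ j, (rot3 Real.pi).1 i j ^ m := by
  have hm3 : 3 ≤ m := by
    simp only [Finset.mem_insert, Finset.mem_singleton, not_or] at hm
    omega
  rw [sum_rot3_pi]
  have h1 : (-(1 / 3) : ℝ) ^ m ≤ (1 / 3) ^ 3 := by
    refine (le_abs_self _).trans ?_
    rw [abs_pow, abs_neg, abs_of_pos (by norm_num)]
    exact pow_le_pow_of_le_one (by norm_num) (by norm_num) hm3
  have h2 : (2 / 3 : ℝ) ^ m ≤ (2 / 3) ^ 3 :=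
    pow_le_pow_of_le_one (by norm_num) (by norm_num) hm3
  norm_num at h1 h2 ⊢
  linarith

/-- Rotating two copies by `π/4` detects all positive particle numbers except two. -/
theorem rot2_detects {m : ℕ} (hm1 : 1 ≤ m) (hm : m ∉ ({2} : Finset ℕ)) :
    1 / 2 ≤ ((2 : ℕ) : ℝ) - ∑ i, ∑ j, (rot2 (Real.pi / 4)).1 i j ^ m := by
  have hr2 : √2 * √2 = (2 : ℝ) := Real.mul_self_sqrt (by norm_num)
  have hr : √2 ≤ (3 / 2 : ℝ) := by rw [Real.sqrt_le_left (by norm_num)]; norm_num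
  have hr0 : (0 : ℝ) ≤ √2 := Real.sqrt_nonneg _
  rw [sum_rot2_pi_div_four]
  rcases eq_or_ne m 1 with rfl | hm'
  · norm_num; linarith
  · have hm3 : 3 ≤ m := by
      simp only [Finset.mem_singleton] at hm
      omega
    have h2 : (√2 / 2) ^ m ≤ (√2 / 2) ^ 3 :=
      pow_le_pow_of_le_one (by positivity) (by linarith) hm3
    have h1 : (-(√2 / 2)) ^ m ≤ (√2 / 2) ^ 3 := by
      refine (le_abs_self _).trans ?_
      rwa [abs_pow, abs_neg, abs_of_nonneg (by positivity)]
    have h3 : (√2 / 2) ^ 3 = √2 / 4 := by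
      calc (√2 / 2) ^ 3 = √2 * √2 * √2 / 8 := by ring
        _ = √2 / 4 := by rw [hr2]; ring
    rw [h3] at h1 h2
    push_cast
    linarith

/-- The rejection probability of the three-copy test. -/
theorem threeCopy_bounds {E : ℝ} (hn : 0 < n) (hE : 0 < E) {ψ : Modes n} (hψ : ‖ψ‖ = 1) :
    ∃ d, 0 ≤ d ∧ d ≤ 1 ∧ distTo (gaussianStates n) (pureState ψ) = ENNReal.ofReal d ∧
      0 ≤ threeCopyAcceptProb ψ ∧ threeCopyAcceptProb ψ ≤ 1 ∧ 1 - threeCopyAcceptProb ψ ≤ 3 * d ∧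
      (E₂ ψ ≤ ENNReal.ofReal E →
        rejectConst * min (d ^ 2) (1 / ((n : ℝ) ^ 4 * E ^ 4)) ≤ 1 - threeCopyAcceptProb ψ) := by
  set P : Modes n → Prop := fun g => ∃ l, IsGaussVec g l with hPdef
  have hP : ∀ g, P g → ‖g‖ = 1 := fun g ⟨l, hg⟩ => hg.1
  obtain ⟨d, hd0, hd1, hdist, hd, hopt⟩ := overlap_of_distTo (Q := gaussianStates n) hP
    (fun g ⟨l, hg⟩ => hg.mem) (fun σ hσ => by
      obtain ⟨φ, l, h1, h2⟩ := exists_isGaussVec_of_mem hσ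
      exact ⟨φ, ⟨l, h1⟩, h2⟩) ⟨coh 0, 0, isGaussVec_vac⟩ hψ
  have hp1 := acceptProb_le_one (Set.range rot3) hψ
  refine ⟨d, hd0, hd1, hdist, acceptProb_nonneg _ _, hp1, ?_, fun hE₂ => ?_⟩
  · refine one_sub_acceptProb_le le_rfl hP (fun g ⟨l, hg⟩ => ?_) hψ hd0 hd1 hopt
    rw [mem_invariantSubspace]
    rintro _ ⟨θ, rfl⟩
    exact hg.mixUnitary_tensorPow (rot3_row_sum θ)
  · have hn' : (0 : ℝ) < n := by exact_mod_cast hn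
    rw [← mul_pow]
    refine min_le_one_sub hd0 (sub_nonneg.2 hp1) (by positivity) (fun hd4 => ?_) ?_
    · refine le_trans ?_ (norm_mixUnitary_sub_le hψ (Set.mem_range_self Real.pi))
      obtain ⟨A₁, hA₁⟩ := exists_norm_sec_one_le n
      obtain ⟨A₂, hA₂⟩ := exists_norm_sec_two_le n
      refine sub_le_mixDefect (A := A₁ + A₂) (by norm_num) le_rfl (rot3 Real.pi) {1, 2}
        (fun m => rot3_detects) ?_ ?_ ?_ hψ hd0 hd4 hd hopt
      · intro m hm
        rw [sum_rot3_pi]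
        rcases Finset.mem_insert.1 hm with rfl | hm
        · norm_num
        · rw [Finset.mem_singleton.1 hm]; norm_num
      · intro f d κ hf hd hκ hκ' h hα
        rw [Finset.sum_pair (by norm_num), add_mul]
        exact add_le_add (hA₁ P (fun g l hg => ⟨l, hg⟩) hP f d κ hf hd hκ hκ' h hα)
          (hA₂ P (fun g hg => ⟨0, hg⟩) hP f d κ hf hd hκ hκ' h hα)
      · rintro g ⟨l, hg⟩
        obtain ⟨B, U, c, hU, hc, rfl⟩ := exists_gauE_eq_smul hg
        refine ⟨(gauE B U).trans (displaceE _), fun f => ?_, fun h ⟨l, hh⟩ => ?_, c, hc, rfl⟩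
        · exact ((mixCov_displaceE (rot3_row_sum _) (rot3_col_sum _) _).mixDefect_eq _).trans
            ((mixCov_of_isGaussianUnitary _ (isGaussianUnitary_gauE B hU)).mixDefect_eq f)
        · exact ⟨_, ((isGaussianUnitary_gauE B hU).isGaussVec hh).displace _⟩
    · exact rotFlow_rot3.sq_dist_le_of_E₂_le le_rfl hn sum_abs_axisJ hP
        (fun S U hU g ⟨l, hg⟩ => ⟨_, hU.isGaussVec hg⟩) (fun f hf => by
          obtain ⟨g, l, hg, h⟩ := exists_gauss_near_rot3 hf
          exact ⟨g, ⟨l, hg⟩, h⟩) (fun t => Set.mem_range_self t) hψ hE hE₂ hd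

/-- The rejection probability of the two-copy test. -/
theorem twoCopy_bounds {E : ℝ} (hn : 0 < n) (hE : 0 < E) {ψ : Modes n} (hψ : ‖ψ‖ = 1) :
    ∃ d, 0 ≤ d ∧ d ≤ 1 ∧ distTo (zeroMeanGaussianStates n) (pureState ψ) = ENNReal.ofReal d ∧
      0 ≤ twoCopyAcceptProb ψ ∧ twoCopyAcceptProb ψ ≤ 1 ∧ 1 - twoCopyAcceptProb ψ ≤ 3 * d ∧
      (E₂ ψ ≤ ENNReal.ofReal E →
        rejectConst * min (d ^ 2) (1 / ((n : ℝ) ^ 4 * E ^ 4)) ≤ 1 - twoCopyAcceptProb ψ) := by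
  set P : Modes n → Prop := fun g => IsGaussVec g 0 with hPdef
  have hP : ∀ g, P g → ‖g‖ = 1 := fun g hg => hg.1
  obtain ⟨d, hd0, hd1, hdist, hd, hopt⟩ := overlap_of_distTo (Q := zeroMeanGaussianStates n) hP
    (fun g hg => hg.mem_zeroMean) (fun σ hσ => exists_isGaussVec_of_mem_zeroMean hσ)
    ⟨coh 0, isGaussVec_vac⟩ hψ
  have hPU : ∀ S U, IsGaussianUnitary S U → ∀ g, P g → P (U g) := fun S U hU g hg => by
    have := hU.isGaussVec hg
    rwa [Matrix.mulVec_zero] at this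
  have hp1 := acceptProb_le_one (insert swap2 (Set.range rot2)) hψ
  refine ⟨d, hd0, hd1, hdist, acceptProb_nonneg _ _, hp1, ?_, fun hE₂ => ?_⟩
  · refine one_sub_acceptProb_le (by norm_num) hP (fun g hg => ?_) hψ hd0 hd1 hopt
    exact mem_invariantSubspace.2 fun o _ => hg.mixUnitary_tensorPow_of_zero o
  · have hn' : (0 : ℝ) < n := by exact_mod_cast hn
    rw [← mul_pow]
    refine min_le_one_sub hd0 (sub_nonneg.2 hp1) (by positivity) (fun hd4 => ?_) ?_
    · refine le_trans ?_ (norm_mixUnitary_sub_le hψ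
        (Set.mem_insert_of_mem _ (Set.mem_range_self (Real.pi / 4))))
      obtain ⟨A, hA⟩ := exists_norm_sec_two_le n
      refine sub_le_mixDefect (A := A) le_rfl (by norm_num) (rot2 (Real.pi / 4)) {2}
        (fun m => rot2_detects) ?_ ?_ ?_ hψ hd0 hd4 hd hopt
      · intro m hm
        rw [sum_rot2_pi_div_four, Finset.mem_singleton.1 hm, neg_sq, div_pow,
          Real.sq_sqrt (by norm_num)]
        norm_num
      · intro f d κ hf hd hκ hκ' h hα
        rw [Finset.sum_singleton]
        exact hA P (fun g hg => hg) hP f d κ hf hd hκ hκ' h hα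
      · intro g hg
        obtain ⟨B, U, c, hU, hc, h⟩ := exists_gauE_eq_smul hg
        have h0 : (Sum.elim (fun i => (0 : Fin n ⊕ Fin n → ℝ) (Sum.inr i))
            fun i => -(0 : Fin n ⊕ Fin n → ℝ) (Sum.inl i)) = 0 := by
          funext i; rcases i with i | i <;> simp
        rw [h0, displace_zero] at h
        exact ⟨gauE B U, (mixCov_of_isGaussianUnitary _ (isGaussianUnitary_gauE B hU)).mixDefect_eq,
          hPU _ _ (isGaussianUnitary_gauE B hU), c, hc, h⟩
    · exact rotFlow_rot2.sq_dist_le_of_E₂_le (by norm_num) hn sum_abs_rot2 hP hPU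
        (fun f hf => exists_gauss_near_rot2 hf)
        (fun t => Set.mem_insert_of_mem _ (Set.mem_range_self t)) hψ hE hE₂ hd

end GaussTest

theorem mainTheorem2 :
    -- the three-copy test and arbitrary pure Gaussian states
    (∃ C : ℝ, 0 < C ∧
      (∃ K : ℝ, 0 < K ∧ ∀ (n : ℕ) (E εA εB δ ε : ℝ), 0 < n → 0 < E → 0 ≤ εA → εA < εB →
        0 < δ → δ < 1 → ε = C * min (εB ^ 2) (1 / ((n : ℝ) ^ 4 * E ^ 4)) - εA → 0 < ε →
        ∀ N : ℕ, K * (ε ^ 2)⁻¹ * Real.log δ⁻¹ ≤ N →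
          GaussTest.RoundsSuffice (n := n) GaussTest.threeCopyAcceptProb Set.univ
            (GaussTest.gaussianStates n) E εA εB δ N) ∧
      (∀ c : ℝ, 0 < c → ∃ K : ℝ, 0 < K ∧
        ∀ (n : ℕ) (E εA εB δ ε : ℝ), 0 < n → 0 < E → 0 ≤ εA → εA < εB →
        0 < δ → δ < 1 → ε = C * min (εB ^ 2) (1 / ((n : ℝ) ^ 4 * E ^ 4)) - εA → 0 < ε →
        εA ≤ c * ε →
        ∀ N : ℕ, K * ε⁻¹ * Real.log δ⁻¹ ≤ N →
          GaussTest.RoundsSuffice (n := n) GaussTest.threeCopyAcceptProb Set.univ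
            (GaussTest.gaussianStates n) E εA εB δ N)) ∧
    -- the two-copy test, even-parity states and zero-mean pure Gaussian states
    (∃ C : ℝ, 0 < C ∧
      (∃ K : ℝ, 0 < K ∧ ∀ (n : ℕ) (E εA εB δ ε : ℝ), 0 < n → 0 < E → 0 ≤ εA → εA < εB →
        0 < δ → δ < 1 → ε = C * min (εB ^ 2) (1 / ((n : ℝ) ^ 4 * E ^ 4)) - εA → 0 < ε →
        ∀ N : ℕ, K * (ε ^ 2)⁻¹ * Real.log δ⁻¹ ≤ N →
          GaussTest.RoundsSuffice (n := n) GaussTest.twoCopyAcceptProb {ψ | GaussTest.EvenParity ψ}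
            (GaussTest.zeroMeanGaussianStates n) E εA εB δ N) ∧
      (∀ c : ℝ, 0 < c → ∃ K : ℝ, 0 < K ∧
        ∀ (n : ℕ) (E εA εB δ ε : ℝ), 0 < n → 0 < E → 0 ≤ εA → εA < εB →
        0 < δ → δ < 1 → ε = C * min (εB ^ 2) (1 / ((n : ℝ) ^ 4 * E ^ 4)) - εA → 0 < ε →
        εA ≤ c * ε →
        ∀ N : ℕ, K * ε⁻¹ * Real.log δ⁻¹ ≤ N →
          GaussTest.RoundsSuffice (n := n) GaussTest.twoCopyAcceptProb {ψ | GaussTest.EvenParity ψ}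
            (GaussTest.zeroMeanGaussianStates n) E εA εB δ N)) := by
  exact ⟨GaussTest.exists_rounds fun _ _ hn hE _ _ hψ => GaussTest.threeCopy_bounds hn hE hψ,
    GaussTest.exists_rounds fun _ _ hn hE _ _ hψ => GaussTest.twoCopy_bounds hn hE hψ⟩
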